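/- Let $N\ge 1$ be an integer, and let $\mathcal H^{(N)}=L^2_s(\mathbb R^{3N})\otimes\mathcal F_s$, where $\mathcal F_s=\bigoplus_{n\ge0}L^2_s(\mathbb R^{3n})$ is the bosonic Fock space, with creation and annihilation operators $a^*(f)=\int f(k)a_k^*\,dk$, $a(f)=\int\overline{f(k)}\,a_k\,dk$, $[a_k,a_l^*]=\delta(k-l)$, field operators $\Phi(f)=a(f)+a^*(f)$ and number operator $\mathcal N$. For $x\in\mathbb R^3$ and $K>0$ put $$G_x(k)=\frac{e^{-ikx}}{|k|},\qquad G_{K,x}(k)=G_x(k)\,\mathbf 1_{|k|\le K},\qquad B_{K,x}(k)=\frac{-e^{-ikx}}{|k|(1+k^2)}\,\mathbf 1_{|k|\ge K}.$$ *Free Hamiltonian.* $H_N^0=-\sum_{j=1}^N\Delta_j+\mathcal N$ with domain $\mathcal D(H_N^0)=\big(H^2_s(\mathbb R^{3N})\otimes\mathcal F_s\big)\cap\mathcal D(\mathcal N)$. *Fröhlich Hamiltonian.* $H_N^{\rm F}$ is the self-adjoint operator associated with the quadratic form with domain $\mathcal D((H_N^0)^{1/2})$ that is given by the (formal) expression $$\sum_{j=1}^N\Big[-\Delta_j+N^{-1/2}\int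 dk\,|k|^{-1}\big(e^{ikx_j}a_k+e^{-ikx_j}a_k^*\big)\Big]+\mathcal N,$$ that is, by the limit $\Lambda\to\infty$ of the forms of $\sum_{j}\big[-\Delta_j+N^{-1/2}\Phi(G_{\Lambda,x_j})\big]+\mathcal N$. *Gross transform.* $U_K$ is the unitary operator $$U_K=\exp\Big[N^{-1/2}\sum_{j=1}^N\big(a(B_{K,x_j})-a^*(B_{K,x_j})\big)\Big].$$ *Gross transformed Hamiltonian.* $$H_{N,K}^{\rm G}=\sum_{j=1}^N\Big[-\Delta_j+N^{-1/2}\Phi(G_{K,x_j})\Big]+\mathcal N+\sum_{j=1}^N A_{K,x_j}+\sum_{j,l=1}^N V_K(x_j-x_l),$$ where $$A_{K,x}=2iN^{-1/2}\Big(\nabla_x\cdot a(kB_{K,x})+a^*(kB_{K,x})\cdot\nabla_x\Big)+N^{-1}\Phi(kB_{K,x})^2,$$ $$V_K(x-y)=N^{-1}\Big(\langle B_{K,x},B_{K,y}\rangle+2\,{\rm Re}\,\langle G_x,B_{K,y}\rangle\Big).$$ **Statement.** (1) For all $N\ge1$ and all $K>0$, the operator $H_{N,K}^{\rm G}$ is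 self-adjoint with domain $\mathcal D(H_N^0)$. (2) There is a constant $\widetilde K>0$, independent of $N$, such that for all $K\ge\widetilde K$ and all $N\ge1$, $$H_N^{\rm F}=U_K^*\,H_{N,K}^{\rm G}\,U_K,\qquad \mathcal D(H_N^{\rm F})=U_K^*\,\mathcal D(H_N^0).$$ -/

import Mathlib

open MeasureTheory Filter Topology
open scoped ContDiff InnerProductSpace ComplexConjugate

noncomputable section

namespace Froehlich

/-- Euclidean space `ℝ³`. -/
abbrev E := EuclideanSpace ℝ (Fin 3)

/-- Configurations `(x, k)` of `N` particles and `n` phonons. -/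
abbrev Conf (N n : ℕ) := (Fin N → E) × (Fin n → E)

/-- Square integrable functions of `N` particle positions and `n` phonon momenta. -/
abbrev L2 (N n : ℕ) := Lp ℂ 2 (volume : Measure (Conf N n))

/-- The Hilbert sum `⨁ₙ L²(ℝ^{3N} × ℝ^{3n})`, without any exchange symmetry. -/
abbrev Full (N : ℕ) := lp (fun n : ℕ => L2 N n) 2

instance instAddCommGroupL2 (N n : ℕ) : AddCommGroup (L2 N n) := inferInstance

instance instModuleL2 (N n : ℕ) : Module ℂ (L2 N n) := inferInstance

instance instNormedAddCommGroupFull (N : ℕ) : NormedAddCommGroup (Full N) := inferInstance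

instance instInnerProductSpaceFull (N : ℕ) : InnerProductSpace ℂ (Full N) := inferInstance

instance instAddCommGroupFull (N : ℕ) : AddCommGroup (Full N) := inferInstance

instance instModuleFull (N : ℕ) : Module ℂ (Full N) := inferInstance

/-- The `n`-phonon component of a vector. -/
def sector {N : ℕ} (n : ℕ) : Full N →L[ℂ] L2 N n := lp.evalCLM ℂ (fun n : ℕ => L2 N n) 2 n

theorem sector_ext {N : ℕ} {Ψ χ : Full N} (h : ∀ n, sector n Ψ = sector n χ) : Ψ = χ :=
  lp.ext (funext h)

theorem sector_zero_ae {N : ℕ} (n : ℕ) : sector n (0 : Full N) =ᵐ[volume] fun _ => (0 : ℂ) := by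
  rw [map_zero]
  exact Lp.coeFn_zero _ _ _

theorem sector_add_ae {N : ℕ} (n : ℕ) (Ψ χ : Full N) :
    sector n (Ψ + χ) =ᵐ[volume] fun p => sector n Ψ p + sector n χ p := by
  rw [map_add]
  exact Lp.coeFn_add _ _

theorem sector_smul_ae {N : ℕ} (n : ℕ) (c : ℂ) (Ψ : Full N) :
    sector n (c • Ψ) =ᵐ[volume] fun p => c * sector n Ψ p := by
  rw [map_smul]
  exact Lp.coeFn_smul _ _

/-! ### Helper facts on configurations -/

def permConf {N n : ℕ} (σ : Equiv.Perm (Fin N)) (τ : Equiv.Perm (Fin n)) (p : Conf N n) :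
    Conf N n := (fun j => p.1 (σ j), fun i => p.2 (τ i))

theorem measurePreserving_perm {n : ℕ} (τ : Equiv.Perm (Fin n)) :
    MeasurePreserving (fun (k : Fin n → E) i => k (τ i)) volume volume := by
  have h := volume_measurePreserving_piCongrLeft (fun _ : Fin n => E) τ.symm
  convert h using 1
  funext k i
  have := MeasurableEquiv.piCongrLeft_apply_apply (e := τ.symm) (β := fun _ : Fin n => E) k (τ i)
  simpa using this.symm

theorem measurePreserving_permConf {N n : ℕ} (σ : Equiv.Perm (Fin N)) (τ : Equiv.Perm (Fin n)) :
    MeasurePreserving (permConf (N := N) (n := n) σ τ) volume volume :=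
  (measurePreserving_perm σ).prod (measurePreserving_perm τ)

theorem measurePreserving_cons {N n : ℕ} :
    MeasurePreserving (fun z : Conf N n × E => ((z.1.1, Fin.cons z.2 z.1.2) : Conf N (n + 1)))
      volume volume := by
  have h1 : MeasurePreserving (fun w : (Fin n → E) × E => (Fin.cons w.2 w.1 : Fin (n + 1) → E))
      volume volume := by
    have h := (volume_preserving_piFinSuccAbove (fun _ : Fin (n + 1) => E) 0).symm
    have h2 : MeasurePreserving (Prod.swap : (Fin n → E) × E → E × (Fin n → E)) volume volume :=
      Measure.measurePreserving_swap
    have h3 := h.comp h2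
    have e : (fun w : (Fin n → E) × E => (Fin.cons w.2 w.1 : Fin (n + 1) → E)) =
        (MeasurableEquiv.piFinSuccAbove (fun _ : Fin (n + 1) => E) 0).symm ∘ Prod.swap := by
      funext w
      simp [MeasurableEquiv.piFinSuccAbove, Fin.insertNthEquiv]
    rw [e]
    exact h3
  have h3 : MeasurePreserving (fun z : Conf N n × E => (z.1.1, (z.1.2, z.2))) volume volume :=
    volume_preserving_prodAssoc
  exact ((MeasurePreserving.id (volume : Measure (Fin N → E))).prod h1).comp h3

theorem quasiMeasurePreserving_removeNth {N n : ℕ} (i : Fin (n + 1)) :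
    Measure.QuasiMeasurePreserving
      (fun p : Conf N (n + 1) => ((p.1, i.removeNth p.2) : Conf N n)) volume volume := by
  have h := volume_preserving_piFinSuccAbove (fun _ : Fin (n + 1) => E) i
  have h1 : Measure.QuasiMeasurePreserving (fun k : Fin (n + 1) → E => i.removeNth k)
      volume volume := by
    have h2 : Measure.QuasiMeasurePreserving (Prod.snd : E × (Fin n → E) → (Fin n → E))
        volume volume := Measure.quasiMeasurePreserving_snd
    exact h2.comp h.quasiMeasurePreserving
  have h3 : MeasurePreserving (fun p : (Fin N → E) × (Fin (n + 1) → E) =>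
      (p.1, MeasurableEquiv.piFinSuccAbove (fun _ : Fin (n + 1) => E) i p.2)) volume volume :=
    (MeasurePreserving.id (volume : Measure (Fin N → E))).prod h
  have h4 : Measure.QuasiMeasurePreserving (fun p : (Fin N → E) × (E × (Fin n → E)) =>
      (p.1, p.2.2)) volume volume :=
    QuasiMeasurePreserving.prodMap
      (Measure.QuasiMeasurePreserving.id (volume : Measure (Fin N → E)))
      Measure.quasiMeasurePreserving_snd
  exact h4.comp h3.quasiMeasurePreserving

/-- Symmetry under permutations of the particles and under permutations of the phonons. -/
def IsBosonic {N : ℕ} (Ψ : Full N) : Prop :=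
  ∀ (n : ℕ) (σ : Equiv.Perm (Fin N)) (τ : Equiv.Perm (Fin n)),
    (fun p => sector n Ψ (permConf σ τ p)) =ᵐ[volume] sector n Ψ

theorem IsBosonic.zero (N : ℕ) : IsBosonic (0 : Full N) := by
  intro n σ τ
  have h0 := sector_zero_ae (N := N) n
  have h1 := (measurePreserving_permConf σ τ).quasiMeasurePreserving.ae h0
  filter_upwards [h0, h1] with p hp hp1
  rw [hp, hp1]

theorem IsBosonic.add {N : ℕ} {a b : Full N} (ha : IsBosonic a) (hb : IsBosonic b) :
    IsBosonic (a + b) := by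
  intro n σ τ
  have h0 := sector_add_ae n a b
  have h1 := (measurePreserving_permConf σ τ).quasiMeasurePreserving.ae h0
  filter_upwards [h0, h1, ha n σ τ, hb n σ τ] with p hp hp1 hpa hpb
  exact hp1.trans ((congrArg₂ (· + ·) hpa hpb).trans hp.symm)

theorem IsBosonic.smul {N : ℕ} (c : ℂ) {a : Full N} (ha : IsBosonic a) : IsBosonic (c • a) := by
  intro n σ τ
  have h0 := sector_smul_ae n c a
  have h1 := (measurePreserving_permConf σ τ).quasiMeasurePreserving.ae h0
  filter_upwards [h0, h1, ha n σ τ] with p hp hp1 hpa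
  exact hp1.trans ((congrArg (c * ·) hpa).trans hp.symm)

/-- The subspace `L²_s(ℝ^{3N}) ⊗ 𝓕_s`. -/
def bosonic (N : ℕ) : Submodule ℂ (Full N) where
  carrier := {Ψ | IsBosonic Ψ}
  zero_mem' := IsBosonic.zero N
  add_mem' := IsBosonic.add
  smul_mem' c _ := IsBosonic.smul c

theorem isClosed_bosonic (N : ℕ) : IsClosed (bosonic N : Set (Full N)) := by
  have : (bosonic N : Set (Full N)) = ⋂ (n : ℕ) (σ : Equiv.Perm (Fin N)) (τ : Equiv.Perm (Fin n)),
      {Ψ : Full N | Lp.compMeasurePreserving _ (measurePreserving_permConf σ τ) (sector n Ψ)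
        = sector n Ψ} := by
    ext Ψ
    simp only [Set.mem_iInter, Set.mem_ofPred_eq, SetLike.mem_coe]
    refine forall_congr' fun n => forall_congr' fun σ => forall_congr' fun τ => ?_
    have h := Lp.coeFn_compMeasurePreserving (sector n Ψ) (measurePreserving_permConf σ τ)
    constructor
    · intro h1
      exact Lp.ext (h.trans h1)
    · intro h1
      rw [h1] at h
      exact h.symm
  rw [this]
  refine isClosed_iInter fun n => isClosed_iInter fun σ => isClosed_iInter fun τ => ?_
  exact isClosed_eq ((Lp.isometry_compMeasurePreserving
    (measurePreserving_permConf σ τ)).continuous.comp (sector n).continuous) (sector n).continuous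

/-- The Hilbert space `L²_s(ℝ^{3N}) ⊗ 𝓕_s` of the `N`-particle system. -/
abbrev H (N : ℕ) := ↥(bosonic N)

instance instCompleteSpaceH (N : ℕ) : CompleteSpace (H N) :=
  (isClosed_bosonic N).completeSpace_coe

/-- The unit vector in the direction of the `i`-th coordinate of the `j`-th particle. -/
def dir {N : ℕ} (n : ℕ) (j : Fin N) (i : Fin 3) : Conf N n :=
  (Pi.single j (EuclideanSpace.single i (1 : ℝ)), 0)

theorem integrable_testFunction {N n : ℕ} {φ : Conf N n → ℝ} (h1 : Continuous φ)
    (h2 : HasCompactSupport φ) (u : L2 N n) :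
    Integrable (fun p => (φ p : ℂ) * u p) := by
  have h3 : MemLp (fun p => (φ p : ℂ)) 2 (volume : Measure (Conf N n)) :=
    (h1.memLp_of_hasCompactSupport h2).ofReal
  exact h3.integrable_mul (Lp.memLp u)

theorem continuous_fderiv_testFunction {N n : ℕ} {φ : Conf N n → ℝ} (h1 : ContDiff ℝ ∞ φ)
    (v : Conf N n) : Continuous fun p => fderiv ℝ φ p v :=
  (h1.continuous_fderiv (by simp)).clm_apply continuous_const

theorem integral_mul_sector_add {N n : ℕ} {φ : Conf N n → ℝ} (h1 : Continuous φ)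
    (h2 : HasCompactSupport φ) (u v : Full N) :
    ∫ p, (φ p : ℂ) * sector n (u + v) p =
      (∫ p, (φ p : ℂ) * sector n u p) + ∫ p, (φ p : ℂ) * sector n v p := by
  rw [← integral_add (integrable_testFunction h1 h2 _) (integrable_testFunction h1 h2 _)]
  refine integral_congr_ae ?_
  filter_upwards [sector_add_ae n u v] with p hp
  rw [hp, mul_add]

theorem integral_mul_sector_smul {N n : ℕ} (φ : Conf N n → ℝ) (c : ℂ) (u : Full N) :
    ∫ p, (φ p : ℂ) * sector n (c • u) p = c * ∫ p, (φ p : ℂ) * sector n u p := by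
  rw [← integral_const_mul]
  refine integral_congr_ae ?_
  filter_upwards [sector_smul_ae n c u] with p hp
  rw [hp]
  ring

/-- `χ` is the weak partial derivative of `Ψ` with respect to the `i`-th coordinate of the `j`-th
particle, in every phonon sector. -/
def HasPartial {N : ℕ} (j : Fin N) (i : Fin 3) (Ψ χ : Full N) : Prop :=
  ∀ (n : ℕ) (φ : Conf N n → ℝ), ContDiff ℝ ∞ φ → HasCompactSupport φ →
    ∫ p, (fderiv ℝ φ p (dir n j i) : ℂ) * sector n Ψ p = - ∫ p, (φ p : ℂ) * sector n χ p

theorem integral_mul_sector_zero {N n : ℕ} (φ : Conf N n → ℝ) :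
    ∫ p, (φ p : ℂ) * sector n (0 : Full N) p = 0 := by
  refine integral_eq_zero_of_ae ?_
  filter_upwards [sector_zero_ae (N := N) n] with p hp
  rw [hp, mul_zero, Pi.zero_apply]

theorem HasPartial.zero {N : ℕ} (j : Fin N) (i : Fin 3) : HasPartial j i (0 : Full N) 0 := by
  intro n φ h1 h2
  rw [integral_mul_sector_zero (fun p => fderiv ℝ φ p (dir n j i)), integral_mul_sector_zero φ,
    neg_zero]

theorem HasPartial.add {N : ℕ} {j : Fin N} {i : Fin 3} {Ψ Ψ' χ χ' : Full N}
    (ha : HasPartial j i Ψ χ) (hb : HasPartial j i Ψ' χ') :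
    HasPartial j i (Ψ + Ψ') (χ + χ') := by
  intro n φ h1 h2
  have e1 := integral_mul_sector_add (continuous_fderiv_testFunction h1 (dir n j i))
    (h2.fderiv_apply ℝ _) Ψ Ψ'
  have e2 := integral_mul_sector_add h1.continuous h2 χ χ'
  exact e1.trans ((congrArg₂ (· + ·) (ha n φ h1 h2) (hb n φ h1 h2)).trans
    ((neg_add _ _).symm.trans (congrArg Neg.neg e2.symm)))

theorem HasPartial.smul {N : ℕ} {j : Fin N} {i : Fin 3} (c : ℂ) {Ψ χ : Full N}
    (ha : HasPartial j i Ψ χ) : HasPartial j i (c • Ψ) (c • χ) := by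
  intro n φ h1 h2
  have e1 := integral_mul_sector_smul (fun p => fderiv ℝ φ p (dir n j i)) c Ψ
  have e2 := integral_mul_sector_smul φ c χ
  exact e1.trans ((congrArg (c * ·) (ha n φ h1 h2)).trans
    ((mul_neg _ _).trans (congrArg Neg.neg e2.symm)))

/-- A weak partial derivative is unique. -/
theorem HasPartial.eq_zero {N : ℕ} {j : Fin N} {i : Fin 3} {χ : Full N}
    (hw : HasPartial j i 0 χ) : χ = 0 := by
  refine sector_ext fun n => Lp.ext (Filter.EventuallyEq.trans ?_ (sector_zero_ae n).symm)
  refine ae_eq_zero_of_integral_contDiff_smul_eq_zero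
    ((Lp.memLp (sector n χ)).locallyIntegrable (by norm_num)) fun φ h1 h2 => ?_
  have := hw n φ h1 h2
  rw [integral_mul_sector_zero (fun p => fderiv ℝ φ p (dir n j i))] at this
  simpa using this.symm

/-- The weak partial derivative `∂_{j,i}` on its maximal domain in `Full N`. -/
def partialDeriv (N : ℕ) (j : Fin N) (i : Fin 3) : Full N →ₗ.[ℂ] Full N :=
  Submodule.toLinearPMap
    { carrier := {w | HasPartial j i w.1 w.2}
      zero_mem' := HasPartial.zero j i
      add_mem' := HasPartial.add
      smul_mem' := fun c _ => HasPartial.smul c }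

/-! ### Phonon operators -/

/-- `χ = c(𝓝) Ψ`: the `n`-phonon component is multiplied by `c n`. -/
def HasNumberFun {N : ℕ} (c : ℕ → ℂ) (Ψ χ : Full N) : Prop :=
  ∀ n, sector n χ = c n • sector n Ψ

/-- The function `c(𝓝)` of the number operator, on its maximal domain. -/
def numberFun (N : ℕ) (c : ℕ → ℂ) : Full N →ₗ.[ℂ] Full N :=
  Submodule.toLinearPMap
    { carrier := {w | HasNumberFun c w.1 w.2}
      zero_mem' := fun n => by simp
      add_mem' := fun {a b} ha hb n => by
        have e1 := ha n
        have e2 := hb n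
        exact (map_add _ _ _).trans ((congrArg₂ (· + ·) e1 e2).trans
          ((smul_add _ _ _).symm.trans (congrArg (c n • ·) (map_add _ _ _).symm)))
      smul_mem' := fun z a ha n => by
        have e1 := ha n
        exact (map_smul _ _ _).trans ((congrArg (z • ·) e1).trans
          ((smul_comm _ _ _).trans (congrArg (c n • ·) (map_smul _ _ _).symm))) }

/-- The number operator `𝓝`. -/
def numberOp (N : ℕ) : Full N →ₗ.[ℂ] Full N := numberFun N fun n => (n : ℂ)

/-- The operator `𝓝^{1/2}`. -/
def sqrtNumberOp (N : ℕ) : Full N →ₗ.[ℂ] Full N := numberFun N fun n => (√(n : ℝ) : ℂ)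

/-- `χ = a*(f_{x_j}) Ψ` for the form factor `f : x ↦ (k ↦ f x k)`. -/
def HasCreation {N : ℕ} (f : E → E → ℂ) (j : Fin N) (Ψ χ : Full N) : Prop :=
  sector 0 χ = 0 ∧ ∀ n, sector (n + 1) χ =ᵐ[volume] fun p =>
    ∑ i : Fin (n + 1), ((√(n + 1 : ℝ))⁻¹ : ℂ) * f (p.1 j) (p.2 i) *
      sector n Ψ (p.1, i.removeNth p.2)

theorem HasCreation.zero {N : ℕ} (f : E → E → ℂ) (j : Fin N) :
    HasCreation f j (0 : Full N) 0 := by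
  refine ⟨map_zero _, fun n => ?_⟩
  have h (i : Fin (n + 1)) := (quasiMeasurePreserving_removeNth (N := N) i).ae (sector_zero_ae n)
  filter_upwards [sector_zero_ae (N := N) (n + 1), eventually_all.2 h] with p hp hq
  exact hp.trans (Finset.sum_eq_zero fun i _ => (congrArg _ (hq i)).trans (mul_zero _)).symm

theorem HasCreation.add {N : ℕ} {f : E → E → ℂ} {j : Fin N} {Ψ Ψ' χ χ' : Full N}
    (ha : HasCreation f j Ψ χ) (hb : HasCreation f j Ψ' χ') :
    HasCreation f j (Ψ + Ψ') (χ + χ') := by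
  refine ⟨by rw [map_add, ha.1, hb.1, add_zero], fun n => ?_⟩
  have h (i : Fin (n + 1)) := (quasiMeasurePreserving_removeNth (N := N) i).ae
    (sector_add_ae n Ψ Ψ')
  filter_upwards [sector_add_ae (n + 1) χ χ', ha.2 n, hb.2 n, eventually_all.2 h] with p hp h1 h2 hq
  refine hp.trans ((congrArg₂ (· + ·) h1 h2).trans ?_)
  refine (Finset.sum_add_distrib.symm).trans (Finset.sum_congr rfl fun i _ => ?_)
  exact ((congrArg _ (hq i)).trans (mul_add _ _ _)).symm

theorem HasCreation.smul {N : ℕ} {f : E → E → ℂ} {j : Fin N} (c : ℂ) {Ψ χ : Full N}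
    (ha : HasCreation f j Ψ χ) : HasCreation f j (c • Ψ) (c • χ) := by
  refine ⟨by rw [map_smul, ha.1, smul_zero], fun n => ?_⟩
  have h (i : Fin (n + 1)) := (quasiMeasurePreserving_removeNth (N := N) i).ae
    (sector_smul_ae n c Ψ)
  filter_upwards [sector_smul_ae (n + 1) c χ, ha.2 n, eventually_all.2 h] with p hp h1 hq
  refine hp.trans ((congrArg (c * ·) h1).trans ?_)
  refine (Finset.mul_sum _ _ _).trans (Finset.sum_congr rfl fun i _ => ?_)
  exact ((congrArg _ (hq i)).trans (mul_left_comm _ _ _)).symm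

theorem HasCreation.eq_zero {N : ℕ} {f : E → E → ℂ} {j : Fin N} {χ : Full N}
    (h : HasCreation f j 0 χ) : χ = 0 := by
  refine sector_ext fun n => ?_
  rcases n with _ | n
  · rw [h.1, map_zero]
  · refine Lp.ext (Filter.EventuallyEq.trans ?_ (sector_zero_ae (n + 1)).symm)
    exact (h.2 n).trans (((HasCreation.zero f j).2 n).symm.trans (sector_zero_ae (n + 1)))

/-- The creation operator `a*(f_{x_j})` on its maximal domain in `Full N`. -/
def creation {N : ℕ} (f : E → E → ℂ) (j : Fin N) : Full N →ₗ.[ℂ] Full N :=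
  Submodule.toLinearPMap
    { carrier := {w | HasCreation f j w.1 w.2}
      zero_mem' := HasCreation.zero f j
      add_mem' := HasCreation.add
      smul_mem' := fun c _ => HasCreation.smul c }

/-- The integrand `k ↦ conj (f_{x_j}(k)) Ψ⁽ⁿ⁺¹⁾(x, k, k₁, …, kₙ)` of the annihilation operator. -/
def annihilationIntegrand {N : ℕ} (f : E → E → ℂ) (j : Fin N) (Ψ : Full N) (n : ℕ)
    (p : Conf N n) (k : E) : ℂ :=
  conj (f (p.1 j) k) * sector (n + 1) Ψ (p.1, Fin.cons k p.2)

/-- `χ = a(f_{x_j}) Ψ` for the form factor `f : x ↦ (k ↦ f x k)`. -/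
def HasAnnihilation {N : ℕ} (f : E → E → ℂ) (j : Fin N) (Ψ χ : Full N) : Prop :=
  ∀ n, ∀ᵐ p : Conf N n, Integrable (annihilationIntegrand f j Ψ n p) ∧
    sector n χ p = √(n + 1 : ℝ) * ∫ k, annihilationIntegrand f j Ψ n p k

theorem ae_ae_cons {N n : ℕ} {P : Conf N (n + 1) → Prop} (h : ∀ᵐ p, P p) :
    ∀ᵐ p : Conf N n, ∀ᵐ k : E, P (p.1, Fin.cons k p.2) :=
  Measure.ae_ae_of_ae_prod (measurePreserving_cons.quasiMeasurePreserving.ae h)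

theorem HasAnnihilation.zero {N : ℕ} (f : E → E → ℂ) (j : Fin N) :
    HasAnnihilation f j (0 : Full N) 0 := by
  intro n
  filter_upwards [sector_zero_ae (N := N) n, ae_ae_cons (sector_zero_ae (N := N) (n + 1))]
    with p hp hq
  have h : annihilationIntegrand f j 0 n p =ᵐ[volume] fun _ => (0 : ℂ) := by
    filter_upwards [hq] with k hk
    exact (congrArg _ hk).trans (mul_zero _)
  refine ⟨(integrable_zero _ _ _).congr h.symm, ?_⟩
  rw [integral_congr_ae h]
  simpa using hp

theorem HasAnnihilation.add {N : ℕ} {f : E → E → ℂ} {j : Fin N} {Ψ Ψ' χ χ' : Full N}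
    (ha : HasAnnihilation f j Ψ χ) (hb : HasAnnihilation f j Ψ' χ') :
    HasAnnihilation f j (Ψ + Ψ') (χ + χ') := by
  intro n
  filter_upwards [sector_add_ae n χ χ', ae_ae_cons (sector_add_ae (n + 1) Ψ Ψ'), ha n, hb n]
    with p hp hq h1 h2
  have h : annihilationIntegrand f j (Ψ + Ψ') n p =ᵐ[volume] fun k =>
      annihilationIntegrand f j Ψ n p k + annihilationIntegrand f j Ψ' n p k := by
    filter_upwards [hq] with k hk
    exact (congrArg _ hk).trans (mul_add _ _ _)
  refine ⟨(h1.1.add h2.1).congr h.symm, ?_⟩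
  rw [integral_congr_ae h, integral_add h1.1 h2.1, mul_add]
  exact hp.trans (congrArg₂ (· + ·) h1.2 h2.2)

theorem HasAnnihilation.smul {N : ℕ} {f : E → E → ℂ} {j : Fin N} (c : ℂ) {Ψ χ : Full N}
    (ha : HasAnnihilation f j Ψ χ) : HasAnnihilation f j (c • Ψ) (c • χ) := by
  intro n
  filter_upwards [sector_smul_ae n c χ, ae_ae_cons (sector_smul_ae (n + 1) c Ψ), ha n]
    with p hp hq h1
  have h : annihilationIntegrand f j (c • Ψ) n p =ᵐ[volume] fun k =>
      c * annihilationIntegrand f j Ψ n p k := by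
    filter_upwards [hq] with k hk
    exact (congrArg _ hk).trans (mul_left_comm _ _ _)
  refine ⟨(h1.1.const_mul c).congr h.symm, ?_⟩
  rw [integral_congr_ae h, integral_const_mul, mul_left_comm]
  exact hp.trans (congrArg (c * ·) h1.2)

theorem HasAnnihilation.eq_zero {N : ℕ} {f : E → E → ℂ} {j : Fin N} {χ : Full N}
    (h : HasAnnihilation f j 0 χ) : χ = 0 := by
  refine sector_ext fun n => Lp.ext ?_
  filter_upwards [h n, HasAnnihilation.zero f j n] with p h1 h2
  exact h1.2.trans h2.2.symm

/-- The annihilation operator `a(f_{x_j})` on its maximal domain in `Full N`. -/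
def annihilation {N : ℕ} (f : E → E → ℂ) (j : Fin N) : Full N →ₗ.[ℂ] Full N :=
  Submodule.toLinearPMap
    { carrier := {w | HasAnnihilation f j w.1 w.2}
      zero_mem' := HasAnnihilation.zero f j
      add_mem' := HasAnnihilation.add
      smul_mem' := fun c _ => HasAnnihilation.smul c }

/-- The field operator `Φ(f_{x_j}) = a(f_{x_j}) + a*(f_{x_j})`. -/
def field {N : ℕ} (f : E → E → ℂ) (j : Fin N) : Full N →ₗ.[ℂ] Full N :=
  annihilation f j + creation f j

/-- `χ = m(x) Ψ` for a function `m` of the particle positions. -/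
def HasMul {N : ℕ} (m : (Fin N → E) → ℂ) (Ψ χ : Full N) : Prop :=
  ∀ n, sector n χ =ᵐ[volume] fun p => m p.1 * sector n Ψ p

/-- Multiplication by a function of the particle positions, on its maximal domain. -/
def mulOp {N : ℕ} (m : (Fin N → E) → ℂ) : Full N →ₗ.[ℂ] Full N :=
  Submodule.toLinearPMap
    { carrier := {w | HasMul m w.1 w.2}
      zero_mem' := fun n => by
        filter_upwards [sector_zero_ae (N := N) n] with p hp
        exact hp.trans ((congrArg (m p.1 * ·) hp).trans (mul_zero _)).symm
      add_mem' := fun {a b} ha hb n => by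
        filter_upwards [sector_add_ae n a.1 b.1, sector_add_ae n a.2 b.2, ha n, hb n]
          with p h1 h2 h3 h4
        exact (h2.trans (congrArg₂ (· + ·) h3 h4)).trans
          ((congrArg (m p.1 * ·) h1).trans (mul_add _ _ _)).symm
      smul_mem' := fun c a ha n => by
        filter_upwards [sector_smul_ae n c a.1, sector_smul_ae n c a.2, ha n] with p h1 h2 h3
        exact (h2.trans (congrArg (c * ·) h3)).trans
          ((congrArg (m p.1 * ·) h1).trans (mul_left_comm _ _ _)).symm }

/-- The form factor `f_x(k) = g(k) e^{-ikx}`. -/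
def formFactor (g : E → ℂ) (x k : E) : ℂ := g k * Complex.exp (-Complex.I * (inner ℝ k x : ℝ))

theorem norm_formFactor (g : E → ℂ) (x k : E) : ‖formFactor g x k‖ = ‖g k‖ := by
  simp [formFactor, Complex.norm_exp]

theorem memLp_formFactor {g : E → ℂ} (hg : MemLp g 2) (x : E) : MemLp (formFactor g x) 2 := by
  refine hg.congr_norm ?_ (ae_of_all _ fun k => (norm_formFactor g x k).symm)
  refine hg.aestronglyMeasurable.mul (Continuous.aestronglyMeasurable ?_)
  fun_prop

theorem sq_norm_integral_mul_le {f u : E → ℂ} (hf : MemLp f 2) (hu : MemLp u 2) :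
    ‖∫ k, conj (f k) * u k‖ ^ 2 ≤ (∫ k, ‖f k‖ ^ 2) * ∫ k, ‖u k‖ ^ 2 := by
  have h1 : ‖∫ k, conj (f k) * u k‖ ≤ ∫ k, ‖f k‖ * ‖u k‖ := by
    refine (norm_integral_le_integral_norm _).trans (le_of_eq ?_)
    simp
  have h2 := integral_mul_norm_le_Lp_mul_Lq (μ := (volume : Measure E)) (f := f) (g := u)
    (Real.HolderConjugate.two_two) (by simpa using hf) (by simpa using hu)
  simp only [Real.rpow_two, ← Real.sqrt_eq_rpow] at h2
  calc ‖∫ k, conj (f k) * u k‖ ^ 2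
      ≤ (√(∫ k, ‖f k‖ ^ 2) * √(∫ k, ‖u k‖ ^ 2)) ^ 2 := by
        gcongr
        exact h1.trans h2
    _ = _ := by
        rw [mul_pow, Real.sq_sqrt (by positivity), Real.sq_sqrt (by positivity)]

theorem sq_norm_L2 {N n : ℕ} (u : L2 N n) : ‖u‖ ^ 2 = ∫ p, ‖u p‖ ^ 2 := by
  have h := L2.inner_def (𝕜 := ℂ) u u
  rw [inner_self_eq_norm_sq_to_K] at h
  have h2 : (∫ p, inner ℂ (u p) (u p)) = ((∫ p, ‖u p‖ ^ 2 : ℝ) : ℂ) := by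
    rw [← integral_complex_ofReal]
    refine integral_congr_ae (ae_of_all _ fun p => ?_)
    simp [inner_self_eq_norm_sq_to_K]
  rw [h2] at h
  exact Complex.ofReal_injective (by simpa using h)

theorem integral_comp_measurePreserving {α β : Type*} [MeasurableSpace α] [MeasurableSpace β]
    {μ : Measure α} {ν : Measure β} {f : α → β} (hf : MeasurePreserving f μ ν) {g : β → ℝ}
    (hg : AEStronglyMeasurable g ν) : ∫ b, g b ∂ν = ∫ a, g (f a) ∂μ := by
  rw [← integral_map hf.measurable.aemeasurable (by rwa [hf.map_eq]), hf.map_eq]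

theorem memLp_cons {N n : ℕ} (v : L2 N (n + 1)) :
    MemLp (fun z : Conf N n × E => v (z.1.1, Fin.cons z.2 z.1.2)) 2 volume :=
  (Lp.memLp v).comp_measurePreserving measurePreserving_cons

theorem exists_annihilation_aux {N n : ℕ} {g : E → ℂ} (hg : MemLp g 2) (j : Fin N)
    (v : L2 N (n + 1)) : ∃ η : L2 N n,
      (∀ᵐ p : Conf N n,
        Integrable (fun k => conj (formFactor g (p.1 j) k) * v (p.1, Fin.cons k p.2)) ∧
        η p = √(n + 1 : ℝ) * ∫ k, conj (formFactor g (p.1 j) k) * v (p.1, Fin.cons k p.2)) ∧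
      ‖η‖ ^ 2 ≤ (∫ k, ‖g k‖ ^ 2) * ((n + 1) * ‖v‖ ^ 2) := by
  set u : Conf N n × E → ℂ := fun z => v (z.1.1, Fin.cons z.2 z.1.2) with hu
  have hmp := measurePreserving_cons (N := N) (n := n)
  have hu2 : MemLp u 2 (volume : Measure (Conf N n × E)) := memLp_cons v
  have hui : Integrable (fun z => ‖u z‖ ^ 2) ((volume : Measure (Conf N n)).prod volume) :=
    (memLp_two_iff_integrable_sq_norm hu2.1).1 hu2
  have hum : AEStronglyMeasurable u ((volume : Measure (Conf N n)).prod volume) := hu2.1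
  have hslice : ∀ᵐ p : Conf N n, MemLp (fun k => u (p, k)) 2 := by
    filter_upwards [hum.prodMk_left, hui.prod_right_ae] with p h1 h2
    exact (memLp_two_iff_integrable_sq_norm h1).2 h2
  have hint : Integrable (fun p : Conf N n => ∫ k, ‖u (p, k)‖ ^ 2) := hui.integral_prod_left
  set w : Conf N n × E → ℂ := fun z => conj (formFactor g (z.1.1 j) z.2) * u z with hw
  have hwm : AEStronglyMeasurable w ((volume : Measure (Conf N n)).prod volume) := by
    refine AEStronglyMeasurable.mul ?_ hum
    refine Complex.continuous_conj.comp_aestronglyMeasurable ?_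
    refine AEStronglyMeasurable.mul hg.1.comp_snd (Continuous.aestronglyMeasurable ?_)
    fun_prop
  set F : Conf N n → ℂ := fun p => √(n + 1 : ℝ) * ∫ k, w (p, k) with hF
  have hFm : AEStronglyMeasurable F volume :=
    (hwm.integral_prod_right').const_mul _
  have hbound : ∀ᵐ p : Conf N n,
      ‖F p‖ ^ 2 ≤ (∫ k, ‖g k‖ ^ 2) * ((n + 1) * ∫ k, ‖u (p, k)‖ ^ 2) := by
    filter_upwards [hslice] with p hp
    have h := sq_norm_integral_mul_le (memLp_formFactor hg (p.1 j)) hp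
    simp only [norm_formFactor] at h
    have h3 : ‖F p‖ ^ 2 = (n + 1) * ‖∫ k, conj (formFactor g (p.1 j) k) * u (p, k)‖ ^ 2 := by
      simp only [hF, norm_mul, mul_pow, Complex.norm_real, Real.norm_eq_abs, sq_abs]
      rw [Real.sq_sqrt (by positivity)]
    rw [h3, mul_left_comm]
    gcongr
  have hdom : Integrable fun p : Conf N n =>
      (∫ k, ‖g k‖ ^ 2) * ((n + 1) * ∫ k, ‖u (p, k)‖ ^ 2) := (hint.const_mul _).const_mul _
  have hF2i : Integrable fun p : Conf N n => ‖F p‖ ^ 2 := by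
    refine hdom.mono' (hFm.norm.pow 2) ?_
    filter_upwards [hbound] with p hp
    rwa [Real.norm_of_nonneg (by positivity)]
  have hF2 : MemLp F 2 volume := (memLp_two_iff_integrable_sq_norm hFm).2 hF2i
  refine ⟨hF2.toLp F, ?_, ?_⟩
  · filter_upwards [hslice, hF2.coeFn_toLp] with p h1 h2
    exact ⟨(memLp_formFactor hg (p.1 j)).star.integrable_mul h1, h2⟩
  · rw [sq_norm_L2, sq_norm_L2]
    have e1 : ∫ p, ‖(hF2.toLp F) p‖ ^ 2 = ∫ p, ‖F p‖ ^ 2 := by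
      refine integral_congr_ae ?_
      filter_upwards [hF2.coeFn_toLp] with p h2
      rw [h2]
    have e2 : ∫ p, ‖v p‖ ^ 2 = ∫ p : Conf N n, ∫ k, ‖u (p, k)‖ ^ 2 := by
      have h5 := integral_prod _ hui
      refine Eq.trans ?_ h5
      exact integral_comp_measurePreserving hmp ((Lp.aestronglyMeasurable v).norm.pow 2)
    rw [e1, e2, ← integral_const_mul, ← integral_const_mul]
    exact integral_mono_ae hF2i hdom hbound

theorem sq_norm_sqrt_smul {N n : ℕ} (m : ℕ) (u : L2 N n) :
    ‖(√(m : ℝ) : ℂ) • u‖ ^ 2 = m * ‖u‖ ^ 2 := by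
  rw [norm_smul, mul_pow, Complex.norm_real, Real.norm_eq_abs, sq_abs,
    Real.sq_sqrt (by positivity)]

theorem summable_sq_norm_sector {N : ℕ} (χ : Full N) : Summable fun n => ‖sector n χ‖ ^ 2 := by
  have h := (lp.memℓp χ).summable (by norm_num)
  refine h.congr fun n => ?_
  simp [sector]
  rfl

/-- Annihilation operators with square integrable form factors are defined on `D(𝓝^{1/2})`. -/
theorem exists_annihilation {N : ℕ} {g : E → ℂ} (hg : MemLp g 2) (j : Fin N) {Ψ χ : Full N}
    (h : HasNumberFun (fun n => (√(n : ℝ) : ℂ)) Ψ χ) :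
    ∃ η, HasAnnihilation (formFactor g) j Ψ η := by
  choose η h1 h2 using fun n => exists_annihilation_aux (n := n) hg j (sector (n + 1) Ψ)
  have h3 : ∀ n : ℕ, ((n : ℝ) + 1) * ‖sector (n + 1) Ψ‖ ^ 2 = ‖sector (n + 1) χ‖ ^ 2 := by
    intro n
    have h4 := sq_norm_sqrt_smul (n + 1) (sector (n + 1) Ψ)
    have h5 := congrArg (fun v : L2 N (n + 1) => ‖v‖ ^ 2) (h (n + 1))
    refine Eq.symm (h5.trans (h4.trans ?_))
    push_cast
    rfl
  have hs' : Summable fun n => ‖η n‖ ^ 2 := by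
    refine Summable.of_nonneg_of_le (fun n => by positivity) h2 (Summable.mul_left _ ?_)
    exact ((summable_nat_add_iff 1).2 (summable_sq_norm_sector χ)).congr fun n => (h3 n).symm
  have hm : Memℓp (E := fun n => L2 N n) η 2 := by
    refine memℓp_gen ?_
    simpa using hs'
  exact ⟨⟨η, hm⟩, h1⟩

/-! ### The free operator -/

/-- Composition `B A` on its natural domain `{Ψ ∈ D(A) | A Ψ ∈ D(B)}`. -/
def opComp {N : ℕ} (B A : Full N →ₗ.[ℂ] Full N) : Full N →ₗ.[ℂ] Full N :=
  B.comp (A.domRestrict ((B.domain.comap A.toFun).map A.domain.subtype)) (by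
    rintro ⟨x, hx1, hx2⟩
    obtain ⟨⟨y, hy1⟩, hy2, rfl⟩ := hx1
    exact hy2)

/-- The part of an operator in the symmetric subspace, on `{Ψ ∈ D(A) ∩ H | A Ψ ∈ H}`. -/
def symPart {N : ℕ} (A : Full N →ₗ.[ℂ] Full N) : H N →ₗ.[ℂ] H N :=
  (A.graph.comap ((bosonic N).subtype.prodMap (bosonic N).subtype)).toLinearPMap

/-- The Laplacian `Δ_j` of the `j`-th particle. -/
def laplacian {N : ℕ} (j : Fin N) : Full N →ₗ.[ℂ] Full N :=
  ∑ i : Fin 3, opComp (partialDeriv N j i) (partialDeriv N j i)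

/-- `H²(ℝ^{3N}) ⊗ 𝓕`: all first and second weak partial derivatives with respect to the particle
coordinates are square integrable. -/
def sobolevTwo (N : ℕ) : Submodule ℂ (Full N) :=
  ⨅ (j : Fin N) (i : Fin 3), (partialDeriv N j i).domain ⊓
    ⨅ (l : Fin N) (m : Fin 3), (opComp (partialDeriv N l m) (partialDeriv N j i)).domain

/-- The free Hamiltonian `H_N^0 = -∑ⱼ Δⱼ + 𝓝` with domain `(H²_s(ℝ^{3N}) ⊗ 𝓕_s) ∩ D(𝓝)`. -/
def freeHamiltonian (N : ℕ) : H N →ₗ.[ℂ] H N :=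
  symPart ((-(∑ j : Fin N, laplacian j) + numberOp N).domRestrict (sobolevTwo N))

/-! ### The Fröhlich Hamiltonian -/

/-- The coupling `N^{-1/2}`. -/
def coupling (N : ℕ) : ℂ := ((√(N : ℝ))⁻¹ : ℝ)

/-- `|k|⁻¹ 𝟙_{|k| ≤ Λ}`, so that `G_{Λ,x} = formFactor (gCut Λ) x`. -/
def gCut (Λ : ℝ) (k : E) : ℂ := if ‖k‖ ≤ Λ then ((‖k‖⁻¹ : ℝ) : ℂ) else 0

theorem memLp_gCut (Λ : ℝ) : MemLp (gCut Λ) 2 := by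
  have hm : Measurable (gCut Λ) :=
    Measurable.ite (measurableSet_le measurable_norm measurable_const)
      (Complex.measurable_ofReal.comp measurable_norm.inv) measurable_const
  refine (memLp_two_iff_integrable_sq_norm hm.aestronglyMeasurable).2 ?_
  have h : (fun k : E => ‖gCut Λ k‖ ^ 2) =
      fun k => (fun r : ℝ => if r ≤ Λ then (r⁻¹) ^ 2 else 0) ‖k‖ := by
    funext k
    by_cases hk : ‖k‖ ≤ Λ <;> simp [gCut, hk]
  rw [h]
  refine (integrable_fun_norm_addHaar (volume : Measure E)
    (f := fun r : ℝ => if r ≤ Λ then (r⁻¹) ^ 2 else 0)).2 ?_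
  have h2 : IntegrableOn (fun _ : ℝ => (1 : ℝ)) (Set.Ioc 0 Λ) := by simp
  have h3 : IntegrableOn ((Set.Ioc 0 Λ).indicator fun _ : ℝ => (1 : ℝ)) (Set.Ioi 0) :=
    ((integrable_indicator_iff measurableSet_Ioc).2 h2).integrableOn
  refine h3.congr_fun (fun r hr => ?_) measurableSet_Ioi
  have hr0 : (r : ℝ) ≠ 0 := (Set.mem_Ioi.1 hr).ne'
  by_cases h4 : r ≤ Λ
  · simp [h4, Set.mem_Ioi.1 hr, hr0, Set.indicator]
  · simp [h4, Set.indicator]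

/-- The form domain `D((H_N^0)^{1/2}) = (H¹_s(ℝ^{3N}) ⊗ 𝓕_s) ∩ D(𝓝^{1/2})`. -/
def formDomain (N : ℕ) : Submodule ℂ (Full N) :=
  bosonic N ⊓ (⨅ (j : Fin N) (i : Fin 3), (partialDeriv N j i).domain) ⊓ (sqrtNumberOp N).domain

theorem formDomain_le_partialDeriv {N : ℕ} (j : Fin N) (i : Fin 3) :
    formDomain N ≤ (partialDeriv N j i).domain :=
  inf_le_left.trans (inf_le_right.trans ((iInf_le _ j).trans (iInf_le _ i)))

theorem formDomain_le_sqrtNumberOp (N : ℕ) : formDomain N ≤ (sqrtNumberOp N).domain :=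
  inf_le_right

theorem formDomain_le_annihilation {N : ℕ} (Λ : ℝ) (j : Fin N) :
    formDomain N ≤ (annihilation (formFactor (gCut Λ)) j).domain := by
  intro Ψ hΨ
  obtain ⟨⟨_, χ⟩, h1, rfl⟩ := formDomain_le_sqrtNumberOp N hΨ
  obtain ⟨η, hη⟩ := exists_annihilation (memLp_gCut Λ) j h1
  exact ⟨(_, η), hη, rfl⟩

/-- `∂_{j,i}` on the form domain. -/
def formPartial {N : ℕ} (j : Fin N) (i : Fin 3) : formDomain N →ₗ[ℂ] Full N :=
  (partialDeriv N j i).toFun ∘ₗ Submodule.inclusion (formDomain_le_partialDeriv j i)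

/-- `𝓝^{1/2}` on the form domain. -/
def formSqrtNumber (N : ℕ) : formDomain N →ₗ[ℂ] Full N :=
  (sqrtNumberOp N).toFun ∘ₗ Submodule.inclusion (formDomain_le_sqrtNumberOp N)

/-- `a(G_{Λ,x_j})` on the form domain. -/
def formAnnihilation {N : ℕ} (Λ : ℝ) (j : Fin N) : formDomain N →ₗ[ℂ] Full N :=
  (annihilation (formFactor (gCut Λ)) j).toFun ∘ₗ
    Submodule.inclusion (formDomain_le_annihilation Λ j)

/-- The sesquilinear form of `∑ⱼ [-Δⱼ + N^{-1/2} Φ(G_{Λ,x_j})] + 𝓝`. -/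
def cutoffForm {N : ℕ} (Λ : ℝ) (χ Ψ : formDomain N) : ℂ :=
  (∑ j : Fin N, ∑ i : Fin 3, inner ℂ (formPartial j i χ) (formPartial j i Ψ))
    + inner ℂ (formSqrtNumber N χ) (formSqrtNumber N Ψ)
    + coupling N * ∑ j : Fin N, (inner ℂ (χ : Full N) (formAnnihilation Λ j Ψ)
        + inner ℂ (formAnnihilation Λ j χ) (Ψ : Full N))

theorem cutoffForm_add {N : ℕ} (Λ : ℝ) (χ Ψ Ψ' : formDomain N) :
    cutoffForm Λ χ (Ψ + Ψ') = cutoffForm Λ χ Ψ + cutoffForm Λ χ Ψ' := by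
  simp only [cutoffForm, map_add, inner_add_right, Finset.sum_add_distrib, Submodule.coe_add]
  ring

theorem cutoffForm_smul {N : ℕ} (Λ : ℝ) (c : ℂ) (χ Ψ : formDomain N) :
    cutoffForm Λ χ (c • Ψ) = c * cutoffForm Λ χ Ψ := by
  simp only [cutoffForm, map_smul, inner_smul_right, Submodule.coe_smul, ← Finset.mul_sum,
    ← mul_add]
  ring

/-- `Ψ ∈ D(H_N^F)` and `H_N^F Ψ = η`: the vector `Ψ` lies in the form domain, and the quadratic form
of the Fröhlich Hamiltonian, i.e. the limit of the cutoff forms, satisfies `q(χ, Ψ) = ⟨χ, η⟩` for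
all `χ` in the form domain. -/
def HasFroehlich {N : ℕ} (Ψ η : H N) : Prop :=
  ∃ h : (Ψ : Full N) ∈ formDomain N, ∀ χ : formDomain N,
    Tendsto (fun Λ : ℝ => cutoffForm Λ χ ⟨Ψ, h⟩) atTop (𝓝 (inner ℂ (χ : Full N) (η : Full N)))

theorem HasFroehlich.zero (N : ℕ) : HasFroehlich (0 : H N) 0 := by
  refine ⟨(formDomain N).zero_mem, fun χ => ?_⟩
  have h (Λ : ℝ) : cutoffForm Λ χ 0 = 0 := by
    have h0 := cutoffForm_smul Λ 0 χ 0
    rwa [zero_smul, zero_mul] at h0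
  have h1 : inner ℂ (χ : Full N) ((0 : H N) : Full N) = 0 := inner_zero_right _
  rw [h1]
  exact tendsto_const_nhds.congr fun Λ => (h Λ).symm

theorem HasFroehlich.add {N : ℕ} {Ψ Ψ' η η' : H N} (ha : HasFroehlich Ψ η)
    (hb : HasFroehlich Ψ' η') : HasFroehlich (Ψ + Ψ') (η + η') := by
  obtain ⟨ha, ha'⟩ := ha
  obtain ⟨hb, hb'⟩ := hb
  refine ⟨(formDomain N).add_mem ha hb, fun χ => ?_⟩
  have h1 : inner ℂ (χ : Full N) ((η + η' : H N) : Full N) = inner ℂ (χ : Full N) (η : Full N)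
      + inner ℂ (χ : Full N) (η' : Full N) := inner_add_right _ _ _
  rw [h1]
  exact ((ha' χ).add (hb' χ)).congr fun Λ => (cutoffForm_add Λ χ ⟨Ψ, ha⟩ ⟨Ψ', hb⟩).symm

theorem HasFroehlich.smul {N : ℕ} (c : ℂ) {Ψ η : H N} (ha : HasFroehlich Ψ η) :
    HasFroehlich (c • Ψ) (c • η) := by
  obtain ⟨ha, ha'⟩ := ha
  refine ⟨(formDomain N).smul_mem c ha, fun χ => ?_⟩
  have h1 : inner ℂ (χ : Full N) ((c • η : H N) : Full N) = c * inner ℂ (χ : Full N) (η : Full N) :=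
    inner_smul_right _ _ _
  rw [h1]
  exact ((ha' χ).const_mul c).congr fun Λ => (cutoffForm_smul Λ c χ ⟨Ψ, ha⟩).symm

/-- The Fröhlich Hamiltonian `H_N^F`: the operator associated with its quadratic form. -/
def froehlichHamiltonian (N : ℕ) : H N →ₗ.[ℂ] H N :=
  Submodule.toLinearPMap
    { carrier := {w | HasFroehlich w.1 w.2}
      zero_mem' := HasFroehlich.zero N
      add_mem' := HasFroehlich.add
      smul_mem' := fun c _ => HasFroehlich.smul c }

/-! ### The Gross transform and the Gross transformed Hamiltonian -/

/-- `-𝟙_{|k| ≥ K} / (|k| (1 + |k|²))`, so that `B_{K,x} = formFactor (bCut K) x`. -/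
def bCut (K : ℝ) (k : E) : ℂ := if K ≤ ‖k‖ then ((-1 / (‖k‖ * (1 + ‖k‖ ^ 2)) : ℝ) : ℂ) else 0

/-- The exponent `N^{-1/2} ∑ⱼ (a(B_{K,x_j}) - a*(B_{K,x_j}))` of the Gross transform. -/
def grossGenerator (N : ℕ) (K : ℝ) : H N →ₗ.[ℂ] H N :=
  symPart (coupling N • ∑ j : Fin N,
    (annihilation (formFactor (bCut K)) j - creation (formFactor (bCut K)) j))

/-- Vectors with finitely many phonons. -/
def IsFinitePhonon {N : ℕ} (Ψ : H N) : Prop := ∃ M : ℕ, ∀ n, M ≤ n → sector n (Ψ : Full N) = 0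

/-- `U` is the unitary operator `exp (grossGenerator N K)`: on the dense set of vectors with finitely
many phonons it is given by the exponential series. -/
def IsGrossTransform (N : ℕ) (K : ℝ) (U : H N ≃ₗᵢ[ℂ] H N) : Prop :=
  ∀ Ψ : H N, IsFinitePhonon Ψ → ∃ v : ℕ → H N, v 0 = Ψ ∧
    (∀ m, (v m, v (m + 1)) ∈ (grossGenerator N K).graph) ∧
    HasSum (fun m => ((m.factorial : ℂ))⁻¹ • v m) (U Ψ)

/-- The `i`-th component of the form factor `k B_{K,x}(k)`. -/
def kB (K : ℝ) (i : Fin 3) : E → E → ℂ := formFactor fun k => (k i : ℂ) * bCut K k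

/-- `A_{K,x_j} = 2 i N^{-1/2} (∇_j · a(k B_{K,x_j}) + a*(k B_{K,x_j}) · ∇_j) + N⁻¹ Φ(k B_{K,x_j})²`. -/
def grossA {N : ℕ} (K : ℝ) (j : Fin N) : Full N →ₗ.[ℂ] Full N :=
  (2 * Complex.I * coupling N) • ∑ i : Fin 3,
      (opComp (partialDeriv N j i) (annihilation (kB K i) j)
        + opComp (creation (kB K i) j) (partialDeriv N j i))
    + ((N : ℂ)⁻¹) • ∑ i : Fin 3, opComp (field (kB K i) j) (field (kB K i) j)

/-- `V_K(x - y) = N⁻¹ (⟨B_{K,x}, B_{K,y}⟩ + 2 Re ⟨G_x, B_{K,y}⟩)`. -/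
def grossV (N : ℕ) (K : ℝ) (x y : E) : ℂ :=
  (N : ℂ)⁻¹ * ((∫ k, conj (formFactor (bCut K) x k) * formFactor (bCut K) y k)
    + 2 * ((∫ k, conj (formFactor (fun k => ((‖k‖⁻¹ : ℝ) : ℂ)) x k)
        * formFactor (bCut K) y k).re : ℂ))

/-- The Gross transformed Hamiltonian
`∑ⱼ [-Δⱼ + N^{-1/2} Φ(G_{K,x_j})] + 𝓝 + ∑ⱼ A_{K,x_j} + ∑_{j,l} V_K(x_j - x_l)` on its natural
domain. -/
def grossHamiltonian (N : ℕ) (K : ℝ) : H N →ₗ.[ℂ] H N :=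
  symPart (∑ j : Fin N, (-laplacian j + coupling N • field (formFactor (gCut K)) j) + numberOp N
    + ∑ j : Fin N, grossA K j
    + mulOp fun x => ∑ j : Fin N, ∑ l : Fin N, grossV N K (x j) (x l))

/-- The operator `U* A U` on the domain `U* D(A)`. -/
def conjugate {N : ℕ} (U : H N ≃ₗᵢ[ℂ] H N) (A : H N →ₗ.[ℂ] H N) : H N →ₗ.[ℂ] H N :=
  (A.graph.comap (U.toLinearEquiv.toLinearMap.prodMap U.toLinearEquiv.toLinearMap)).toLinearPMap

end Froehlich

end

/-!
The argument takes place in the space `Fk N` of all phonon sectors, on the *regular domain*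
`regDom N` of phonon-symmetric vectors that lie in `D(𝓝)` and have square integrable pure second
derivatives. Weak derivatives are treated as generators of the translation groups
(`hasPartial_iff`); this reduces commutators to relations between bounded operators.

*Self-adjointness of the transformed operator.* The critical perturbations of the free
operator are the terms linear in the momenta, since their form factor `v = k B` decays merely like
`|k|⁻²`. Although `k v` is not square integrable, the commutator of a derivative with `a(v)` is
infinitesimally bounded by the derivatives (`exists_hasGen_alpha_singular`). On a momentum shell of
size `R`, the annihilation operators that carry the plane waves of a lattice of shifts are almost
orthogonal, and translating a vector by a small shift costs only its derivatives
(`norm_alpha_le_of_lattice`); the contributions of the shells `1024 ^ m < |k| ≤ 1024 ^ (m + 1)` form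
a geometric series. Hence the perturbation is bounded relative to the free operator; its bound
relative to `𝓝`, however, is not small. Smallness is replaced by a lower bound: tested against
`𝓝 Ψ`, the kinetic energy of `𝓝^{1/2} Ψ` completes the square of the field, up to terms that are
small relative to the free operator (`re_inner_wN_ge`, `bddBelowRel_kinL_add_pertL`). This controls
`𝓝 Ψ` by the full operator, and with it all other terms (`exists_a_priori`). The estimate is uniform
along the path from the free to the full operator, so the continuity method yields solutions of the
equation `(H ± i) Ψ = f` in the regular domain, starting from the free equation, which is solved by
projection and difference quotients (`exists_strong_solution`). A symmetric operator for which
`H ± i` are onto is self-adjoint, and its domain is that of the free operator. No condition on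
`K > 0` is needed, so that `1` serves as the lower bound for `K` in the second part.

*The Gross transform.* The vectors with finitely many phonons are analytic for the generator, and
the exponential series extends to a unitary operator (`exists_unitary_exp`,
`exists_gross_equiv`); on that dense set it is prescribed, whence uniqueness. The commutators of the
generator with a field operator, with a derivative and with `𝓝` are bounded operators or field
operators whose further commutators with the generator are multiplications by functions of the
particle positions. Therefore the series can be conjugated term by term (`exp_mem_of_commutator`),
and the inverse transform `W` maps the regular domain into `D(𝓝)` and into the form domain.

*Comparison with the Fröhlich form.* For `Ψ = W Φ` with regular `Φ`, the cutoff form of `Ψ` is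
expressed through the transformed momenta, the square of which contains a term that is linear in the
field and diverges with the cutoff `Λ` (`tendsto_momSq`). Since `k² B + B = -G` beyond `K`, this
term, the commutator of `𝓝` with the generator and the interaction with the momenta beyond `K` add
up to the interaction with the momenta below `K` (`tendsto_form_sum`), while the multiplication
operators add up to the pair potential (`tendsto_shift`). So the limit of the forms is
`⟨χ, W H Φ⟩` (`tendsto_form`): the graph of `U* H U` is contained in the graph of the Fröhlich
operator. The latter is symmetric as a limit of hermitian forms, whereas `U* H U + i` is onto, so
that the two graphs coincide (`le_of_symmetric`).
-/

noncomputable section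

open MeasureTheory Filter Topology
open scoped ContDiff InnerProductSpace ComplexConjugate

set_option linter.unusedSectionVars false

namespace Froehlich

/-! ### Operators assembled from phonon sectors -/

-- Shortcut instances, so that addition and scalar multiplication on `L2` are found directly.
instance instDistribMulActionL2 (N n : ℕ) : DistribMulAction ℂ (L2 N n) := inferInstance

instance instDistribSMulL2 (N n : ℕ) : DistribSMul ℂ (L2 N n) := inferInstance

instance instMulActionL2 (N n : ℕ) : MulAction ℂ (L2 N n) := inferInstance

instance instSMulL2 (N n : ℕ) : SMul ℂ (L2 N n) := inferInstance

instance instAddMonoidL2 (N n : ℕ) : AddMonoid (L2 N n) := inferInstance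

instance instAddZeroClassL2 (N n : ℕ) : AddZeroClass (L2 N n) := inferInstance

/-- The Hilbert space `Full N`, as a type which elaboration does not unfold. -/
def Fk (N : ℕ) : Type := Full N

instance instNormedAddCommGroupFk (N : ℕ) : NormedAddCommGroup (Fk N) :=
  inferInstanceAs (NormedAddCommGroup (Full N))

instance instInnerProductSpaceFk (N : ℕ) : InnerProductSpace ℂ (Fk N) :=
  inferInstanceAs (InnerProductSpace ℂ (Full N))

instance instCompleteSpaceFk (N : ℕ) : CompleteSpace (Fk N) :=
  inferInstanceAs (CompleteSpace (Full N))

/-- The identification of `Fk N` with `Full N`. -/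
def toFull (N : ℕ) : Fk N ≃ₗᵢ[ℂ] Full N := LinearIsometryEquiv.refl ℂ (Full N)

section Sectors

variable {N : ℕ}
variable {C : ℝ}

/-- The `n`-phonon component of a vector. -/
def sec (n : ℕ) : Fk N →L[ℂ] L2 N n :=
  (sector n).comp (toFull N).toLinearIsometry.toContinuousLinearMap

lemma sector_toFull (n : ℕ) (Ψ : Fk N) : sector n (toFull N Ψ) = sec n Ψ := rfl

lemma sec_ext {Ψ χ : Fk N} (h : ∀ n, sec n Ψ = sec n χ) : Ψ = χ :=
  (toFull N).injective (sector_ext h)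

/-- The vector with prescribed phonon components. -/
def ofSeq (η : ∀ n, L2 N n) (h : Summable fun n => ‖η n‖ ^ 2) : Fk N :=
  (toFull N).symm ⟨η, memℓp_gen (by simpa using h)⟩

@[simp]
lemma sec_ofSeq (η : ∀ n, L2 N n) (h : Summable fun n => ‖η n‖ ^ 2) (n : ℕ) :
    sec n (ofSeq η h) = η n := rfl

lemma sec_add (n : ℕ) (Ψ χ : Fk N) : sec n (Ψ + χ) = sec n Ψ + sec n χ := map_add _ _ _

lemma sec_sub (n : ℕ) (Ψ χ : Fk N) : sec n (Ψ - χ) = sec n Ψ - sec n χ := map_sub _ _ _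

lemma sec_smul (n : ℕ) (c : ℂ) (Ψ : Fk N) : sec n (c • Ψ) = c • sec n Ψ := map_smul _ _ _

lemma sec_zero (n : ℕ) : sec n (0 : Fk N) = 0 := map_zero _

lemma sec_neg (n : ℕ) (Ψ : Fk N) : sec n (-Ψ) = -sec n Ψ := map_neg _ _

lemma L2_smul_smul {n : ℕ} (a b : ℂ) (u : L2 N n) : a • b • u = (a * b) • u := smul_smul a b u

lemma hasSum_inner_sec (Ψ χ : Fk N) :
    HasSum (fun n => inner ℂ (sec n Ψ) (sec n χ)) (inner ℂ Ψ χ) :=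
  lp.hasSum_inner (toFull N Ψ) (toFull N χ)

lemma hasSum_sq_norm_sec (Ψ : Fk N) : HasSum (fun n => ‖sec n Ψ‖ ^ 2) (‖Ψ‖ ^ 2) := by
  have h := lp.hasSum_norm (p := 2) (by norm_num) (toFull N Ψ)
  have h1 : HasSum (fun n => ‖(toFull N Ψ : ∀ n, L2 N n) n‖ ^ 2) (‖toFull N Ψ‖ ^ 2) := by
    simpa using h
  exact h1

attribute [irreducible] sec ofSeq toFull Fk

lemma norm_le_of_sq_le {Ψ : Fk N} (hC : 0 ≤ C) {f : ℕ → ℝ} {s : ℝ} (hf : HasSum f s)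
    (h : ∀ n, ‖sec n Ψ‖ ^ 2 ≤ C ^ 2 * f n) {t : ℝ} (hs : s ≤ t ^ 2) (ht : 0 ≤ t) :
    ‖Ψ‖ ≤ C * t := by
  have h1 := hasSum_le h (hasSum_sq_norm_sec Ψ) (hf.mul_left (C ^ 2))
  refine (sq_le_sq₀ (norm_nonneg _) (by positivity)).1 ?_
  calc ‖Ψ‖ ^ 2 ≤ C ^ 2 * s := h1
    _ ≤ C ^ 2 * t ^ 2 := by gcongr
    _ = (C * t) ^ 2 := by ring

lemma norm_le_of_sec_le {Ψ χ : Fk N} (hC : 0 ≤ C)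
    (h : ∀ n, ‖sec n Ψ‖ ≤ C * ‖sec n χ‖) : ‖Ψ‖ ≤ C * ‖χ‖ := by
  refine norm_le_of_sq_le hC (hasSum_sq_norm_sec χ) (fun n => ?_) le_rfl (norm_nonneg _)
  rw [← mul_pow]
  gcongr
  exact h n

lemma summable_sq_norm_succ (χ : Fk N) : Summable fun n => ‖sec (n + 1) χ‖ ^ 2 :=
  (summable_nat_add_iff (f := fun n => ‖sec n χ‖ ^ 2) 1).2 (hasSum_sq_norm_sec χ).summable

lemma norm_le_of_sec_le_succ {Ψ χ : Fk N} (hC : 0 ≤ C)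
    (h : ∀ n, ‖sec n Ψ‖ ≤ C * ‖sec (n + 1) χ‖) : ‖Ψ‖ ≤ C * ‖χ‖ := by
  refine norm_le_of_sq_le hC (summable_sq_norm_succ χ).hasSum (fun n => ?_) ?_ (norm_nonneg _)
  · rw [← mul_pow]
    gcongr
    exact h n
  · have h1 := hasSum_sq_norm_sec χ
    rw [← h1.tsum_eq, h1.summable.tsum_eq_zero_add]
    exact le_add_of_nonneg_left (by positivity)

lemma norm_le_of_sec_succ_le {Ψ χ : Fk N} (hC : 0 ≤ C) (h0 : sec 0 Ψ = 0)
    (h : ∀ n, ‖sec (n + 1) Ψ‖ ≤ C * ‖sec n χ‖) : ‖Ψ‖ ≤ C * ‖χ‖ := by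
  refine (sq_le_sq₀ (norm_nonneg _) (by positivity)).1 ?_
  have h1 := hasSum_sq_norm_sec Ψ
  rw [← h1.tsum_eq, h1.summable.tsum_eq_zero_add, h0]
  have h2 := hasSum_sq_norm_sec χ
  rw [mul_pow, ← h2.tsum_eq, ← tsum_mul_left]
  simp only [norm_zero, ne_eq, OfNat.ofNat_ne_zero, not_false_eq_true, zero_pow, zero_add]
  refine (summable_sq_norm_succ Ψ).tsum_le_tsum (fun n => ?_) (h2.summable.mul_left _)
  rw [← mul_pow]
  gcongr
  exact h n

/-- The bounded operator acting in each phonon sec by `T n`. -/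
def diagOp (T : ∀ n, L2 N n →L[ℂ] L2 N n) (C : ℝ) (h : ∀ n u, ‖T n u‖ ≤ C * ‖u‖) :
    Fk N →L[ℂ] Fk N :=
  LinearMap.mkContinuous
    { toFun := fun Ψ => ofSeq (fun n => T n (sec n Ψ)) (by
        refine Summable.of_nonneg_of_le (fun n => by positivity) (fun n => ?_)
          ((hasSum_sq_norm_sec Ψ).summable.mul_left (C ^ 2))
        rw [← mul_pow]
        gcongr
        exact h n _)
      map_add' := fun Ψ χ => sec_ext fun n => by simp
      map_smul' := fun c Ψ => sec_ext fun n => by simp }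
    (max C 0) (fun Ψ => norm_le_of_sec_le (le_max_right _ _) fun n =>
      (congrArg norm (sec_ofSeq _ _ n)).trans_le ((h n _).trans (by gcongr; exact le_max_left _ _)))

@[simp]
lemma sec_diagOp (T : ∀ n, L2 N n →L[ℂ] L2 N n) (C : ℝ) (h : ∀ n u, ‖T n u‖ ≤ C * ‖u‖)
    (n : ℕ) (Ψ : Fk N) : sec n (diagOp T C h Ψ) = T n (sec n Ψ) :=
  sec_ofSeq _ _ _

/-- The bounded operator lowering the phonon number by one, through `T n`. -/
def lowerOp (T : ∀ n, L2 N (n + 1) →L[ℂ] L2 N n) (C : ℝ) (hC : 0 ≤ C)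
    (h : ∀ n u, ‖T n u‖ ≤ C * ‖u‖) : Fk N →L[ℂ] Fk N :=
  LinearMap.mkContinuous
    { toFun := fun Ψ => ofSeq (fun n => T n (sec (n + 1) Ψ)) (by
        refine Summable.of_nonneg_of_le (fun n => by positivity) (fun n => ?_)
          ((summable_sq_norm_succ Ψ).mul_left (C ^ 2))
        rw [← mul_pow]
        gcongr
        exact h n _)
      map_add' := fun Ψ χ => sec_ext fun n => by simp
      map_smul' := fun c Ψ => sec_ext fun n => by simp }
    C (fun Ψ => norm_le_of_sec_le_succ hC fun n =>
      (congrArg norm (sec_ofSeq _ _ n)).trans_le (h n _))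

@[simp]
lemma sec_lowerOp (T : ∀ n, L2 N (n + 1) →L[ℂ] L2 N n) (C : ℝ) (hC : 0 ≤ C)
    (h : ∀ n u, ‖T n u‖ ≤ C * ‖u‖) (n : ℕ) (Ψ : Fk N) :
    sec n (lowerOp T C hC h Ψ) = T n (sec (n + 1) Ψ) := sec_ofSeq _ _ _

lemma norm_lowerOp_le (T : ∀ n, L2 N (n + 1) →L[ℂ] L2 N n) (C : ℝ) (hC : 0 ≤ C)
    (h : ∀ n u, ‖T n u‖ ≤ C * ‖u‖) (Ψ : Fk N) : ‖lowerOp T C hC h Ψ‖ ≤ C * ‖Ψ‖ :=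
  norm_le_of_sec_le_succ hC fun n => (congrArg norm (sec_lowerOp T C hC h n Ψ)).trans_le (h n _)

/-- The components of the image of `Ψ` under an operator raising the phonon number by one. -/
def raiseSeq (T : ∀ n, L2 N n →L[ℂ] L2 N (n + 1)) (Ψ : Fk N) : ∀ n, L2 N n
  | 0 => 0
  | n + 1 => T n (sec n Ψ)

/-- The bounded operator raising the phonon number by one, through `T n`. -/
def raiseOp (T : ∀ n, L2 N n →L[ℂ] L2 N (n + 1)) (C : ℝ) (hC : 0 ≤ C)
    (h : ∀ n u, ‖T n u‖ ≤ C * ‖u‖) : Fk N →L[ℂ] Fk N :=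
  LinearMap.mkContinuous
    { toFun := fun Ψ => ofSeq (raiseSeq T Ψ) (by
        refine (summable_nat_add_iff 1).1 ?_
        refine Summable.of_nonneg_of_le (fun n => by positivity) (fun n => ?_)
          ((hasSum_sq_norm_sec Ψ).summable.mul_left (C ^ 2))
        rw [← mul_pow]
        gcongr
        exact h n _)
      map_add' := fun Ψ χ => sec_ext fun n => by cases n <;> simp [raiseSeq]
      map_smul' := fun c Ψ => sec_ext fun n => by cases n <;> simp [raiseSeq] }
    C (fun Ψ => norm_le_of_sec_succ_le hC (sec_ofSeq _ _ 0) fun n =>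
      (congrArg norm (sec_ofSeq _ _ (n + 1))).trans_le (h n _))

@[simp]
lemma sec_zero_raiseOp (T : ∀ n, L2 N n →L[ℂ] L2 N (n + 1)) (C : ℝ) (hC : 0 ≤ C)
    (h : ∀ n u, ‖T n u‖ ≤ C * ‖u‖) (Ψ : Fk N) : sec 0 (raiseOp T C hC h Ψ) = 0 :=
  sec_ofSeq _ _ _

@[simp]
lemma sec_succ_raiseOp (T : ∀ n, L2 N n →L[ℂ] L2 N (n + 1)) (C : ℝ) (hC : 0 ≤ C)
    (h : ∀ n u, ‖T n u‖ ≤ C * ‖u‖) (n : ℕ) (Ψ : Fk N) :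
    sec (n + 1) (raiseOp T C hC h Ψ) = T n (sec n Ψ) :=
  sec_ofSeq _ _ _

lemma norm_raiseOp_le (T : ∀ n, L2 N n →L[ℂ] L2 N (n + 1)) (C : ℝ) (hC : 0 ≤ C)
    (h : ∀ n u, ‖T n u‖ ≤ C * ‖u‖) (Ψ : Fk N) : ‖raiseOp T C hC h Ψ‖ ≤ C * ‖Ψ‖ :=
  norm_le_of_sec_succ_le hC (sec_zero_raiseOp T C hC h Ψ) fun n =>
    (congrArg norm (sec_succ_raiseOp T C hC h n Ψ)).trans_le (h n _)

attribute [irreducible] diagOp lowerOp raiseOp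

end Sectors

/-! ### Substitutions in configuration space -/

section Substitution

variable {N n : ℕ}

/-- The isometry `u ↦ u ∘ φ` for a measure preserving map `φ` of configurations. -/
def subst (φ : Conf N n → Conf N n) (hφ : MeasurePreserving φ volume volume) :
    L2 N n →ₗᵢ[ℂ] L2 N n :=
  Lp.compMeasurePreservingₗᵢ ℂ φ hφ

lemma subst_ae {φ : Conf N n → Conf N n} (hφ : MeasurePreserving φ volume volume) (u : L2 N n) :
    subst φ hφ u =ᵐ[volume] fun p => u (φ p) :=
  Lp.coeFn_compMeasurePreserving u hφ

lemma subst_eq_iff {φ : Conf N n → Conf N n} (hφ : MeasurePreserving φ volume volume)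
    (u v : L2 N n) : subst φ hφ u = v ↔ (fun p => u (φ p)) =ᵐ[volume] v :=
  ⟨fun h => (subst_ae hφ u).symm.trans (by rw [h]), fun h => Lp.ext ((subst_ae hφ u).trans h)⟩

lemma subst_subst {φ ψ : Conf N n → Conf N n} (hφ : MeasurePreserving φ volume volume)
    (hψ : MeasurePreserving ψ volume volume) (u : L2 N n) :
    subst φ hφ (subst ψ hψ u) = subst (ψ ∘ φ) (hψ.comp hφ) u := by
  rw [subst_eq_iff]
  filter_upwards [hφ.quasiMeasurePreserving.ae (subst_ae hψ u), subst_ae (hψ.comp hφ) u]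
    with p h1 h2
  exact h1.trans h2.symm

lemma subst_congr {φ ψ : Conf N n → Conf N n} (hφ : MeasurePreserving φ volume volume)
    (hψ : MeasurePreserving ψ volume volume) (h : φ = ψ) (u : L2 N n) :
    subst φ hφ u = subst ψ hψ u := by
  subst h; rfl

lemma subst_of_eq_id {φ : Conf N n → Conf N n} (hφ : MeasurePreserving φ volume volume)
    (h : ∀ p, φ p = p) (u : L2 N n) : subst φ hφ u = u := by
  rw [subst_eq_iff]
  exact ae_of_all _ fun p => congrArg u (h p)

lemma inner_subst_right {φ ψ : Conf N n → Conf N n} (hφ : MeasurePreserving φ volume volume)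
    (hψ : MeasurePreserving ψ volume volume) (h : ∀ p, ψ (φ p) = p) (u v : L2 N n) :
    inner ℂ u (subst φ hφ v) = inner ℂ (subst ψ hψ u) v := by
  have h1 : subst φ hφ (subst ψ hψ u) = u := by
    rw [subst_subst]
    exact subst_of_eq_id _ h u
  conv_lhs => rw [← h1]
  exact LinearIsometry.inner_map_map _ _ _

/-- Permutation of the particles by `σ` and of the phonons by `τ`. -/
def permS (σ : Equiv.Perm (Fin N)) (τ : Equiv.Perm (Fin n)) : L2 N n →ₗᵢ[ℂ] L2 N n :=
  subst (permConf σ τ) (measurePreserving_permConf σ τ)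

lemma permS_ae (σ : Equiv.Perm (Fin N)) (τ : Equiv.Perm (Fin n)) (u : L2 N n) :
    permS σ τ u =ᵐ[volume] fun p => u (permConf σ τ p) := subst_ae _ u

lemma permS_permS (σ σ' : Equiv.Perm (Fin N)) (τ τ' : Equiv.Perm (Fin n)) (u : L2 N n) :
    permS σ τ (permS σ' τ' u) = permS (σ * σ') (τ * τ') u :=
  (subst_subst _ _ u).trans (subst_congr _ _ rfl u)

lemma permS_one (u : L2 N n) : permS 1 1 u = u := subst_of_eq_id _ (fun _ => rfl) u

lemma inner_permS_right (σ : Equiv.Perm (Fin N)) (τ : Equiv.Perm (Fin n)) (u v : L2 N n) :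
    inner ℂ u (permS σ τ v) = inner ℂ (permS σ⁻¹ τ⁻¹ u) v := by
  refine inner_subst_right _ _ (fun p => ?_) u v
  simp [permConf]

lemma measurePreserving_shift (w : Fin N → E) :
    MeasurePreserving (fun p : Conf N n => ((p.1 + w, p.2) : Conf N n)) volume volume :=
  (measurePreserving_add_right volume w).prod (MeasurePreserving.id volume)

/-- Translation of the particles by `w`. -/
def transS (w : Fin N → E) : L2 N n →ₗᵢ[ℂ] L2 N n := subst _ (measurePreserving_shift w)

lemma transS_ae (w : Fin N → E) (u : L2 N n) :
    transS w u =ᵐ[volume] fun p => u (p.1 + w, p.2) := subst_ae _ u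

lemma transS_transS (w w' : Fin N → E) (u : L2 N n) :
    transS w (transS w' u) = transS (w + w') u :=
  (subst_subst _ _ u).trans (subst_congr _ _ (by funext p; simp [add_assoc]) u)

lemma transS_zero (u : L2 N n) : transS 0 u = u := subst_of_eq_id _ (fun p => by simp) u

lemma permS_transS (σ : Equiv.Perm (Fin N)) (τ : Equiv.Perm (Fin n)) (w : Fin N → E)
    (u : L2 N n) : permS σ τ (transS (fun j => w (σ j)) u) = transS w (permS σ τ u) := by
  unfold permS transS
  rw [subst_subst, subst_subst]
  exact subst_congr _ _ rfl u

lemma continuous_transS (u : L2 N n) : Continuous fun w : Fin N → E => transS w u := by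
  have h : Continuous fun w : Fin N → E => (⟨fun p => (p.1 + w, p.2), by fun_prop⟩ :
      C(Conf N n, Conf N n)) := by
    refine ContinuousMap.continuous_of_continuous_uncurry _ ?_
    simp only [Function.uncurry_def, ContinuousMap.coe_mk]
    fun_prop
  exact Continuous.compMeasurePreservingLp continuous_const h
    (fun w => measurePreserving_shift w) (by norm_num)

attribute [irreducible] permS transS

end Substitution

/-! ### Adding and removing a phonon -/

/-- Square integrable form factors. -/
abbrev Form := Lp ℂ 2 (volume : Measure E)

lemma sq_norm_Lp_two {α : Type*} [MeasurableSpace α] {μ : Measure α} (u : Lp ℂ 2 μ) :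
    ‖u‖ ^ 2 = ∫ p, ‖u p‖ ^ 2 ∂μ := by
  have h := L2.inner_def (𝕜 := ℂ) u u
  rw [inner_self_eq_norm_sq_to_K] at h
  have h2 : (∫ p, inner ℂ (u p) (u p) ∂μ) = ((∫ p, ‖u p‖ ^ 2 ∂μ : ℝ) : ℂ) := by
    rw [← integral_complex_ofReal]
    refine integral_congr_ae (ae_of_all _ fun p => ?_)
    simp [inner_self_eq_norm_sq_to_K]
  rw [h2] at h
  exact Complex.ofReal_injective (by simpa using h)

lemma integral_comp_measurePreserving' {α β F : Type*} [MeasurableSpace α] [MeasurableSpace β]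
    [NormedAddCommGroup F] [NormedSpace ℝ F] {μ : Measure α} {ν : Measure β} {f : α → β}
    (hf : MeasurePreserving f μ ν) {g : β → F} (hg : AEStronglyMeasurable g ν) :
    ∫ b, g b ∂ν = ∫ a, g (f a) ∂μ := by
  rw [← integral_map hf.measurable.aemeasurable (by rwa [hf.map_eq]), hf.map_eq]

section Phonons

variable {N n : ℕ}
variable {g : E → ℂ}

lemma measurePreserving_uncons :
    MeasurePreserving (fun p : Conf N (n + 1) =>
      (((p.1, fun i => p.2 i.succ), p.2 0) : Conf N n × E)) volume volume := by
  have h1 := (volume_preserving_piFinSuccAbove (fun _ : Fin (n + 1) => E) 0)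
  have h2 : MeasurePreserving (Prod.swap : E × (Fin n → E) → (Fin n → E) × E) volume volume :=
    Measure.measurePreserving_swap
  have h3 := (MeasurePreserving.id (volume : Measure (Fin N → E))).prod (h2.comp h1)
  have h4 : MeasurePreserving (MeasurableEquiv.prodAssoc.symm :
      (Fin N → E) × ((Fin n → E) × E) → ((Fin N → E) × (Fin n → E)) × E) volume volume :=
    (volume_preserving_prodAssoc (α₁ := Fin N → E) (β₁ := Fin n → E) (γ₁ := E)).symm
  exact h4.comp h3

lemma aestronglyMeasurable_formFactor (hg : AEStronglyMeasurable g volume)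
    (j : Fin N) : AEStronglyMeasurable (fun z : Conf N n × E => formFactor g (z.1.1 j) z.2)
      ((volume : Measure (Conf N n)).prod volume) := by
  refine AEStronglyMeasurable.mul hg.comp_snd (Continuous.aestronglyMeasurable ?_)
  fun_prop

lemma integrable_sq_insert (hg : MemLp g 2) (j : Fin N) (u : L2 N n) :
    Integrable (fun z : Conf N n × E => ‖formFactor g (z.1.1 j) z.2 * u z.1‖ ^ 2)
      ((volume : Measure (Conf N n)).prod volume) := by
  have h := ((memLp_two_iff_integrable_sq_norm (Lp.aestronglyMeasurable u)).1 (Lp.memLp u)).mul_prod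
    ((memLp_two_iff_integrable_sq_norm hg.1).1 hg)
  refine h.congr (ae_of_all _ fun z => ?_)
  simp only [norm_mul, norm_formFactor]
  ring

lemma memLp_insert (hg : MemLp g 2) (j : Fin N) (u : L2 N n) :
    MemLp (fun z : Conf N n × E => formFactor g (z.1.1 j) z.2 * u z.1) 2
      ((volume : Measure (Conf N n)).prod volume) :=
  (memLp_two_iff_integrable_sq_norm ((aestronglyMeasurable_formFactor hg.1 j).mul
    (Lp.aestronglyMeasurable u).comp_fst)).2 (integrable_sq_insert hg j u)

/-- The function `(x, k₀, k₁, …) ↦ g_{x_j}(k₀) u(x, k₁, …)`. -/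
def insertFun (g : E → ℂ) (j : Fin N) (u : Conf N n → ℂ) (p : Conf N (n + 1)) : ℂ :=
  formFactor g (p.1 j) (p.2 0) * u (p.1, fun i => p.2 i.succ)

lemma memLp_insertFun (hg : MemLp g 2) (j : Fin N) (u : L2 N n) :
    MemLp (insertFun g j u) 2 volume := by
  have h := (memLp_insert hg j u).comp_measurePreserving measurePreserving_uncons
  exact h

lemma quasiMeasurePreserving_phonon {m : ℕ} (i : Fin m) :
    Measure.QuasiMeasurePreserving (fun p : Conf N m => p.2 i) volume volume :=
  (Measure.quasiMeasurePreserving_eval (fun _ : Fin m => (volume : Measure E)) i).comp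
    Measure.quasiMeasurePreserving_snd

lemma quasiMeasurePreserving_tail :
    Measure.QuasiMeasurePreserving (fun p : Conf N (n + 1) =>
      ((p.1, fun i => p.2 i.succ) : Conf N n)) volume volume :=
  quasiMeasurePreserving_removeNth 0

lemma insertFun_congr {g' : E → ℂ} (hg : g =ᵐ[volume] g') (j : Fin N) {u u' : Conf N n → ℂ}
    (hu : u =ᵐ[volume] u') : insertFun g j u =ᵐ[volume] insertFun g' j u' := by
  filter_upwards [(quasiMeasurePreserving_phonon (N := N) (0 : Fin (n + 1))).ae hg,
    quasiMeasurePreserving_tail.ae hu] with p h1 h2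
  simp only [insertFun, formFactor]
  rw [h1, h2]

/-- The vector `g_{x_j} ⊗ u`. -/
def insertVec (g : Form) (j : Fin N) (u : L2 N n) : L2 N (n + 1) :=
  (memLp_insertFun (Lp.memLp g) j u).toLp _

lemma insertVec_ae (g : Form) (j : Fin N) (u : L2 N n) :
    insertVec g j u =ᵐ[volume] insertFun g j u :=
  (memLp_insertFun (Lp.memLp g) j u).coeFn_toLp

lemma norm_insertVec (g : Form) (j : Fin N) (u : L2 N n) :
    ‖insertVec g j u‖ = ‖g‖ * ‖u‖ := by
  refine (sq_eq_sq₀ (norm_nonneg _) (by positivity)).1 ?_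
  rw [mul_pow, sq_norm_Lp_two, sq_norm_Lp_two, sq_norm_Lp_two]
  have h1 : ∀ᵐ p : Conf N (n + 1), ‖insertVec g j u p‖ ^ 2 = ‖insertFun g j u p‖ ^ 2 := by
    filter_upwards [insertVec_ae g j u] with p hp
    rw [hp]
  refine (integral_congr_ae h1).trans ?_
  have h2 := integral_comp_measurePreserving (measurePreserving_uncons (N := N) (n := n))
    (g := fun z => ‖formFactor g (z.1.1 j) z.2 * u z.1‖ ^ 2)
    (integrable_sq_insert (Lp.memLp g) j u).1
  refine h2.symm.trans ?_
  rw [mul_comm, ← integral_prod_mul]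
  refine integral_congr_ae (ae_of_all _ fun z => ?_)
  simp only [norm_mul, norm_formFactor]
  ring

lemma insertVec_add_right (g : Form) (j : Fin N) (u v : L2 N n) :
    insertVec g j (u + v) = insertVec g j u + insertVec g j v := by
  refine Lp.ext ?_
  filter_upwards [insertVec_ae g j (u + v), insertVec_ae g j u, insertVec_ae g j v,
    Lp.coeFn_add (insertVec g j u) (insertVec g j v),
    insertFun_congr (ae_eq_refl g) j (Lp.coeFn_add u v)] with p h1 h2 h3 h4 h5
  rw [h1, h4, Pi.add_apply, h2, h3, h5]
  simp only [insertFun, formFactor, Pi.add_apply]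
  ring

lemma insertVec_smul_right (g : Form) (j : Fin N) (c : ℂ) (u : L2 N n) :
    insertVec g j (c • u) = c • insertVec g j u := by
  refine Lp.ext ?_
  filter_upwards [insertVec_ae g j (c • u), insertVec_ae g j u,
    Lp.coeFn_smul c (insertVec g j u),
    insertFun_congr (ae_eq_refl g) j (Lp.coeFn_smul c u)] with p h1 h2 h4 h5
  rw [h1, h4, Pi.smul_apply, h2, h5]
  simp only [insertFun, formFactor, Pi.smul_apply, smul_eq_mul]
  ring

/-- Adding a phonon: the operator `u ↦ g_{x_j} ⊗ u`, without symmetrization. -/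
def insertS (g : Form) (j : Fin N) (n : ℕ) : L2 N n →L[ℂ] L2 N (n + 1) :=
  LinearMap.mkContinuous
    { toFun := insertVec g j
      map_add' := insertVec_add_right g j
      map_smul' := insertVec_smul_right g j }
    ‖g‖ (fun u => (norm_insertVec g j u).le)

lemma norm_insertS_le (g : Form) (j : Fin N) (u : L2 N n) :
    ‖insertS g j n u‖ ≤ ‖g‖ * ‖u‖ := (norm_insertVec g j u).le

lemma insertS_ae (g : Form) (j : Fin N) (u : L2 N n) :
    insertS g j n u =ᵐ[volume] insertFun g j u := insertVec_ae g j u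

lemma insertS_toLp_ae (hg : MemLp g 2) (j : Fin N) (u : L2 N n) :
    insertS (hg.toLp g) j n u =ᵐ[volume] insertFun g j u :=
  (insertS_ae _ j u).trans (insertFun_congr hg.coeFn_toLp j (ae_eq_refl _))

lemma insertS_add (g g' : Form) (j : Fin N) (u : L2 N n) :
    insertS (g + g') j n u = insertS g j n u + insertS g' j n u := by
  refine Lp.ext ?_
  filter_upwards [insertS_ae (g + g') j u, insertS_ae g j u, insertS_ae g' j u,
    Lp.coeFn_add (insertS g j n u) (insertS g' j n u),
    insertFun_congr (Lp.coeFn_add g g') j (ae_eq_refl u)] with p h1 h2 h3 h4 h5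
  rw [h1, h4, Pi.add_apply, h2, h3, h5]
  simp only [insertFun, formFactor, Pi.add_apply]
  ring

lemma insertS_smul (c : ℂ) (g : Form) (j : Fin N) (u : L2 N n) :
    insertS (c • g) j n u = c • insertS g j n u := by
  refine Lp.ext ?_
  filter_upwards [insertS_ae (c • g) j u, insertS_ae g j u,
    Lp.coeFn_smul c (insertS g j n u),
    insertFun_congr (Lp.coeFn_smul c g) j (ae_eq_refl u)] with p h1 h2 h4 h5
  rw [h1, h4, Pi.smul_apply, h2, h5]
  simp only [insertFun, formFactor, Pi.smul_apply, smul_eq_mul]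
  ring

/-- Removing a phonon: the operator `u ↦ ∫ conj (g_{x_j}(k)) u(x, k, ·) dk`. -/
def removeS (g : Form) (j : Fin N) (n : ℕ) : L2 N (n + 1) →L[ℂ] L2 N n :=
  ContinuousLinearMap.adjoint (insertS g j n)

lemma inner_removeS_right (g : Form) (j : Fin N) (u : L2 N n) (v : L2 N (n + 1)) :
    inner ℂ u (removeS g j n v) = inner ℂ (insertS g j n u) v :=
  ContinuousLinearMap.adjoint_inner_right _ _ _

lemma inner_removeS_left (g : Form) (j : Fin N) (u : L2 N n) (v : L2 N (n + 1)) :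
    inner ℂ (removeS g j n v) u = inner ℂ v (insertS g j n u) :=
  ContinuousLinearMap.adjoint_inner_left _ _ _

lemma norm_removeS_le (g : Form) (j : Fin N) (v : L2 N (n + 1)) :
    ‖removeS g j n v‖ ≤ ‖g‖ * ‖v‖ := by
  refine ((removeS g j n).le_opNorm v).trans ?_
  gcongr
  rw [removeS, LinearIsometryEquiv.norm_map]
  exact ContinuousLinearMap.opNorm_le_bound _ (norm_nonneg _) (norm_insertS_le g j)

lemma removeS_add (g g' : Form) (j : Fin N) (v : L2 N (n + 1)) :
    removeS (g + g') j n v = removeS g j n v + removeS g' j n v := by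
  refine ext_inner_left ℂ fun u => ?_
  rw [inner_add_right, inner_removeS_right, inner_removeS_right, inner_removeS_right, insertS_add,
    inner_add_left]

lemma removeS_smul (c : ℂ) (g : Form) (j : Fin N) (v : L2 N (n + 1)) :
    removeS (c • g) j n v = conj c • removeS g j n v := by
  refine ext_inner_left ℂ fun u => ?_
  rw [inner_smul_right, inner_removeS_right, inner_removeS_right, insertS_smul, inner_smul_left]

lemma removeS_ae (hg : MemLp g 2) (j : Fin N) (v : L2 N (n + 1)) :
    ∀ᵐ p : Conf N n,
      Integrable (fun k => conj (formFactor g (p.1 j) k) * v (p.1, Fin.cons k p.2)) ∧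
      removeS (hg.toLp g) j n v p =
        ∫ k, conj (formFactor g (p.1 j) k) * v (p.1, Fin.cons k p.2) := by
  obtain ⟨η, h1, -⟩ := exists_annihilation_aux hg j v
  have hn : (√(n + 1 : ℝ) : ℂ) ≠ 0 := by
    have : (0 : ℝ) < √(n + 1 : ℝ) := by positivity
    exact_mod_cast this.ne'
  have key : (√(n + 1 : ℝ) : ℂ) • removeS (hg.toLp g) j n v = η := by
    refine ext_inner_left ℂ fun u => ?_
    rw [inner_smul_right, inner_removeS_right, L2.inner_def, L2.inner_def]
    have e1 : ∫ p, inner ℂ (insertS (hg.toLp g) j n u p) (v p) =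
        ∫ p, v p * conj (insertFun g j u p) := by
      refine integral_congr_ae ?_
      filter_upwards [insertS_toLp_ae hg j u] with p hp
      rw [hp]
      rfl
    have hmp := measurePreserving_cons (N := N) (n := n)
    have hi : Integrable (fun p => v p * conj (insertFun g j u p)) :=
      (Lp.memLp v).integrable_mul (memLp_insertFun hg j u).star
    have e2 : ∫ p, v p * conj (insertFun g j u p) = ∫ z : Conf N n × E,
        v (z.1.1, Fin.cons z.2 z.1.2) * conj (formFactor g (z.1.1 j) z.2 * u z.1) :=
      integral_comp_measurePreserving' hmp hi.1
    have hi2 : Integrable (fun z : Conf N n × E =>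
        v (z.1.1, Fin.cons z.2 z.1.2) * conj (formFactor g (z.1.1 j) z.2 * u z.1))
        ((volume : Measure (Conf N n)).prod volume) := hmp.integrable_comp_of_integrable hi
    have e3 := integral_prod _ hi2
    rw [e1, e2]
    refine (congrArg _ e3).trans ?_
    rw [← integral_const_mul]
    refine integral_congr_ae ?_
    filter_upwards [h1] with p hp
    rw [hp.2]
    show _ = (√(n + 1 : ℝ) * ∫ k, _) * conj (u p)
    rw [mul_assoc, ← integral_mul_const]
    congr 1
    refine integral_congr_ae (ae_of_all _ fun k => ?_)
    simp only [map_mul]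
    ring
  have h2 := Lp.coeFn_smul (√(n + 1 : ℝ) : ℂ) (removeS (hg.toLp g) j n v)
  rw [key] at h2
  filter_upwards [h1, h2] with p hp hq
  refine ⟨hp.1, mul_left_cancel₀ hn ?_⟩
  rw [← hp.2, hq]
  rfl

/-- The permutation of phonons moving the first one to position `i`. -/
def cyc (i : Fin (n + 1)) : Equiv.Perm (Fin (n + 1)) := i.cycleRange.symm

lemma cyc_zero (i : Fin (n + 1)) : cyc i 0 = i := Fin.cycleRange_symm_zero i

lemma cyc_succ (i : Fin (n + 1)) (m : Fin n) : cyc i m.succ = i.succAbove m :=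
  Fin.cycleRange_symm_succ i m

/-- Adding a phonon, with symmetrization over its position. -/
def symInsertS (g : Form) (j : Fin N) (n : ℕ) : L2 N n →L[ℂ] L2 N (n + 1) :=
  ((n + 1 : ℂ)⁻¹) • ∑ i : Fin (n + 1),
    (permS 1 (cyc i)).toContinuousLinearMap.comp (insertS g j n)

lemma symInsertS_apply (g : Form) (j : Fin N) (u : L2 N n) :
    symInsertS g j n u = ((n + 1 : ℂ)⁻¹) • ∑ i : Fin (n + 1), permS 1 (cyc i) (insertS g j n u) := by
  simp [symInsertS]

lemma norm_symInsertS_le (g : Form) (j : Fin N) (u : L2 N n) :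
    ‖symInsertS g j n u‖ ≤ ‖g‖ * ‖u‖ := by
  rw [symInsertS_apply, norm_smul]
  have h1 : ‖(n + 1 : ℂ)⁻¹‖ = ((n : ℝ) + 1)⁻¹ := by
    rw [norm_inv]
    norm_cast
  have h2 : ‖∑ i : Fin (n + 1), permS 1 (cyc i) (insertS g j n u)‖
      ≤ ((n : ℝ) + 1) * (‖g‖ * ‖u‖) := by
    refine (norm_sum_le _ _).trans ?_
    have h3 : ∀ i ∈ (Finset.univ : Finset (Fin (n + 1))),
        ‖permS 1 (cyc i) (insertS g j n u)‖ ≤ ‖g‖ * ‖u‖ := fun i _ => by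
      rw [LinearIsometry.norm_map]
      exact norm_insertS_le g j u
    refine (Finset.sum_le_card_nsmul _ _ _ h3).trans (le_of_eq ?_)
    simp
  rw [h1]
  calc _ ≤ ((n : ℝ) + 1)⁻¹ * (((n : ℝ) + 1) * (‖g‖ * ‖u‖)) := by gcongr
    _ = ‖g‖ * ‖u‖ := by field_simp

lemma permS_insertS_ae (hg : MemLp g 2) (j : Fin N) (u : L2 N n) (i : Fin (n + 1)) :
    permS 1 (cyc i) (insertS (hg.toLp g) j n u) =ᵐ[volume] fun p =>
      formFactor g (p.1 j) (p.2 i) * u (p.1, i.removeNth p.2) := by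
  refine (permS_ae _ _ _).trans ?_
  filter_upwards [(measurePreserving_permConf (N := N) 1 (cyc i)).quasiMeasurePreserving.ae
    (insertS_toLp_ae hg j u)] with p hp
  refine hp.trans ?_
  simp only [insertFun, permConf, cyc_zero, cyc_succ]
  rfl

lemma symInsertS_add (g g' : Form) (j : Fin N) (u : L2 N n) :
    symInsertS (g + g') j n u = symInsertS g j n u + symInsertS g' j n u := by
  simp only [symInsertS_apply, insertS_add, map_add, Finset.sum_add_distrib, smul_add]

lemma symInsertS_smul (c : ℂ) (g : Form) (j : Fin N) (u : L2 N n) :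
    symInsertS (c • g) j n u = c • symInsertS g j n u := by
  simp only [symInsertS_apply, insertS_smul, map_smul, ← Finset.smul_sum]
  rw [smul_comm]

attribute [irreducible] insertS removeS symInsertS

end Phonons

/-! ### Exchange symmetry of the phonons and the canonical commutation relations -/

section Symmetry

variable {N n : ℕ}

/-- The extension of a permutation of `n` phonons which leaves an additional first one fixed. -/
def extPerm (τ : Equiv.Perm (Fin n)) : Equiv.Perm (Fin (n + 1)) :=
  Equiv.Perm.decomposeFin.symm (0, τ)

lemma extPerm_zero (τ : Equiv.Perm (Fin n)) : extPerm τ 0 = 0 := by simp [extPerm]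

lemma extPerm_succ (τ : Equiv.Perm (Fin n)) (i : Fin n) : extPerm τ i.succ = (τ i).succ := by
  simp [extPerm]

lemma exists_extPerm {ρ : Equiv.Perm (Fin (n + 1))} (h : ρ 0 = 0) :
    ∃ τ : Equiv.Perm (Fin n), ρ = extPerm τ := by
  refine ⟨(Equiv.Perm.decomposeFin ρ).2, ?_⟩
  have h1 : (Equiv.Perm.decomposeFin ρ).1 = 0 := by
    have h2 := Equiv.Perm.decomposeFin_symm_apply_zero (Equiv.Perm.decomposeFin ρ).1
      (Equiv.Perm.decomposeFin ρ).2
    rw [Prod.mk.eta, Equiv.symm_apply_apply, h] at h2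
    exact h2.symm
  rw [extPerm, ← h1, Prod.mk.eta, Equiv.symm_apply_apply]

lemma permS_ext_insertS (g : Form) (j : Fin N) (τ : Equiv.Perm (Fin n)) (u : L2 N n) :
    permS 1 (extPerm τ) (insertS g j n u) = insertS g j n (permS 1 τ u) := by
  refine Lp.ext ?_
  have h1 := (measurePreserving_permConf (N := N) 1 (extPerm τ)).quasiMeasurePreserving.ae
    (insertS_ae g j u)
  filter_upwards [permS_ae 1 (extPerm τ) (insertS g j n u), h1,
    insertS_ae g j (permS 1 τ u), insertFun_congr (ae_eq_refl g) j
      (permS_ae 1 τ u)] with p h2 h3 h4 h5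
  refine h2.trans (h3.trans ((h4.trans h5).trans ?_).symm)
  simp only [insertFun, permConf, extPerm_zero, extPerm_succ, Equiv.Perm.coe_one, id]

lemma permS_removeS (g : Form) (j : Fin N) (τ : Equiv.Perm (Fin n)) (v : L2 N (n + 1)) :
    permS 1 τ (removeS g j n v) = removeS g j n (permS 1 (extPerm τ) v) := by
  refine ext_inner_left ℂ fun u => ?_
  rw [inner_permS_right, inner_removeS_right, inner_removeS_right, inner_permS_right]
  congr 1
  have h : permS 1 (extPerm τ) (insertS g j n (permS 1⁻¹ τ⁻¹ u)) = insertS g j n u := by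
    rw [permS_ext_insertS, permS_permS]
    simp [permS_one]
  rw [← h, permS_permS]
  simp [permS_one]

/-- Symmetry under permutations of the phonons, in one sector. -/
def SymS (u : L2 N n) : Prop := ∀ τ : Equiv.Perm (Fin n), permS 1 τ u = u

lemma SymS.removeS {v : L2 N (n + 1)} (hv : SymS v) (g : Form) (j : Fin N) :
    SymS (removeS g j n v) := fun τ => by rw [permS_removeS, hv]

lemma SymS.symInsertS {u : L2 N n} (hu : SymS u) (g : Form) (j : Fin N) :
    SymS (symInsertS g j n u) := by
  intro τ
  rw [symInsertS_apply, map_smul, map_sum]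
  congr 1
  rw [← Equiv.sum_comp τ fun i => permS 1 (cyc i) (insertS g j n u)]
  refine Finset.sum_congr rfl fun i _ => ?_
  obtain ⟨ρ, hρ⟩ := exists_extPerm (ρ := (cyc (τ i))⁻¹ * (τ * cyc i)) (by
    simp only [Equiv.Perm.mul_apply, cyc_zero]
    rw [Equiv.Perm.inv_eq_iff_eq, cyc_zero])
  have h : τ * cyc i = cyc (τ i) * extPerm ρ := by rw [← hρ]; group
  rw [permS_permS, h, ← one_mul (1 * 1 : Equiv.Perm (Fin N)), ← permS_permS, mul_one,
    permS_ext_insertS, hu ρ]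

lemma inner_symInsertS_right {v : L2 N (n + 1)} (hv : SymS v) (g : Form) (j : Fin N)
    (u : L2 N n) : inner ℂ v (symInsertS g j n u) = inner ℂ (removeS g j n v) u := by
  rw [symInsertS_apply, inner_smul_right, inner_sum]
  have h (i : Fin (n + 1)) : inner ℂ v (permS 1 (cyc i) (insertS g j n u))
      = inner ℂ (removeS g j n v) u := by
    rw [inner_permS_right, inv_one, hv, inner_removeS_left]
  simp only [h, Finset.sum_const, Finset.card_univ, Fintype.card_fin, nsmul_eq_mul]
  have h2 : (n + 1 : ℂ) ≠ 0 := by exact_mod_cast n.succ_ne_zero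
  push_cast
  field_simp

lemma removeS_removeS_comm {v : L2 N (n + 2)} (hv : SymS v) (f g : Form) (j l : Fin N) :
    removeS f j n (removeS g l (n + 1) v) = removeS g l n (removeS f j (n + 1) v) := by
  refine ext_inner_left ℂ fun u => ?_
  simp only [inner_removeS_right]
  have h : permS 1 (Equiv.swap 0 1) (insertS g l (n + 1) (insertS f j n u))
      = insertS f j (n + 1) (insertS g l n u) := by
    refine Lp.ext ?_
    have h1 := (measurePreserving_permConf (N := N) 1 (Equiv.swap (0 : Fin (n + 2)) 1)
      ).quasiMeasurePreserving.ae ((insertS_ae g l (insertS f j n u)).trans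
        (insertFun_congr (ae_eq_refl g) l (insertS_ae f j u)))
    filter_upwards [permS_ae 1 (Equiv.swap 0 1)
      (insertS g l (n + 1) (insertS f j n u)), h1,
      (insertS_ae f j (insertS g l n u)).trans
        (insertFun_congr (ae_eq_refl f) j (insertS_ae g l u))] with p h2 h3 h4
    refine h2.trans (h3.trans (h4.trans ?_).symm)
    have e (i : Fin n) : Equiv.swap (0 : Fin (n + 2)) 1 i.succ.succ = i.succ.succ := by
      refine Equiv.swap_apply_of_ne_of_ne (Fin.succ_ne_zero _) ?_
      rw [← Fin.succ_zero_eq_one, Ne, Fin.succ_inj]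
      exact Fin.succ_ne_zero _
    simp only [insertFun, permConf, Equiv.swap_apply_left, Fin.succ_zero_eq_one, e,
      Equiv.swap_apply_right, Equiv.Perm.coe_one, id]
    ring
  rw [← h]
  conv_rhs => rw [← hv (Equiv.swap 0 1)]
  rw [LinearIsometry.inner_map_map]

lemma removeS_form_ae (g : Form) (j : Fin N) (v : L2 N (n + 1)) :
    ∀ᵐ p : Conf N n, removeS g j n v p =
        ∫ k, conj (formFactor g (p.1 j) k) * v (p.1, Fin.cons k p.2) := by
  have h := removeS_ae (Lp.memLp g) j v
  rw [Lp.toLp_coeFn] at h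
  exact h.mono fun p hp => hp.2

lemma permS_insertS_form_ae (g : Form) (j : Fin N) (u : L2 N n) (i : Fin (n + 1)) :
    permS 1 (cyc i) (insertS g j n u) =ᵐ[volume] fun p =>
      formFactor g (p.1 j) (p.2 i) * u (p.1, i.removeNth p.2) := by
  have h := permS_insertS_ae (Lp.memLp g) j u i
  rwa [Lp.toLp_coeFn] at h

/-- The function `⟨f_{x_j}, g_{x_l}⟩` of the particle positions. -/
def pairing (f g : Form) (j l : Fin N) (x : Fin N → E) : ℂ :=
  ∫ k, conj (formFactor f (x j) k) * formFactor g (x l) k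

lemma norm_pairing_le (f g : Form) (j l : Fin N) (x : Fin N → E) :
    ‖pairing f g j l x‖ ≤ ‖f‖ * ‖g‖ := by
  refine (sq_le_sq₀ (norm_nonneg _) (by positivity)).1 ?_
  refine (sq_norm_integral_mul_le (memLp_formFactor (Lp.memLp f) _)
    (memLp_formFactor (Lp.memLp g) _)).trans (le_of_eq ?_)
  simp only [norm_formFactor]
  rw [mul_pow, sq_norm_Lp_two, sq_norm_Lp_two]

lemma aestronglyMeasurable_pairing (f g : Form) (j l : Fin N) :
    AEStronglyMeasurable (pairing f g j l) volume := by
  have h (g : Form) (j : Fin N) : AEStronglyMeasurable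
      (fun z : (Fin N → E) × E => formFactor g (z.1 j) z.2)
      ((volume : Measure (Fin N → E)).prod volume) := by
    refine AEStronglyMeasurable.mul (Lp.aestronglyMeasurable g).comp_snd
      (Continuous.aestronglyMeasurable ?_)
    fun_prop
  exact ((Complex.continuous_conj.comp_aestronglyMeasurable (h f j)).mul (h g l)
    ).integral_prod_right'

lemma removeS_permS_zero (f g : Form) (j l : Fin N) (u : L2 N n) :
    removeS f j n (permS 1 (cyc 0) (insertS g l n u)) =ᵐ[volume] fun p =>
      pairing f g j l p.1 * u p := by
  filter_upwards [removeS_form_ae f j (permS 1 (cyc 0) (insertS g l n u)),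
    ae_ae_cons (permS_insertS_form_ae g l u 0)] with p h1 h2
  rw [h1, pairing, ← integral_mul_const]
  refine integral_congr_ae ?_
  filter_upwards [h2] with k hk
  rw [hk, Fin.cons_zero, Fin.removeNth_zero, Fin.tail_cons]
  ring

lemma removeS_permS_succ (f g : Form) (j l : Fin N) (u : L2 N (n + 1)) (i : Fin (n + 1)) :
    removeS f j (n + 1) (permS 1 (cyc i.succ) (insertS g l (n + 1) u)) =
      permS 1 (cyc i) (insertS g l n (removeS f j n u)) := by
  refine Lp.ext ?_
  filter_upwards [removeS_form_ae f j (permS 1 (cyc i.succ) (insertS g l (n + 1) u)),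
    ae_ae_cons (permS_insertS_form_ae g l u i.succ),
    permS_insertS_form_ae g l (removeS f j n u) i,
    (quasiMeasurePreserving_removeNth (N := N) i).ae (removeS_form_ae f j u)] with p h1 h2 h3 h4
  rw [h1, h3, h4, ← integral_const_mul]
  refine integral_congr_ae ?_
  filter_upwards [h2] with k hk
  rw [hk, Fin.cons_succ]
  have e : i.succ.removeNth (Fin.cons k p.2 : Fin (n + 2) → E) = Fin.cons k (i.removeNth p.2) := by
    funext m
    cases m using Fin.cases <;> simp [Fin.removeNth]
  rw [e]
  ring

lemma smul_symInsertS (g : Form) (j : Fin N) (u : L2 N n) :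
    ((n : ℂ) + 1) • symInsertS g j n u = ∑ i : Fin (n + 1), permS 1 (cyc i) (insertS g j n u) := by
  have h : (n : ℂ) + 1 ≠ 0 := by exact_mod_cast n.succ_ne_zero
  rw [symInsertS_apply, smul_inv_smul₀ h]

/-- The canonical commutation relation `a(f) a*(g) = a*(g) a(f) + ⟨f, g⟩` in one sector. -/
lemma removeS_symInsertS_ae (f g : Form) (j l : Fin N) (u : L2 N (n + 1)) :
    ((((n + 1 : ℕ) : ℂ) + 1) • removeS f j (n + 1) (symInsertS g l (n + 1) u)
      - ((n : ℂ) + 1) • symInsertS g l n (removeS f j n u) : L2 N (n + 1)) =ᵐ[volume]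
        fun p => pairing f g j l p.1 * u p := by
  have e : (((n + 1 : ℕ) : ℂ) + 1) • removeS f j (n + 1) (symInsertS g l (n + 1) u)
      - ((n : ℂ) + 1) • symInsertS g l n (removeS f j n u)
      = removeS f j (n + 1) (permS 1 (cyc 0) (insertS g l (n + 1) u)) := by
    rw [← map_smul, smul_symInsertS, smul_symInsertS, map_sum, Fin.sum_univ_succ]
    simp only [removeS_permS_succ]
    rw [add_sub_cancel_right]
  rw [e]
  exact removeS_permS_zero f g j l u

lemma removeS_symInsertS_zero_ae (f g : Form) (j l : Fin N) (u : L2 N 0) :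
    removeS f j 0 (symInsertS g l 0 u) =ᵐ[volume] fun p => pairing f g j l p.1 * u p := by
  have e : removeS f j 0 (symInsertS g l 0 u) = removeS f j 0 (permS 1 (cyc 0) (insertS g l 0 u)) := by
    rw [symInsertS_apply]
    simp
  rw [e]
  exact removeS_permS_zero f g j l u

end Symmetry

/-! ### Functions of the number operator -/

section Number

lemma norm_inner_self' {F : Type*} [NormedAddCommGroup F] [InnerProductSpace ℂ F] (x : F) :
    ‖inner ℂ x x‖ = ‖x‖ ^ 2 := by
  rw [inner_self_eq_norm_sq_to_K]
  simp

variable {N : ℕ}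
variable {Ψ χ : Fk N} {c d : ℕ → ℂ} {B : ℝ}

lemma sq_norm_smul_sec_smul (z c : ℂ) (Ψ : Fk N) (n : ℕ) :
    ‖c • sec n (z • Ψ)‖ ^ 2 = ‖z‖ ^ 2 * ‖c • sec n Ψ‖ ^ 2 := by
  rw [sec_smul, norm_smul, norm_smul, norm_smul]
  ring

lemma sq_norm_smul_sec_add_le (c : ℂ) (Ψ χ : Fk N) (n : ℕ) :
    ‖c • sec n (Ψ + χ)‖ ^ 2 ≤ 2 * (‖c • sec n Ψ‖ ^ 2 + ‖c • sec n χ‖ ^ 2) := by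
  rw [sec_add, smul_add]
  have h := norm_add_le (c • sec n Ψ) (c • sec n χ)
  nlinarith [sq_nonneg (‖c • sec n Ψ‖ - ‖c • sec n χ‖),
    norm_nonneg (c • sec n Ψ + c • sec n χ)]

/-- The maximal domain of `c(𝓝)`. -/
def numDom (N : ℕ) (c : ℕ → ℂ) : Submodule ℂ (Fk N) where
  carrier := {Ψ | Summable fun n => ‖c n • sec n Ψ‖ ^ 2}
  zero_mem' := by simp [summable_zero]
  add_mem' := fun {a b} ha hb =>
    Summable.of_nonneg_of_le (fun n => by positivity)
      (fun n => sq_norm_smul_sec_add_le (c n) a b n) ((Summable.add ha hb).mul_left 2)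
  smul_mem' := fun z a ha =>
    (Summable.mul_left (‖z‖ ^ 2) ha).congr fun n => (sq_norm_smul_sec_smul z (c n) a n).symm

open Classical in
/-- `c(𝓝) Ψ`, with the value `0` outside of the domain. -/
def numFun (c : ℕ → ℂ) (Ψ : Fk N) : Fk N :=
  if h : Ψ ∈ numDom N c then ofSeq (fun n => c n • sec n Ψ) h else 0

lemma sec_numFun (h : Ψ ∈ numDom N c) (n : ℕ) :
    sec n (numFun c Ψ) = c n • sec n Ψ := by
  rw [numFun, dif_pos h]
  exact sec_ofSeq _ h n

lemma numFun_of_notMem (h : Ψ ∉ numDom N c) : numFun c Ψ = 0 := by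
  rw [numFun, dif_neg h]

attribute [irreducible] numFun

lemma hasNumberFun_iff :
    HasNumberFun c (toFull N Ψ) (toFull N χ) ↔ ∀ n, sec n χ = c n • sec n Ψ := by
  simp only [HasNumberFun, sector_toFull]

lemma mem_numDom_of_sec (h : ∀ n, sec n χ = c n • sec n Ψ) :
    Ψ ∈ numDom N c :=
  (hasSum_sq_norm_sec χ).summable.congr fun n => by rw [h n]

lemma eq_numFun_of_sec (h : ∀ n, sec n χ = c n • sec n Ψ) :
    χ = numFun c Ψ :=
  sec_ext fun n => by rw [h n, sec_numFun (mem_numDom_of_sec h)]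

lemma numFun_add (h : Ψ ∈ numDom N c) (h' : χ ∈ numDom N c) :
    numFun c (Ψ + χ) = numFun c Ψ + numFun c χ :=
  sec_ext fun n => by
    simp only [sec_numFun (add_mem h h'), sec_add, sec_add, sec_numFun h, sec_numFun h', smul_add]

lemma numFun_smul (z : ℂ) (h : Ψ ∈ numDom N c) :
    numFun c (z • Ψ) = z • numFun c Ψ :=
  sec_ext fun n => by
    simp only [sec_numFun (Submodule.smul_mem _ z h), sec_smul, sec_numFun h]
    exact smul_comm (c n) z (sec n Ψ)

lemma numFun_sub (h : Ψ ∈ numDom N c) (h' : χ ∈ numDom N c) :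
    numFun c (Ψ - χ) = numFun c Ψ - numFun c χ :=
  sec_ext fun n => by
    simp only [sec_numFun (sub_mem h h'), sec_sub, sec_sub, sec_numFun h, sec_numFun h', smul_sub]

lemma norm_le_add_of_sq_le {Φ : Fk N} {A : ℝ} (hA : 0 ≤ A) (hB : 0 ≤ B)
    (h : ∀ n, ‖sec n Φ‖ ^ 2 ≤ A ^ 2 * ‖sec n Ψ‖ ^ 2 + B ^ 2 * ‖sec n χ‖ ^ 2) :
    ‖Φ‖ ≤ A * ‖Ψ‖ + B * ‖χ‖ := by
  have h1 := hasSum_le h (hasSum_sq_norm_sec Φ) (((hasSum_sq_norm_sec Ψ).mul_left (A ^ 2)).add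
    ((hasSum_sq_norm_sec χ).mul_left (B ^ 2)))
  refine (sq_le_sq₀ (norm_nonneg _) (by positivity)).1 (h1.trans ?_)
  have := mul_nonneg (mul_nonneg hA (norm_nonneg Ψ)) (mul_nonneg hB (norm_nonneg χ))
  nlinarith

lemma numDom_mono {A : ℝ}
    (h : ∀ n, ‖d n‖ ^ 2 ≤ A * ‖c n‖ ^ 2 + B) : numDom N c ≤ numDom N d := by
  intro Ψ hΨ
  refine Summable.of_nonneg_of_le (fun n => by positivity) (fun n => ?_)
    ((Summable.mul_left A hΨ).add ((hasSum_sq_norm_sec Ψ).summable.mul_left B))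
  rw [norm_smul, norm_smul, mul_pow, mul_pow]
  nlinarith [mul_le_mul_of_nonneg_right (h n) (sq_nonneg ‖sec n Ψ‖)]

lemma numDom_of_bounded (h : ∀ n, ‖c n‖ ≤ B) (Ψ : Fk N) :
    Ψ ∈ numDom N c := by
  refine Summable.of_nonneg_of_le (fun n => by positivity) (fun n => ?_)
    ((hasSum_sq_norm_sec Ψ).summable.mul_left (B ^ 2))
  rw [norm_smul, mul_pow]
  gcongr
  exact h n

lemma numFun_mem (h : Ψ ∈ numDom N d)
    (h' : Ψ ∈ numDom N fun n => c n * d n) : numFun d Ψ ∈ numDom N c :=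
  Summable.congr h' fun n => by simp only [sec_numFun h, L2_smul_smul]

lemma numFun_numFun (h : Ψ ∈ numDom N d)
    (h' : Ψ ∈ numDom N fun n => c n * d n) :
    numFun c (numFun d Ψ) = numFun (fun n => c n * d n) Ψ :=
  sec_ext fun n => by
    simp only [sec_numFun (numFun_mem h h'), sec_numFun h, sec_numFun h', L2_smul_smul]

lemma inner_numFun_numFun (h : Ψ ∈ numDom N d)
    (hχ : χ ∈ numDom N c) (h' : Ψ ∈ numDom N fun n => conj (c n) * d n) :
    inner ℂ (numFun c χ) (numFun d Ψ) = inner ℂ χ (numFun (fun n => conj (c n) * d n) Ψ) := by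
  refine (hasSum_inner_sec _ _).unique ((hasSum_inner_sec _ _).congr_fun fun n => ?_)
  simp only [sec_numFun h, sec_numFun hχ n, sec_numFun h', inner_smul_left, inner_smul_right,
    inner_smul_right, mul_assoc]
  ring

/-- The weight of `𝓝^{1/2}`. -/
def sq0 (n : ℕ) : ℂ := (√(n : ℝ) : ℂ)

/-- The weight of `(𝓝 + 1)^{1/2}`. -/
def sq1 (n : ℕ) : ℂ := (√(n + 1 : ℝ) : ℂ)

/-- The weight of `𝓝`. -/
def wN (n : ℕ) : ℂ := (n : ℂ)

lemma norm_sq0_sq (n : ℕ) : ‖sq0 n‖ ^ 2 = n := by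
  rw [sq0, Complex.norm_real, Real.norm_eq_abs, sq_abs, Real.sq_sqrt (by positivity)]

lemma norm_sq1_sq (n : ℕ) : ‖sq1 n‖ ^ 2 = n + 1 := by
  rw [sq1, Complex.norm_real, Real.norm_eq_abs, sq_abs, Real.sq_sqrt (by positivity)]

lemma norm_wN (n : ℕ) : ‖wN n‖ = n := by simp [wN]

lemma sq0_mul_self (n : ℕ) : sq0 n * sq0 n = wN n := by
  rw [sq0, wN, ← Complex.ofReal_mul, Real.mul_self_sqrt (by positivity)]
  simp

lemma sq1_mul_self (n : ℕ) : sq1 n * sq1 n = n + 1 := by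
  rw [sq1, ← Complex.ofReal_mul, Real.mul_self_sqrt (by positivity)]
  simp

lemma sq0_succ (n : ℕ) : sq0 (n + 1) = sq1 n := by simp [sq0, sq1]

lemma conj_sq0 (n : ℕ) : conj (sq0 n) = sq0 n := Complex.conj_ofReal _

lemma conj_sq1 (n : ℕ) : conj (sq1 n) = sq1 n := Complex.conj_ofReal _

lemma sq1_ne_zero (n : ℕ) : sq1 n ≠ 0 := by
  intro h
  have := norm_sq1_sq n
  rw [h, norm_zero] at this
  have h2 : (0 : ℝ) < n + 1 := by positivity
  linarith

lemma wN_le_sq0 : numDom N wN ≤ numDom N sq0 :=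
  numDom_mono (A := 1) (B := 0) fun n => by
    rw [norm_sq0_sq, norm_wN]
    have : (n : ℝ) ≤ n ^ 2 := by exact_mod_cast Nat.le_self_pow two_ne_zero n
    linarith

lemma sq0_le_sq1 : numDom N sq0 ≤ numDom N sq1 :=
  numDom_mono (A := 1) (B := 1) fun n => by
    rw [norm_sq0_sq, norm_sq1_sq]
    linarith

lemma norm_numFun_sq1_le (h : Ψ ∈ numDom N sq0) :
    ‖numFun sq1 Ψ‖ ≤ ‖numFun sq0 Ψ‖ + ‖Ψ‖ := by
  have := norm_le_add_of_sq_le (Φ := numFun sq1 Ψ) (Ψ := numFun sq0 Ψ) (χ := Ψ) zero_le_one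
    zero_le_one (fun n => by
      simp only [sec_numFun h, sec_numFun (sq0_le_sq1 h), norm_smul, norm_smul, mul_pow, mul_pow,
        norm_sq0_sq, norm_sq1_sq]
      linarith)
  simpa using this

/-- `‖𝓝^{1/2} Ψ‖² ≤ ‖𝓝 Ψ‖ ‖Ψ‖`. -/
lemma sq_norm_numFun_sq0_le (h : Ψ ∈ numDom N wN) :
    ‖numFun sq0 Ψ‖ ^ 2 ≤ ‖numFun wN Ψ‖ * ‖Ψ‖ := by
  have h1 : (fun n => conj (sq0 n) * sq0 n) = wN := by
    funext n
    rw [conj_sq0, sq0_mul_self]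
  have h2 := inner_numFun_numFun (wN_le_sq0 h) (wN_le_sq0 h) (by rwa [h1])
  rw [h1] at h2
  exact (norm_inner_self' (numFun sq0 Ψ)).symm.trans_le ((congrArg norm h2).trans_le
    ((norm_inner_le_norm _ _).trans_eq (mul_comm _ _)))

/-- Vectors with finitely many phonons. -/
def IsFin (Ψ : Fk N) : Prop := ∃ M : ℕ, ∀ n, M ≤ n → sec n Ψ = 0

lemma IsFin.mem_numDom (h : IsFin Ψ) (c : ℕ → ℂ) : Ψ ∈ numDom N c := by
  obtain ⟨M, hM⟩ := h
  refine summable_of_ne_finset_zero (s := Finset.range M) fun n hn => ?_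
  rw [hM n (by simpa using hn)]
  simp

lemma IsFin.add (h : IsFin Ψ) (h' : IsFin χ) : IsFin (Ψ + χ) := by
  obtain ⟨M, hM⟩ := h
  obtain ⟨M', hM'⟩ := h'
  refine ⟨max M M', fun n hn => ?_⟩
  rw [sec_add, hM n ((le_max_left _ _).trans hn), hM' n ((le_max_right _ _).trans hn), add_zero]

lemma IsFin.smul (h : IsFin Ψ) (z : ℂ) : IsFin (z • Ψ) := by
  obtain ⟨M, hM⟩ := h
  exact ⟨M, fun n hn => by rw [sec_smul, hM n hn, smul_zero]⟩

lemma IsFin.numFun (h : IsFin Ψ) (c : ℕ → ℂ) : IsFin (numFun c Ψ) := by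
  have h' := h.mem_numDom c
  obtain ⟨M, hM⟩ := h
  exact ⟨M, fun n hn => by simp only [sec_numFun h', hM n hn, smul_zero]⟩

/-- The projection to fewer than `M` phonons. -/
def trunc (M : ℕ) (Ψ : Fk N) : Fk N := numFun (fun n => if n < M then 1 else 0) Ψ

lemma trunc_bound (M n : ℕ) : ‖(if n < M then 1 else 0 : ℂ)‖ ≤ 1 := by split_ifs <;> simp

lemma trunc_mem (M : ℕ) (Ψ : Fk N) : Ψ ∈ numDom N (fun n => if n < M then 1 else 0) :=
  numDom_of_bounded (trunc_bound M) Ψ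

lemma sec_trunc (M n : ℕ) (Ψ : Fk N) :
    sec n (trunc M Ψ) = if n < M then sec n Ψ else 0 := by
  simp only [trunc, sec_numFun (numDom_of_bounded (trunc_bound M) Ψ)]
  split_ifs <;> simp

lemma isFin_trunc (M : ℕ) (Ψ : Fk N) : IsFin (trunc M Ψ) :=
  ⟨M, fun n hn => by rw [sec_trunc, if_neg (by omega)]⟩

lemma trunc_numFun (M : ℕ) (h : Ψ ∈ numDom N c) :
    trunc M (numFun c Ψ) = numFun c (trunc M Ψ) :=
  sec_ext fun n => by
    simp only [sec_trunc, sec_numFun h, sec_numFun ((isFin_trunc M Ψ).mem_numDom c), sec_trunc]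
    split_ifs <;> simp

lemma sec_trunc_sub (M n : ℕ) (Ψ : Fk N) :
    ‖sec n (trunc M Ψ - Ψ)‖ ^ 2 = if n < M then 0 else ‖sec n Ψ‖ ^ 2 := by
  simp only [sec_sub, sec_trunc]
  split_ifs <;> simp

lemma tendsto_trunc (Ψ : Fk N) : Tendsto (fun M => trunc M Ψ) atTop (𝓝 Ψ) := by
  refine tendsto_iff_norm_sub_tendsto_zero.2 ?_
  have h0 : Tendsto (fun M => ∑' n, ‖sec (n + M) Ψ‖ ^ 2) atTop (𝓝 0) :=
    tendsto_sum_nat_add fun n => ‖sec n Ψ‖ ^ 2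
  have h1 : ∀ M, ‖trunc M Ψ - Ψ‖ ^ 2 = ∑' n, ‖sec (n + M) Ψ‖ ^ 2 := by
    intro M
    have h2 := hasSum_sq_norm_sec (trunc M Ψ - Ψ)
    simp only [sec_trunc_sub] at h2
    refine h2.tsum_eq.symm.trans ((h2.summable.sum_add_tsum_nat_add M).symm.trans ?_)
    rw [Finset.sum_eq_zero, zero_add]
    · exact tsum_congr fun n => if_neg (by omega)
    · exact fun n hn => if_pos (by simpa using hn)
  have h3 : Tendsto (fun M => ‖trunc M Ψ - Ψ‖ ^ 2) atTop (𝓝 0) := by simpa only [h1] using h0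
  have h4 := h3.sqrt
  simpa [Real.sqrt_sq (norm_nonneg _)] using h4

end Number

/-! ### Annihilation and creation operators -/

section AnnihilationCreation

variable {N : ℕ}
variable {Ψ : Fk N} {g : E → ℂ} {n : ℕ}

/-- The annihilation operator without its factor `√(n + 1)`. -/
def alpha (g : Form) (j : Fin N) : Fk N →L[ℂ] Fk N :=
  lowerOp (removeS g j) ‖g‖ (norm_nonneg g) fun _ => norm_removeS_le g j

/-- The creation operator without its factor `√(n + 1)`. -/
def alphaD (g : Form) (j : Fin N) : Fk N →L[ℂ] Fk N :=
  raiseOp (symInsertS g j) ‖g‖ (norm_nonneg g) fun _ => norm_symInsertS_le g j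

lemma norm_alpha_le (g : Form) (j : Fin N) (Ψ : Fk N) : ‖alpha g j Ψ‖ ≤ ‖g‖ * ‖Ψ‖ :=
  norm_lowerOp_le _ _ _ _ _

lemma norm_alphaD_le (g : Form) (j : Fin N) (Ψ : Fk N) : ‖alphaD g j Ψ‖ ≤ ‖g‖ * ‖Ψ‖ :=
  norm_raiseOp_le _ _ _ _ _

@[simp]
lemma sec_alpha (g : Form) (j : Fin N) (n : ℕ) (Ψ : Fk N) :
    sec n (alpha g j Ψ) = removeS g j n (sec (n + 1) Ψ) := sec_lowerOp _ _ _ _ _ _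

@[simp]
lemma sec_zero_alphaD (g : Form) (j : Fin N) (Ψ : Fk N) :
    sec 0 (alphaD g j Ψ) = 0 := sec_zero_raiseOp _ _ _ _ _

@[simp]
lemma sec_succ_alphaD (g : Form) (j : Fin N) (n : ℕ) (Ψ : Fk N) :
    sec (n + 1) (alphaD g j Ψ) = symInsertS g j n (sec n Ψ) :=
  sec_succ_raiseOp _ _ _ _ _ _

lemma alpha_add_form (g g' : Form) (j : Fin N) (Ψ : Fk N) :
    alpha (g + g') j Ψ = alpha g j Ψ + alpha g' j Ψ :=
  sec_ext fun n => by simp [removeS_add]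

lemma alpha_smul_form (c : ℂ) (g : Form) (j : Fin N) (Ψ : Fk N) :
    alpha (c • g) j Ψ = conj c • alpha g j Ψ :=
  sec_ext fun n => by simp [removeS_smul]

lemma alphaD_add_form (g g' : Form) (j : Fin N) (Ψ : Fk N) :
    alphaD (g + g') j Ψ = alphaD g j Ψ + alphaD g' j Ψ :=
  sec_ext fun n => by cases n <;> simp [symInsertS_add]

lemma alphaD_smul_form (c : ℂ) (g : Form) (j : Fin N) (Ψ : Fk N) :
    alphaD (c • g) j Ψ = c • alphaD g j Ψ :=
  sec_ext fun n => by cases n <;> simp [symInsertS_smul]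

attribute [irreducible] alpha alphaD

lemma SymS.zero : SymS (0 : L2 N n) := fun _ => map_zero _

lemma SymS.add {u v : L2 N n} (hu : SymS u) (hv : SymS v) : SymS (u + v) := fun τ =>
  (map_add _ _ _).trans (congrArg₂ (· + ·) (hu τ) (hv τ))

lemma SymS.smul {u : L2 N n} (hu : SymS u) (c : ℂ) : SymS (c • u) := fun τ =>
  (map_smul _ _ _).trans (congrArg (c • ·) (hu τ))

/-- The space of vectors which are symmetric in the phonons, but not necessarily in the
particles. -/
def phSym (N : ℕ) : Submodule ℂ (Fk N) where
  carrier := {Ψ | ∀ n, SymS (sec n Ψ)}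
  zero_mem' := fun n => by simpa only [sec_zero] using SymS.zero
  add_mem' := fun {a b} ha hb n => by simpa only [sec_add] using (ha n).add (hb n)
  smul_mem' := fun c a ha n => by simpa only [sec_smul] using (ha n).smul c

lemma mem_phSym : Ψ ∈ phSym N ↔ ∀ n, SymS (sec n Ψ) := Iff.rfl

lemma isClosed_phSym (N : ℕ) : IsClosed (phSym N : Set (Fk N)) := by
  have : (phSym N : Set (Fk N)) = ⋂ (n : ℕ) (τ : Equiv.Perm (Fin n)),
      {Ψ : Fk N | permS 1 τ (sec n Ψ) = sec n Ψ} := by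
    ext Ψ
    simp only [Set.mem_iInter]
    rfl
  rw [this]
  refine isClosed_iInter fun n => isClosed_iInter fun τ => ?_
  exact isClosed_eq ((permS 1 τ).continuous.comp (sec n).continuous) (sec n).continuous

lemma alpha_mem_phSym (h : Ψ ∈ phSym N) (g : Form) (j : Fin N) :
    alpha g j Ψ ∈ phSym N := mem_phSym.2 fun n => by
  simpa only [sec_alpha] using (mem_phSym.1 h (n + 1)).removeS g j

lemma alphaD_mem_phSym (h : Ψ ∈ phSym N) (g : Form) (j : Fin N) :
    alphaD g j Ψ ∈ phSym N := mem_phSym.2 fun n => by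
  cases n with
  | zero => simpa only [sec_zero_alphaD] using SymS.zero
  | succ n => simpa only [sec_succ_alphaD] using (mem_phSym.1 h n).symInsertS g j

lemma numFun_mem_phSym (h : Ψ ∈ phSym N) (c : ℕ → ℂ) : numFun c Ψ ∈ phSym N := by
  by_cases hΨ : Ψ ∈ numDom N c
  · exact mem_phSym.2 fun n => by
      simpa only [sec_numFun hΨ] using (mem_phSym.1 h n).smul (c n)
  · exact (numFun_of_notMem hΨ).symm ▸ zero_mem _

lemma inner_alphaD_right {χ : Fk N} (hχ : χ ∈ phSym N) (g : Form) (j : Fin N) (Ψ : Fk N) :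
    inner ℂ χ (alphaD g j Ψ) = inner ℂ (alpha g j χ) Ψ := by
  have h1 := (hasSum_nat_add_iff' 1).2 (hasSum_inner_sec χ (alphaD g j Ψ))
  simp only [Finset.range_one, Finset.sum_singleton, sec_zero_alphaD, inner_zero_right,
    sub_zero, sec_succ_alphaD, inner_symInsertS_right (mem_phSym.1 hχ (_ + 1))] at h1
  have h2 := hasSum_inner_sec (alpha g j χ) Ψ
  simp only [sec_alpha] at h2
  exact h1.unique h2

/-- The annihilation operator `a(g_{x_j})`, defined on `D(𝓝^{1/2})`. -/
def ann (g : Form) (j : Fin N) (Ψ : Fk N) : Fk N := alpha g j (numFun sq0 Ψ)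

/-- The creation operator `a*(g_{x_j})`, defined on `D(𝓝^{1/2})`. -/
def cre (g : Form) (j : Fin N) (Ψ : Fk N) : Fk N := alphaD g j (numFun sq1 Ψ)

lemma sec_ann (h : Ψ ∈ numDom N sq0) (g : Form) (j : Fin N) (n : ℕ) :
    sec n (ann g j Ψ) = sq1 n • removeS g j n (sec (n + 1) Ψ) := by
  simp only [ann, sec_alpha, sec_numFun h, map_smul, sq0_succ]

lemma sec_zero_cre (Ψ : Fk N) (g : Form) (j : Fin N) : sec 0 (cre g j Ψ) = 0 :=
  sec_zero_alphaD _ _ _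

lemma sec_succ_cre (h : Ψ ∈ numDom N sq0) (g : Form) (j : Fin N) (n : ℕ) :
    sec (n + 1) (cre g j Ψ) = sq1 n • symInsertS g j n (sec n Ψ) := by
  simp only [cre, sec_succ_alphaD, sec_numFun (sq0_le_sq1 h), map_smul]

lemma hasAnnihilation_iff (hg : MemLp g 2) (j : Fin N) (Ψ η : Fk N) :
    HasAnnihilation (formFactor g) j (toFull N Ψ) (toFull N η) ↔
      ∀ n, sec n η = sq1 n • removeS (hg.toLp g) j n (sec (n + 1) Ψ) := by
  have e (n : ℕ) (p : Conf N n) : annihilationIntegrand (formFactor g) j (toFull N Ψ) n p =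
      fun k => conj (formFactor g (p.1 j) k) * sec (n + 1) Ψ (p.1, Fin.cons k p.2) := by
    funext k
    simp only [annihilationIntegrand, sector_toFull]
  simp only [HasAnnihilation, e, sector_toFull]
  refine forall_congr' fun n => ?_
  have h1 := removeS_ae hg j (sec (n + 1) Ψ)
  have h2 := Lp.coeFn_smul (sq1 n) (removeS (hg.toLp g) j n (sec (n + 1) Ψ))
  constructor
  · intro h
    refine Lp.ext ?_
    filter_upwards [h, h1, h2] with p hp hp1 hp2
    rw [hp2, hp.2, Pi.smul_apply, hp1.2]
    rfl
  · intro h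
    rw [h]
    filter_upwards [h1, h2] with p hp1 hp2
    refine ⟨hp1.1, ?_⟩
    rw [hp2, Pi.smul_apply, hp1.2]
    rfl

lemma hasAnnihilation_ann (hg : MemLp g 2) (j : Fin N)
    (h : Ψ ∈ numDom N sq0) : HasAnnihilation (formFactor g) j (toFull N Ψ)
    (toFull N (ann (hg.toLp g) j Ψ)) :=
  (hasAnnihilation_iff hg j _ _).2 (sec_ann h _ j)

lemma sq1_smul_symInsertS_ae (hg : MemLp g 2) (j : Fin N) (u : L2 N n) :
    (sq1 n • symInsertS (hg.toLp g) j n u : L2 N (n + 1)) =ᵐ[volume] fun p =>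
      ∑ i : Fin (n + 1), ((√(n + 1 : ℝ))⁻¹ : ℂ) * formFactor g (p.1 j) (p.2 i) *
        u (p.1, i.removeNth p.2) := by
  have e : sq1 n • symInsertS (hg.toLp g) j n u = (sq1 n)⁻¹ •
      ∑ i : Fin (n + 1), permS 1 (cyc i) (insertS (hg.toLp g) j n u) := by
    rw [← smul_symInsertS, ← sq1_mul_self, L2_smul_smul, ← mul_assoc,
      inv_mul_cancel₀ (sq1_ne_zero n), one_mul]
  rw [e]
  have h1 (i : Fin (n + 1)) := permS_insertS_ae hg j u i
  filter_upwards [Lp.coeFn_smul (sq1 n)⁻¹ (∑ i : Fin (n + 1), permS 1 (cyc i)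
    (insertS (hg.toLp g) j n u)), eventually_all.2 h1,
    Lp.coeFn_fun_finsetSum Finset.univ (fun i : Fin (n + 1) => permS 1 (cyc i)
    (insertS (hg.toLp g) j n u))] with p hp hq hr
  rw [hp, Pi.smul_apply, hr, smul_eq_mul, Finset.mul_sum]
  refine Finset.sum_congr rfl fun i _ => ?_
  rw [hq i, ← mul_assoc]
  rfl

lemma hasCreation_iff (hg : MemLp g 2) (j : Fin N) (Ψ η : Fk N) :
    HasCreation (formFactor g) j (toFull N Ψ) (toFull N η) ↔ sec 0 η = 0 ∧
      ∀ n, sec (n + 1) η = sq1 n • symInsertS (hg.toLp g) j n (sec n Ψ) := by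
  simp only [HasCreation, sector_toFull]
  refine and_congr_right fun _ => forall_congr' fun n => ?_
  have key : (sq1 n • symInsertS (hg.toLp g) j n (sec n Ψ) : L2 N (n + 1)) =ᵐ[volume] fun p =>
      ∑ i : Fin (n + 1), ((√(n + 1 : ℝ))⁻¹ : ℂ) * formFactor g (p.1 j) (p.2 i) *
        sec n Ψ (p.1, i.removeNth p.2) := by
    exact sq1_smul_symInsertS_ae hg j _
  constructor
  · exact fun h => Lp.ext (h.trans key.symm)
  · intro h
    exact (EventuallyEq.of_eq (congrArg (fun u : L2 N (n + 1) => (u : Conf N (n + 1) → ℂ)) h)).trans key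

lemma hasCreation_cre (hg : MemLp g 2) (j : Fin N)
    (h : Ψ ∈ numDom N sq0) : HasCreation (formFactor g) j (toFull N Ψ)
    (toFull N (cre (hg.toLp g) j Ψ)) :=
  (hasCreation_iff hg j _ _).2 ⟨sec_zero_cre _ _ _, sec_succ_cre h _ j⟩

end AnnihilationCreation

/-! ### One-parameter unitary groups -/

section OneParameter

variable {F : Type*} [NormedAddCommGroup F] [InnerProductSpace ℂ F] [CompleteSpace F]

/-- A strongly continuous one-parameter group of isometries. -/
structure UnitaryGroup (F : Type*) [NormedAddCommGroup F] [InnerProductSpace ℂ F] where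
  /-- The isometry at time `t`. -/
  T : ℝ → F →ₗᵢ[ℂ] F
  zero : ∀ x, T 0 x = x
  add : ∀ s t x, T s (T t x) = T (s + t) x
  cont : ∀ x, Continuous fun t => T t x

namespace UnitaryGroup

/-- `y` is the value of the generator at `x`. -/
def HasGen (G : UnitaryGroup F) (x y : F) : Prop := HasDerivAt (fun t => G.T t x) y 0

variable {G : UnitaryGroup F} {x y x' y' : F}

lemma HasGen.unique (h : G.HasGen x y) (h' : G.HasGen x y') : y = y' := HasDerivAt.unique h h'

lemma hasGen_zero : G.HasGen 0 0 := by
  have : (fun t => G.T t (0 : F)) = fun _ => 0 := funext fun t => map_zero _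
  rw [HasGen, this]
  exact hasDerivAt_const _ _

lemma HasGen.map (h : G.HasGen x y) {G' : UnitaryGroup F} (B : F →L[ℂ] F)
    (hB : ∀ t z, B (G.T t z) = G'.T t (B z)) : G'.HasGen (B x) (B y) := by
  have h1 := (B.restrictScalars ℝ).hasFDerivAt.comp_hasDerivAt (0 : ℝ) h
  exact h1.congr_of_eventuallyEq (Eventually.of_forall fun t => (hB t x).symm)

lemma HasGen.add (h : G.HasGen x y) (h' : G.HasGen x' y') : G.HasGen (x + x') (y + y') := by
  refine (HasDerivAt.add h h').congr_of_eventuallyEq (Eventually.of_forall fun t => ?_)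
  exact map_add _ _ _

lemma HasGen.sub (h : G.HasGen x y) (h' : G.HasGen x' y') : G.HasGen (x - x') (y - y') := by
  refine (HasDerivAt.sub h h').congr_of_eventuallyEq (Eventually.of_forall fun t => ?_)
  exact map_sub _ _ _

lemma HasGen.smul (h : G.HasGen x y) (c : ℂ) : G.HasGen (c • x) (c • y) :=
  h.map (c • ContinuousLinearMap.id ℂ F) fun t z => by simp

lemma HasGen.sum {ι : Type*} {s : Finset ι} {u v : ι → F} (h : ∀ i ∈ s, G.HasGen (u i) (v i)) :
    G.HasGen (∑ i ∈ s, u i) (∑ i ∈ s, v i) := by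
  classical
  induction s using Finset.induction_on with
  | empty => simpa using hasGen_zero
  | insert a s ha ih =>
    rw [Finset.sum_insert ha, Finset.sum_insert ha]
    exact (h a (Finset.mem_insert_self _ _)).add (ih fun i hi => h i (Finset.mem_insert_of_mem hi))

lemma HasGen.hasDerivAt (h : G.HasGen x y) (t : ℝ) :
    HasDerivAt (fun t => G.T t x) (G.T t y) t := by
  have h0 : HasDerivAt (fun s => G.T s x) y (t - t) := by rw [sub_self]; exact h
  have h1 := HasDerivAt.comp_sub_const t t h0
  have h2 := ((G.T t).toContinuousLinearMap.restrictScalars ℝ).hasFDerivAt.comp_hasDerivAt t h1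
  refine h2.congr_of_eventuallyEq (Eventually.of_forall fun s => ?_)
  simp [G.add]

lemma HasGen.norm_sub_le (h : G.HasGen x y) (t : ℝ) : ‖G.T t x - x‖ ≤ |t| * ‖y‖ := by
  have h1 := (convex_univ (𝕜 := ℝ) (E := ℝ)).norm_image_sub_le_of_norm_hasDerivWithin_le
    (f := fun t => G.T t x) (f' := fun t => G.T t y) (C := ‖y‖) (x := 0) (y := t)
    (fun s _ => (h.hasDerivAt s).hasDerivWithinAt) (fun s _ => by simp) trivial trivial
  simpa [G.zero, mul_comm] using h1

lemma inner_T_left (t : ℝ) : inner ℂ (G.T t x) y = inner ℂ x (G.T (-t) y) := by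
  rw [← (G.T (-t)).inner_map_map, G.add, neg_add_cancel, G.zero]

lemma HasGen.inner_left (h : G.HasGen x y) (h' : G.HasGen x' y') :
    inner ℂ y x' = -inner ℂ x y' := by
  have h1 := HasDerivAt.inner ℂ h h'
  have h2 : (fun t => inner ℂ (G.T t x) (G.T t x')) = fun _ => inner ℂ x x' :=
    funext fun t => (G.T t).inner_map_map _ _
  rw [h2] at h1
  have h3 := h1.unique (hasDerivAt_const _ _)
  simp only [G.zero] at h3
  exact eq_neg_of_add_eq_zero_right h3

/-- The time average `∫₀ᵗ T_s y ds` without its normalization. -/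
def avg (G : UnitaryGroup F) (t : ℝ) (y : F) : F := ∫ s in (0 : ℝ)..t, G.T s y

lemma hasDerivAt_avg (t : ℝ) (y : F) : HasDerivAt (fun t => G.avg t y) (G.T t y) t :=
  intervalIntegral.integral_hasDerivAt_right ((G.cont y).intervalIntegrable _ _)
    ((G.cont y).stronglyMeasurableAtFilter _ _) (G.cont y).continuousAt

lemma avg_zero (y : F) : G.avg 0 y = 0 := intervalIntegral.integral_same

lemma avg_sub (t : ℝ) (y y' : F) : G.avg t (y - y') = G.avg t y - G.avg t y' := by
  rw [avg, avg, avg, ← intervalIntegral.integral_sub ((G.cont y).intervalIntegrable _ _)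
    ((G.cont y').intervalIntegrable _ _)]
  simp

lemma norm_avg_le (t : ℝ) (y : F) : ‖G.avg t y‖ ≤ ‖y‖ * |t| := by
  rw [avg]
  have h := intervalIntegral.norm_integral_le_of_norm_le_const (a := 0) (b := t) (C := ‖y‖)
    (f := fun s => G.T s y) (fun s _ => (G.T s).norm_map y |>.le)
  simpa only [sub_zero] using h

lemma continuous_avg (t : ℝ) : Continuous fun y => G.avg t y := by
  refine (LipschitzWith.of_dist_le_mul (K := ‖t‖₊) fun y y' => ?_).continuous
  rw [dist_eq_norm, dist_eq_norm, ← avg_sub, mul_comm]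
  exact norm_avg_le t _

/-- The integrated form of the relation `y = G x`. -/
lemma hasGen_iff : G.HasGen x y ↔ ∀ t, G.T t x - x = G.avg t y := by
  constructor
  · intro h t
    have h1 : ∀ s, HasDerivAt (fun s => G.T s x - x - G.avg s y) 0 s := fun s => by
      have := ((h.hasDerivAt s).sub_const x).sub (hasDerivAt_avg (G := G) s y)
      rw [sub_self] at this
      exact this
    have h2 := is_const_of_deriv_eq_zero (fun s => (h1 s).differentiableAt) (fun s => (h1 s).deriv)
      t 0
    simp only [G.zero, avg_zero, sub_self] at h2
    exact sub_eq_zero.1 h2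
  · intro h
    have h1 : (fun t => G.T t x) = fun t => G.avg t y + x := funext fun t => by
      rw [← h t, sub_add_cancel]
    rw [HasGen, h1]
    have h2 := (hasDerivAt_avg (G := G) 0 y).add_const x
    rwa [G.zero] at h2

lemma isClosed_hasGen : IsClosed {p : F × F | G.HasGen p.1 p.2} := by
  have : {p : F × F | G.HasGen p.1 p.2} = ⋂ t, {p : F × F | G.T t p.1 - p.1 = G.avg t p.2} := by
    ext p
    simp only [Set.mem_iInter]
    exact hasGen_iff
  rw [this]
  exact isClosed_iInter fun t => isClosed_eq
    (((G.T t).continuous.comp continuous_fst).sub continuous_fst)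
    ((continuous_avg t).comp continuous_snd)

lemma hasGen_of_tendsto {ι : Type*} {l : Filter ι} [l.NeBot] {u v : ι → F}
    (h : ∀ i, G.HasGen (u i) (v i)) (hu : Tendsto u l (𝓝 x)) (hv : Tendsto v l (𝓝 y)) :
    G.HasGen x y :=
  isClosed_hasGen.mem_of_tendsto (hu.prodMk_nhds hv) (Eventually.of_forall h)

lemma hasGen_avg (t : ℝ) (y : F) : G.HasGen (G.avg t y) (G.T t y - y) := by
  have h1 : ∀ h, G.T h (G.avg t y) = G.avg (h + t) y - G.avg h y := by
    intro h
    have e1 : G.T h (G.avg t y) = ∫ s in (0 : ℝ)..t, G.T (h + s) y := by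
      have := (G.T h).toContinuousLinearMap.intervalIntegral_comp_comm
        ((G.cont y).intervalIntegrable (μ := volume) (0 : ℝ) t)
      simp only [LinearIsometry.coe_toContinuousLinearMap, G.add] at this
      exact this.symm
    rw [e1, intervalIntegral.integral_comp_add_left (fun s => G.T s y), avg, avg, add_zero]
    rw [eq_sub_iff_add_eq, add_comm]
    exact intervalIntegral.integral_add_adjacent_intervals
      ((G.cont y).intervalIntegrable (μ := volume) _ _)
      ((G.cont y).intervalIntegrable (μ := volume) _ _)
  have h2 : HasDerivAt (fun h => G.avg (h + t) y - G.avg h y) (G.T t y - y) 0 := by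
    have h3 : HasDerivAt (fun h => G.avg (h + t) y) (G.T (0 + t) y) 0 :=
      (hasDerivAt_avg (0 + t) y).comp_add_const 0 t
    have h4 := h3.sub (hasDerivAt_avg (G := G) 0 y)
    rwa [zero_add, G.zero] at h4
  exact h2.congr_of_eventuallyEq (Eventually.of_forall h1)

lemma inner_avg (t : ℝ) : inner ℂ x (G.avg t y) = -inner ℂ (G.avg (-t) x) y := by
  have h1 : ∀ t, HasDerivAt (fun t => inner ℂ x (G.avg t y) + inner ℂ (G.avg (-t) x) y) (0 : ℂ) t := by
    intro t
    have h3 : HasDerivAt (fun t => G.avg (-t) x) ((-1 : ℝ) • G.T (-t) x) t :=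
      HasDerivAt.scomp t (hasDerivAt_avg (-t) x) (hasDerivAt_neg t)
    have h4 := (HasDerivAt.inner ℂ (hasDerivAt_const t x) (hasDerivAt_avg (G := G) t y)).add
      (HasDerivAt.inner ℂ h3 (hasDerivAt_const t y))
    refine h4.congr_deriv ?_
    simp only [inner_zero_left, inner_zero_right, add_zero, neg_smul, one_smul, inner_neg_left,
      inner_T_left, neg_neg]
    ring
  have h2 := is_const_of_deriv_eq_zero (fun s => (h1 s).differentiableAt) (fun s => (h1 s).deriv)
      t 0
  simp only [avg_zero, neg_zero, inner_zero_left, inner_zero_right, add_zero] at h2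
  exact eq_neg_of_add_eq_zero_left h2

/-- The generator is skew-adjoint: a weak value of the generator is a value. -/
lemma hasGen_of_inner (h : ∀ z z', G.HasGen z z' → inner ℂ x z' = -inner ℂ y z) :
    G.HasGen x y := by
  refine hasGen_iff.2 fun t => ext_inner_right ℂ fun z => ?_
  have h1 := h _ _ (hasGen_avg (-t) z)
  rw [inner_avg, neg_neg, neg_neg] at h1
  rw [← h1, inner_sub_left, inner_T_left, inner_sub_right]

lemma exists_hasGen_of_bounded {M : ℝ} (h : ∀ t, ‖G.T t x - x‖ ≤ M * |t|) :
    ∃ y, G.HasGen x y := by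
  have hM : 0 ≤ M := by simpa using (norm_nonneg _).trans (h 1)
  let D : Submodule ℂ F :=
    { carrier := {z | ∃ z', G.HasGen z z'}
      zero_mem' := ⟨0, hasGen_zero⟩
      add_mem' := fun ⟨_, ha⟩ ⟨_, hb⟩ => ⟨_, ha.add hb⟩
      smul_mem' := fun c _ ⟨_, ha⟩ => ⟨_, ha.smul c⟩ }
  choose g hg using fun z : D => z.2
  let f : D →ₗ[ℂ] ℂ :=
    { toFun := fun z => -inner ℂ x (g z)
      map_add' := fun a b => by
        rw [(hg (a + b)).unique ((hg a).add (hg b)), inner_add_right, neg_add]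
      map_smul' := fun c a => by
        rw [(hg (c • a)).unique ((hg a).smul c), inner_smul_right, RingHom.id_apply, smul_eq_mul,
          mul_neg] }
  have hf : ∀ z, ‖f z‖ ≤ M * ‖z‖ := by
    intro z
    have h1 : Tendsto (fun t : ℝ => ‖inner ℂ x (t⁻¹ • (G.T t z - z))‖) (𝓝[≠] 0)
        (𝓝 ‖inner ℂ x (g z)‖) := by
      have h2 := hasDerivAt_iff_tendsto_slope_zero.1 (hg z)
      simp only [zero_add, G.zero] at h2
      exact (tendsto_const_nhds.inner h2).norm
    have h3 : ‖f z‖ = ‖inner ℂ x (g z)‖ := norm_neg _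
    rw [h3]
    refine le_of_tendsto h1 (eventually_mem_nhdsWithin.mono fun t ht => ?_)
    have ht' : 0 < |t| := abs_pos.2 ht
    have h4 : inner ℂ x (t⁻¹ • (G.T t z - z)) = ((t⁻¹ : ℝ) : ℂ) * inner ℂ (G.T (-t) x - x) (z : F) := by
      rw [inner_sub_left, inner_T_left, neg_neg, ← inner_sub_right, ← inner_smul_right,
        Complex.coe_smul]
    rw [h4, norm_mul, Complex.norm_real, norm_inv, Real.norm_eq_abs]
    calc |t|⁻¹ * ‖inner ℂ (G.T (-t) x - x) (z : F)‖
        ≤ |t|⁻¹ * ((M * |-t|) * ‖z‖) := by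
          gcongr
          exact (norm_inner_le_norm _ _).trans (mul_le_mul_of_nonneg_right (h _) (norm_nonneg _))
      _ = M * ‖z‖ := by rw [abs_neg]; field_simp
  obtain ⟨φ, hφ, -⟩ := exists_extension_norm_eq D (f.mkContinuous M hf)
  refine ⟨(InnerProductSpace.toDual ℂ F).symm φ, hasGen_of_inner fun z z' hz => ?_⟩
  rw [InnerProductSpace.toDual_symm_apply]
  have h5 := hφ ⟨z, z', hz⟩
  rw [show φ z = _ from h5]
  show _ = -(-inner ℂ x (g ⟨z, z', hz⟩))
  rw [neg_neg, (hg ⟨z, z', hz⟩).unique hz]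

/-! ### Commuting groups -/

/-- The difference `T_t - 1`. -/
def diff (G : UnitaryGroup F) (t : ℝ) : F →L[ℂ] F :=
  (G.T t).toContinuousLinearMap - ContinuousLinearMap.id ℂ F

@[simp]
lemma diff_apply (t : ℝ) (x : F) : G.diff t x = G.T t x - x := rfl

lemma inner_diff_left (t : ℝ) : inner ℂ (G.diff t x) y = inner ℂ x (G.diff (-t) y) := by
  simp only [diff_apply, inner_sub_left, inner_sub_right, inner_T_left]

/-- The groups `G` and `G'` commute. -/
def Commute (G G' : UnitaryGroup F) : Prop := ∀ s t x, G.T s (G'.T t x) = G'.T t (G.T s x)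

lemma Commute.diff {G G' : UnitaryGroup F} (h : G.Commute G') (s t : ℝ) (x : F) :
    G.diff s (G'.T t x) = G'.T t (G.diff s x) := by
  simp only [diff_apply, h s t x, map_sub]

lemma HasGen.norm_diff_le (h : G.HasGen x y) (t : ℝ) : ‖G.diff t x‖ ≤ |t| * ‖y‖ :=
  h.norm_sub_le t

lemma commute_self (G : UnitaryGroup F) : G.Commute G := fun s t x => by
  rw [G.add, G.add, add_comm]

lemma HasGen.diff {G G' : UnitaryGroup F} (h : G'.Commute G) (hx : G.HasGen x y) (t : ℝ) :
    G.HasGen (G'.diff t x) (G'.diff t y) :=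
  hx.map (G'.diff t) fun s z => h.diff t s z

/-- Square integrability of the pure second derivatives implies that of the mixed ones. -/
lemma exists_mixed {G G' : UnitaryGroup F} (hc : G.Commute G') {b d b' d' : F}
    (h1 : G.HasGen x b) (h2 : G.HasGen b d) (h1' : G'.HasGen x b') (h2' : G'.HasGen b' d') :
    ∃ y, G.HasGen b' y := by
  refine exists_hasGen_of_bounded (M := √(‖d‖ * ‖d'‖)) fun t => ?_
  have e1 : inner ℂ (G.diff t b') (G.diff t b') = -inner ℂ (G.diff t x) (G.diff t d') :=
    (h1'.diff hc t).inner_left (h2'.diff hc t)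
  have e2 : inner ℂ (G.diff t x) (G.diff t d') = inner ℂ (G.diff (-t) (G.diff t x)) d' := by
    have := inner_diff_left (G := G) (x := G.diff t x) (y := d') (-t)
    rw [neg_neg] at this
    exact this.symm
  have e3 : ‖G.diff (-t) (G.diff t x)‖ ≤ |t| * (|t| * ‖d‖) := by
    have := (h1.diff G.commute_self t).norm_diff_le (-t)
    rw [abs_neg] at this
    refine this.trans ?_
    gcongr
    exact h2.norm_diff_le t
  have e4 : ‖G.diff t b'‖ ^ 2 ≤ |t| * (|t| * ‖d‖) * ‖d'‖ := by
    rw [← norm_inner_self', e1, e2, norm_neg]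
    exact (norm_inner_le_norm _ _).trans (by gcongr)
  refine (sq_le_sq₀ (norm_nonneg _) (by positivity)).1 (e4.trans (le_of_eq ?_))
  rw [mul_pow, Real.sq_sqrt (by positivity)]
  ring

lemma exists_near_domain {ι : Type*} (G : ι → UnitaryGroup F)
    (hc : ∀ l m, (G l).Commute (G m)) (s : Finset ι) (x : F) {ε : ℝ} (hε : 0 < ε) :
    ∃ z, ‖z - x‖ < ε ∧ ∀ l ∈ s, ∃ y, (G l).HasGen z y := by
  classical
  induction s using Finset.induction_on generalizing ε with
  | empty => exact ⟨x, by simpa using hε, by simp⟩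
  | insert m s _ ih =>
    obtain ⟨z, hz, hz'⟩ := ih (half_pos hε)
    have h1 := hasDerivAt_iff_tendsto_slope_zero.1 (hasDerivAt_avg (G := G m) 0 z)
    simp only [zero_add, avg_zero, sub_zero, (G m).zero] at h1
    obtain ⟨t, ht⟩ := ((tendsto_iff_norm_sub_tendsto_zero.1 h1).eventually
      (gt_mem_nhds (half_pos hε))).exists
    refine ⟨t⁻¹ • (G m).avg t z, ?_, fun l hl => ?_⟩
    · calc ‖t⁻¹ • (G m).avg t z - x‖ ≤ ‖t⁻¹ • (G m).avg t z - z‖ + ‖z - x‖ :=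
          norm_sub_le_norm_sub_add_norm_sub _ _ _
        _ < ε := by linarith
    · have hs : ∀ w, t⁻¹ • w = ((t⁻¹ : ℝ) : ℂ) • w := fun w : F => (Complex.coe_smul _ _).symm
      rw [hs]
      rcases Finset.mem_insert.1 hl with rfl | hl
      · exact ⟨_, (hasGen_avg t z).smul _⟩
      · obtain ⟨y, hy⟩ := hz' l hl
        have h2 : (G l).HasGen ((G m).avg t z) ((G m).avg t y) := by
          refine hasGen_iff.2 fun r => ?_
          have hy' := hasGen_iff.1 hy r
          have e1 : ∀ w, (G l).T r ((G m).avg t w) = (G m).avg t ((G l).T r w) := fun w => by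
            have := ((G l).T r).toContinuousLinearMap.intervalIntegral_comp_comm
              (((G m).cont w).intervalIntegrable (μ := volume) (0 : ℝ) t)
            exact this.symm.trans (intervalIntegral.integral_congr fun s _ => hc l m r s w)
          have e2 : (G m).avg t ((G l).avg r y) = (G l).avg r ((G m).avg t y) := by
            let L : F →ₗ[ℂ] F :=
              { toFun := fun w => (G m).avg t w
                map_add' := fun a b => by
                  have := avg_sub (G := G m) t (a + b) b
                  rw [add_sub_cancel_right] at this
                  rw [this, sub_add_cancel]
                map_smul' := fun c a => by
                  simp only [avg, map_smul, intervalIntegral.integral_smul, RingHom.id_apply] }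
            have := (⟨L, continuous_avg t⟩ : F →L[ℂ] F).intervalIntegral_comp_comm
              (((G l).cont y).intervalIntegrable (μ := volume) (0 : ℝ) r)
            rw [avg, avg]
            refine this.symm.trans ?_
            refine intervalIntegral.integral_congr fun s _ => ?_
            have := ((G l).T s).toContinuousLinearMap.intervalIntegral_comp_comm
              (((G m).cont y).intervalIntegrable (μ := volume) (0 : ℝ) t)
            exact (intervalIntegral.integral_congr fun r _ => (hc l m s r y).symm).trans this
          rw [e1, ← avg_sub, hy', e2]
        exact ⟨_, h2.smul _⟩

end UnitaryGroup

end OneParameter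

/-! ### The resolvent of a sum of squares of commuting generators -/

section Resolvent

variable {F : Type*} [NormedAddCommGroup F] [InnerProductSpace ℂ F] [CompleteSpace F]
  {ι : Type*} [Fintype ι]

open UnitaryGroup

/-- The closed space of all `(a, b)` such that `b l` is the value at `R a` of the `l`-th
generator. -/
def gradSpace (G : ι → UnitaryGroup F) (R : F →L[ℂ] F) :
    Submodule ℂ (PiLp 2 fun _ : Option ι => F) where
  carrier := {p | ∀ l, (G l).HasGen (R (p none)) (p (some l))}
  zero_mem' := fun l => by
    show (G l).HasGen (R 0) 0
    rw [map_zero]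
    exact hasGen_zero
  add_mem' := fun {a b} ha hb l => by
    show (G l).HasGen (R (a none + b none)) (a (some l) + b (some l))
    rw [map_add]
    exact (ha l).add (hb l)
  smul_mem' := fun c a ha l => by
    show (G l).HasGen (R (c • a none)) (c • a (some l))
    rw [map_smul]
    exact (ha l).smul c

lemma isClosed_gradSpace (G : ι → UnitaryGroup F) (R : F →L[ℂ] F) :
    IsClosed (gradSpace G R : Set (PiLp 2 fun _ : Option ι => F)) := by
  have : (gradSpace G R : Set (PiLp 2 fun _ : Option ι => F)) =
      ⋂ l, {p | (G l).HasGen (R (p none)) (p (some l))} := by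
    ext p
    simp only [Set.mem_iInter]
    rfl
  rw [this]
  refine isClosed_iInter fun l => ?_
  have h : Continuous fun p : PiLp 2 fun _ : Option ι => F => (R (p none), p (some l)) := by
    have h1 (o : Option ι) : Continuous fun p : PiLp 2 fun _ : Option ι => F => p o :=
      PiLp.continuous_apply 2 _ o
    exact (R.continuous.comp (h1 _)).prodMk (h1 _)
  exact (isClosed_hasGen (G := G l)).preimage h

/-- The weak solution of `(R⁻² - ∑ₗ Gₗ²) R a = f`, by projection. -/
lemma exists_weak_solution (G : ι → UnitaryGroup F) (R : F →L[ℂ] F)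
    (hR : ∀ x y, inner ℂ (R x) y = inner ℂ x (R y)) (f : F) :
    ∃ (a : F) (b : ι → F), (∀ l, (G l).HasGen (R a) (b l)) ∧
      ∀ (a' : F) (b' : ι → F), (∀ l, (G l).HasGen (R a') (b' l)) →
        inner ℂ a a' + ∑ l, inner ℂ (b l) (b' l) = inner ℂ f (R a') := by
  classical
  have : CompleteSpace (gradSpace G R) := (isClosed_gradSpace G R).completeSpace_coe
  let f0 : PiLp 2 fun _ : Option ι => F := WithLp.toLp 2 fun o => Option.elim o (R f) fun _ => 0
  obtain ⟨p, hp, hp'⟩ : ∃ p ∈ gradSpace G R, ∀ w ∈ gradSpace G R, inner ℂ (f0 - p) w = 0 :=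
    ⟨(gradSpace G R).starProjection f0, (gradSpace G R).starProjection_apply_mem f0, fun w hw =>
      Submodule.starProjection_inner_eq_zero f0 w hw⟩
  refine ⟨p none, fun l => p (some l), hp, fun a' b' h => ?_⟩
  have h1 := hp' (WithLp.toLp 2 fun o => Option.elim o a' b') h
  rw [inner_sub_left, sub_eq_zero, PiLp.inner_apply, PiLp.inner_apply, Fintype.sum_option,
    Fintype.sum_option] at h1
  simp only [f0, Option.elim_none, Option.elim_some, inner_zero_left, Finset.sum_const_zero,
    add_zero] at h1
  rw [← h1, hR]

/-- Solvability of `(R⁻² - ∑ₗ Gₗ²) u = f` with `u = R a`: the weak solution has square integrable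
second derivatives, as the difference quotients of the equation show. -/
lemma exists_strong_solution (G : ι → UnitaryGroup F) (hc : ∀ l m, (G l).Commute (G m))
    (R : F →L[ℂ] F) (hR : ∀ x y, inner ℂ (R x) y = inner ℂ x (R y))
    (hRc : ∀ l t x, R ((G l).T t x) = (G l).T t (R x)) (f : F) :
    ∃ (a : F) (b d : ι → F), (∀ l, (G l).HasGen (R a) (b l)) ∧
      (∀ l, (G l).HasGen (b l) (d l)) ∧ a = R (f + ∑ l, d l) := by
  obtain ⟨a, b, hb, hw⟩ := exists_weak_solution G R hR f
  have key : ∀ l m, ∃ y, (G l).HasGen (b m) y := by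
    intro l m
    refine exists_hasGen_of_bounded (M := ‖f‖) fun t => ?_
    set B := (G l).diff t with hB
    set B' := (G l).diff (-t) with hB'
    have hRB : ∀ s x, R ((G l).diff s x) = (G l).diff s (R x) := fun s x => by
      simp only [diff_apply, map_sub, hRc]
    have h1 := hw (B' (B a)) (fun m => B' (B (b m))) fun m => by
      rw [hRB, hRB]
      exact ((hb m).diff (hc l m) t).diff (hc l m) (-t)
    have h2 : ∀ x, inner ℂ x (B' (B x)) = ((‖B x‖ ^ 2 : ℝ) : ℂ) := fun x => by
      rw [hB', ← inner_diff_left, inner_self_eq_norm_sq_to_K, Complex.ofReal_pow]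
      rfl
    simp only [h2] at h1
    have h3 : ‖B a‖ ^ 2 + ∑ m, ‖B (b m)‖ ^ 2 ≤ ‖f‖ * (|t| * ‖B (b l)‖) := by
      have h4 : ‖((‖B a‖ ^ 2 + ∑ m, ‖B (b m)‖ ^ 2 : ℝ) : ℂ)‖ =
          ‖B a‖ ^ 2 + ∑ m, ‖B (b m)‖ ^ 2 := by
        rw [Complex.norm_real, Real.norm_of_nonneg (by positivity)]
      rw [← h4]
      push_cast
      push_cast at h1
      rw [h1]
      refine (norm_inner_le_norm _ _).trans ?_
      gcongr
      rw [hB', ← abs_neg t, hRB, hB, hRB]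
      exact ((hb l).diff (hc l l) t).norm_diff_le (-t)
    have h5 : ∀ m, ‖B (b m)‖ ^ 2 ≤ ‖f‖ * (|t| * ‖B (b l)‖) := fun m => by
      have := Finset.single_le_sum (f := fun m => ‖B (b m)‖ ^ 2) (fun m _ => by positivity)
        (Finset.mem_univ m)
      have h6 : 0 ≤ ‖B a‖ ^ 2 := by positivity
      linarith
    have h7 : ‖B (b l)‖ ≤ ‖f‖ * |t| := by
      by_contra! hlt
      have h8 : 0 < ‖B (b l)‖ := lt_of_le_of_lt (by positivity) hlt
      nlinarith [h5 l]
    refine (sq_le_sq₀ (norm_nonneg _) (by positivity)).1 ((h5 m).trans ?_)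
    calc ‖f‖ * (|t| * ‖B (b l)‖) ≤ ‖f‖ * (|t| * (‖f‖ * |t|)) := by gcongr
      _ = (‖f‖ * |t|) ^ 2 := by ring
  choose d hd using fun l => key l l
  refine ⟨a, b, d, hb, hd, ?_⟩
  have h9 : ∀ z, (∀ l, ∃ y, (G l).HasGen z y) → inner ℂ (a - R (f + ∑ l, d l)) z = 0 := by
    intro z hz
    choose y hy using hz
    have hRz : ∀ l, (G l).HasGen (R z) (R (y l)) := fun l => (hy l).map R fun t x => hRc l t x
    have h1 := hw z (fun l => R (y l)) hRz
    have h2 : ∀ l, inner ℂ (b l) (R (y l)) = -inner ℂ (d l) (R z) := fun l => by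
      rw [(hd l).inner_left (hRz l), neg_neg]
    simp only [h2] at h1
    rw [inner_sub_left, hR, inner_add_left, sum_inner, ← h1]
    simp
  have h10 : ∀ z, inner ℂ (a - R (f + ∑ l, d l)) z = 0 := by
    intro z
    by_contra hne
    set q := a - R (f + ∑ l, d l)
    have hpos : 0 < ‖inner ℂ q z‖ := norm_pos_iff.2 hne
    obtain ⟨z', hz', hd'⟩ := exists_near_domain G hc Finset.univ z
      (ε := ‖inner ℂ q z‖ / (‖q‖ + 1)) (by positivity)
    have h11 := h9 z' fun l => hd' l (Finset.mem_univ l)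
    have h12 : ‖inner ℂ q z‖ ≤ ‖q‖ * ‖z' - z‖ := by
      have : inner ℂ q (z' - z) = -inner ℂ q z := by rw [inner_sub_right, h11, zero_sub]
      rw [← norm_neg, ← this]
      exact norm_inner_le_norm _ _
    have h13 : ‖z' - z‖ * (‖q‖ + 1) < ‖inner ℂ q z‖ := (lt_div_iff₀ (by positivity)).1 hz'
    nlinarith [norm_nonneg (z' - z)]
  exact sub_eq_zero.1 (inner_self_eq_zero.1 (h10 _))

end Resolvent

/-! ### The continuity method and a criterion for self-adjointness -/

section Criterion

variable {F : Type*} [NormedAddCommGroup F] [InnerProductSpace ℂ F] [CompleteSpace F]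

lemma surjective_one_add (B : F →L[ℂ] F) (h : ‖B‖ < 1) (f : F) : ∃ g, g + B g = f := by
  have hu := (Units.oneSub (-B) (by rwa [norm_neg])).isUnit
  obtain ⟨u, hu'⟩ := hu
  refine ⟨(↑u⁻¹ : F →L[ℂ] F) f, ?_⟩
  have h1 : ((u : F →L[ℂ] F) * (↑u⁻¹ : F →L[ℂ] F)) f = f := by rw [Units.mul_inv]; rfl
  rw [hu'] at h1
  simpa using h1

variable {D : Type*} [AddCommGroup D] [Module ℂ D]

lemma surjective_step (A B : D →ₗ[ℂ] F) (C δ : ℝ) (hC : 0 ≤ C) (hδ : |δ| * C < 1)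
    (h : ∀ u, ‖B u‖ ≤ C * ‖A u‖) (hA : Function.Surjective A) :
    Function.Surjective (A + (δ : ℂ) • B) := by
  obtain ⟨r, hr⟩ := A.exists_rightInverse_of_surjective (LinearMap.range_eq_top.2 hA)
  have hr' : ∀ f, A (r f) = f := fun f => LinearMap.congr_fun hr f
  let S : F →L[ℂ] F := LinearMap.mkContinuous (((δ : ℂ) • B) ∘ₗ r) (|δ| * C) fun f => by
    simp only [LinearMap.comp_apply, LinearMap.smul_apply, norm_smul, Complex.norm_real,
      Real.norm_eq_abs, mul_assoc]
    gcongr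
    exact (h _).trans_eq (by rw [hr'])
  intro f
  obtain ⟨g, hg⟩ := surjective_one_add S
    ((LinearMap.mkContinuous_norm_le _ (by positivity) _).trans_lt hδ) f
  exact ⟨r g, by rw [LinearMap.add_apply, hr']; exact hg⟩

/-- The continuity method. -/
lemma surjective_of_path (A B : D →ₗ[ℂ] F) (C : ℝ)
    (h : ∀ t : ℝ, 0 ≤ t → t ≤ 1 → ∀ u, ‖B u‖ ≤ C * ‖(A + (t : ℂ) • B) u‖)
    (hA : Function.Surjective A) : Function.Surjective (A + B) := by
  obtain ⟨n, hn⟩ := exists_nat_gt (max C 0)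
  have hn0 : (0 : ℝ) < n := (le_max_right _ _).trans_lt hn
  have key : ∀ k : ℕ, k ≤ n → Function.Surjective (A + (((k : ℝ) / n : ℝ) : ℂ) • B) := by
    intro k
    induction k with
    | zero => intro _; simpa using hA
    | succ k ih =>
      intro hk
      have h1 := surjective_step (A + (((k : ℝ) / n : ℝ) : ℂ) • B) B (max C 0) ((n : ℝ)⁻¹)
        (le_max_right _ _) (by
          rw [abs_of_pos (by positivity), inv_mul_lt_iff₀ hn0, mul_one]
          exact hn) (fun u => (h ((k : ℝ) / n) (by positivity) ((div_le_one hn0).2 (by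
            exact_mod_cast (Nat.le_succ k).trans hk)) u).trans
              (mul_le_mul_of_nonneg_right (le_max_left _ _) (norm_nonneg _)))
        (ih ((Nat.le_succ k).trans hk))
      have e : A + (((k : ℝ) / n : ℝ) : ℂ) • B + (((n : ℝ)⁻¹ : ℝ) : ℂ) • B =
          A + ((((k + 1 : ℕ) : ℝ) / n : ℝ) : ℂ) • B := by
        rw [add_assoc, ← add_smul, ← Complex.ofReal_add]
        congr 3
        push_cast
        field_simp
      rwa [e] at h1
  have := key n le_rfl
  rw [div_self hn0.ne'] at this
  simpa using this

lemma sq_norm_add_I_smul {x y : F} (h : (inner ℂ x y).im = 0) (μ : ℝ) :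
    ‖x + (μ * Complex.I : ℂ) • y‖ ^ 2 = ‖x‖ ^ 2 + μ ^ 2 * ‖y‖ ^ 2 := by
  have h1 := norm_add_sq (𝕜 := ℂ) x ((μ * Complex.I : ℂ) • y)
  rw [h1, inner_smul_right, norm_smul]
  have h2 : RCLike.re ((μ * Complex.I : ℂ) * inner ℂ x y) = 0 := by
    show ((μ * Complex.I : ℂ) * inner ℂ x y).re = 0
    simp [h]
  rw [h2]
  simp [mul_pow]

lemma inner_im_eq_zero_of_symm {x y : F} (h : inner ℂ x y = inner ℂ y x) :
    (inner ℂ x y).im = 0 := by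
  have h1 := inner_conj_symm (𝕜 := ℂ) x y
  rw [← h] at h1
  have := congrArg Complex.im h1
  simp only [Complex.conj_im] at this
  linarith

/-- A symmetric operator `A` such that `A + iμ` and `A - iμ` are onto is self-adjoint. -/
lemma isSelfAdjoint_of_surjective (A : F →ₗ.[ℂ] F)
    (hsym : ∀ x y : A.domain, inner ℂ (A x) (y : F) = inner ℂ (x : F) (A y)) (μ : ℝ) (hμ : μ ≠ 0)
    (hp : ∀ f, ∃ x : A.domain, A x + (μ * Complex.I : ℂ) • (x : F) = f)
    (hm : ∀ f, ∃ x : A.domain, A x - (μ * Complex.I : ℂ) • (x : F) = f) :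
    IsSelfAdjoint A := by
  have hz : (μ * Complex.I : ℂ) ≠ 0 := mul_ne_zero (by exact_mod_cast hμ) Complex.I_ne_zero
  have hdense : Dense (A.domain : Set F) := by
    rw [Submodule.dense_iff_topologicalClosure_eq_top, Submodule.topologicalClosure_eq_top_iff,
      Submodule.eq_bot_iff]
    intro z hz'
    obtain ⟨x, hx⟩ := hp z
    have h1 : inner ℂ (x : F) z = 0 := (Submodule.mem_orthogonal _ _).1 hz' x x.2
    rw [← hx, inner_add_right, inner_smul_right] at h1
    have h2 : (inner ℂ (x : F) (A x)).im = 0 := inner_im_eq_zero_of_symm (hsym x x).symm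
    have h3 := congrArg Complex.im h1
    rw [Complex.add_im, h2, inner_self_eq_norm_sq_to_K] at h3
    have h4 : ((μ * Complex.I : ℂ) * ((‖(x : F)‖ : ℝ) : ℂ) ^ 2).im = μ * ‖(x : F)‖ ^ 2 := by
      rw [← Complex.ofReal_pow, mul_assoc, mul_comm Complex.I, ← mul_assoc, ← Complex.ofReal_mul,
        Complex.mul_I_im, Complex.ofReal_re]
    have h5 : μ * ‖(x : F)‖ ^ 2 = 0 := by
      rw [← h4]
      simpa using h3
    have h6 : (x : F) = 0 := by
      rcases mul_eq_zero.1 h5 with h | h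
      · exact absurd h hμ
      · exact norm_eq_zero.1 (pow_eq_zero_iff two_ne_zero |>.1 h)
    have h7 : x = 0 := Subtype.ext h6
    rw [← hx, h7]
    simp
  have hle : A ≤ A.adjoint := LinearPMap.IsFormalAdjoint.le_adjoint hdense fun x y => hsym x y
  have hge : A.adjoint.domain ≤ A.domain := by
    intro y hy
    obtain ⟨x, hx⟩ := hp (A.adjoint ⟨y, hy⟩ + (μ * Complex.I : ℂ) • y)
    obtain ⟨w, hw⟩ := hm (y - x)
    have h1 := LinearPMap.adjoint_isFormalAdjoint hdense ⟨y, hy⟩ w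
    have h2 : inner ℂ (y - x) (y - x) = 0 := by
      nth_rewrite 2 [← hw]
      rw [inner_sub_left, inner_sub_right, inner_sub_right, inner_smul_right, inner_smul_right,
        ← hsym, ← h1]
      have h3 : A.adjoint ⟨y, hy⟩ = A x + (μ * Complex.I : ℂ) • (x : F) - (μ * Complex.I : ℂ) • y := by
        rw [hx, add_sub_cancel_right]
      rw [h3, inner_sub_left, inner_add_left, inner_smul_left, inner_smul_left]
      simp only [map_mul, Complex.conj_ofReal, Complex.conj_I]
      ring
    rw [sub_eq_zero.1 (inner_self_eq_zero.1 h2)]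
    exact x.2
  exact (LinearPMap.eq_of_le_of_domain_eq hle (le_antisymm hle.1 hge)).symm

end Criterion

/-! ### Bounded multiplication operators -/

section Multiplication

variable {α : Type*} [MeasurableSpace α] {μ : Measure α}

/-- Bounded measurable functions. -/
def IsBddMul (m : α → ℂ) (μ : Measure α) : Prop := AEStronglyMeasurable m μ ∧ ∃ C, ∀ x, ‖m x‖ ≤ C

lemma IsBddMul.memLp_mul {m : α → ℂ} (hm : IsBddMul m μ) (u : Lp ℂ 2 μ) :
    MemLp (fun x => m x * u x) 2 μ := by
  obtain ⟨hm, C, hC⟩ := hm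
  refine (Lp.memLp u).of_le_mul (c := C) (hm.mul (Lp.aestronglyMeasurable u))
    (ae_of_all _ fun x => ?_)
  rw [norm_mul]
  gcongr
  exact hC x

lemma norm_toLp_mul_le {m : α → ℂ} (hm : IsBddMul m μ) {C : ℝ} (hC : ∀ x, ‖m x‖ ≤ C)
    (u : Lp ℂ 2 μ) : ‖(hm.memLp_mul u).toLp _‖ ≤ C * ‖u‖ := by
  refine Lp.norm_le_mul_norm_of_ae_le_mul ?_
  filter_upwards [(hm.memLp_mul u).coeFn_toLp] with x hx
  rw [hx, norm_mul]
  gcongr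
  exact hC x

/-- Multiplication by a bounded measurable function on `L²`. -/
def mulLp (m : α → ℂ) (hm : IsBddMul m μ) : Lp ℂ 2 μ →L[ℂ] Lp ℂ 2 μ :=
  LinearMap.mkContinuous
    { toFun := fun u => (hm.memLp_mul u).toLp _
      map_add' := fun u v => by
        refine Lp.ext ?_
        filter_upwards [(hm.memLp_mul (u + v)).coeFn_toLp, (hm.memLp_mul u).coeFn_toLp,
          (hm.memLp_mul v).coeFn_toLp, Lp.coeFn_add u v, Lp.coeFn_add
            ((hm.memLp_mul u).toLp _) ((hm.memLp_mul v).toLp _)] with x h1 h2 h3 h4 h5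
        rw [h1, h5, Pi.add_apply, h2, h3, h4, Pi.add_apply, mul_add]
      map_smul' := fun c u => by
        refine Lp.ext ?_
        filter_upwards [(hm.memLp_mul (c • u)).coeFn_toLp, (hm.memLp_mul u).coeFn_toLp,
          Lp.coeFn_smul c u, Lp.coeFn_smul c ((hm.memLp_mul u).toLp _)] with x h1 h2 h4 h5
        rw [h1, RingHom.id_apply, h5, Pi.smul_apply, h2, h4, Pi.smul_apply, smul_eq_mul,
          smul_eq_mul, mul_left_comm] }
    hm.2.choose fun u => norm_toLp_mul_le hm hm.2.choose_spec u

lemma mulLp_ae {m : α → ℂ} (hm : IsBddMul m μ) (u : Lp ℂ 2 μ) :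
    mulLp m hm u =ᵐ[μ] fun x => m x * u x := (hm.memLp_mul u).coeFn_toLp

lemma norm_mulLp_le {m : α → ℂ} (hm : IsBddMul m μ) {C : ℝ} (hC : ∀ x, ‖m x‖ ≤ C)
    (u : Lp ℂ 2 μ) : ‖mulLp m hm u‖ ≤ C * ‖u‖ := norm_toLp_mul_le hm hC u

attribute [irreducible] mulLp

end Multiplication

section FullOperators

variable {N : ℕ}
variable {m : (Fin N → E) → ℂ} {Ψ : Fk N} {n : ℕ} {c : ℕ → ℂ}

lemma IsBddMul.comp_fst (hm : IsBddMul m volume) (n : ℕ) :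
    IsBddMul (fun p : Conf N n => m p.1) volume :=
  ⟨hm.1.comp_fst, hm.2.choose, fun p => hm.2.choose_spec p.1⟩

/-- Multiplication by a bounded function of the particle positions, in one sector. -/
def mulS (m : (Fin N → E) → ℂ) (hm : IsBddMul m volume) (n : ℕ) : L2 N n →L[ℂ] L2 N n :=
  mulLp (fun p : Conf N n => m p.1) (hm.comp_fst n)

lemma norm_mulS_le (hm : IsBddMul m volume) {C : ℝ}
    (hC : ∀ x, ‖m x‖ ≤ C) (n : ℕ) (u : L2 N n) : ‖mulS m hm n u‖ ≤ C * ‖u‖ :=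
  norm_mulLp_le (hm.comp_fst n) (fun p => hC p.1) u

lemma mulS_ae (hm : IsBddMul m volume) (n : ℕ) (u : L2 N n) :
    mulS m hm n u =ᵐ[volume] fun p => m p.1 * u p := mulLp_ae (hm.comp_fst n) u

attribute [irreducible] mulS

/-- Multiplication by a bounded function of the particle positions. -/
def mulB (m : (Fin N → E) → ℂ) (hm : IsBddMul m volume) : Fk N →L[ℂ] Fk N :=
  diagOp (mulS m hm) hm.2.choose (norm_mulS_le hm hm.2.choose_spec)

lemma sec_mulB (hm : IsBddMul m volume) (n : ℕ) (Ψ : Fk N) :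
    sec n (mulB m hm Ψ) = mulS m hm n (sec n Ψ) := sec_diagOp _ _ _ _ _

lemma norm_mulB_le (hm : IsBddMul m volume) {C : ℝ} (hC : ∀ x, ‖m x‖ ≤ C)
    (Ψ : Fk N) : ‖mulB m hm Ψ‖ ≤ C * ‖Ψ‖ := by
  refine norm_le_of_sec_le ((norm_nonneg _).trans (hC 0)) fun n => ?_
  rw [sec_mulB]
  exact norm_mulS_le hm hC n _

lemma sec_mulB_ae (hm : IsBddMul m volume) (n : ℕ) (Ψ : Fk N) :
    sec n (mulB m hm Ψ) =ᵐ[volume] fun p => m p.1 * sec n Ψ p := by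
  rw [sec_mulB]
  exact mulS_ae hm n _

lemma inner_mulB_left {m' : (Fin N → E) → ℂ} (hm : IsBddMul m volume)
    (hm' : IsBddMul m' volume) (h : ∀ x, m' x = conj (m x)) (Ψ χ : Fk N) :
    inner ℂ (mulB m hm Ψ) χ = inner ℂ Ψ (mulB m' hm' χ) := by
  have h1 := hasSum_inner_sec (mulB m hm Ψ) χ
  have h2 := hasSum_inner_sec Ψ (mulB m' hm' χ)
  refine h1.unique (h2.congr_fun fun n => ?_)
  rw [L2.inner_def, L2.inner_def]
  refine integral_congr_ae ?_
  filter_upwards [sec_mulB_ae hm n Ψ, sec_mulB_ae hm' n χ] with p hp hq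
  rw [hp, hq, h]
  simp only [RCLike.inner_apply, map_mul]
  ring

attribute [irreducible] mulB

lemma norm_isometry_le (T : ∀ n, L2 N n →ₗᵢ[ℂ] L2 N n) (n : ℕ) (u : L2 N n) :
    ‖(T n).toContinuousLinearMap u‖ ≤ 1 * ‖u‖ := by
  rw [one_mul]
  exact ((T n).norm_map u).le

/-- The isometry acting in each phonon sector by `T n`. -/
def diagIso (T : ∀ n, L2 N n →ₗᵢ[ℂ] L2 N n) : Fk N →ₗᵢ[ℂ] Fk N where
  toLinearMap :=
    (diagOp (fun n => (T n).toContinuousLinearMap) 1 (norm_isometry_le T)).toLinearMap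
  norm_map' := fun Ψ => by
    refine (sq_eq_sq₀ (norm_nonneg _) (norm_nonneg _)).1 ?_
    refine (hasSum_sq_norm_sec _).unique ((hasSum_sq_norm_sec Ψ).congr_fun fun n => ?_)
    have : sec n (diagOp (fun n => (T n).toContinuousLinearMap) 1 (norm_isometry_le T) Ψ) =
        T n (sec n Ψ) := sec_diagOp _ _ _ _ _
    exact congrArg (fun x => ‖x‖ ^ 2) this |>.trans (by simp)

lemma sec_diagIso (T : ∀ n, L2 N n →ₗᵢ[ℂ] L2 N n) (n : ℕ) (Ψ : Fk N) :
    sec n (diagIso T Ψ) = T n (sec n Ψ) := sec_diagOp _ _ (norm_isometry_le T) _ _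

attribute [irreducible] diagIso

lemma numFun_diagIso (T : ∀ n, L2 N n →ₗᵢ[ℂ] L2 N n)
    (h : Ψ ∈ numDom N c) :
    diagIso T Ψ ∈ numDom N c ∧ numFun c (diagIso T Ψ) = diagIso T (numFun c Ψ) := by
  have h1 : ∀ n, sec n (diagIso T (numFun c Ψ)) = c n • sec n (diagIso T Ψ) := fun n => by
    rw [sec_diagIso, sec_numFun h, map_smul, sec_diagIso]
  exact ⟨mem_numDom_of_sec h1, (eq_numFun_of_sec h1).symm⟩

/-- Translation of the particles by `w`. -/
def trans (w : Fin N → E) : Fk N →ₗᵢ[ℂ] Fk N := diagIso fun _ => transS w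

/-- Permutation of the particles. -/
def permP (σ : Equiv.Perm (Fin N)) : Fk N →ₗᵢ[ℂ] Fk N := diagIso fun _ => permS σ 1

/-- Permutation of the phonons, by `τ n` in the sector with `n` phonons. -/
def permT (τ : ∀ n, Equiv.Perm (Fin n)) : Fk N →ₗᵢ[ℂ] Fk N := diagIso fun n => permS 1 (τ n)

lemma sec_trans (w : Fin N → E) (n : ℕ) (Ψ : Fk N) : sec n (trans w Ψ) = transS w (sec n Ψ) :=
  sec_diagIso _ _ _

lemma sec_permP (σ : Equiv.Perm (Fin N)) (n : ℕ) (Ψ : Fk N) :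
    sec n (permP σ Ψ) = permS σ 1 (sec n Ψ) := sec_diagIso _ _ _

lemma sec_permT (τ : ∀ n, Equiv.Perm (Fin n)) (n : ℕ) (Ψ : Fk N) :
    sec n (permT τ Ψ) = permS 1 (τ n) (sec n Ψ) := sec_diagIso _ _ _

lemma numFun_permP (σ : Equiv.Perm (Fin N)) (h : Ψ ∈ numDom N c) :
    permP σ Ψ ∈ numDom N c ∧ numFun c (permP σ Ψ) = permP σ (numFun c Ψ) := numFun_diagIso _ h

lemma numFun_permT (τ : ∀ n, Equiv.Perm (Fin n))
    (h : Ψ ∈ numDom N c) :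
    permT τ Ψ ∈ numDom N c ∧ numFun c (permT τ Ψ) = permT τ (numFun c Ψ) := numFun_diagIso _ h

attribute [irreducible] trans permP permT

lemma trans_trans (w w' : Fin N → E) (Ψ : Fk N) : trans w (trans w' Ψ) = trans (w + w') Ψ :=
  sec_ext fun n => by simp only [sec_trans, transS_transS]

lemma trans_zero (Ψ : Fk N) : trans 0 Ψ = Ψ :=
  sec_ext fun n => by simp only [sec_trans, transS_zero]

lemma permP_trans (σ : Equiv.Perm (Fin N)) (w : Fin N → E) (Ψ : Fk N) :
    permP σ (trans (fun j => w (σ j)) Ψ) = trans w (permP σ Ψ) :=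
  sec_ext fun n => by simp only [sec_trans, sec_permP, permS_transS]

lemma permT_trans (τ : ∀ n, Equiv.Perm (Fin n)) (w : Fin N → E) (Ψ : Fk N) :
    permT τ (trans w Ψ) = trans w (permT τ Ψ) :=
  sec_ext fun n => by
    have := permS_transS 1 (τ n) w (sec n Ψ)
    simp only [sec_trans, sec_permT]
    exact this

lemma mem_phSym_iff : Ψ ∈ phSym N ↔ ∀ τ, permT τ Ψ = Ψ := by
  constructor
  · intro h τ
    exact sec_ext fun n => by rw [sec_permT, mem_phSym.1 h n]
  · intro h
    refine mem_phSym.2 fun n τ => ?_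
    have h1 := congrArg (sec n) (h (Function.update (fun n => (1 : Equiv.Perm (Fin n))) n τ))
    rwa [sec_permT, Function.update_self] at h1

lemma permP_mem_phSym (h : Ψ ∈ phSym N) (σ : Equiv.Perm (Fin N)) :
    permP σ Ψ ∈ phSym N := by
  refine mem_phSym.2 fun n τ => ?_
  rw [sec_permP, permS_permS, one_mul, mul_one]
  conv_rhs => rw [← mem_phSym.1 h n τ]
  rw [permS_permS, one_mul, mul_one]

lemma mulB_mem_phSym (hm : IsBddMul m volume)
    (h : Ψ ∈ phSym N) : mulB m hm Ψ ∈ phSym N := by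
  refine mem_phSym.2 fun n τ => Lp.ext ?_
  filter_upwards [permS_ae 1 τ (sec n (mulB m hm Ψ)),
    (measurePreserving_permConf 1 τ).quasiMeasurePreserving.ae (sec_mulB_ae hm n Ψ),
    sec_mulB_ae hm n Ψ, permS_ae 1 τ (sec n Ψ),
    EventuallyEq.of_eq (congrArg (fun u : L2 N n => (u : Conf N n → ℂ))
      (mem_phSym.1 h n τ))] with p h1 h2 h3 h4 h5
  rw [h1, h2, h3, ← h4, h5]
  rfl

lemma permP_mulB {m' : (Fin N → E) → ℂ} (hm : IsBddMul m volume) (hm' : IsBddMul m' volume)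
    (σ : Equiv.Perm (Fin N)) (h : ∀ x, m (fun j => x (σ j)) = m' x) (Ψ : Fk N) :
    permP σ (mulB m hm Ψ) = mulB m' hm' (permP σ Ψ) := by
  refine sec_ext fun n => Lp.ext ?_
  rw [sec_permP]
  filter_upwards [permS_ae σ 1 (sec n (mulB m hm Ψ)),
    (measurePreserving_permConf σ 1).quasiMeasurePreserving.ae (sec_mulB_ae hm n Ψ),
    sec_mulB_ae hm' n (permP σ Ψ), (permS_ae σ 1 (sec n Ψ))] with p h1 h2 h3 h4
  rw [h1, h2, h3, sec_permP, h4, ← h]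
  rfl

/-- Bosonic vectors. -/
lemma toFull_mem_bosonic_iff :
    toFull N Ψ ∈ bosonic N ↔ Ψ ∈ phSym N ∧ ∀ σ, permP σ Ψ = Ψ := by
  have h1 : toFull N Ψ ∈ bosonic N ↔ ∀ n σ τ, permS σ τ (sec n Ψ) = sec n Ψ := by
    show IsBosonic _ ↔ _
    simp only [IsBosonic, sector_toFull]
    refine forall_congr' fun n => forall_congr' fun σ => forall_congr' fun τ => ?_
    exact ⟨fun h => Lp.ext ((permS_ae σ τ _).trans h), fun h => (permS_ae σ τ _).symm.trans
      (EventuallyEq.of_eq (congrArg (fun u : L2 N n => (u : Conf N n → ℂ)) h))⟩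
  rw [h1]
  constructor
  · exact fun h => ⟨mem_phSym.2 fun n τ => h n 1 τ, fun σ => sec_ext fun n => by
      rw [sec_permP, h n σ 1]⟩
  · rintro ⟨h, h'⟩ n σ τ
    have h2 := congrArg (sec n) (h' σ)
    rw [sec_permP] at h2
    rw [← mul_one σ, ← one_mul τ, ← permS_permS, mem_phSym.1 h n τ, h2]

lemma continuous_trans (Ψ : Fk N) : Continuous fun w : Fin N → E => trans w Ψ := by
  refine continuous_iff_continuousAt.2 fun w0 => ?_
  refine tendsto_iff_norm_sub_tendsto_zero.2 ?_
  have h1 : ∀ w, ‖trans w Ψ - trans w0 Ψ‖ ^ 2 =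
      ∑' n, ‖transS w (sec n Ψ) - transS w0 (sec n Ψ)‖ ^ 2 := fun w => by
    rw [← (hasSum_sq_norm_sec _).tsum_eq]
    simp only [sec_sub, sec_trans]
  have h2 : Tendsto (fun w => ∑' n, ‖transS w (sec n Ψ) - transS w0 (sec n Ψ)‖ ^ 2) (𝓝 w0)
      (𝓝 (∑' n : ℕ, (0 : ℝ))) := by
    refine tendsto_tsum_of_dominated_convergence (bound := fun n => 4 * ‖sec n Ψ‖ ^ 2)
      ((hasSum_sq_norm_sec Ψ).summable.mul_left 4) (fun n => ?_)
        (Eventually.of_forall fun w n => ?_)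
    · have h3 := tendsto_iff_norm_sub_tendsto_zero.1 ((continuous_transS (sec n Ψ)).tendsto w0)
      simpa using h3.pow 2
    · rw [Real.norm_of_nonneg (by positivity)]
      have h4 := norm_sub_le (transS w (sec n Ψ)) (transS w0 (sec n Ψ))
      rw [LinearIsometry.norm_map, LinearIsometry.norm_map] at h4
      nlinarith [norm_nonneg (transS w (sec n Ψ) - transS w0 (sec n Ψ))]
  simp only [tsum_zero, ← h1] at h2
  simpa [Real.sqrt_sq (norm_nonneg _)] using h2.sqrt

/-- The group of translations of the particles in the direction `w`. -/
def transGroup (w : Fin N → E) : UnitaryGroup (Fk N) where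
  T := fun t => trans (t • w)
  zero := fun Ψ => by rw [zero_smul, trans_zero]
  add := fun s t Ψ => by rw [trans_trans, add_smul]
  cont := fun Ψ => (continuous_trans Ψ).comp (continuous_id.smul continuous_const)

lemma transGroup_T (w : Fin N → E) (t : ℝ) : (transGroup w).T t = trans (t • w) := rfl

lemma transGroup_commute (w w' : Fin N → E) : (transGroup w).Commute (transGroup w') :=
  fun s t Ψ => by rw [transGroup_T, transGroup_T, trans_trans, trans_trans, add_comm]

/-! ### Covariance of the phonon operators under translations and permutations -/

lemma isBddMul_phase (z : E) :
    IsBddMul (fun k : E => Complex.exp (-Complex.I * (inner ℝ k z : ℝ))) volume :=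
  ⟨Continuous.aestronglyMeasurable (by fun_prop), 1, fun k => by simp [Complex.norm_exp]⟩

/-- Multiplication of a form factor by `e^{-ikz}`. -/
def modF (z : E) : Form →L[ℂ] Form := mulLp _ (isBddMul_phase z)

lemma modF_ae (z : E) (g : Form) :
    modF z g =ᵐ[volume] fun k => Complex.exp (-Complex.I * (inner ℝ k z : ℝ)) * g k := mulLp_ae _ _

lemma formFactor_modF_ae (z : E) (g : Form) :
    ∀ᵐ k, ∀ x, formFactor (modF z g) x k = formFactor g (x + z) k := by
  filter_upwards [modF_ae z g] with k hk x
  simp only [formFactor]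
  rw [hk, inner_add_right, mul_right_comm, ← Complex.exp_add, mul_comm (g k)]
  congr 2
  push_cast
  ring

lemma transS_removeS (w : Fin N → E) (g : Form) (j : Fin N) (v : L2 N (n + 1)) :
    transS w (removeS g j n v) = removeS (modF (w j) g) j n (transS w v) := by
  refine Lp.ext ?_
  filter_upwards [transS_ae w (removeS g j n v),
    (measurePreserving_shift w).quasiMeasurePreserving.ae (removeS_form_ae g j v),
    removeS_form_ae (modF (w j) g) j (transS w v), ae_ae_cons (transS_ae w v)] with p h1 h2 h3 h4
  rw [h1, h2, h3]
  refine integral_congr_ae ?_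
  filter_upwards [formFactor_modF_ae (w j) g, h4] with k h5 h6
  rw [h5, h6]
  rfl

lemma transS_insertS (w : Fin N → E) (g : Form) (j : Fin N) (u : L2 N n) :
    transS w (insertS g j n u) = insertS (modF (w j) g) j n (transS w u) := by
  refine Lp.ext ?_
  have hq : ∀ᵐ p : Conf N (n + 1), ∀ x, formFactor (modF (w j) g) x (p.2 0) =
      formFactor g (x + w j) (p.2 0) :=
    ((Measure.quasiMeasurePreserving_snd (μ := (volume : Measure (Conf N n)))).comp
      measurePreserving_uncons.quasiMeasurePreserving).ae (formFactor_modF_ae (w j) g)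
  filter_upwards [transS_ae w (insertS g j n u),
    (measurePreserving_shift w).quasiMeasurePreserving.ae (insertS_ae g j u),
    insertS_ae (modF (w j) g) j (transS w u), insertFun_congr (ae_eq_refl (modF (w j) g)) j
      (transS_ae w u), hq] with p h1 h2 h3 h4 h5
  rw [h1, h2, h3, h4]
  simp only [insertFun]
  rw [h5]
  rfl

lemma transS_symInsertS (w : Fin N → E) (g : Form) (j : Fin N) (u : L2 N n) :
    transS w (symInsertS g j n u) = symInsertS (modF (w j) g) j n (transS w u) := by
  rw [symInsertS_apply, symInsertS_apply, map_smul, map_sum, ← transS_insertS]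
  congr 1
  exact Finset.sum_congr rfl fun i _ => (permS_transS 1 (cyc i) w _).symm

lemma permS_removeS' (σ : Equiv.Perm (Fin N)) (g : Form) (j : Fin N)
    (v : L2 N (n + 1)) : permS σ 1 (removeS g j n v) = removeS g (σ j) n (permS σ 1 v) := by
  refine Lp.ext ?_
  filter_upwards [permS_ae σ 1 (removeS g j n v),
    (measurePreserving_permConf σ 1).quasiMeasurePreserving.ae (removeS_form_ae g j v),
    removeS_form_ae g (σ j) (permS σ 1 v), ae_ae_cons (permS_ae σ 1 v)] with p h1 h2 h3 h4
  rw [h1, h2, h3]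
  refine integral_congr_ae ?_
  filter_upwards [h4] with k h6
  rw [h6]
  rfl

lemma permS_insertS' (σ : Equiv.Perm (Fin N)) (g : Form) (j : Fin N) (u : L2 N n) :
    permS σ 1 (insertS g j n u) = insertS g (σ j) n (permS σ 1 u) := by
  refine Lp.ext ?_
  filter_upwards [permS_ae σ 1 (insertS g j n u),
    (measurePreserving_permConf σ 1).quasiMeasurePreserving.ae (insertS_ae g j u),
    insertS_ae g (σ j) (permS σ 1 u), insertFun_congr (ae_eq_refl g) (σ j)
      (permS_ae σ 1 u)] with p h1 h2 h3 h4
  rw [h1, h2, h3, h4]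
  rfl

lemma permS_symInsertS (σ : Equiv.Perm (Fin N)) (g : Form) (j : Fin N) (u : L2 N n) :
    permS σ 1 (symInsertS g j n u) = symInsertS g (σ j) n (permS σ 1 u) := by
  rw [symInsertS_apply, symInsertS_apply, map_smul, map_sum, ← permS_insertS']
  congr 1
  refine Finset.sum_congr rfl fun i _ => ?_
  rw [permS_permS, permS_permS, one_mul, mul_one, mul_one, one_mul]

lemma trans_alpha (w : Fin N → E) (g : Form) (j : Fin N) (Ψ : Fk N) :
    trans w (alpha g j Ψ) = alpha (modF (w j) g) j (trans w Ψ) :=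
  sec_ext fun n => by simp only [sec_trans, sec_alpha, transS_removeS]

lemma trans_alphaD (w : Fin N → E) (g : Form) (j : Fin N) (Ψ : Fk N) :
    trans w (alphaD g j Ψ) = alphaD (modF (w j) g) j (trans w Ψ) :=
  sec_ext fun n => by
    cases n with
    | zero => simp only [sec_trans, sec_zero_alphaD, map_zero]
    | succ n => simp only [sec_trans, sec_succ_alphaD, transS_symInsertS]

lemma permP_alpha (σ : Equiv.Perm (Fin N)) (g : Form) (j : Fin N) (Ψ : Fk N) :
    permP σ (alpha g j Ψ) = alpha g (σ j) (permP σ Ψ) :=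
  sec_ext fun n => by simp only [sec_permP, sec_alpha, permS_removeS']

lemma permP_alphaD (σ : Equiv.Perm (Fin N)) (g : Form) (j : Fin N) (Ψ : Fk N) :
    permP σ (alphaD g j Ψ) = alphaD g (σ j) (permP σ Ψ) :=
  sec_ext fun n => by
    cases n with
    | zero => simp only [sec_permP, sec_zero_alphaD, map_zero]
    | succ n => simp only [sec_permP, sec_succ_alphaD, permS_symInsertS]

end FullOperators

/-! ### Weak derivatives as generators of translations -/

section Gradient

variable {N : ℕ}
variable {n : ℕ} {j l : Fin N} {i : Fin 3} {Ψ χ : Fk N} {g q : Form}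

/-- The direction of the `i`-th coordinate of the `j`-th particle. -/
def eDir (j : Fin N) (i : Fin 3) : Fin N → E := Pi.single j (EuclideanSpace.single i (1 : ℝ))

lemma dir_eq (n : ℕ) (j : Fin N) (i : Fin 3) : (dir n j i : Conf N n) = (eDir j i, 0) := rfl

/-- The group of translations of the `j`-th particle in the `i`-th direction, with generator
`∂_{j,i}`. -/
def grad (j : Fin N) (i : Fin 3) : UnitaryGroup (Fk N) := transGroup (eDir j i)

lemma grad_commute (j l : Fin N) (i m : Fin 3) : (grad j i).Commute (grad l m) :=
  transGroup_commute _ _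

lemma memLp_test {φ : Conf N n → ℝ} (h1 : Continuous φ) (h2 : HasCompactSupport φ) :
    MemLp (fun p => (φ p : ℂ)) 2 (volume : Measure (Conf N n)) :=
  (h1.memLp_of_hasCompactSupport h2).ofReal

/-- Integration of the `n`-phonon component against a test function. -/
def testL {φ : Conf N n → ℝ} (h1 : Continuous φ) (h2 : HasCompactSupport φ) :
    Fk N →L[ℂ] ℂ := (innerSL ℂ ((memLp_test h1 h2).toLp _)).comp (sec n)

lemma testL_apply {φ : Conf N n → ℝ} (h1 : Continuous φ) (h2 : HasCompactSupport φ)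
    (Ψ : Fk N) : testL h1 h2 Ψ = ∫ p, (φ p : ℂ) * sec n Ψ p := by
  rw [testL, ContinuousLinearMap.comp_apply, innerSL_apply_apply, L2.inner_def]
  refine integral_congr_ae ?_
  filter_upwards [(memLp_test h1 h2).coeFn_toLp] with p hp
  rw [hp]
  simp [mul_comm]

lemma eq_zero_of_testL {x : Fk N} (h : ∀ (n : ℕ) (φ : Conf N n → ℝ) (h1 : ContDiff ℝ ∞ φ)
    (h2 : HasCompactSupport φ), testL h1.continuous h2 x = 0) : x = 0 := by
  refine sec_ext fun n => Lp.ext ?_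
  rw [sec_zero]
  refine EventuallyEq.trans ?_ (Lp.coeFn_zero _ _ _).symm
  refine ae_eq_zero_of_integral_contDiff_smul_eq_zero
    ((Lp.memLp (sec n x)).locallyIntegrable (by norm_num)) fun φ h1 h2 => ?_
  have := h n φ h1 h2
  rw [testL_apply] at this
  simpa using this

lemma testL_trans {φ φ' : Conf N n → ℝ} (h1 : Continuous φ) (h2 : HasCompactSupport φ)
    (h1' : Continuous φ') (h2' : HasCompactSupport φ') (w : Fin N → E)
    (h : ∀ p, φ' (p.1 + w, p.2) = φ p) (Ψ : Fk N) :
    testL h1 h2 (trans w Ψ) = testL h1' h2' Ψ := by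
  rw [testL_apply, testL_apply, integral_comp_measurePreserving'
    (measurePreserving_shift w) (integrable_testFunction h1' h2' _).1]
  refine integral_congr_ae ?_
  rw [sec_trans]
  filter_upwards [transS_ae w (sec n Ψ)] with p hp
  rw [hp, h]

lemma hasCompactSupport_shift {φ : Conf N n → ℝ} (h2 : HasCompactSupport φ)
    (v : Conf N n) : HasCompactSupport fun p => φ (p - v) :=
  h2.comp_homeomorph (Homeomorph.subRight v)

lemma hasDerivAt_test {φ : Conf N n → ℝ} (h1 : ContDiff ℝ ∞ φ)
    (h2 : HasCompactSupport φ) (v : Conf N n) (u : L2 N n) :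
    HasDerivAt (fun t : ℝ => ∫ p, (φ (p - t • v) : ℂ) * u p)
      (-∫ p, (fderiv ℝ φ p v : ℂ) * u p) 0 := by
  have hc : IsCompact ((fun q : Conf N n × ℝ => q.1 + q.2 • v) ''
      (tsupport φ ×ˢ Set.Icc (-1 : ℝ) 1)) :=
    (h2.isCompact.prod isCompact_Icc).image (by fun_prop)
  set S := (fun q : Conf N n × ℝ => q.1 + q.2 • v) '' (tsupport φ ×ˢ Set.Icc (-1 : ℝ) 1)
  obtain ⟨C, hC⟩ := (h2.fderiv_apply (𝕜 := ℝ) v).exists_bound_of_continuous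
    (continuous_fderiv_testFunction h1 v)
  have hS : MemLp (S.indicator fun _ => C) 2 (volume : Measure (Conf N n)) :=
    memLp_indicator_const 2 hc.measurableSet C (Or.inr hc.measure_lt_top.ne)
  have hφc (t : ℝ) : Continuous fun p => φ (p - t • v) :=
    h1.continuous.comp (by fun_prop)
  have hφd (t : ℝ) : Continuous fun p => fderiv ℝ φ (p - t • v) v :=
    (continuous_fderiv_testFunction h1 v).comp (by fun_prop)
  have key := hasDerivAt_integral_of_dominated_loc_of_deriv_le (𝕜 := ℝ) (μ := volume)
    (F := fun t p => (φ (p - t • v) : ℂ) * u p)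
    (F' := fun t p => -(fderiv ℝ φ (p - t • v) v : ℂ) * u p) (x₀ := 0)
    (s := Set.Ioo (-1 : ℝ) 1)
    (bound := fun p => S.indicator (fun _ => C) p * ‖u p‖)
    (Ioo_mem_nhds (by norm_num) (by norm_num))
    (Eventually.of_forall fun t => (integrable_testFunction (hφc t)
      (hasCompactSupport_shift h2 (t • v)) u).1)
    (integrable_testFunction (hφc 0) (hasCompactSupport_shift h2 _) u)
    (((Complex.continuous_ofReal.comp (hφd 0)).neg.aestronglyMeasurable).mul
      (Lp.aestronglyMeasurable u))
    (ae_of_all _ fun p t ht => by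
      rw [norm_mul, norm_neg, Complex.norm_real]
      gcongr
      by_cases hp : p ∈ S
      · rw [Set.indicator_of_mem hp]
        exact hC _
      · have h3 : fderiv ℝ φ (p - t • v) = 0 := by
          by_contra hne
          refine hp ⟨(p - t • v, t), ⟨support_fderiv_subset ℝ hne, ⟨ht.1.le, ht.2.le⟩⟩, ?_⟩
          simp
        rw [h3, Set.indicator_of_notMem hp]
        simp)
    (hS.integrable_mul (Lp.memLp u).norm)
    (ae_of_all _ fun p t _ => by
      have h4 : HasDerivAt (fun t : ℝ => p - t • v) (-v) t := by
        simpa using ((hasDerivAt_id t).smul_const v).const_sub p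
      have h5 := ((h1.differentiable (by simp)).differentiableAt
        (x := p - t • v)).hasFDerivAt.comp_hasDerivAt t h4
      rw [map_neg] at h5
      have h6 := h5.ofReal_comp.mul_const (u p)
      simpa using h6)
  refine key.2.congr_deriv ?_
  rw [← integral_neg]
  refine integral_congr_ae (ae_of_all _ fun p => ?_)
  simp

lemma smul_dir (n : ℕ) (j : Fin N) (i : Fin 3) (t : ℝ) :
    t • (dir n j i : Conf N n) = (t • eDir j i, 0) := by
  rw [dir_eq, Prod.smul_mk, smul_zero]

lemma testL_grad {φ : Conf N n → ℝ} (h1 : ContDiff ℝ ∞ φ)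
    (h2 : HasCompactSupport φ) (j : Fin N) (i : Fin 3) (t : ℝ) (Ψ : Fk N) :
    testL h1.continuous h2 ((grad j i).T t Ψ) =
      ∫ p, (φ (p - t • dir n j i) : ℂ) * sec n Ψ p := by
  have h3 : Continuous fun p : Conf N n => φ (p - t • dir n j i) :=
    h1.continuous.comp (by fun_prop)
  have := testL_trans h1.continuous h2 h3 (hasCompactSupport_shift h2 _) (t • eDir j i)
    (fun p => congrArg φ (by rw [smul_dir]; ext <;> simp)) Ψ
  rw [testL_apply h3] at this
  exact this

lemma hasDerivAt_testL_grad {φ : Conf N n → ℝ} (h1 : ContDiff ℝ ∞ φ)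
    (h2 : HasCompactSupport φ) (j : Fin N) (i : Fin 3) (Ψ : Fk N) :
    HasDerivAt (fun t => testL h1.continuous h2 ((grad j i).T t Ψ))
      (-∫ p, (fderiv ℝ φ p (dir n j i) : ℂ) * sec n Ψ p) 0 := by
  have e := funext fun t => testL_grad h1 h2 j i t Ψ
  rw [e]
  exact hasDerivAt_test h1 h2 _ _

/-- The weak partial derivative is the generator of translations. -/
lemma hasPartial_iff :
    HasPartial j i (toFull N Ψ) (toFull N χ) ↔ (grad j i).HasGen Ψ χ := by
  simp only [HasPartial, sector_toFull]
  constructor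
  · intro h
    refine UnitaryGroup.hasGen_iff.2 fun t => sub_eq_zero.1 (eq_zero_of_testL fun n φ h1 h2 => ?_)
    set L := testL (N := N) h1.continuous h2
    have h3 : ∀ s, HasDerivAt (fun s => L ((grad j i).T s Ψ - Ψ - (grad j i).avg s χ)) 0 s := by
      intro s
      have hs1 : ContDiff ℝ ∞ fun p : Conf N n => φ (p - s • dir n j i) :=
        h1.comp (contDiff_id.sub contDiff_const)
      have hs2 := hasCompactSupport_shift h2 (s • dir n j i)
      have h4 := hasDerivAt_testL_grad hs1 hs2 j i Ψ
      rw [h n _ hs1 hs2, neg_neg] at h4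
      have h5 : ∀ r, testL hs1.continuous hs2 ((grad j i).T r Ψ) = L ((grad j i).T (s + r) Ψ) := by
        intro r
        rw [← (grad j i).add, testL_grad h1 h2, testL_apply]
      simp only [h5] at h4
      have h6 : HasDerivAt (fun r => L ((grad j i).T r Ψ)) (L ((grad j i).T s χ)) s := by
        have h7 : L ((grad j i).T s χ) = ∫ p, (φ (p - s • dir n j i) : ℂ) * sec n χ p :=
          testL_grad h1 h2 j i s χ
        rw [h7]
        have h8 : HasDerivAt (fun r => L ((grad j i).T (s + r) Ψ))
          (∫ p, (φ (p - s • dir n j i) : ℂ) * sec n χ p) (s - s) := by rwa [sub_self]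
        have h9 := HasDerivAt.comp_sub_const s s h8
        simpa using h9
      have h10 := (L.restrictScalars ℝ).hasFDerivAt.comp_hasDerivAt s
        (UnitaryGroup.hasDerivAt_avg (G := grad j i) s χ)
      have h11 := (h6.sub_const (L Ψ)).sub h10
      have h12 : L ((grad j i).T s χ) - (L.restrictScalars ℝ) ((grad j i).T s χ) = 0 := sub_self _
      rw [h12] at h11
      refine h11.congr_of_eventuallyEq (Eventually.of_forall fun r => ?_)
      simp only [map_sub]
      rfl
    have h4 := is_const_of_deriv_eq_zero (fun s => (h3 s).differentiableAt) (fun s => (h3 s).deriv)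
      t 0
    rw [h4, (grad j i).zero, UnitaryGroup.avg_zero, sub_self, sub_self, map_zero]
  · intro h n φ h1 h2
    have h3 := ((testL (N := N) h1.continuous h2).restrictScalars ℝ).hasFDerivAt.comp_hasDerivAt
      (0 : ℝ) h
    have h4 := h3.unique (hasDerivAt_testL_grad h1 h2 j i Ψ)
    have h5 := testL_apply h1.continuous h2 χ
    rw [← h5, ← neg_eq_iff_eq_neg]
    exact h4.symm

lemma hasGen_of_sec_smul {Ψ' χ' : Fk N} {c : ℕ → ℂ}
    (h1 : ∀ n, sec n Ψ' = c n • sec n Ψ) (h2 : ∀ n, sec n χ' = c n • sec n χ)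
    (h : (grad j i).HasGen Ψ χ) : (grad j i).HasGen Ψ' χ' := by
  rw [← hasPartial_iff] at h ⊢
  intro n φ hφ hφ'
  have h3 := h n φ hφ hφ'
  simp only [sector_toFull] at h3 ⊢
  have e : ∀ (ψ : Conf N n → ℝ) (u : L2 N n), ∫ p, (ψ p : ℂ) * (c n • u : L2 N n) p =
      c n * ∫ p, (ψ p : ℂ) * u p := fun ψ u => by
    rw [← integral_const_mul]
    refine integral_congr_ae ?_
    filter_upwards [Lp.coeFn_smul (c n) u] with p hp
    rw [hp, Pi.smul_apply, smul_eq_mul]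
    ring
  rw [h1, h2, e φ, e fun p => fderiv ℝ φ p (dir n j i), h3, mul_neg]

lemma hasGen_numFun {c : ℕ → ℂ} (hΨ : Ψ ∈ numDom N c)
    (hχ : χ ∈ numDom N c) (h : (grad j i).HasGen Ψ χ) :
    (grad j i).HasGen (numFun c Ψ) (numFun c χ) :=
  hasGen_of_sec_smul (sec_numFun hΨ) (sec_numFun hχ) h

/-! ### Commutators of derivatives with phonon operators -/

lemma hasDerivAt_form_op {A : Form → Fk N →L[ℂ] Fk N}
    (hadd : ∀ g g' Ψ, A (g + g') Ψ = A g Ψ + A g' Ψ)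
    (hsmul : ∀ (t : ℝ) g Ψ, A ((t : ℂ) • g) Ψ = (t : ℂ) • A g Ψ)
    (hnorm : ∀ g Ψ, ‖A g Ψ‖ ≤ ‖g‖ * ‖Ψ‖) {γ : ℝ → Form} {C : ℝ}
    (hγ : ∀ᶠ t in 𝓝 0, ‖γ t - (g + (t : ℂ) • q)‖ ≤ C * t ^ 2) {G : UnitaryGroup (Fk N)}
    (h : G.HasGen Ψ χ) :
    HasDerivAt (fun t => A (γ t) (G.T t Ψ)) (A q Ψ + A g χ) 0 := by
  have e : (fun t => A (γ t) (G.T t Ψ)) = fun t => A (γ t - (g + (t : ℂ) • q)) (G.T t Ψ) +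
      (t • A q (G.T t Ψ) + A g (G.T t Ψ)) := funext fun t => by
    rw [← Complex.coe_smul, ← hsmul, add_comm (A ((t : ℂ) • q) _), ← hadd, ← hadd, sub_add_cancel]
  have h1 : ∀ g, HasDerivAt (fun t => A g (G.T t Ψ)) (A g χ) 0 := fun g =>
    ((A g).restrictScalars ℝ).hasFDerivAt.comp_hasDerivAt (0 : ℝ) h
  have h2 : HasDerivAt (fun t : ℝ => t • A q (G.T t Ψ)) (A q Ψ) 0 := by
    have := (hasDerivAt_id (0 : ℝ)).smul (h1 q)
    refine this.congr_deriv ?_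
    simp [G.zero]
  have h3 : HasDerivAt (fun t => A (γ t - (g + (t : ℂ) • q)) (G.T t Ψ)) 0 0 := by
    have h4 : (fun t : ℝ => A (γ t - (g + (t : ℂ) • q)) (G.T t Ψ)) =O[𝓝 0]
        fun t : ℝ => ‖t - 0‖ ^ 2 := by
      refine Asymptotics.IsBigO.of_bound (C * ‖Ψ‖) (hγ.mono fun t ht => ?_)
      refine (hnorm _ _).trans ?_
      rw [LinearIsometry.norm_map]
      calc _ ≤ C * t ^ 2 * ‖Ψ‖ := by gcongr
        _ = _ := by simp; ring
    have h5 := (Asymptotics.IsBigO.hasFDerivAt h4 (by norm_num)).hasDerivAt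
    simpa using h5
  rw [e]
  refine (h3.add (h2.add (h1 g))).congr_deriv ?_
  rw [zero_add]

lemma modF_zero (g : Form) : modF 0 g = g := by
  refine Lp.ext ?_
  filter_upwards [modF_ae 0 g] with k hk
  rw [hk]
  simp

/-- The form factor `g` has bounded support and `q = -i kᵢ g`. -/
def IsMulK (i : Fin 3) (g q : Form) : Prop :=
  (∃ R : ℝ, ∀ᵐ k, R < ‖k‖ → g k = 0) ∧ q =ᵐ[volume] fun k => -Complex.I * (k i : ℂ) * g k

lemma IsMulK.modF_bound (h : IsMulK i g q) :
    ∃ C : ℝ, ∀ᶠ t : ℝ in 𝓝 0,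
      ‖modF (t • EuclideanSpace.single i (1 : ℝ)) g - (g + (t : ℂ) • q)‖ ≤ C * t ^ 2 := by
  obtain ⟨⟨R, hR⟩, hq⟩ := h
  set R' := max R 1
  have hR0 : 0 < R' := lt_max_of_lt_right one_pos
  refine ⟨R' ^ 2 * ‖g‖, ?_⟩
  have h0 : ∀ᶠ t : ℝ in 𝓝 0, |t| < R'⁻¹ := by
    have := (continuous_abs.tendsto' (0 : ℝ) 0 abs_zero).eventually (gt_mem_nhds (inv_pos.2 hR0))
    exact this
  filter_upwards [h0] with t ht
  have h1 : ‖modF (t • EuclideanSpace.single i (1 : ℝ)) g - (g + (t : ℂ) • q)‖ ≤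
      (t ^ 2 * R' ^ 2) * ‖g‖ := by
    refine Lp.norm_le_mul_norm_of_ae_le_mul ?_
    filter_upwards [modF_ae (t • EuclideanSpace.single i (1 : ℝ)) g, hR, hq,
      Lp.coeFn_sub (modF (t • EuclideanSpace.single i (1 : ℝ)) g) (g + (t : ℂ) • q),
      Lp.coeFn_add g ((t : ℂ) • q), Lp.coeFn_smul (t : ℂ) q] with k h1 h2 h3 h4 h5 h6
    rw [h4, Pi.sub_apply, h5, Pi.add_apply, h6, Pi.smul_apply, h1, h3]
    by_cases hk : R < ‖k‖
    · rw [h2 hk]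
      simp
    · have hi : inner ℝ k (t • EuclideanSpace.single i (1 : ℝ)) = t * k i := by
        rw [inner_smul_right, EuclideanSpace.inner_single_right]
        simp
      rw [hi]
      have hki : |k i| ≤ R' := by
        have := PiLp.norm_apply_le k i
        rw [Real.norm_eq_abs] at this
        exact this.trans ((not_lt.1 hk).trans (le_max_left _ _))
      have hx : ‖(-Complex.I * ((t * k i : ℝ) : ℂ))‖ = |t| * |k i| := by
        rw [norm_mul, norm_neg, Complex.norm_I, one_mul, Complex.norm_real, Real.norm_eq_abs,
          abs_mul]
      have hx1 : ‖(-Complex.I * ((t * k i : ℝ) : ℂ))‖ ≤ 1 := by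
        rw [hx]
        calc |t| * |k i| ≤ R'⁻¹ * R' := by gcongr
          _ = 1 := inv_mul_cancel₀ hR0.ne'
      have h7 := Complex.norm_exp_sub_one_sub_id_le hx1
      have e : Complex.exp (-Complex.I * ((t * k i : ℝ) : ℂ)) * g k -
          (g k + (t : ℂ) • (-Complex.I * (k i : ℂ) * g k)) =
          (Complex.exp (-Complex.I * ((t * k i : ℝ) : ℂ)) - 1
            - (-Complex.I * ((t * k i : ℝ) : ℂ))) * g k := by
        rw [smul_eq_mul]
        push_cast
        ring
      rw [e, norm_mul]
      gcongr
      refine h7.trans ?_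
      rw [hx, mul_pow, sq_abs]
      gcongr
  refine h1.trans (le_of_eq ?_)
  ring

lemma smul_eDir_self (j : Fin N) (i : Fin 3) (t : ℝ) :
    (t • eDir j i) j = t • EuclideanSpace.single i (1 : ℝ) := by
  rw [Pi.smul_apply, eDir, Pi.single_eq_same]

lemma smul_eDir_of_ne (h : l ≠ j) (i : Fin 3) (t : ℝ) :
    (t • eDir j i) l = 0 := by
  rw [Pi.smul_apply, eDir, Pi.single_eq_of_ne h, smul_zero]

section Commutators

variable {j : Fin N} {i : Fin 3} {Ψ χ : Fk N}

lemma alpha_real_smul (j : Fin N) (t : ℝ) (g : Form) (Ψ : Fk N) :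
    alpha ((t : ℂ) • g) j Ψ = (t : ℂ) • alpha g j Ψ := by
  rw [alpha_smul_form, Complex.conj_ofReal]

lemma hasGen_alpha (h : (grad j i).HasGen Ψ χ) (hg : IsMulK i g q) :
    (grad j i).HasGen (alpha g j Ψ) (alpha q j Ψ + alpha g j χ) := by
  obtain ⟨C, hC⟩ := hg.modF_bound
  have h1 := hasDerivAt_form_op (A := fun g => alpha g j) (fun g g' Ψ => alpha_add_form g g' j Ψ)
    (alpha_real_smul j) (fun g Ψ => norm_alpha_le g j Ψ) hC h
  refine h1.congr_of_eventuallyEq (Eventually.of_forall fun t => ?_)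
  show trans (t • eDir j i) _ = _
  rw [trans_alpha, smul_eDir_self]
  rfl

lemma hasGen_alphaD (h : (grad j i).HasGen Ψ χ) (hg : IsMulK i g q) :
    (grad j i).HasGen (alphaD g j Ψ) (alphaD q j Ψ + alphaD g j χ) := by
  obtain ⟨C, hC⟩ := hg.modF_bound
  have h1 := hasDerivAt_form_op (A := fun g => alphaD g j)
    (fun g g' Ψ => alphaD_add_form g g' j Ψ)
    (fun t g Ψ => alphaD_smul_form _ g j Ψ) (fun g Ψ => norm_alphaD_le g j Ψ) hC h
  refine h1.congr_of_eventuallyEq (Eventually.of_forall fun t => ?_)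
  show trans (t • eDir j i) _ = _
  rw [trans_alphaD, smul_eDir_self]
  rfl

lemma hasGen_alpha_of_ne (h : (grad j i).HasGen Ψ χ) (hl : l ≠ j) (g : Form) :
    (grad j i).HasGen (alpha g l Ψ) (alpha g l χ) :=
  h.map (alpha g l) fun t z => by
    show _ = trans (t • eDir j i) _
    rw [trans_alpha, smul_eDir_of_ne hl, modF_zero]
    rfl

lemma hasGen_alphaD_of_ne (h : (grad j i).HasGen Ψ χ) (hl : l ≠ j) (g : Form) :
    (grad j i).HasGen (alphaD g l Ψ) (alphaD g l χ) :=
  h.map (alphaD g l) fun t z => by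
    show _ = trans (t • eDir j i) _
    rw [trans_alphaD, smul_eDir_of_ne hl, modF_zero]
    rfl

end Commutators

end Gradient

/-! ### Phonon operators on the domains of powers of the number operator -/

section Domains

variable {N : ℕ}
variable {Ψ χ : Fk N} {c : ℕ → ℂ}

lemma alpha_numDom {d : ℕ → ℂ} (hcd : ∀ n, d (n + 1) = c n) (h : Ψ ∈ numDom N d)
    (g : Form) (j : Fin N) :
    alpha g j Ψ ∈ numDom N c ∧ numFun c (alpha g j Ψ) = alpha g j (numFun d Ψ) := by
  have h1 : ∀ n, sec n (alpha g j (numFun d Ψ)) = c n • sec n (alpha g j Ψ) := fun n => by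
    rw [sec_alpha, sec_numFun h, map_smul, sec_alpha, hcd]
  exact ⟨mem_numDom_of_sec h1, (eq_numFun_of_sec h1).symm⟩

lemma alphaD_numDom {d : ℕ → ℂ} (hcd : ∀ n, d n = c (n + 1)) (h : Ψ ∈ numDom N d)
    (g : Form) (j : Fin N) :
    alphaD g j Ψ ∈ numDom N c ∧ numFun c (alphaD g j Ψ) = alphaD g j (numFun d Ψ) := by
  have h1 : ∀ n, sec n (alphaD g j (numFun d Ψ)) = c n • sec n (alphaD g j Ψ) := fun n => by
    cases n with
    | zero => rw [sec_zero_alphaD, sec_zero_alphaD, smul_zero]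
    | succ n => rw [sec_succ_alphaD, sec_numFun h, map_smul, sec_succ_alphaD, hcd]
  exact ⟨mem_numDom_of_sec h1, (eq_numFun_of_sec h1).symm⟩

lemma ann_eq (h : Ψ ∈ numDom N sq0) (g : Form) (j : Fin N) :
    alpha g j Ψ ∈ numDom N sq1 ∧ ann g j Ψ = numFun sq1 (alpha g j Ψ) := by
  have := alpha_numDom (c := sq1) (d := sq0) sq0_succ h g j
  exact ⟨this.1, this.2.symm⟩

lemma norm_ann_le (g : Form) (j : Fin N) (Ψ : Fk N) : ‖ann g j Ψ‖ ≤ ‖g‖ * ‖numFun sq0 Ψ‖ :=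
  norm_alpha_le _ _ _

lemma norm_cre_le (g : Form) (j : Fin N) (h : Ψ ∈ numDom N sq0) :
    ‖cre g j Ψ‖ ≤ ‖g‖ * (‖numFun sq0 Ψ‖ + ‖Ψ‖) :=
  (norm_alphaD_le _ _ _).trans (by gcongr; exact norm_numFun_sq1_le h)

lemma ann_add (h : Ψ ∈ numDom N sq0) (h' : χ ∈ numDom N sq0) (g : Form)
    (j : Fin N) : ann g j (Ψ + χ) = ann g j Ψ + ann g j χ := by
  rw [ann, numFun_add h h', map_add]
  rfl

lemma ann_smul (c : ℂ) (h : Ψ ∈ numDom N sq0) (g : Form) (j : Fin N) :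
    ann g j (c • Ψ) = c • ann g j Ψ := by
  rw [ann, numFun_smul c h, map_smul]
  rfl

lemma cre_add (h : Ψ ∈ numDom N sq0) (h' : χ ∈ numDom N sq0) (g : Form)
    (j : Fin N) : cre g j (Ψ + χ) = cre g j Ψ + cre g j χ := by
  rw [cre, numFun_add (sq0_le_sq1 h) (sq0_le_sq1 h'), map_add]
  rfl

lemma cre_smul (c : ℂ) (h : Ψ ∈ numDom N sq0) (g : Form) (j : Fin N) :
    cre g j (c • Ψ) = c • cre g j Ψ := by
  rw [cre, numFun_smul c (sq0_le_sq1 h), map_smul]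
  rfl

lemma inner_numFun_symm (hc : ∀ n, conj (c n) = c n)
    (h : Ψ ∈ numDom N c) (h' : χ ∈ numDom N c) :
    inner ℂ (numFun c χ) Ψ = inner ℂ χ (numFun c Ψ) := by
  refine (hasSum_inner_sec _ _).unique ((hasSum_inner_sec _ _).congr_fun fun n => ?_)
  rw [sec_numFun h, sec_numFun h', inner_smul_left, inner_smul_right, hc]

lemma inner_cre_right (hχ : χ ∈ phSym N) (h : χ ∈ numDom N sq0)
    (h' : Ψ ∈ numDom N sq0) (g : Form) (j : Fin N) :
    inner ℂ χ (cre g j Ψ) = inner ℂ (ann g j χ) Ψ := by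
  rw [cre, inner_alphaD_right hχ, (ann_eq h g j).2,
    inner_numFun_symm conj_sq1 (sq0_le_sq1 h') (ann_eq h g j).1]

lemma ann_mem_phSym (h : Ψ ∈ phSym N) (g : Form) (j : Fin N) : ann g j Ψ ∈ phSym N :=
  alpha_mem_phSym (numFun_mem_phSym h _) g j

lemma cre_mem_phSym (h : Ψ ∈ phSym N) (g : Form) (j : Fin N) : cre g j Ψ ∈ phSym N :=
  alphaD_mem_phSym (numFun_mem_phSym h _) g j

lemma numDom_sq0_mul_sq0 (h : Ψ ∈ numDom N wN) :
    Ψ ∈ numDom N fun n => sq0 n * sq0 n := by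
  rwa [show (fun n => sq0 n * sq0 n) = wN from funext sq0_mul_self]

lemma numFun_sq0_mem (h : Ψ ∈ numDom N wN) : numFun sq0 Ψ ∈ numDom N sq0 :=
  numFun_mem (wN_le_sq0 h) (numDom_sq0_mul_sq0 h)

lemma numFun_sq0_sq0 (h : Ψ ∈ numDom N wN) :
    numFun sq0 (numFun sq0 Ψ) = numFun wN Ψ := by
  rw [numFun_numFun (wN_le_sq0 h) (numDom_sq0_mul_sq0 h),
    show (fun n => sq0 n * sq0 n) = wN from funext sq0_mul_self]

lemma norm_sq0_le (n : ℕ) : ‖sq0 n‖ ≤ ‖wN n‖ := by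
  rw [norm_wN]
  refine (sq_le_sq₀ (norm_nonneg _) (by positivity)).1 ?_
  rw [norm_sq0_sq]
  exact_mod_cast Nat.le_self_pow two_ne_zero n

lemma norm_numFun_sq0_le (h : Ψ ∈ numDom N wN) :
    ‖numFun sq0 Ψ‖ ≤ ‖numFun wN Ψ‖ := by
  have := norm_le_of_sec_le (Ψ := numFun sq0 Ψ) (χ := numFun wN Ψ) zero_le_one fun n => by
    rw [sec_numFun h, sec_numFun (wN_le_sq0 h), one_mul, norm_smul, norm_smul]
    gcongr
    exact norm_sq0_le n
  simpa using this

/-- An annihilation operator maps `D(𝓝)` to `D(𝓝^{1/2})`. -/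
lemma ann_mem_sq0 (h : Ψ ∈ numDom N wN) (g : Form) (j : Fin N) :
    ann g j Ψ ∈ numDom N sq0 ∧ ‖numFun sq0 (ann g j Ψ)‖ ≤ ‖g‖ * ‖numFun wN Ψ‖ := by
  -- the weight `√(n - 1)`
  have h0 : ∀ n : ℕ, ‖sq0 (n - 1)‖ ≤ ‖sq0 n‖ := fun n => by
    refine (sq_le_sq₀ (norm_nonneg _) (norm_nonneg _)).1 ?_
    rw [norm_sq0_sq, norm_sq0_sq]
    exact_mod_cast Nat.sub_le n 1
  have h1 : numFun sq0 Ψ ∈ numDom N fun n => sq0 (n - 1) :=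
    numDom_mono (A := 1) (B := 0) (fun n => by
      rw [one_mul, add_zero]
      exact pow_le_pow_left₀ (norm_nonneg _) (h0 n) 2) (numFun_sq0_mem h)
  obtain ⟨h2, h3⟩ := alpha_numDom (c := sq0) (d := fun n => sq0 (n - 1)) (fun n => rfl) h1 g j
  refine ⟨h2, ?_⟩
  rw [ann, h3]
  refine (norm_alpha_le _ _ _).trans ?_
  gcongr
  have := norm_le_of_sec_le (Ψ := numFun (fun n => sq0 (n - 1)) (numFun sq0 Ψ))
    (χ := numFun wN Ψ) zero_le_one fun n => by
      rw [sec_numFun h1, ← numFun_sq0_sq0 h, sec_numFun (numFun_sq0_mem h), one_mul, norm_smul,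
        norm_smul]
      gcongr
      exact h0 n
  simpa using this

/-- A creation operator maps `D(𝓝)` to `D(𝓝^{1/2})`. -/
lemma cre_mem_sq0 (h : Ψ ∈ numDom N wN) (g : Form) (j : Fin N) :
    cre g j Ψ ∈ numDom N sq0 ∧
      ‖numFun sq0 (cre g j Ψ)‖ ≤ ‖g‖ * (‖numFun wN Ψ‖ + ‖Ψ‖) := by
  have h0 : ∀ n, sq1 n * sq1 n = ((n : ℂ) + 1) := sq1_mul_self
  have hn : ∀ n : ℕ, ‖(n : ℂ) + 1‖ = n + 1 := fun n => by exact_mod_cast Complex.norm_natCast (n + 1)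
  have h1 : Ψ ∈ numDom N fun n => sq1 n * sq1 n :=
    numDom_mono (A := 2) (B := 2) (fun n => by
      rw [h0, hn, norm_wN]
      nlinarith [sq_nonneg ((n : ℝ) - 1)]) h
  have h2 := sq0_le_sq1 (wN_le_sq0 h)
  have h3 := numFun_mem h2 h1
  obtain ⟨h4, h5⟩ := alphaD_numDom (c := sq0) (d := sq1) (fun n => (sq0_succ n).symm) h3 g j
  refine ⟨h4, ?_⟩
  rw [cre, h5, numFun_numFun h2 h1]
  refine (norm_alphaD_le _ _ _).trans ?_
  gcongr
  have h6 : numFun (fun n => sq1 n * sq1 n) Ψ = numFun wN Ψ + Ψ := by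
    refine (eq_numFun_of_sec fun n => ?_).symm
    rw [sec_add, sec_numFun h, h0, add_smul, one_smul]
    rfl
  rw [h6]
  exact norm_add_le _ _

/-- The field operator `Φ(g_{x_j})`. -/
def fld (g : Form) (j : Fin N) (Ψ : Fk N) : Fk N := ann g j Ψ + cre g j Ψ

lemma fld_add (h : Ψ ∈ numDom N sq0) (h' : χ ∈ numDom N sq0) (g : Form)
    (j : Fin N) : fld g j (Ψ + χ) = fld g j Ψ + fld g j χ := by
  rw [fld, ann_add h h', cre_add h h', fld, fld]
  abel

lemma fld_smul (c : ℂ) (h : Ψ ∈ numDom N sq0) (g : Form) (j : Fin N) :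
    fld g j (c • Ψ) = c • fld g j Ψ := by
  rw [fld, ann_smul c h, cre_smul c h, fld, smul_add]

lemma norm_fld_le (g : Form) (j : Fin N) (h : Ψ ∈ numDom N sq0) :
    ‖fld g j Ψ‖ ≤ ‖g‖ * (2 * ‖numFun sq0 Ψ‖ + ‖Ψ‖) := by
  refine (norm_add_le _ _).trans ((add_le_add (norm_ann_le g j Ψ) (norm_cre_le g j h)).trans
    (le_of_eq ?_))
  ring

lemma fld_mem_sq0 (h : Ψ ∈ numDom N wN) (g : Form) (j : Fin N) :
    fld g j Ψ ∈ numDom N sq0 := add_mem (ann_mem_sq0 h g j).1 (cre_mem_sq0 h g j).1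

lemma norm_sq0_fld_le (h : Ψ ∈ numDom N wN) (g : Form) (j : Fin N) :
    ‖numFun sq0 (fld g j Ψ)‖ ≤ ‖g‖ * (2 * ‖numFun wN Ψ‖ + ‖Ψ‖) := by
  rw [fld, numFun_add (ann_mem_sq0 h g j).1 (cre_mem_sq0 h g j).1]
  refine (norm_add_le _ _).trans ((add_le_add (ann_mem_sq0 h g j).2
    (cre_mem_sq0 h g j).2).trans (le_of_eq ?_))
  ring

lemma fld_mem_phSym (h : Ψ ∈ phSym N) (g : Form) (j : Fin N) : fld g j Ψ ∈ phSym N :=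
  add_mem (ann_mem_phSym h g j) (cre_mem_phSym h g j)

lemma inner_fld_right (hχ : χ ∈ phSym N) (hΨ : Ψ ∈ phSym N)
    (h : χ ∈ numDom N sq0) (h' : Ψ ∈ numDom N sq0) (g : Form) (j : Fin N) :
    inner ℂ χ (fld g j Ψ) = inner ℂ (fld g j χ) Ψ := by
  have h1 : inner ℂ χ (ann g j Ψ) = inner ℂ (cre g j χ) Ψ := by
    rw [← inner_conj_symm, ← inner_cre_right hΨ h' h, inner_conj_symm]
  rw [fld, fld, inner_add_right, inner_add_left, h1, inner_cre_right hχ h h', add_comm]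

/-- `‖Φ(g)² Ψ‖` is bounded by the graph norm of `𝓝`. -/
lemma norm_fld_fld_le (f g : Form) (j l : Fin N) (h : Ψ ∈ numDom N wN) :
    ‖fld f j (fld g l Ψ)‖ ≤ ‖f‖ * ‖g‖ * (6 * ‖numFun wN Ψ‖ + 3 * ‖Ψ‖) := by
  refine (norm_fld_le f j (fld_mem_sq0 h g l)).trans ?_
  have h1 := norm_sq0_fld_le h g l
  have h2 := norm_fld_le g l (wN_le_sq0 h)
  have h3 := norm_numFun_sq0_le h
  have h4 : 2 * ‖numFun sq0 (fld g l Ψ)‖ + ‖fld g l Ψ‖ ≤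
      ‖g‖ * (6 * ‖numFun wN Ψ‖ + 3 * ‖Ψ‖) := by
    nlinarith [mul_le_mul_of_nonneg_left h3 (norm_nonneg g)]
  calc _ ≤ ‖f‖ * (‖g‖ * (6 * ‖numFun wN Ψ‖ + 3 * ‖Ψ‖)) := by gcongr
    _ = _ := by ring

end Domains

/-! ### The algebra of phonon operators on vectors with finitely many phonons -/

section FiniteVectors

variable {N : ℕ}
variable {m : (Fin N → E) → ℂ} {Ψ : Fk N}

/-- The space of phonon-symmetric vectors with finitely many phonons. -/
def finV (N : ℕ) : Submodule ℂ (Fk N) where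
  carrier := {Ψ | Ψ ∈ phSym N ∧ IsFin Ψ}
  zero_mem' := ⟨zero_mem _, 0, fun n _ => sec_zero n⟩
  add_mem' := fun ha hb => ⟨add_mem ha.1 hb.1, ha.2.add hb.2⟩
  smul_mem' := fun c _ ha => ⟨Submodule.smul_mem _ c ha.1, ha.2.smul c⟩

lemma finV_numDom (u : finV N) (c : ℕ → ℂ) : (u : Fk N) ∈ numDom N c := u.2.2.mem_numDom c

lemma trunc_mem_finV (h : Ψ ∈ phSym N) (M : ℕ) : trunc M Ψ ∈ finV N :=
  ⟨numFun_mem_phSym h _, isFin_trunc M Ψ⟩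

lemma isFin_alpha (h : IsFin Ψ) (g : Form) (j : Fin N) : IsFin (alpha g j Ψ) := by
  obtain ⟨M, hM⟩ := h
  exact ⟨M, fun n hn => by rw [sec_alpha, hM (n + 1) (by omega), map_zero]⟩

lemma isFin_alphaD (h : IsFin Ψ) (g : Form) (j : Fin N) : IsFin (alphaD g j Ψ) := by
  obtain ⟨M, hM⟩ := h
  refine ⟨M + 1, fun n hn => ?_⟩
  obtain ⟨n, rfl⟩ : ∃ m, n = m + 1 := ⟨n - 1, by omega⟩
  rw [sec_succ_alphaD, hM n (by omega), map_zero]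

/-- The annihilation operator on vectors with finitely many phonons. -/
def annV (g : Form) (j : Fin N) : Module.End ℂ (finV N) where
  toFun u := ⟨ann g j u, ann_mem_phSym u.2.1 g j, isFin_alpha (u.2.2.numFun _) g j⟩
  map_add' u v := Subtype.ext (ann_add (finV_numDom u _) (finV_numDom v _) g j)
  map_smul' c u := Subtype.ext (ann_smul c (finV_numDom u _) g j)

/-- The creation operator on vectors with finitely many phonons. -/
def creV (g : Form) (j : Fin N) : Module.End ℂ (finV N) where
  toFun u := ⟨cre g j u, cre_mem_phSym u.2.1 g j, isFin_alphaD (u.2.2.numFun _) g j⟩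
  map_add' u v := Subtype.ext (cre_add (finV_numDom u _) (finV_numDom v _) g j)
  map_smul' c u := Subtype.ext (cre_smul c (finV_numDom u _) g j)

/-- The number operator on vectors with finitely many phonons. -/
def numV (N : ℕ) : Module.End ℂ (finV N) where
  toFun u := ⟨numFun wN u, numFun_mem_phSym u.2.1 _, u.2.2.numFun _⟩
  map_add' u v := Subtype.ext (numFun_add (finV_numDom u _) (finV_numDom v _))
  map_smul' c u := Subtype.ext (numFun_smul c (finV_numDom u _))

lemma isFin_mulB (hm : IsBddMul m volume) (h : IsFin Ψ) :
    IsFin (mulB m hm Ψ) := by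
  obtain ⟨M, hM⟩ := h
  refine ⟨M, fun n hn => Lp.ext ?_⟩
  filter_upwards [sec_mulB_ae hm n Ψ, Lp.coeFn_zero ℂ 2 (volume : Measure (Conf N n))] with p h1 h2
  rw [h1, hM n hn, h2]
  simp

/-- Multiplication operators on vectors with finitely many phonons. -/
def mulV (m : (Fin N → E) → ℂ) (hm : IsBddMul m volume) : Module.End ℂ (finV N) where
  toFun u := ⟨mulB m hm u, mulB_mem_phSym hm u.2.1, isFin_mulB hm u.2.2⟩
  map_add' _ _ := Subtype.ext (map_add _ _ _)
  map_smul' _ _ := Subtype.ext (map_smul _ _ _)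

lemma annV_coe (g : Form) (j : Fin N) (u : finV N) : (annV g j u : Fk N) = ann g j u := rfl

lemma creV_coe (g : Form) (j : Fin N) (u : finV N) : (creV g j u : Fk N) = cre g j u := rfl

lemma numV_coe (u : finV N) : (numV N u : Fk N) = numFun wN u := rfl

lemma mulV_coe (hm : IsBddMul m volume) (u : finV N) :
    (mulV m hm u : Fk N) = mulB m hm u := rfl

lemma finV_ext {x y : finV N} (h : ∀ χ : finV N, inner ℂ (χ : Fk N) x = inner ℂ (χ : Fk N) y) :
    x = y := by
  have h1 := h (x - y)
  rw [← sub_eq_zero, ← inner_sub_right] at h1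
  exact sub_eq_zero.1 (Subtype.ext (inner_self_eq_zero.1 h1))

lemma inner_creV (χ u : finV N) (g : Form) (j : Fin N) :
    inner ℂ (χ : Fk N) (creV g j u) = inner ℂ (annV g j χ : Fk N) u :=
  inner_cre_right χ.2.1 (finV_numDom χ _) (finV_numDom u _) g j

lemma annV_commute (f g : Form) (j l : Fin N) : Commute (annV f j) (annV g l) := by
  refine LinearMap.ext fun u => Subtype.ext (sec_ext fun n => ?_)
  show sec n (ann f j (annV g l u)) = sec n (ann g l (annV f j u))
  rw [sec_ann (finV_numDom _ _), sec_ann (finV_numDom _ _), annV_coe, annV_coe,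
    sec_ann (finV_numDom _ _), sec_ann (finV_numDom _ _), map_smul, map_smul,
    removeS_removeS_comm (mem_phSym.1 u.2.1 (n + 2))]

lemma creV_commute (f g : Form) (j l : Fin N) : Commute (creV f j) (creV g l) := by
  refine LinearMap.ext fun u => finV_ext fun χ => ?_
  show inner ℂ (χ : Fk N) (creV f j (creV g l u)) = inner ℂ (χ : Fk N) (creV g l (creV f j u))
  rw [inner_creV, inner_creV, inner_creV, inner_creV]
  have h := LinearMap.congr_fun (annV_commute f g j l) χ
  exact congrArg (fun x : finV N => inner ℂ (x : Fk N) (u : Fk N)) h.symm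

lemma isBddMul_pairing (f g : Form) (j l : Fin N) : IsBddMul (pairing f g j l) volume :=
  ⟨aestronglyMeasurable_pairing f g j l, ‖f‖ * ‖g‖, norm_pairing_le f g j l⟩

/-- The canonical commutation relations. -/
lemma annV_creV (f g : Form) (j l : Fin N) :
    annV f j * creV g l = creV g l * annV f j + mulV _ (isBddMul_pairing f g j l) := by
  refine LinearMap.ext fun u => Subtype.ext (sec_ext fun n => ?_)
  show sec n (ann f j (creV g l u)) =
    sec n (cre g l (annV f j u) + mulB _ (isBddMul_pairing f g j l) u)
  have h1 : sec n (ann f j (creV g l u)) =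
      ((n : ℂ) + 1) • removeS f j n (symInsertS g l n (sec n (u : Fk N))) := by
    rw [sec_ann (finV_numDom _ _), creV_coe, sec_succ_cre (finV_numDom _ _), map_smul,
      L2_smul_smul, sq1_mul_self]
  rw [sec_add]
  cases n with
  | zero =>
    have h3 := Lp.ext ((removeS_symInsertS_zero_ae f g j l (sec 0 (u : Fk N))).trans
      (sec_mulB_ae (isBddMul_pairing f g j l) 0 (u : Fk N)).symm)
    have h4 : sec 0 (cre g l (annV f j u)) = 0 := sec_zero_cre _ _ _
    have h5 : ((0 : ℕ) : ℂ) + 1 = 1 := by simp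
    refine (h1.trans ((congrArg (· • _) h5).trans ((one_smul ℂ _).trans h3))).trans ?_
    exact (zero_add _).symm.trans (congrArg (· + _) h4.symm)
  | succ n =>
    have h4 : sec (n + 1) (cre g l (annV f j u)) =
        ((n : ℂ) + 1) • symInsertS g l n (removeS f j n (sec (n + 1) (u : Fk N))) := by
      rw [sec_succ_cre (finV_numDom _ _), annV_coe, sec_ann (finV_numDom _ _), map_smul,
        L2_smul_smul, sq1_mul_self]
    have h7 := Lp.ext ((removeS_symInsertS_ae f g j l (sec (n + 1) (u : Fk N))).trans
      (sec_mulB_ae (isBddMul_pairing f g j l) (n + 1) (u : Fk N)).symm)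
    exact h1.trans ((sub_eq_iff_eq_add'.1 h7).trans (congrArg (· + _) h4.symm))

lemma mulB_alpha (hm : IsBddMul m volume) (g : Form) (j : Fin N)
    (Ψ : Fk N) : mulB m hm (alpha g j Ψ) = alpha g j (mulB m hm Ψ) := by
  refine sec_ext fun n => Lp.ext ?_
  have h0 := removeS_form_ae g j (sec (n + 1) Ψ)
  have h1 := removeS_form_ae g j (sec (n + 1) (mulB m hm Ψ))
  filter_upwards [sec_mulB_ae hm n (alpha g j Ψ), h0, h1,
    ae_ae_cons (sec_mulB_ae hm (n + 1) Ψ)] with p h2 h3 h4 h5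
  rw [h2, sec_alpha, sec_alpha, h3, h4, ← integral_const_mul]
  refine integral_congr_ae ?_
  filter_upwards [h5] with k hk
  rw [hk]
  ring

lemma numFun_mulB (hm : IsBddMul m volume) {c : ℕ → ℂ}
    (h : Ψ ∈ numDom N c) : mulB m hm Ψ ∈ numDom N c ∧
      numFun c (mulB m hm Ψ) = mulB m hm (numFun c Ψ) := by
  have h1 : ∀ n, sec n (mulB m hm (numFun c Ψ)) = c n • sec n (mulB m hm Ψ) := fun n => by
    rw [sec_mulB, sec_numFun h, map_smul, sec_mulB]
  exact ⟨mem_numDom_of_sec h1, (eq_numFun_of_sec h1).symm⟩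

lemma mulV_annV (hm : IsBddMul m volume) (g : Form) (j : Fin N) :
    Commute (mulV m hm) (annV g j) := by
  refine LinearMap.ext fun u => Subtype.ext ?_
  show mulB m hm (ann g j u) = ann g j (mulB m hm u)
  rw [ann, mulB_alpha, ann, (numFun_mulB hm (finV_numDom u _)).2]

lemma IsBddMul.conj (hm : IsBddMul m volume) :
    IsBddMul (fun x => conj (m x)) volume :=
  ⟨Complex.continuous_conj.comp_aestronglyMeasurable hm.1, hm.2.choose, fun x => by
    rw [RCLike.norm_conj]; exact hm.2.choose_spec x⟩

lemma inner_mulV (hm : IsBddMul m volume) (χ u : finV N) :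
    inner ℂ (χ : Fk N) (mulV m hm u) = inner ℂ (mulV _ hm.conj χ : Fk N) u := by
  rw [mulV_coe, mulV_coe, inner_mulB_left hm.conj hm fun x => (Complex.conj_conj _).symm]

lemma mulV_creV (hm : IsBddMul m volume) (g : Form) (j : Fin N) :
    Commute (mulV m hm) (creV g j) := by
  refine LinearMap.ext fun u => finV_ext fun χ => ?_
  show inner ℂ (χ : Fk N) (mulV m hm (creV g j u)) = inner ℂ (χ : Fk N) (creV g j (mulV m hm u))
  rw [inner_mulV, inner_creV, inner_creV, inner_mulV]
  exact congrArg (fun x : finV N => inner ℂ (x : Fk N) (u : Fk N))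
    (LinearMap.congr_fun (mulV_annV hm.conj g j) χ).symm

lemma inner_numV (χ u : finV N) :
    inner ℂ (χ : Fk N) (numV N u) = inner ℂ (numV N χ : Fk N) u :=
  (inner_numFun_symm (fun n => by simp [wN]) (finV_numDom u _) (finV_numDom χ _)).symm

lemma numV_annV (g : Form) (j : Fin N) : numV N * annV g j = annV g j * numV N - annV g j := by
  refine LinearMap.ext fun u => Subtype.ext (sec_ext fun n => ?_)
  show sec n (numFun wN (annV g j u)) = sec n (ann g j (numV N u) - ann g j u)
  rw [sec_numFun (finV_numDom _ _), annV_coe, sec_sub, sec_ann (finV_numDom _ _),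
    sec_ann (finV_numDom _ _), numV_coe, sec_numFun (finV_numDom _ _), map_smul]
  simp only [wN]
  push_cast
  module

lemma numV_creV (g : Form) (j : Fin N) : numV N * creV g j = creV g j * numV N + creV g j := by
  refine LinearMap.ext fun u => finV_ext fun χ => ?_
  show inner ℂ (χ : Fk N) (numV N (creV g j u)) =
    inner ℂ (χ : Fk N) (creV g j (numV N u) + creV g j u : finV N)
  have h0 : numV N (annV g j χ) = annV g j (numV N χ) - annV g j χ :=
    LinearMap.congr_fun (numV_annV g j) χ
  have h2 : ((numV N (annV g j χ) : finV N) : Fk N) =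
      (annV g j (numV N χ) : finV N) - (annV g j χ : finV N) := by
    rw [h0, Submodule.coe_sub]
  rw [Submodule.coe_add, inner_add_right, inner_numV, inner_creV, inner_creV, inner_creV,
    inner_numV, h2, inner_sub_left]
  ring

end FiniteVectors

/-! ### Almost orthogonality of modulated annihilation operators -/

section Orthogonality

variable {N n : ℕ}
variable {m : E → ℂ}

lemma removeS_insertS (f g : Form) (j : Fin N) (u : L2 N n) :
    removeS f j n (insertS g j n u) = (inner ℂ f g : ℂ) • u := by
  have h := removeS_permS_zero f g j j u
  rw [show cyc (0 : Fin (n + 1)) = 1 by simp only [cyc, Fin.cycleRange_zero]; rfl, permS_one] at h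
  refine Lp.ext ?_
  filter_upwards [h, Lp.coeFn_smul (inner ℂ f g : ℂ) u] with p h1 h2
  rw [h1, h2, Pi.smul_apply, smul_eq_mul, L2.inner_def, pairing]
  congr 2
  funext k
  have e : conj (Complex.exp (-Complex.I * (inner ℝ k (p.1 j) : ℝ))) *
      Complex.exp (-Complex.I * (inner ℝ k (p.1 j) : ℝ)) = 1 := by
    rw [← Complex.exp_conj, ← Complex.exp_add]
    simp
  simp only [formFactor, map_mul, RCLike.inner_apply]
  linear_combination (conj (f k) * g k) * e

/-- Bessel's inequality for the operators removing a phonon in orthogonal states. -/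
lemma sum_sq_norm_removeS_le {ι : Type*} [DecidableEq ι] (s : Finset ι) (e : ι → Form)
    (ho : ∀ z z', z ≠ z' → inner ℂ (e z) (e z') = (0 : ℂ)) {L : ℝ} (hL : ∀ z, ‖e z‖ ≤ L)
    (j : Fin N) (v : L2 N (n + 1)) :
    ∑ z ∈ s, ‖removeS (e z) j n v‖ ^ 2 ≤ L ^ 2 * ‖v‖ ^ 2 := by
  set S := ∑ z ∈ s, ‖removeS (e z) j n v‖ ^ 2 with hS
  have hS0 : 0 ≤ S := Finset.sum_nonneg fun _ _ => by positivity
  set w := ∑ z ∈ s, insertS (e z) j n (removeS (e z) j n v) with hw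
  have h1 : inner ℂ w v = (S : ℂ) := by
    rw [hw, sum_inner, hS, Complex.ofReal_sum]
    refine Finset.sum_congr rfl fun z _ => ?_
    rw [← inner_removeS_right, inner_self_eq_norm_sq_to_K]
    norm_cast
  have h2 : ‖w‖ ^ 2 ≤ L ^ 2 * S := by
    have h3 : inner ℂ w w = ((∑ z ∈ s, ‖insertS (e z) j n (removeS (e z) j n v)‖ ^ 2 : ℝ) : ℂ) := by
      rw [Complex.ofReal_sum]
      nth_rewrite 1 [hw]
      rw [sum_inner]
      refine Finset.sum_congr rfl fun z hz => ?_
      rw [hw, inner_sum, Finset.sum_eq_single z]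
      · rw [inner_self_eq_norm_sq_to_K]
        norm_cast
      · intro z' _ hz'
        rw [← inner_removeS_right, removeS_insertS, ho _ _ hz'.symm, zero_smul, inner_zero_right]
      · exact fun h => absurd hz h
    rw [inner_self_eq_norm_sq_to_K] at h3
    have h4 : ‖w‖ ^ 2 = ∑ z ∈ s, ‖insertS (e z) j n (removeS (e z) j n v)‖ ^ 2 := by
      exact Complex.ofReal_injective (by simpa using h3)
    rw [h4, hS, Finset.mul_sum]
    refine Finset.sum_le_sum fun z _ => ?_
    rw [← mul_pow]
    refine pow_le_pow_left₀ (norm_nonneg _) ((norm_insertS_le _ _ _).trans ?_) 2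
    gcongr
    exact hL z
  have h3 : S ≤ ‖w‖ * ‖v‖ := by
    have := norm_inner_le_norm (𝕜 := ℂ) w v
    rwa [h1, Complex.norm_real, Real.norm_of_nonneg hS0] at this
  rcases hS0.eq_or_lt with h0 | h0
  · rw [← h0]
    positivity
  · have h4 : S * S ≤ L ^ 2 * ‖v‖ ^ 2 * S := by
      calc S * S ≤ (‖w‖ * ‖v‖) * (‖w‖ * ‖v‖) := by gcongr
        _ = ‖w‖ ^ 2 * ‖v‖ ^ 2 := by ring
        _ ≤ L ^ 2 * S * ‖v‖ ^ 2 := by gcongr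
        _ = _ := by ring
    exact le_of_mul_le_mul_right h4 h0

lemma isBddMul_phonon (hm : IsBddMul m volume) :
    IsBddMul (fun p : Conf N (n + 1) => conj (m (p.2 0))) volume :=
  ⟨Complex.continuous_conj.comp_aestronglyMeasurable
    (hm.1.comp_quasiMeasurePreserving (quasiMeasurePreserving_phonon 0)), hm.2.choose, fun p => by
      rw [RCLike.norm_conj]; exact hm.2.choose_spec _⟩

lemma removeS_mulLp (hm : IsBddMul m volume) (g : Form) (j : Fin N)
    (v : L2 N (n + 1)) :
    removeS (mulLp m hm g) j n v = removeS g j n (mulLp _ (isBddMul_phonon hm) v) := by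
  refine Lp.ext ?_
  filter_upwards [removeS_form_ae (mulLp m hm g) j v,
    removeS_form_ae g j (mulLp _ (isBddMul_phonon hm) v),
    ae_ae_cons (mulLp_ae (isBddMul_phonon hm) v)] with p h1 h2 h3
  rw [h1, h2]
  refine integral_congr_ae ?_
  filter_upwards [mulLp_ae hm g, h3] with k h4 h5
  simp only [formFactor]
  rw [h4, h5, Fin.cons_zero, map_mul, map_mul, map_mul]
  ring

lemma sum_sq_norm_alpha_le {ι : Type*} [DecidableEq ι] (s : Finset ι) (e : ι → Form)
    (ho : ∀ z z', z ≠ z' → inner ℂ (e z) (e z') = (0 : ℂ)) {L : ℝ} (hL : ∀ z, ‖e z‖ ≤ L)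
    (hm : IsBddMul m volume) {M : ℝ} (hM : ∀ k, ‖m k‖ ≤ M)
    (j : Fin N) (Ψ : Fk N) :
    ∑ z ∈ s, ‖alpha (mulLp m hm (e z)) j Ψ‖ ^ 2 ≤ L ^ 2 * M ^ 2 * ‖Ψ‖ ^ 2 := by
  have h1 : HasSum (fun n => ∑ z ∈ s, ‖removeS (mulLp m hm (e z)) j n (sec (n + 1) Ψ)‖ ^ 2)
      (∑ z ∈ s, ‖alpha (mulLp m hm (e z)) j Ψ‖ ^ 2) :=
    hasSum_sum fun z _ => (hasSum_sq_norm_sec _).congr_fun fun n => by rw [sec_alpha]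
  have h2 := (summable_sq_norm_succ Ψ).hasSum
  have h3 : ∑' n, ‖sec (n + 1) Ψ‖ ^ 2 ≤ ‖Ψ‖ ^ 2 := by
    rw [← (hasSum_sq_norm_sec Ψ).tsum_eq, (hasSum_sq_norm_sec Ψ).summable.tsum_eq_zero_add]
    exact le_add_of_nonneg_left (by positivity)
  refine (hasSum_le (fun n => ?_) h1 (h2.mul_left (L ^ 2 * M ^ 2))).trans (by gcongr)
  simp only [removeS_mulLp]
  refine (sum_sq_norm_removeS_le s e ho hL j _).trans ?_
  have h4 := norm_mulLp_le (isBddMul_phonon (N := N) (n := n) hm)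
    (fun p => by rw [RCLike.norm_conj]; exact hM _) (sec (n + 1) Ψ)
  exact (mul_le_mul_of_nonneg_left (pow_le_pow_left₀ (norm_nonneg _) h4 2) (sq_nonneg L)).trans
    (le_of_eq (by ring))

end Orthogonality

/-! ### Plane waves on a cube -/

section Cube

/-- The cube `[-R, R]³`. -/
def cube (R : ℝ) : Set E := {k | ∀ i, k i ∈ Set.Icc (-R) R}

lemma measurableSet_cube (R : ℝ) : MeasurableSet (cube R) := by
  have : cube R = ⋂ i : Fin 3, (fun k : E => k i) ⁻¹' Set.Icc (-R) R := by
    ext k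
    simp [cube]
  rw [this]
  exact MeasurableSet.iInter fun i => measurableSet_Icc.preimage (by fun_prop)

open scoped Classical in
lemma integral_cube_prod (R : ℝ) (f : Fin 3 → ℝ → ℂ) :
    ∫ k, (cube R).indicator (fun k : E => ∏ i, f i (k i)) k =
      ∏ i, ∫ x in Set.Icc (-R) R, f i x := by
  have h1 : (fun k : E => (cube R).indicator (fun k : E => ∏ i, f i (k i)) k) =
      fun k : E => (fun y : Fin 3 → ℝ => ∏ i, (Set.Icc (-R) R).indicator (f i) (y i))
        (WithLp.ofLp k) := by
    funext k
    simp only [Set.indicator_apply]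
    by_cases hk : k ∈ cube R
    · rw [if_pos hk]
      exact Finset.prod_congr rfl fun i _ => (if_pos (hk i)).symm
    · rw [if_neg hk]
      obtain ⟨i, hi⟩ := not_forall.1 hk
      exact (Finset.prod_eq_zero (Finset.mem_univ i) (if_neg hi)).symm
  rw [h1, (PiLp.volume_preserving_ofLp (Fin 3)).integral_comp
    (MeasurableEquiv.toLp 2 (Fin 3 → ℝ)).symm.measurableEmbedding
    (g := fun y : Fin 3 → ℝ => ∏ i, (Set.Icc (-R) R).indicator (f i) (y i)),
    integral_fintype_prod_volume_eq_prod]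
  exact Finset.prod_congr rfl fun i _ => integral_indicator measurableSet_Icc

lemma memLp_cube (R : ℝ) : MemLp ((cube R).indicator fun _ : E => (1 : ℂ)) 2 := by
  refine memLp_indicator_const 2 (measurableSet_cube R) 1 (Or.inr ?_)
  refine ((measure_mono (t := Metric.closedBall (0 : E) (3 * |R|)) fun k hk => ?_).trans_lt
    measure_closedBall_lt_top).ne
  rw [mem_closedBall_zero_iff, EuclideanSpace.norm_eq]
  refine Real.sqrt_le_iff.2 ⟨by positivity, ?_⟩
  have h : ∀ i, ‖k i‖ ^ 2 ≤ |R| ^ 2 := fun i => by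
    refine pow_le_pow_left₀ (norm_nonneg _) ?_ 2
    exact (abs_le.2 (hk i)).trans (le_abs_self R)
  rw [Fin.sum_univ_three]
  nlinarith [h 0, h 1, h 2, sq_nonneg R, sq_abs R]

/-- The indicator function of the cube `[-R, R]³`. -/
def box (R : ℝ) : Form := (memLp_cube R).toLp _

/-- The lattice dual to the cube `[-R, R]³`. -/
def latt (R : ℝ) (z : Fin 3 → ℕ) : E := WithLp.toLp 2 fun i => Real.pi / R * z i

lemma inner_modF_box (R : ℝ) (z z' : Fin 3 → ℕ) :
    inner ℂ (modF (latt R z) (box R)) (modF (latt R z') (box R)) =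
      ∏ i, ∫ x in Set.Icc (-R) R,
        Complex.exp (Complex.I * (Real.pi / R * ((z i : ℝ) - z' i) : ℝ) * x) := by
  rw [← integral_cube_prod R fun i x =>
    Complex.exp (Complex.I * (Real.pi / R * ((z i : ℝ) - z' i) : ℝ) * x), L2.inner_def]
  refine integral_congr_ae ?_
  filter_upwards [modF_ae (latt R z) (box R), modF_ae (latt R z') (box R),
    (memLp_cube R).coeFn_toLp] with k h1 h2 h3
  rw [h1, h2, box, h3]
  by_cases hk : k ∈ cube R
  · rw [Set.indicator_of_mem hk, Set.indicator_of_mem hk, mul_one, mul_one, RCLike.inner_apply,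
      ← Complex.exp_conj, ← Complex.exp_add, ← Complex.exp_sum]
    congr 1
    have e : ∀ z : Fin 3 → ℕ, inner ℝ k (latt R z) = ∑ i, Real.pi / R * z i * k i := fun z => by
      simp [PiLp.inner_apply, latt]
    rw [e, e]
    simp only [map_mul, map_neg, Complex.conj_I, Complex.conj_ofReal, Fin.sum_univ_three]
    push_cast
    ring
  · rw [Set.indicator_of_notMem hk, Set.indicator_of_notMem hk]
    simp

lemma integral_exp_period {R : ℝ} (hR : 0 < R) {a b : ℕ} (hab : a ≠ b) :
    ∫ x in Set.Icc (-R) R, Complex.exp (Complex.I * (Real.pi / R * ((a : ℝ) - b) : ℝ) * x) = 0 := by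
  have hab' : (a : ℝ) - b ≠ 0 := sub_ne_zero.2 (by exact_mod_cast hab)
  have hc : Complex.I * (Real.pi / R * ((a : ℝ) - b) : ℝ) ≠ 0 := by
    refine mul_ne_zero Complex.I_ne_zero (Complex.ofReal_ne_zero.2 ?_)
    exact mul_ne_zero (div_ne_zero Real.pi_ne_zero hR.ne') hab'
  rw [integral_Icc_eq_integral_Ioc, ← intervalIntegral.integral_of_le (by linarith),
    integral_exp_mul_complex hc]
  have hR' : (R : ℂ) ≠ 0 := Complex.ofReal_ne_zero.2 hR.ne'
  have e : Complex.I * (Real.pi / R * ((a : ℝ) - b) : ℝ) * (R : ℂ) =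
      Complex.I * (Real.pi / R * ((a : ℝ) - b) : ℝ) * ((-R : ℝ) : ℂ) +
        ((a : ℤ) - (b : ℤ) : ℤ) * (2 * Real.pi * Complex.I) := by
    push_cast
    field_simp
    ring
  rw [e, Complex.exp_periodic.int_mul, sub_self, zero_div]

lemma inner_modF_box_of_ne {R : ℝ} (hR : 0 < R) {z z' : Fin 3 → ℕ} (h : z ≠ z') :
    inner ℂ (modF (latt R z) (box R)) (modF (latt R z') (box R)) = 0 := by
  obtain ⟨i, hi⟩ := Function.ne_iff.1 h
  rw [inner_modF_box]
  exact Finset.prod_eq_zero (Finset.mem_univ i) (integral_exp_period hR hi)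

lemma sq_norm_modF_box {R : ℝ} (hR : 0 < R) (z : Fin 3 → ℕ) :
    ‖modF (latt R z) (box R)‖ ^ 2 = (2 * R) ^ 3 := by
  have h := inner_modF_box R z z
  rw [inner_self_eq_norm_sq_to_K] at h
  have e : ∀ i : Fin 3, ∫ x in Set.Icc (-R) R,
      Complex.exp (Complex.I * (Real.pi / R * ((z i : ℝ) - z i) : ℝ) * x) = ((2 * R : ℝ) : ℂ) := by
    intro i
    simp only [sub_self, mul_zero, Complex.ofReal_zero, zero_mul, Complex.exp_zero]
    rw [setIntegral_const, Complex.real_smul, mul_one, measureReal_def, Real.volume_Icc,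
      ENNReal.toReal_ofReal (by linarith)]
    congr 1
    ring
  rw [Finset.prod_congr rfl fun i _ => e i, Finset.prod_const] at h
  simp only [Finset.card_univ, Fintype.card_fin] at h
  exact Complex.ofReal_injective (by simpa using h)

end Cube

/-! ### Annihilation operators with singular form factors -/

section SingularForm

variable {N : ℕ} {j : Fin N}
variable {Ψ : Fk N} {χ : Fin 3 → Fk N} {g : Form}

lemma modF_neg_norm_le (z : E) (g : Form) : ‖modF z g‖ ≤ ‖g‖ := by
  have := norm_mulLp_le (isBddMul_phase z) (C := 1) (fun k => by simp [Complex.norm_exp]) g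
  rwa [one_mul] at this

lemma modF_mulLp {m : E → ℂ} (hm : IsBddMul m volume) (z : E) (g : Form) :
    modF z (mulLp m hm g) = mulLp m hm (modF z g) := by
  refine Lp.ext ?_
  filter_upwards [modF_ae z (mulLp m hm g), mulLp_ae hm g, mulLp_ae hm (modF z g), modF_ae z g]
    with k h1 h2 h3 h4
  rw [h1, h2, h3, h4]
  ring

lemma norm_trans_single_sub_le
    (h : ∀ i, (grad j i).HasGen Ψ (χ i)) (z : E) :
    ‖trans (Pi.single j z) Ψ - Ψ‖ ≤ ∑ i, |z i| * ‖χ i‖ := by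
  have h1 : ∀ s : Finset (Fin 3), ‖trans (∑ i ∈ s, z i • eDir j i) Ψ - Ψ‖ ≤
      ∑ i ∈ s, |z i| * ‖χ i‖ := by
    intro s
    induction s using Finset.induction_on with
    | empty => simp [trans_zero]
    | insert i s hi ih =>
      rw [Finset.sum_insert hi, Finset.sum_insert hi, add_comm (z i • eDir j i), ← trans_trans]
      have e : trans (∑ i ∈ s, z i • eDir j i) (trans (z i • eDir j i) Ψ) - Ψ =
          trans (∑ i ∈ s, z i • eDir j i) (trans (z i • eDir j i) Ψ - Ψ) +
            (trans (∑ i ∈ s, z i • eDir j i) Ψ - Ψ) := by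
        rw [map_sub]
        abel
      rw [e]
      refine (norm_add_le _ _).trans (add_le_add ?_ ih)
      rw [LinearIsometry.norm_map]
      exact (h i).norm_sub_le (z i)
  have e : Pi.single j z = ∑ i, z i • eDir j i := by
    funext l
    rw [Finset.sum_apply]
    by_cases hl : l = j
    · subst hl
      simp only [smul_eDir_self, Pi.single_eq_same]
      ext i
      simp [Finset.sum_apply, Pi.single_apply]
    · simp only [smul_eDir_of_ne hl, Pi.single_eq_of_ne hl, Finset.sum_const_zero]
  rw [e]
  exact h1 Finset.univ

/-- A form factor that is supported in the cube `[-R, R]³` and bounded by `M`: averaging over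
translations by the points of a lattice, the annihilation operator is bounded by derivatives with a
constant that improves on its operator norm. -/
lemma norm_alpha_le_of_lattice {m : E → ℂ} (hm : IsBddMul m volume) {M R c : ℝ}
    (hM : ∀ k, ‖m k‖ ≤ M) (hR : 0 < R) (hc : 0 ≤ c) {p : ℕ} (hp : 0 < p)
    (hb : (2 * R) ^ 3 * M ^ 2 ≤ (c * p ^ 3) ^ 2)
    (h : ∀ i, (grad j i).HasGen Ψ (χ i)) :
    ‖alpha (mulLp m hm (box R)) j Ψ‖ ≤
      c * p ^ 3 * (Real.pi * p ^ 2 / R) * ∑ i, ‖χ i‖ + c * ‖Ψ‖ := by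
  classical
  have hM0 : 0 ≤ M := (norm_nonneg _).trans (hM 0)
  set g := mulLp m hm (box R) with hg
  set P := p ^ 2 with hP
  have hL : ∀ z : Fin 3 → Fin P, ‖modF (latt R fun i => z i) (box R)‖ ≤ √((2 * R) ^ 3) := fun z =>
    Real.le_sqrt_of_sq_le (sq_norm_modF_box hR _).le
  have hsq : √((2 * R) ^ 3) ^ 2 * M ^ 2 ≤ (c * p ^ 3) ^ 2 := by
    rwa [Real.sq_sqrt (by positivity)]
  have hgn : ‖g‖ ≤ c * p ^ 3 := by
    refine (sq_le_sq₀ (norm_nonneg _) (by positivity)).1 (le_trans ?_ hb)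
    have h1 := norm_mulLp_le hm hM (box R)
    have h2 : ‖box R‖ ^ 2 = (2 * R) ^ 3 := by
      rw [← sq_norm_modF_box hR 0]
      have : latt R 0 = 0 := by
        ext i
        simp [latt]
      rw [this, modF_zero]
    calc ‖g‖ ^ 2 ≤ (M * ‖box R‖) ^ 2 := pow_le_pow_left₀ (norm_nonneg _) h1 2
      _ = _ := by rw [mul_pow, h2, mul_comm]
  have h1 : ∀ z : Fin 3 → Fin P, ‖alpha g j Ψ‖ ≤
      ‖alpha (mulLp m hm (modF (latt R fun i => z i) (box R))) j Ψ‖ +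
        c * p ^ 3 * (Real.pi * p ^ 2 / R) * ∑ i, ‖χ i‖ := by
    intro z
    set w : E := latt R fun i => z i
    have h2 := trans_alpha (Pi.single j w) g j Ψ
    rw [Pi.single_eq_same, hg, modF_mulLp, ← hg] at h2
    have h3 := norm_trans_single_sub_le h w
    have h4 : ‖alpha (mulLp m hm (modF w (box R))) j (trans (Pi.single j w) Ψ - Ψ)‖ ≤
        c * p ^ 3 * ∑ i, |w i| * ‖χ i‖ := by
      refine (norm_alpha_le _ _ _).trans ?_
      gcongr
      rw [← modF_mulLp]
      exact (modF_neg_norm_le _ _).trans hgn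
    have h5 : ∑ i, |w i| * ‖χ i‖ ≤ (Real.pi * p ^ 2 / R) * ∑ i, ‖χ i‖ := by
      rw [Finset.mul_sum]
      refine Finset.sum_le_sum fun i _ => ?_
      gcongr
      have e : w i = Real.pi / R * (z i : ℕ) := rfl
      rw [e, abs_of_nonneg (by positivity), div_mul_eq_mul_div]
      gcongr
      exact_mod_cast (z i).2.le
    calc ‖alpha g j Ψ‖ = ‖alpha (mulLp m hm (modF w (box R))) j (trans (Pi.single j w) Ψ)‖ := by
          rw [← h2, LinearIsometry.norm_map]
      _ = ‖alpha (mulLp m hm (modF w (box R))) j Ψ +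
            alpha (mulLp m hm (modF w (box R))) j (trans (Pi.single j w) Ψ - Ψ)‖ := by
          rw [← map_add, add_sub_cancel]
      _ ≤ _ := by
          refine (norm_add_le _ _).trans (add_le_add le_rfl (h4.trans ?_))
          rw [mul_assoc (c * (p : ℝ) ^ 3)]
          exact mul_le_mul_of_nonneg_left h5 (by positivity)
  have h2 := sum_sq_norm_alpha_le (Finset.univ : Finset (Fin 3 → Fin P))
    (fun z => modF (latt R fun i => z i) (box R)) (fun z z' hz => inner_modF_box_of_ne hR fun e =>
      hz (funext fun i => Fin.ext (congrFun e i))) hL hm hM j Ψ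
  have hcard : ((Finset.univ : Finset (Fin 3 → Fin P)).card : ℝ) = (p ^ 3 : ℝ) ^ 2 := by
    simp [hP]
    ring
  have h3 : ∑ z : Fin 3 → Fin P, ‖alpha (mulLp m hm (modF (latt R fun i => z i) (box R))) j Ψ‖ ≤
      (p ^ 3 : ℝ) ^ 2 * (c * ‖Ψ‖) := by
    refine (sq_le_sq₀ (Finset.sum_nonneg fun _ _ => norm_nonneg _) (by positivity)).1 ?_
    refine sq_sum_le_card_mul_sum_sq.trans ?_
    rw [hcard]
    calc _ ≤ (p ^ 3 : ℝ) ^ 2 * (√((2 * R) ^ 3) ^ 2 * M ^ 2 * ‖Ψ‖ ^ 2) := by gcongr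
      _ ≤ (p ^ 3 : ℝ) ^ 2 * ((c * p ^ 3) ^ 2 * ‖Ψ‖ ^ 2) := by gcongr
      _ = _ := by ring
  have h4 := Finset.sum_le_sum fun z (_ : z ∈ (Finset.univ : Finset (Fin 3 → Fin P))) => h1 z
  rw [Finset.sum_add_distrib, Finset.sum_const, Finset.sum_const, nsmul_eq_mul, nsmul_eq_mul,
    hcard] at h4
  have h5 : (p ^ 3 : ℝ) ^ 2 * ‖alpha g j Ψ‖ ≤ (p ^ 3 : ℝ) ^ 2 *
      (c * p ^ 3 * (Real.pi * p ^ 2 / R) * ∑ i, ‖χ i‖ + c * ‖Ψ‖) := by linarith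
  exact le_of_mul_le_mul_left h5 (by positivity)

/-! ### Cutoffs -/

lemma isBddMul_low (R : ℝ) :
    IsBddMul ((Metric.closedBall (0 : E) R).indicator fun _ => (1 : ℂ)) volume :=
  ⟨(measurable_const.indicator Metric.isClosed_closedBall.measurableSet).aestronglyMeasurable, 1,
    fun k => by
      by_cases hk : k ∈ Metric.closedBall (0 : E) R
      · simp [Set.indicator_of_mem hk]
      · simp [Set.indicator_of_notMem hk]⟩

/-- The restriction of a form factor to momenta `|k| ≤ R`. -/
def lowF (R : ℝ) : Form →L[ℂ] Form := mulLp _ (isBddMul_low R)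

open scoped Classical in
lemma lowF_ae (R : ℝ) (g : Form) :
    lowF R g =ᵐ[volume] fun k => if ‖k‖ ≤ R then g k else 0 := by
  filter_upwards [mulLp_ae (isBddMul_low R) g] with k hk
  rw [lowF, hk, Set.indicator_apply]
  simp only [mem_closedBall_zero_iff]
  split_ifs <;> simp

lemma isBddMul_kLow (i : Fin 3) (R : ℝ) :
    IsBddMul ((Metric.closedBall (0 : E) R).indicator fun k => -Complex.I * (k i : ℂ)) volume := by
  refine ⟨((by fun_prop : Measurable fun k : E => -Complex.I * (k i : ℂ)).indicator
    Metric.isClosed_closedBall.measurableSet).aestronglyMeasurable, |R|, fun k => ?_⟩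
  by_cases hk : k ∈ Metric.closedBall (0 : E) R
  · rw [Set.indicator_of_mem hk, norm_mul, norm_neg, Complex.norm_I, one_mul, Complex.norm_real]
    exact (PiLp.norm_apply_le k i).trans ((mem_closedBall_zero_iff.1 hk).trans (le_abs_self R))
  · rw [Set.indicator_of_notMem hk, norm_zero]
    positivity

/-- The form factor `-i kᵢ g`, restricted to momenta `|k| ≤ R`. -/
def kLow (i : Fin 3) (R : ℝ) : Form →L[ℂ] Form := mulLp _ (isBddMul_kLow i R)

open scoped Classical in
lemma kLow_ae (i : Fin 3) (R : ℝ) (g : Form) :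
    kLow i R g =ᵐ[volume] fun k => if ‖k‖ ≤ R then -Complex.I * (k i : ℂ) * g k else 0 := by
  filter_upwards [mulLp_ae (isBddMul_kLow i R) g] with k hk
  rw [kLow, hk, Set.indicator_apply]
  simp only [mem_closedBall_zero_iff]
  split_ifs <;> simp

lemma isMulK_low (i : Fin 3) (R : ℝ) (g : Form) : IsMulK i (lowF R g) (kLow i R g) := by
  refine ⟨⟨R, ?_⟩, ?_⟩
  · filter_upwards [lowF_ae R g] with k hk h
    rw [hk, if_neg (not_le.2 h)]
  · filter_upwards [lowF_ae R g, kLow_ae i R g] with k h1 h2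
    rw [h1, h2]
    split_ifs <;> simp

lemma tendsto_lowF (g : Form) : Tendsto (fun R => lowF R g) atTop (𝓝 g) := by
  have h0 : Tendsto (fun R : ℝ => ∫ k, ‖(g - lowF R g : Form) k‖ ^ 2) atTop
      (𝓝 (∫ _ : E, (0 : ℝ))) := by
    have hint : Integrable (fun k => ‖g k‖ ^ 2) volume :=
      (memLp_two_iff_integrable_sq_norm (Lp.aestronglyMeasurable g)).1 (Lp.memLp g)
    have hae : ∀ R : ℝ, (fun k => ‖(g - lowF R g : Form) k‖ ^ 2) =ᵐ[volume]
        fun k => if ‖k‖ ≤ R then 0 else ‖g k‖ ^ 2 := fun R => by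
      filter_upwards [Lp.coeFn_sub g (lowF R g), lowF_ae R g] with k h1 h2
      rw [h1, Pi.sub_apply, h2]
      split_ifs <;> simp
    refine Tendsto.congr (fun R => (integral_congr_ae (hae R)).symm) ?_
    refine tendsto_integral_filter_of_dominated_convergence (fun k => ‖g k‖ ^ 2)
      (Eventually.of_forall fun R => ?_) (Eventually.of_forall fun R => ae_of_all _ fun k => ?_)
      hint (ae_of_all _ fun k => ?_)
    · exact ((Lp.aestronglyMeasurable (g - lowF R g)).norm.pow 2).congr (hae R)
    · split_ifs <;> simp
    · refine tendsto_const_nhds.congr' ?_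
      filter_upwards [eventually_ge_atTop ‖k‖] with R hR
      rw [if_pos hR]
  simp only [integral_zero, ← sq_norm_Lp_two] at h0
  rw [tendsto_iff_norm_sub_tendsto_zero]
  have h1 := h0.sqrt
  simp only [Real.sqrt_sq (norm_nonneg _), Real.sqrt_zero] at h1
  refine h1.congr fun R => norm_sub_rev _ _

lemma alpha_sub_form (g g' : Form) (j : Fin N) (Ψ : Fk N) :
    alpha (g - g') j Ψ = alpha g j Ψ - alpha g' j Ψ := by
  rw [eq_sub_iff_add_eq, ← alpha_add_form, sub_add_cancel]

lemma alphaD_sub_form (g g' : Form) (j : Fin N) (Ψ : Fk N) :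
    alphaD (g - g') j Ψ = alphaD g j Ψ - alphaD g' j Ψ := by
  rw [eq_sub_iff_add_eq, ← alphaD_add_form, sub_add_cancel]

lemma tendsto_alpha_form {ι : Type*} {l : Filter ι} {g : ι → Form} {g' : Form}
    (h : Tendsto g l (𝓝 g')) (j : Fin N) (Ψ : Fk N) :
    Tendsto (fun n => alpha (g n) j Ψ) l (𝓝 (alpha g' j Ψ)) := by
  rw [tendsto_iff_norm_sub_tendsto_zero] at h ⊢
  refine squeeze_zero (fun _ => norm_nonneg _) (fun n => ?_) (by simpa using h.mul_const ‖Ψ‖)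
  rw [← alpha_sub_form]
  exact norm_alpha_le _ _ _

lemma tendsto_alphaD_form {ι : Type*} {l : Filter ι} {g : ι → Form} {g' : Form}
    (h : Tendsto g l (𝓝 g')) (j : Fin N) (Ψ : Fk N) :
    Tendsto (fun n => alphaD (g n) j Ψ) l (𝓝 (alphaD g' j Ψ)) := by
  rw [tendsto_iff_norm_sub_tendsto_zero] at h ⊢
  refine squeeze_zero (fun _ => norm_nonneg _) (fun n => ?_) (by simpa using h.mul_const ‖Ψ‖)
  rw [← alphaD_sub_form]
  exact norm_alphaD_le _ _ _

/-- The contribution of one momentum shell. -/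
lemma norm_alpha_shell_le (hg : ∀ᵐ k, ‖k‖ ^ 2 * ‖g k‖ ≤ 1) (i : Fin 3) (m : ℕ)
    (h : ∀ i, (grad j i).HasGen Ψ (χ i)) :
    ‖alpha (kLow i (1024 ^ (m + 1)) g) j Ψ - alpha (kLow i (1024 ^ m) g) j Ψ‖ ≤
      2 ^ 17 / 2 ^ m * (∑ i, ‖χ i‖ + ‖Ψ‖) := by
  classical
  rw [← alpha_sub_form]
  -- the form factor of the shell, cut off pointwise at its almost everywhere bound
  set μ : E → ℂ := fun k => if (1024 : ℝ) ^ m < ‖k‖ ∧ ‖k‖ ≤ 1024 ^ (m + 1) ∧ ‖k‖ ^ 2 * ‖g k‖ ≤ 1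
    then -Complex.I * (k i : ℂ) * g k else 0 with hμ
  have hμb : ∀ k, ‖μ k‖ ≤ 1 / 1024 ^ m := by
    intro k
    simp only [hμ]
    split_ifs with hk
    · obtain ⟨h1, _, h3⟩ := hk
      have h0 : (0 : ℝ) < 1024 ^ m := by positivity
      rw [norm_mul, norm_mul, norm_neg, Complex.norm_I, one_mul, Complex.norm_real,
        le_div_iff₀ h0]
      have h4 : ‖k i‖ ≤ ‖k‖ := PiLp.norm_apply_le k i
      calc ‖k i‖ * ‖g k‖ * 1024 ^ m ≤ ‖k‖ * ‖g k‖ * ‖k‖ := by gcongr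
        _ = ‖k‖ ^ 2 * ‖g k‖ := by ring
        _ ≤ 1 := h3
    · rw [norm_zero]
      positivity
  have hμm : IsBddMul μ volume := by
    refine ⟨?_, _, hμb⟩
    have h1 : AEStronglyMeasurable (fun k => if (1024 : ℝ) ^ m < ‖k‖ ∧ ‖k‖ ≤ 1024 ^ (m + 1)
        then -Complex.I * (k i : ℂ) * g k else 0) volume := by
      have h2 : MeasurableSet {k : E | (1024 : ℝ) ^ m < ‖k‖ ∧ ‖k‖ ≤ 1024 ^ (m + 1)} :=
        (measurableSet_lt measurable_const measurable_norm).inter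
          (measurableSet_le measurable_norm measurable_const)
      have h3 : AEStronglyMeasurable (fun k : E => -Complex.I * (k i : ℂ) * g k) volume :=
        (Continuous.aestronglyMeasurable (by fun_prop)).mul (Lp.aestronglyMeasurable g)
      refine (h3.indicator h2).congr (ae_of_all _ fun k => ?_)
      simp [Set.indicator_apply]
    refine h1.congr ?_
    filter_upwards [hg] with k hk
    simp only [hμ, hk, and_true]
  have e : kLow i (1024 ^ (m + 1)) g - kLow i (1024 ^ m) g =
      mulLp μ hμm (box (1024 ^ (m + 1))) := by
    refine Lp.ext ?_
    filter_upwards [Lp.coeFn_sub (kLow i (1024 ^ (m + 1)) g) (kLow i (1024 ^ m) g),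
      kLow_ae i (1024 ^ (m + 1)) g, kLow_ae i (1024 ^ m) g,
      mulLp_ae hμm (box (1024 ^ (m + 1))), (memLp_cube (1024 ^ (m + 1))).coeFn_toLp, hg]
      with k h1 h2 h3 h4 h5 h6
    rw [h1, Pi.sub_apply, h2, h3, h4, box, h5]
    simp only [hμ, h6, and_true]
    have hle : (1024 : ℝ) ^ m ≤ 1024 ^ (m + 1) := pow_le_pow_right₀ (by norm_num) (by omega)
    by_cases h7 : ‖k‖ ≤ 1024 ^ (m + 1)
    · have hc : k ∈ cube (1024 ^ (m + 1)) := fun i =>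
        abs_le.1 ((PiLp.norm_apply_le k i).trans h7)
      rw [Set.indicator_of_mem hc, mul_one, if_pos h7]
      by_cases h8 : ‖k‖ ≤ 1024 ^ m
      · rw [if_pos h8, if_neg fun h => absurd h.1 (not_lt.2 h8), sub_self]
      · rw [if_neg h8, if_pos ⟨not_le.1 h8, h7⟩, sub_zero]
    · have h8 : ¬ ‖k‖ ≤ 1024 ^ m := fun h => h7 (h.trans hle)
      rw [if_neg h7, if_neg h8, if_neg fun h => h7 h.2, sub_self, zero_mul]
  rw [e]
  have h2m : (0 : ℝ) < 2 ^ m := by positivity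
  have e4 : (4 : ℝ) ^ m = (2 ^ m) ^ 2 := by rw [← pow_mul, mul_comm, pow_mul]; norm_num
  have e1024 : (1024 : ℝ) ^ m = (2 ^ m) ^ 10 := by rw [← pow_mul, mul_comm, pow_mul]; norm_num
  have hmain := norm_alpha_le_of_lattice (N := N) (j := j) hμm hμb (R := 1024 ^ (m + 1))
    (c := 2 ^ 17 / 2 ^ m) (by positivity) (by positivity) (p := 4 ^ m) (by positivity)
    (by
      push_cast
      rw [pow_succ (1024 : ℝ) m, e4, e1024]
      set x := (2 : ℝ) ^ m
      have : (2 * (x ^ 10 * 1024)) ^ 3 * (1 / x ^ 10) ^ 2 = 2 ^ 33 * x ^ 10 := by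
        field_simp
        norm_num
      have h2 : (2 ^ 17 / x * (x ^ 2) ^ 3) ^ 2 = 2 ^ 34 * x ^ 10 := by
        field_simp
      rw [this, h2]
      gcongr <;> norm_num) h
  refine hmain.trans ?_
  rw [mul_add]
  gcongr
  push_cast
  rw [pow_succ (1024 : ℝ) m, e4, e1024]
  set x := (2 : ℝ) ^ m
  have : 2 ^ 17 / x * (x ^ 2) ^ 3 * (Real.pi * (x ^ 2) ^ 2 / (x ^ 10 * 1024)) =
      2 ^ 17 / x * (Real.pi / 1024) := by
    field_simp
  rw [this]
  refine mul_le_of_le_one_right (by positivity) ?_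
  have := Real.pi_le_four
  linarith

/-- The commutator of a derivative with an annihilation operator whose form factor decays like
`|k|⁻²`: although `-i kᵢ g` is not square integrable, the commutator is infinitesimally bounded by
the derivatives. -/
lemma exists_hasGen_alpha_singular (hg : ∀ᵐ k, ‖k‖ ^ 2 * ‖g k‖ ≤ 1) (i : Fin 3)
    (h : ∀ i, (grad j i).HasGen Ψ (χ i)) :
    ∃ y, (grad j i).HasGen (alpha g j Ψ) (y + alpha g j (χ i)) ∧
      ∀ m : ℕ, ‖y - alpha (kLow i (1024 ^ m) g) j Ψ‖ ≤ 2 ^ 18 / 2 ^ m * (∑ i, ‖χ i‖ + ‖Ψ‖) := by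
  set S := ∑ i, ‖χ i‖ + ‖Ψ‖ with hS
  set f : ℕ → Fk N := fun m => alpha (kLow i (1024 ^ m) g) j Ψ with hf
  have h1 : ∀ m, dist (f m) (f (m + 1)) ≤ 2 ^ 18 * S / 2 / 2 ^ m := fun m => by
    rw [dist_comm, dist_eq_norm]
    refine (norm_alpha_shell_le hg i m h).trans (le_of_eq ?_)
    ring
  obtain ⟨y, hy⟩ := cauchySeq_tendsto_of_complete (cauchySeq_of_le_geometric_two h1)
  refine ⟨y, ?_, fun m => ?_⟩
  · have h2 : Tendsto (fun m : ℕ => lowF (1024 ^ m) g) atTop (𝓝 g) :=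
      (tendsto_lowF g).comp (tendsto_pow_atTop_atTop_of_one_lt (by norm_num))
    exact UnitaryGroup.hasGen_of_tendsto (fun m => hasGen_alpha (h i) (isMulK_low i (1024 ^ m) g))
      (tendsto_alpha_form h2 j Ψ) (hy.add (tendsto_alpha_form h2 j (χ i)))
  · have := dist_le_of_le_geometric_two_of_tendsto h1 hy m
    rw [dist_comm, dist_eq_norm] at this
    refine this.trans (le_of_eq ?_)
    ring

/-- The commutator is infinitesimally bounded by the derivatives. -/
lemma exists_bound_of_singular (i : Fin 3) {ε : ℝ} (hε : 0 < ε) :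
    ∃ C : ℝ, 0 ≤ C ∧ ∀ {j : Fin N} {Ψ y : Fk N} {s : ℝ}, 0 ≤ s →
      (∀ m : ℕ, ‖y - alpha (kLow i (1024 ^ m) g) j Ψ‖ ≤ 2 ^ 18 / 2 ^ m * (s + ‖Ψ‖)) →
      ‖y‖ ≤ ε * s + C * ‖Ψ‖ := by
  obtain ⟨m, hm⟩ := exists_pow_lt_of_lt_one (show 0 < ε / 2 ^ 18 by positivity)
    (show (1 / 2 : ℝ) < 1 by norm_num)
  have hm' : 2 ^ 18 / 2 ^ m ≤ ε := by
    rw [div_pow, one_pow, div_lt_div_iff₀ (by positivity) (by positivity), one_mul] at hm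
    rw [div_le_iff₀ (by positivity)]
    exact hm.le
  refine ⟨ε + ‖kLow i (1024 ^ m) g‖, by positivity, fun {j Ψ y s} hs h => ?_⟩
  have h1 := norm_alpha_le (kLow i (1024 ^ m) g) j Ψ
  have h2 : ‖y‖ ≤ ‖y - alpha (kLow i (1024 ^ m) g) j Ψ‖ + ‖alpha (kLow i (1024 ^ m) g) j Ψ‖ := by
    simpa using norm_add_le (y - alpha (kLow i (1024 ^ m) g) j Ψ) (alpha (kLow i (1024 ^ m) g) j Ψ)
  have h3 : 2 ^ 18 / 2 ^ m * (s + ‖Ψ‖) ≤ ε * (s + ‖Ψ‖) := by gcongr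
  nlinarith [h m]

end SingularForm

/-! ### Second derivatives and the number operator -/

section Regularity

variable {N : ℕ}
variable {d Ψ χ : Fk N} {j : Fin N} {i : Fin 3}

/-- The projection to `n` phonons. -/
def secProj (n : ℕ) (Ψ : Fk N) : Fk N := numFun (fun m => if m = n then 1 else 0) Ψ

lemma secProj_mem (n : ℕ) (Ψ : Fk N) : Ψ ∈ numDom N fun m => if m = n then 1 else 0 :=
  numDom_of_bounded (B := 1) (fun m => by split_ifs <;> simp) Ψ

lemma inner_secProj (n : ℕ) (Ψ χ : Fk N) :
    inner ℂ (secProj n Ψ) χ = inner ℂ (sec n Ψ) (sec n χ) := by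
  refine (hasSum_inner_sec _ _).unique ?_
  have h : ∀ m, m ≠ n → inner ℂ (sec m (secProj n Ψ)) (sec m χ) = 0 := fun m hm => by
    rw [secProj, sec_numFun (secProj_mem n Ψ), if_neg hm, zero_smul, inner_zero_left]
  have h1 := hasSum_single n h
  rwa [secProj, sec_numFun (secProj_mem n Ψ), if_pos rfl, one_smul] at h1

lemma inner_sec_of_hasGen {Ψ' χ' : Fk N}
    (h : (grad j i).HasGen Ψ χ) (h' : (grad j i).HasGen Ψ' χ') (n : ℕ) :
    inner ℂ (sec n χ) (sec n Ψ') = -inner ℂ (sec n Ψ) (sec n χ') := by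
  rw [← inner_secProj, ← inner_secProj]
  exact (hasGen_numFun (secProj_mem n Ψ) (secProj_mem n χ) h).inner_left h'

/-- Interpolation: a vector in the domain of `𝓝` with a square integrable second derivative has its
first derivative in the domain of `𝓝^{1/2}`. -/
lemma deriv_mem_sq0 (h : (grad j i).HasGen Ψ χ)
    (h' : (grad j i).HasGen χ d) (hΨ : Ψ ∈ numDom N wN) :
    χ ∈ numDom N sq0 ∧ inner ℂ (numFun wN Ψ) (-d) = ((‖numFun sq0 χ‖ ^ 2 : ℝ) : ℂ) := by
  have h1 : ∀ n, inner ℂ (sec n (numFun wN Ψ)) (sec n (-d)) = ((‖sq0 n • sec n χ‖ ^ 2 : ℝ) : ℂ) := by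
    intro n
    have h2 := inner_sec_of_hasGen h h' n
    rw [sec_numFun hΨ, sec_neg, inner_neg_right, inner_smul_left, ← mul_neg, ← h2, norm_smul,
      mul_pow, norm_sq0_sq, inner_self_eq_norm_sq_to_K]
    simp [wN]
  have h2 := (hasSum_inner_sec (numFun wN Ψ) (-d)).congr_fun fun n => (h1 n).symm
  have h3 : χ ∈ numDom N sq0 := Complex.summable_ofReal.1 h2.summable
  refine ⟨h3, h2.unique ?_⟩
  exact Complex.hasSum_ofReal.2 ((hasSum_sq_norm_sec (numFun sq0 χ)).congr_fun fun n => by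
    rw [sec_numFun h3])

lemma inner_neg_second (h : (grad j i).HasGen Ψ χ)
    (h' : (grad j i).HasGen χ d) : inner ℂ Ψ (-d) = ((‖χ‖ ^ 2 : ℝ) : ℂ) := by
  rw [inner_neg_right, ← h.inner_left h', inner_self_eq_norm_sq_to_K]
  norm_cast

/-! ### Commutators with the square root of the number operator -/

lemma norm_sq1_mul_sub_le (n : ℕ) : ‖sq1 n * (sq1 n - sq0 n)‖ ≤ 1 := by
  have h1 : √(n : ℝ) ≤ √(n + 1 : ℝ) := Real.sqrt_le_sqrt (by linarith)
  have e : sq1 n * (sq1 n - sq0 n) = ((√(n + 1 : ℝ) * (√(n + 1 : ℝ) - √(n : ℝ)) : ℝ) : ℂ) := by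
    simp [sq1, sq0]
  have h2 := Real.sq_sqrt (show (0 : ℝ) ≤ n by positivity)
  have h3 := Real.sq_sqrt (show (0 : ℝ) ≤ (n : ℝ) + 1 by positivity)
  have h4 := Real.sqrt_nonneg (n : ℝ)
  rw [e, Complex.norm_real, Real.norm_of_nonneg (mul_nonneg (Real.sqrt_nonneg _) (by linarith))]
  nlinarith

lemma norm_sq0_ann_sub_le (h : Ψ ∈ numDom N wN) (g : Form) (j : Fin N) :
    ‖numFun sq0 (ann g j Ψ) - ann g j (numFun sq0 Ψ)‖ ≤ ‖g‖ * ‖Ψ‖ := by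
  refine norm_le_of_sec_le_succ (norm_nonneg _) fun n => ?_
  have e : sec n (numFun sq0 (ann g j Ψ) - ann g j (numFun sq0 Ψ)) =
      (-(sq1 n * (sq1 n - sq0 n))) • removeS g j n (sec (n + 1) Ψ) := by
    rw [sec_sub, sec_numFun (ann_mem_sq0 h g j).1, sec_ann (wN_le_sq0 h),
      sec_ann (numFun_sq0_mem h), sec_numFun (wN_le_sq0 h), map_smul, L2_smul_smul, L2_smul_smul,
      sq0_succ, ← sub_smul]
    congr 1
    ring
  rw [e, norm_smul, norm_neg]
  calc _ ≤ 1 * (‖g‖ * ‖sec (n + 1) Ψ‖) :=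
        mul_le_mul (norm_sq1_mul_sub_le n) (norm_removeS_le _ _ _) (norm_nonneg _) zero_le_one
    _ = _ := one_mul _

lemma norm_sq0_cre_sub_le (h : Ψ ∈ numDom N wN) (g : Form) (j : Fin N) :
    ‖numFun sq0 (cre g j Ψ) - cre g j (numFun sq0 Ψ)‖ ≤ ‖g‖ * ‖Ψ‖ := by
  refine norm_le_of_sec_succ_le (norm_nonneg _) ?_ fun n => ?_
  · rw [sec_sub, sec_numFun (cre_mem_sq0 h g j).1, sec_zero_cre, sec_zero_cre, smul_zero, sub_zero]
  have e : sec (n + 1) (numFun sq0 (cre g j Ψ) - cre g j (numFun sq0 Ψ)) =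
      (sq1 n * (sq1 n - sq0 n)) • symInsertS g j n (sec n Ψ) := by
    rw [sec_sub, sec_numFun (cre_mem_sq0 h g j).1, sec_succ_cre (wN_le_sq0 h),
      sec_succ_cre (numFun_sq0_mem h), sec_numFun (wN_le_sq0 h), map_smul, L2_smul_smul,
      L2_smul_smul, sq0_succ, ← sub_smul]
    congr 1
    ring
  rw [e, norm_smul]
  calc _ ≤ 1 * (‖g‖ * ‖sec n Ψ‖) :=
        mul_le_mul (norm_sq1_mul_sub_le n) (norm_symInsertS_le _ _ _) (norm_nonneg _) zero_le_one
    _ = _ := one_mul _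

lemma norm_sq0_fld_sub_le (h : Ψ ∈ numDom N wN) (g : Form) (j : Fin N) :
    ‖numFun sq0 (fld g j Ψ) - fld g j (numFun sq0 Ψ)‖ ≤ 2 * ‖g‖ * ‖Ψ‖ := by
  have e : numFun sq0 (fld g j Ψ) - fld g j (numFun sq0 Ψ) =
      (numFun sq0 (ann g j Ψ) - ann g j (numFun sq0 Ψ)) +
        (numFun sq0 (cre g j Ψ) - cre g j (numFun sq0 Ψ)) := by
    rw [fld, numFun_add (ann_mem_sq0 h g j).1 (cre_mem_sq0 h g j).1, fld]
    abel
  rw [e]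
  refine (norm_add_le _ _).trans ((add_le_add (norm_sq0_ann_sub_le h g j)
    (norm_sq0_cre_sub_le h g j)).trans (le_of_eq ?_))
  ring

/-! ### A lower bound for the interaction relative to the number operator -/

lemma isFin_fld (h : IsFin Ψ) (g : Form) (j : Fin N) : IsFin (fld g j Ψ) :=
  (isFin_alpha (h.numFun _) g j).add (isFin_alphaD (h.numFun _) g j)

lemma inner_wN (h : Ψ ∈ numDom N wN) (h' : χ ∈ numDom N sq0) :
    inner ℂ (numFun wN Ψ) χ = inner ℂ (numFun sq0 Ψ) (numFun sq0 χ) := by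
  rw [← numFun_sq0_sq0 h, inner_numFun_symm conj_sq0 h' (numFun_sq0_mem h)]

lemma ann_add_form (g g' : Form) (j : Fin N) (Ψ : Fk N) :
    ann (g + g') j Ψ = ann g j Ψ + ann g' j Ψ := alpha_add_form _ _ _ _

lemma cre_add_form (g g' : Form) (j : Fin N) (Ψ : Fk N) :
    cre (g + g') j Ψ = cre g j Ψ + cre g' j Ψ := alphaD_add_form _ _ _ _

/-- The part of the interaction that is odd under exchange of emission and absorption. -/
lemma abs_im_ann_sub_cre_le {Θ D : Fk N}
    (hD : D ∈ phSym N) (fΘ : IsFin Θ) (fD : IsFin D) (h : (grad j i).HasGen Θ D) (g : Form)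
    (R : ℝ) :
    |(inner ℂ D (ann g j Θ) - inner ℂ D (cre g j Θ)).im| ≤
      ‖Θ‖ * (‖kLow i R g‖ * ‖numFun sq0 Θ‖) +
        ‖D‖ * (‖g - lowF R g‖ * (2 * ‖numFun sq0 Θ‖ + ‖Θ‖)) := by
  set gl := lowF R g
  set gh := g - gl with hgh
  have hg : g = gl + gh := by rw [hgh, add_sub_cancel]
  have hΘ0 := fΘ.mem_numDom sq0
  have hD0 := fD.mem_numDom sq0
  have h1 : (inner ℂ D (ann gl j Θ) - inner ℂ D (cre gl j Θ)).im =
      -(inner ℂ Θ (ann (kLow i R g) j Θ)).im := by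
    have h2 : (grad j i).HasGen (ann gl j Θ) (ann (kLow i R g) j Θ + ann gl j D) :=
      hasGen_alpha (hasGen_numFun hΘ0 hD0 h) (isMulK_low i R g)
    have h3 := h.inner_left h2
    have h4 : inner ℂ Θ (ann gl j D) = conj (inner ℂ D (cre gl j Θ)) := by
      rw [inner_cre_right hD hD0 hΘ0, inner_conj_symm]
    rw [h3, inner_add_right, h4]
    simp only [Complex.sub_im, Complex.neg_im, Complex.add_im, Complex.conj_im]
    ring
  have h5 : |(inner ℂ Θ (ann (kLow i R g) j Θ)).im| ≤ ‖Θ‖ * (‖kLow i R g‖ * ‖numFun sq0 Θ‖) :=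
    (Complex.abs_im_le_norm _).trans ((norm_inner_le_norm _ _).trans (by
      gcongr; exact norm_ann_le _ _ _))
  have h6 : |(inner ℂ D (ann gh j Θ) - inner ℂ D (cre gh j Θ)).im| ≤
      ‖D‖ * (‖gh‖ * (2 * ‖numFun sq0 Θ‖ + ‖Θ‖)) := by
    rw [← inner_sub_right]
    refine (Complex.abs_im_le_norm _).trans ((norm_inner_le_norm _ _).trans ?_)
    gcongr
    refine (norm_sub_le _ _).trans ((add_le_add (norm_ann_le _ _ _)
      (norm_cre_le _ _ hΘ0)).trans (le_of_eq ?_))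
    ring
  have e : (inner ℂ D (ann g j Θ) - inner ℂ D (cre g j Θ)).im =
      (inner ℂ D (ann gl j Θ) - inner ℂ D (cre gl j Θ)).im +
        (inner ℂ D (ann gh j Θ) - inner ℂ D (cre gh j Θ)).im := by
    rw [hg, ann_add_form, cre_add_form, inner_add_right, inner_add_right]
    simp only [Complex.sub_im, Complex.add_im]
    ring
  rw [e, h1]
  refine (abs_add_le _ _).trans (add_le_add ?_ h6)
  rwa [abs_neg]

/-- The interaction of one component of the momentum of one particle with the phonons, tested against
the number operator, for finitely many phonons: up to lower order terms, the kinetic energy of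
`Θ = 𝓝^{1/2} Ψ` completes the square of the field. -/
lemma re_inner_wN_ge {w : Fk N} (sΨ : Ψ ∈ phSym N)
    (sχ : χ ∈ phSym N) (fΨ : IsFin Ψ) (fχ : IsFin χ) (h : (grad j i).HasGen Ψ χ)
    (h' : (grad j i).HasGen χ d) {g : Form} (hw : (grad j i).HasGen (ann g j Ψ) w) (c R : ℝ) :
    -(2 * |c| * (‖g‖ * (‖numFun sq0 χ‖ * ‖Ψ‖ + ‖numFun sq0 Ψ‖ * ‖χ‖)) +
      c ^ 2 * (2 * ‖g‖ ^ 2 * (‖Ψ‖ * (2 * ‖numFun wN Ψ‖ + ‖numFun sq0 Ψ‖) +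
        ‖numFun sq0 Ψ‖ * (2 * ‖numFun sq0 Ψ‖ + ‖Ψ‖))) +
      2 * |c| * (‖numFun sq0 Ψ‖ * (‖kLow i R g‖ * ‖numFun wN Ψ‖) +
        ‖numFun sq0 χ‖ * (‖g - lowF R g‖ * (2 * ‖numFun wN Ψ‖ + ‖numFun sq0 Ψ‖)))) ≤
    (inner ℂ (numFun wN Ψ) (-d + ((2 * Complex.I * c) • (w + cre g j χ) +
      ((c : ℂ) ^ 2) • fld g j (fld g j Ψ)))).re := by
  have hN := fΨ.mem_numDom wN
  have h0 := fΨ.mem_numDom sq0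
  have hχ0 := fχ.mem_numDom sq0
  have hχN := fχ.mem_numDom wN
  set Θ := numFun sq0 Ψ with hΘ
  set D := numFun sq0 χ with hD
  have fΘ : IsFin Θ := fΨ.numFun _
  have fD : IsFin D := fχ.numFun _
  have sΘ : Θ ∈ phSym N := numFun_mem_phSym sΨ _
  have sD : D ∈ phSym N := numFun_mem_phSym sχ _
  have hΘ0 := fΘ.mem_numDom sq0
  have hD0 := fD.mem_numDom sq0
  have hΘD : (grad j i).HasGen Θ D := hasGen_numFun h0 hχ0 h
  have eN : numFun sq0 Θ = numFun wN Ψ := numFun_sq0_sq0 hN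
  -- the kinetic energy
  have k1 := (deriv_mem_sq0 h h' hN).2
  -- absorption
  have k2 : inner ℂ (numFun wN Ψ) w = -inner ℂ D (ann g j Θ) -
      inner ℂ D (numFun sq0 (ann g j Ψ) - ann g j Θ) := by
    have h2 := (hasGen_numFun hN hχN h).inner_left hw
    rw [inner_wN hχN (ann_mem_sq0 hN g j).1] at h2
    rw [inner_sub_right, ← neg_eq_iff_eq_neg.2 h2]
    ring
  -- emission
  have k3 : inner ℂ (numFun wN Ψ) (cre g j χ) = conj (inner ℂ D (ann g j Θ)) +
      inner ℂ Θ (numFun sq0 (cre g j χ) - cre g j D) := by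
    rw [inner_wN hN (cre_mem_sq0 hχN g j).1, inner_conj_symm, ← inner_cre_right sΘ hΘ0 hD0,
      ← inner_add_right, add_sub_cancel]
  -- the square of the field
  have fF : IsFin (fld g j Ψ) := isFin_fld fΨ g j
  have sF : fld g j Ψ ∈ phSym N := fld_mem_phSym sΨ g j
  have k4 : inner ℂ (numFun wN Ψ) (fld g j (fld g j Ψ)) = ((‖fld g j Θ‖ ^ 2 : ℝ) : ℂ) +
      inner ℂ (fld g j Θ) (numFun sq0 (fld g j Ψ) - fld g j Θ) +
      inner ℂ Θ (numFun sq0 (fld g j (fld g j Ψ)) - fld g j (numFun sq0 (fld g j Ψ))) := by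
    have h2 : ((‖fld g j Θ‖ ^ 2 : ℝ) : ℂ) = inner ℂ (fld g j Θ) (fld g j Θ) := by
      rw [inner_self_eq_norm_sq_to_K]
      norm_cast
    rw [inner_wN hN ((isFin_fld fF g j).mem_numDom sq0), h2, ← inner_add_right, add_sub_cancel,
      ← inner_fld_right sΘ (numFun_mem_phSym sF _) hΘ0 ((fF.numFun sq0).mem_numDom sq0),
      ← inner_add_right, add_sub_cancel]
  have J := abs_im_ann_sub_cre_le sD fΘ fD hΘD g R
  rw [eN] at J
  set z := inner ℂ D (ann g j Θ) with hz
  set z' := inner ℂ D (cre g j Θ) with hz'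
  set r1 := inner ℂ D (numFun sq0 (ann g j Ψ) - ann g j Θ) with hr1
  set r2 := inner ℂ Θ (numFun sq0 (cre g j χ) - cre g j D) with hr2
  set r3 := inner ℂ (fld g j Θ) (numFun sq0 (fld g j Ψ) - fld g j Θ) with hr3
  set r4 := inner ℂ Θ (numFun sq0 (fld g j (fld g j Ψ)) - fld g j (numFun sq0 (fld g j Ψ)))
    with hr4
  have hFΘ : ‖fld g j Θ‖ ≤ ‖g‖ * (2 * ‖numFun wN Ψ‖ + ‖Θ‖) := by
    have := norm_fld_le g j hΘ0
    rwa [eN] at this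
  have hFΨ : ‖fld g j Ψ‖ ≤ ‖g‖ * (2 * ‖Θ‖ + ‖Ψ‖) := norm_fld_le g j h0
  have b1 : ‖r1‖ ≤ ‖D‖ * (‖g‖ * ‖Ψ‖) :=
    (norm_inner_le_norm _ _).trans (by gcongr; exact norm_sq0_ann_sub_le hN g j)
  have b2 : ‖r2‖ ≤ ‖Θ‖ * (‖g‖ * ‖χ‖) :=
    (norm_inner_le_norm _ _).trans (by gcongr; exact norm_sq0_cre_sub_le hχN g j)
  have b3 : ‖r3‖ ≤ ‖g‖ * (2 * ‖numFun wN Ψ‖ + ‖Θ‖) * (2 * ‖g‖ * ‖Ψ‖) :=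
    (norm_inner_le_norm _ _).trans (by gcongr; exact norm_sq0_fld_sub_le hN g j)
  have b4 : ‖r4‖ ≤ ‖Θ‖ * (2 * ‖g‖ * (‖g‖ * (2 * ‖Θ‖ + ‖Ψ‖))) :=
    (norm_inner_le_norm _ _).trans (by
      gcongr
      exact (norm_sq0_fld_sub_le (fF.mem_numDom wN) g j).trans (by gcongr))
  -- the field completes the square
  have b5 : |(z + z').im| ≤ ‖D‖ * ‖fld g j Θ‖ := by
    rw [hz, hz', ← inner_add_right]
    exact (Complex.abs_im_le_norm _).trans (norm_inner_le_norm _ _)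
  have e : (inner ℂ (numFun wN Ψ) (-d + ((2 * Complex.I * c) • (w + cre g j χ) +
      ((c : ℂ) ^ 2) • fld g j (fld g j Ψ)))).re =
      ‖D‖ ^ 2 + 2 * c * (z + z').im + 2 * c * (z - z').im + c ^ 2 * ‖fld g j Θ‖ ^ 2 +
        2 * c * (r1 - r2).im + c ^ 2 * (r3 + r4).re := by
    rw [inner_add_right, inner_add_right, inner_smul_right, inner_smul_right, inner_add_right, k1,
      k2, k3, k4]
    simp only [Complex.add_re, Complex.mul_re, Complex.mul_im, Complex.sub_re, Complex.sub_im,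
      Complex.add_im, Complex.ofReal_re, Complex.ofReal_im, Complex.I_re, Complex.I_im,
      Complex.neg_re, Complex.neg_im, Complex.conj_re, Complex.conj_im, Complex.re_ofNat,
      Complex.im_ofNat, pow_two]
    ring
  rw [e]
  have hc {x B : ℝ} (hx : |x| ≤ B) : -(2 * |c| * B) ≤ 2 * c * x := by
    have h2 := mul_le_mul_of_nonneg_left hx (abs_nonneg c)
    rw [← abs_mul] at h2
    linarith [neg_abs_le (c * x)]
  have c1 := hc ((Complex.abs_im_le_norm (r1 - r2)).trans (norm_sub_le _ _))
  have c2 : -(c ^ 2 * (‖r3‖ + ‖r4‖)) ≤ c ^ 2 * (r3 + r4).re := by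
    have h2 : |(r3 + r4).re| ≤ ‖r3‖ + ‖r4‖ := (Complex.abs_re_le_norm _).trans (norm_add_le _ _)
    nlinarith [neg_abs_le (r3 + r4).re, sq_nonneg c]
  have c3 := hc b5
  have c4 := hc J
  have c5 := sq_nonneg (‖D‖ - |c| * ‖fld g j Θ‖)
  rw [sub_sq, mul_pow, sq_abs] at c5
  have c6 : 2 * |c| * (‖r1‖ + ‖r2‖) ≤ 2 * |c| * (‖D‖ * (‖g‖ * ‖Ψ‖) + ‖Θ‖ * (‖g‖ * ‖χ‖)) := by
    gcongr
  have c7 : c ^ 2 * (‖r3‖ + ‖r4‖) ≤ c ^ 2 * (‖g‖ * (2 * ‖numFun wN Ψ‖ + ‖Θ‖) * (2 * ‖g‖ * ‖Ψ‖) +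
      ‖Θ‖ * (2 * ‖g‖ * (‖g‖ * (2 * ‖Θ‖ + ‖Ψ‖)))) := by
    gcongr
  linarith

end Regularity

/-! ### Operators on the regular domain -/

section RegularDomain

variable {N : ℕ}

/-- The domain of the free operator without exchange symmetry of the particles: phonon-symmetric
vectors in the domain of `𝓝` with square integrable pure second derivatives. -/
def regDom (N : ℕ) : Submodule ℂ (Fk N) where
  carrier := {Ψ | Ψ ∈ phSym N ∧ Ψ ∈ numDom N wN ∧
    ∀ l : Fin N × Fin 3, ∃ χ d, (grad l.1 l.2).HasGen Ψ χ ∧ (grad l.1 l.2).HasGen χ d}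
  zero_mem' := ⟨zero_mem _, zero_mem _, fun _ =>
    ⟨0, 0, UnitaryGroup.hasGen_zero, UnitaryGroup.hasGen_zero⟩⟩
  add_mem' := fun ha hb => ⟨add_mem ha.1 hb.1, add_mem ha.2.1 hb.2.1, fun l => by
    obtain ⟨χ, d, h1, h2⟩ := ha.2.2 l
    obtain ⟨χ', d', h1', h2'⟩ := hb.2.2 l
    exact ⟨χ + χ', d + d', h1.add h1', h2.add h2'⟩⟩
  smul_mem' := fun c _ ha => ⟨Submodule.smul_mem _ c ha.1, Submodule.smul_mem _ c ha.2.1,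
    fun l => by
      obtain ⟨χ, d, h1, h2⟩ := ha.2.2 l
      exact ⟨c • χ, c • d, h1.smul c, h2.smul c⟩⟩

section Maps

variable {D : Type*} [AddCommGroup D] [Module ℂ D]

/-- The derivative of a linear map with values in the domain of a partial derivative. -/
def derivMap (l : Fin N × Fin 3) (A : D →ₗ[ℂ] Fk N)
    (h : ∀ x, ∃ y, (grad l.1 l.2).HasGen (A x) y) : D →ₗ[ℂ] Fk N where
  toFun x := (h x).choose
  map_add' x y := (h (x + y)).choose_spec.unique (by
    rw [map_add]; exact (h x).choose_spec.add (h y).choose_spec)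
  map_smul' c x := (h (c • x)).choose_spec.unique (by
    rw [map_smul]; exact (h x).choose_spec.smul c)

lemma derivMap_spec (l : Fin N × Fin 3) (A : D →ₗ[ℂ] Fk N)
    (h : ∀ x, ∃ y, (grad l.1 l.2).HasGen (A x) y) (x : D) :
    (grad l.1 l.2).HasGen (A x) (derivMap l A h x) := (h x).choose_spec

/-- A function of the number operator, applied to a linear map with values in its domain. -/
def numMap (c : ℕ → ℂ) (A : D →ₗ[ℂ] Fk N) (h : ∀ x, A x ∈ numDom N c) : D →ₗ[ℂ] Fk N where
  toFun x := numFun c (A x)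
  map_add' x y := by rw [map_add, numFun_add (h x) (h y)]
  map_smul' z x := by rw [map_smul, numFun_smul z (h x), RingHom.id_apply]

/-- An annihilation operator, applied to a linear map with values in its domain. -/
def annMap (g : Form) (j : Fin N) (A : D →ₗ[ℂ] Fk N) (h : ∀ x, A x ∈ numDom N sq0) :
    D →ₗ[ℂ] Fk N := (alpha g j).toLinearMap ∘ₗ numMap sq0 A h

/-- A creation operator, applied to a linear map with values in its domain. -/
def creMap (g : Form) (j : Fin N) (A : D →ₗ[ℂ] Fk N) (h : ∀ x, A x ∈ numDom N sq0) :
    D →ₗ[ℂ] Fk N := (alphaD g j).toLinearMap ∘ₗ numMap sq1 A fun x => sq0_le_sq1 (h x)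

/-- A field operator, applied to a linear map with values in its domain. -/
def fldMap (g : Form) (j : Fin N) (A : D →ₗ[ℂ] Fk N) (h : ∀ x, A x ∈ numDom N sq0) :
    D →ₗ[ℂ] Fk N := annMap g j A h + creMap g j A h

lemma creMap_apply (g : Form) (j : Fin N) (A : D →ₗ[ℂ] Fk N) (h : ∀ x, A x ∈ numDom N sq0)
    (x : D) : creMap g j A h x = cre g j (A x) := rfl

end Maps

/-- The first derivative on the regular domain. -/
def d1 (l : Fin N × Fin 3) : regDom N →ₗ[ℂ] Fk N :=
  derivMap l (regDom N).subtype fun x => ⟨_, (x.2.2.2 l).choose_spec.choose_spec.1⟩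

lemma d1_spec (l : Fin N × Fin 3) (Ψ : regDom N) :
    (grad l.1 l.2).HasGen (Ψ : Fk N) (d1 l Ψ) :=
  derivMap_spec l (regDom N).subtype _ Ψ

lemma exists_d2 (l : Fin N × Fin 3) (Ψ : regDom N) : ∃ y, (grad l.1 l.2).HasGen (d1 l Ψ) y := by
  obtain ⟨χ, d, h1, h2⟩ := Ψ.2.2.2 l
  rw [(d1_spec l Ψ).unique h1]
  exact ⟨d, h2⟩

/-- The second derivative on the regular domain. -/
def d2 (l : Fin N × Fin 3) : regDom N →ₗ[ℂ] Fk N := derivMap l (d1 l) (exists_d2 l)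

lemma d2_spec (l : Fin N × Fin 3) (Ψ : regDom N) :
    (grad l.1 l.2).HasGen (d1 l Ψ) (d2 l Ψ) := derivMap_spec l (d1 l) _ Ψ

lemma mem_phSym_of_hasGen {l : Fin N × Fin 3} {Ψ χ : Fk N} (h : (grad l.1 l.2).HasGen Ψ χ)
    (hΨ : Ψ ∈ phSym N) : χ ∈ phSym N := by
  rw [mem_phSym_iff] at hΨ ⊢
  intro τ
  have h1 := h.map (permT τ).toContinuousLinearMap (G' := grad l.1 l.2) fun t z =>
    permT_trans τ _ z
  have h2 : (permT τ).toContinuousLinearMap Ψ = Ψ := hΨ τ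
  rw [h2] at h1
  exact h1.unique h

lemma d1_mem_phSym (l : Fin N × Fin 3) (Ψ : regDom N) : d1 l Ψ ∈ phSym N :=
  mem_phSym_of_hasGen (d1_spec l Ψ) Ψ.2.1

lemma reg_wN (Ψ : regDom N) : (Ψ : Fk N) ∈ numDom N wN := Ψ.2.2.1

lemma reg_sq0 (Ψ : regDom N) : (Ψ : Fk N) ∈ numDom N sq0 := wN_le_sq0 Ψ.2.2.1

lemma d1_sq0 (l : Fin N × Fin 3) (Ψ : regDom N) : d1 l Ψ ∈ numDom N sq0 :=
  (deriv_mem_sq0 (d1_spec l Ψ) (d2_spec l Ψ) (reg_wN Ψ)).1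

/-- The kinetic energy. -/
def kinL (N : ℕ) : regDom N →ₗ[ℂ] Fk N := -∑ l, d2 l

/-- The number operator on the regular domain. -/
def numL (N : ℕ) : regDom N →ₗ[ℂ] Fk N := numMap wN (regDom N).subtype reg_wN

lemma numL_apply (Ψ : regDom N) : numL N Ψ = numFun wN Ψ := rfl

lemma kinL_apply (Ψ : regDom N) : kinL N Ψ = ∑ l, -d2 l Ψ := by
  simp [kinL]

lemma inner_numL_kinL (Ψ : regDom N) :
    inner ℂ (numL N Ψ) (kinL N Ψ) = ((∑ l, ‖numFun sq0 (d1 l Ψ)‖ ^ 2 : ℝ) : ℂ) := by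
  rw [kinL_apply, inner_sum, Complex.ofReal_sum]
  exact Finset.sum_congr rfl fun l _ => (deriv_mem_sq0 (d1_spec l Ψ) (d2_spec l Ψ) (reg_wN Ψ)).2

lemma inner_kinL_self (Ψ : regDom N) :
    inner ℂ (Ψ : Fk N) (kinL N Ψ) = ((∑ l, ‖d1 l Ψ‖ ^ 2 : ℝ) : ℂ) := by
  rw [kinL_apply, inner_sum, Complex.ofReal_sum]
  exact Finset.sum_congr rfl fun l _ => inner_neg_second (d1_spec l Ψ) (d2_spec l Ψ)

lemma sum_sq_sq0_d1_le (Ψ : regDom N) :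
    ∑ l, ‖numFun sq0 (d1 l Ψ)‖ ^ 2 ≤ ‖numL N Ψ‖ * ‖kinL N Ψ‖ := by
  have h := norm_inner_le_norm (𝕜 := ℂ) (numL N Ψ) (kinL N Ψ)
  rwa [inner_numL_kinL, Complex.norm_real, Real.norm_of_nonneg
    (Finset.sum_nonneg fun _ _ => sq_nonneg _)] at h

lemma sq_sq0_d1_le (l : Fin N × Fin 3) (Ψ : regDom N) :
    ‖numFun sq0 (d1 l Ψ)‖ ^ 2 ≤ ‖numL N Ψ‖ * ‖kinL N Ψ‖ :=
  (Finset.single_le_sum (f := fun l => ‖numFun sq0 (d1 l Ψ)‖ ^ 2) (fun _ _ => sq_nonneg _)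
    (Finset.mem_univ l)).trans (sum_sq_sq0_d1_le Ψ)

lemma sq_d1_le (l : Fin N × Fin 3) (Ψ : regDom N) :
    ‖d1 l Ψ‖ ^ 2 ≤ ‖(Ψ : Fk N)‖ * ‖kinL N Ψ‖ := by
  have h := norm_inner_le_norm (𝕜 := ℂ) (Ψ : Fk N) (kinL N Ψ)
  rw [inner_kinL_self, Complex.norm_real, Real.norm_of_nonneg
    (Finset.sum_nonneg fun _ _ => sq_nonneg _)] at h
  exact (Finset.single_le_sum (f := fun l => ‖d1 l Ψ‖ ^ 2) (fun _ _ => sq_nonneg _)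
    (Finset.mem_univ l)).trans h

/-- Truncation of the number of phonons on the regular domain. -/
def truncR (M : ℕ) (Ψ : regDom N) : regDom N :=
  ⟨trunc M Ψ, numFun_mem_phSym Ψ.2.1 _, (isFin_trunc M _).mem_numDom _, fun l =>
    ⟨trunc M (d1 l Ψ), trunc M (d2 l Ψ), hasGen_numFun (trunc_mem M _) (trunc_mem M _) (d1_spec l Ψ),
      hasGen_numFun (trunc_mem M _) (trunc_mem M _) (d2_spec l Ψ)⟩⟩

lemma truncR_coe (M : ℕ) (Ψ : regDom N) : (truncR M Ψ : Fk N) = trunc M Ψ := rfl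

lemma d1_truncR (M : ℕ) (l : Fin N × Fin 3) (Ψ : regDom N) :
    d1 l (truncR M Ψ) = trunc M (d1 l Ψ) :=
  (d1_spec l (truncR M Ψ)).unique
    (hasGen_numFun (trunc_mem M _) (trunc_mem M _) (d1_spec l Ψ))

lemma d2_truncR (M : ℕ) (l : Fin N × Fin 3) (Ψ : regDom N) :
    d2 l (truncR M Ψ) = trunc M (d2 l Ψ) := by
  have h := d2_spec l (truncR M Ψ)
  rw [d1_truncR] at h
  exact h.unique (hasGen_numFun (trunc_mem M _) (trunc_mem M _) (d2_spec l Ψ))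

lemma tendsto_numL_truncR (Ψ : regDom N) :
    Tendsto (fun M => numL N (truncR M Ψ)) atTop (𝓝 (numL N Ψ)) :=
  (tendsto_trunc (numL N Ψ)).congr fun M => trunc_numFun M (reg_wN Ψ)

lemma tendsto_kinL_truncR (Ψ : regDom N) :
    Tendsto (fun M => kinL N (truncR M Ψ)) atTop (𝓝 (kinL N Ψ)) := by
  simp only [kinL_apply, d2_truncR]
  exact tendsto_finsetSum _ fun l _ => (tendsto_trunc (d2 l Ψ)).neg

/-! ### The perturbation -/

/-- The data of the Gross transformed interaction: the coupling `c`, the form factor `g` of the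
linear term, the form factors `v i` of the momentum-dependent terms, and the pair potential. -/
structure GrossData (N : ℕ) where
  /-- The coupling constant. -/
  c : ℝ
  /-- The form factor of the linear interaction. -/
  g : Form
  /-- The components of the form factor that is coupled to the momenta. -/
  v : Fin 3 → Form
  hv : ∀ i, ∀ᵐ k, ‖k‖ ^ 2 * ‖v i k‖ ≤ 1
  /-- The potential. -/
  V : (Fin N → E) → ℂ
  hV : IsBddMul V volume
  conj_V : ∀ x, conj (V x) = V x
  V_perm : ∀ (σ : Equiv.Perm (Fin N)) x, V (fun j => x (σ j)) = V x

variable (P : GrossData N)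

namespace GrossData

lemma exists_dann (l : Fin N × Fin 3) (Ψ : regDom N) :
    ∃ y, (grad l.1 l.2).HasGen (ann (P.v l.2) l.1 (Ψ : Fk N))
        (y + ann (P.v l.2) l.1 (d1 l Ψ)) ∧
      ∀ m : ℕ, ‖y - alpha (kLow l.2 (1024 ^ m) (P.v l.2)) l.1 (numFun sq0 (Ψ : Fk N))‖ ≤
        2 ^ 18 / 2 ^ m * (∑ i, ‖numFun sq0 (d1 (l.1, i) Ψ)‖ + ‖numFun sq0 (Ψ : Fk N)‖) :=
  exists_hasGen_alpha_singular (P.hv l.2) l.2 (χ := fun i => numFun sq0 (d1 (l.1, i) Ψ)) fun i =>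
    hasGen_numFun (reg_sq0 Ψ) (d1_sq0 (l.1, i) Ψ) (d1_spec (l.1, i) Ψ)

/-- The annihilation operator with form factor `v i` on the regular domain. -/
def annL (l : Fin N × Fin 3) : regDom N →ₗ[ℂ] Fk N :=
  annMap (P.v l.2) l.1 (regDom N).subtype reg_sq0

/-- The derivative of the annihilation operator with form factor `v i`. -/
def dann (l : Fin N × Fin 3) : regDom N →ₗ[ℂ] Fk N :=
  derivMap l (P.annL l) fun Ψ => ⟨_, (P.exists_dann l Ψ).choose_spec.1⟩

lemma dann_spec (l : Fin N × Fin 3) (Ψ : regDom N) :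
    (grad l.1 l.2).HasGen (ann (P.v l.2) l.1 (Ψ : Fk N)) (P.dann l Ψ) :=
  derivMap_spec l (P.annL l) _ Ψ

/-- The interaction of one component of the momentum of one particle with the phonons. -/
def inter (l : Fin N × Fin 3) : regDom N →ₗ[ℂ] Fk N :=
  (2 * Complex.I * P.c) • (P.dann l + creMap (P.v l.2) l.1 (d1 l) (d1_sq0 l)) +
    ((P.c : ℂ) ^ 2) • fldMap (P.v l.2) l.1
      (fldMap (P.v l.2) l.1 (regDom N).subtype reg_sq0) fun Ψ => fld_mem_sq0 (reg_wN Ψ) _ _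

lemma inter_apply (l : Fin N × Fin 3) (Ψ : regDom N) :
    P.inter l Ψ = (2 * Complex.I * P.c) • (P.dann l Ψ + cre (P.v l.2) l.1 (d1 l Ψ)) +
      ((P.c : ℂ) ^ 2) • fld (P.v l.2) l.1 (fld (P.v l.2) l.1 (Ψ : Fk N)) := rfl

/-- The Gross transformed interaction. -/
def pertL : regDom N →ₗ[ℂ] Fk N :=
  (P.c : ℂ) • ∑ j, fldMap P.g j (regDom N).subtype reg_sq0 + ∑ l, P.inter l +
    (mulB P.V P.hV).toLinearMap ∘ₗ (regDom N).subtype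

lemma pertL_apply (Ψ : regDom N) :
    P.pertL Ψ = (P.c : ℂ) • ∑ j, fld P.g j (Ψ : Fk N) + ∑ l, P.inter l Ψ +
      mulB P.V P.hV (Ψ : Fk N) := by
  simp only [pertL, LinearMap.add_apply, LinearMap.smul_apply, LinearMap.sum_apply]
  rfl

end GrossData

/-! ### Relative bounds -/

/-- `A` is bounded, relative to the free operator, by the number operator and the geometric mean of
the kinetic energy and the number operator. -/
def RelBdd (A : regDom N →ₗ[ℂ] Fk N) : Prop := ∃ C : ℝ, 0 ≤ C ∧ ∀ Ψ : regDom N,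
  ‖A Ψ‖ ≤ C * (√((‖numL N Ψ‖ + ‖(Ψ : Fk N)‖) * ‖kinL N Ψ‖) + (‖numL N Ψ‖ + ‖(Ψ : Fk N)‖))

lemma RelBdd.add {A B : regDom N →ₗ[ℂ] Fk N} (hA : RelBdd A) (hB : RelBdd B) :
    RelBdd (A + B) := by
  obtain ⟨C, hC, h⟩ := hA
  obtain ⟨C', hC', h'⟩ := hB
  refine ⟨C + C', by positivity, fun Ψ => ?_⟩
  rw [add_mul]
  exact (norm_add_le _ _).trans (add_le_add (h Ψ) (h' Ψ))

lemma RelBdd.smul {A : regDom N →ₗ[ℂ] Fk N} (hA : RelBdd A) (c : ℂ) : RelBdd (c • A) := by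
  obtain ⟨C, hC, h⟩ := hA
  refine ⟨‖c‖ * C, by positivity, fun Ψ => ?_⟩
  rw [LinearMap.smul_apply, norm_smul, mul_assoc]
  exact mul_le_mul_of_nonneg_left (h Ψ) (norm_nonneg _)

lemma RelBdd.sum {ι : Type*} {s : Finset ι} {A : ι → regDom N →ₗ[ℂ] Fk N}
    (h : ∀ i ∈ s, RelBdd (A i)) : RelBdd (∑ i ∈ s, A i) := by
  refine Finset.sum_induction _ _ (fun _ _ => RelBdd.add) ⟨0, le_rfl, fun Ψ => by simp⟩ h

lemma norm_sq0_reg_le (Ψ : regDom N) : ‖numFun sq0 (Ψ : Fk N)‖ ≤ ‖numL N Ψ‖ :=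
  norm_numFun_sq0_le (reg_wN Ψ)

lemma relBdd_of_le {A : regDom N →ₗ[ℂ] Fk N} {C : ℝ} (hC : 0 ≤ C)
    (h : ∀ Ψ : regDom N, ‖A Ψ‖ ≤ C * (‖numL N Ψ‖ + ‖(Ψ : Fk N)‖)) : RelBdd A :=
  ⟨C, hC, fun Ψ => (h Ψ).trans (mul_le_mul_of_nonneg_left
    (le_add_of_nonneg_left (Real.sqrt_nonneg _)) hC)⟩

lemma norm_sq0_d1_le (l : Fin N × Fin 3) (Ψ : regDom N) :
    ‖numFun sq0 (d1 l Ψ)‖ ≤ √((‖numL N Ψ‖ + ‖(Ψ : Fk N)‖) * ‖kinL N Ψ‖) :=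
  Real.le_sqrt_of_sq_le ((sq_sq0_d1_le l Ψ).trans (by gcongr; linarith [norm_nonneg (Ψ : Fk N)]))

lemma norm_d1_le (l : Fin N × Fin 3) (Ψ : regDom N) :
    ‖d1 l Ψ‖ ≤ √((‖numL N Ψ‖ + ‖(Ψ : Fk N)‖) * ‖kinL N Ψ‖) :=
  Real.le_sqrt_of_sq_le ((sq_d1_le l Ψ).trans (by gcongr; linarith [norm_nonneg (numL N Ψ)]))

lemma relBdd_dann (l : Fin N × Fin 3) : RelBdd (P.dann l) := by
  obtain ⟨C, hC, h⟩ := exists_bound_of_singular (N := N) (g := P.v l.2) l.2 one_pos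
  refine ⟨3 + ‖P.v l.2‖ + C, by positivity, fun Ψ => ?_⟩
  obtain ⟨y, hy, hy'⟩ := P.exists_dann l Ψ
  rw [(P.dann_spec l Ψ).unique hy]
  have h1 := h (Finset.sum_nonneg fun _ _ => norm_nonneg _) hy'
  set s := ‖numL N Ψ‖ + ‖(Ψ : Fk N)‖ with hs
  set τ := √(s * ‖kinL N Ψ‖) with hτ
  have h2 : ∑ i, ‖numFun sq0 (d1 (l.1, i) Ψ)‖ ≤ 3 * τ := by
    refine (Finset.sum_le_sum fun i _ => norm_sq0_d1_le (l.1, i) Ψ).trans (le_of_eq ?_)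
    simp [hτ, hs]
  have h3 : ‖ann (P.v l.2) l.1 (d1 l Ψ)‖ ≤ ‖P.v l.2‖ * τ :=
    (norm_ann_le _ _ _).trans (by gcongr; exact norm_sq0_d1_le l Ψ)
  have h4 : ‖numFun sq0 (Ψ : Fk N)‖ ≤ s :=
    (norm_sq0_reg_le Ψ).trans (by linarith [norm_nonneg (Ψ : Fk N)])
  have h5 : 0 ≤ τ := Real.sqrt_nonneg _
  have h6 : 0 ≤ s := by positivity
  calc _ ≤ ‖y‖ + ‖ann (P.v l.2) l.1 (d1 l Ψ)‖ := norm_add_le _ _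
    _ ≤ (1 * (3 * τ) + C * s) + ‖P.v l.2‖ * τ := by
        gcongr
        exact h1.trans (by gcongr)
    _ ≤ _ := by nlinarith [mul_nonneg (norm_nonneg (P.v l.2)) h6, mul_nonneg hC h5]

lemma relBdd_creMap (g : Form) (j : Fin N) (l : Fin N × Fin 3) :
    RelBdd (creMap g j (d1 l) (d1_sq0 l)) := by
  refine ⟨2 * ‖g‖, by positivity, fun Ψ => ?_⟩
  rw [creMap_apply]
  have h1 := norm_cre_le g j (d1_sq0 l Ψ)
  have h2 := norm_sq0_d1_le l Ψ
  have h3 := norm_d1_le l Ψ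
  set τ := √((‖numL N Ψ‖ + ‖(Ψ : Fk N)‖) * ‖kinL N Ψ‖)
  calc _ ≤ ‖g‖ * (τ + τ) := h1.trans (by gcongr)
    _ = 2 * ‖g‖ * τ := by ring
    _ ≤ _ := by
        gcongr
        linarith [norm_nonneg (Ψ : Fk N), norm_nonneg (numL N Ψ)]

lemma relBdd_inter (l : Fin N × Fin 3) : RelBdd (P.inter l) := by
  refine (((relBdd_dann P l).add (relBdd_creMap _ _ l)).smul _).add (RelBdd.smul ?_ _)
  refine relBdd_of_le (C := ‖P.v l.2‖ * ‖P.v l.2‖ * 6) (by positivity) fun Ψ => ?_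
  change ‖fld (P.v l.2) l.1 (fld (P.v l.2) l.1 (Ψ : Fk N))‖ ≤ _
  refine (norm_fld_fld_le _ _ _ _ (reg_wN Ψ)).trans ?_
  rw [mul_assoc _ (6 : ℝ)]
  gcongr
  rw [numL_apply]
  linarith [norm_nonneg (Ψ : Fk N)]

lemma relBdd_pertL : RelBdd P.pertL := by
  refine ((RelBdd.smul (RelBdd.sum fun j _ => ?_) _).add (RelBdd.sum fun l _ => ?_)).add ?_
  · refine relBdd_of_le (C := 2 * ‖P.g‖) (by positivity) fun Ψ => ?_
    change ‖fld P.g j (Ψ : Fk N)‖ ≤ _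
    refine (norm_fld_le P.g j (reg_sq0 Ψ)).trans ?_
    have := norm_sq0_reg_le Ψ
    have h := norm_nonneg P.g
    nlinarith [mul_le_mul_of_nonneg_left this h, mul_nonneg h (norm_nonneg (Ψ : Fk N))]
  · exact relBdd_inter P l
  · obtain ⟨C, hC⟩ := P.hV.2
    have hC0 : 0 ≤ C := (norm_nonneg _).trans (hC 0)
    refine relBdd_of_le hC0 fun Ψ => (norm_mulB_le P.hV hC _).trans ?_
    gcongr
    simp only [Submodule.subtype_apply]
    linarith [norm_nonneg (numL N Ψ)]

lemma RelBdd.exists_le {A : regDom N →ₗ[ℂ] Fk N} (hA : RelBdd A) {δ : ℝ} (hδ : 0 < δ) :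
    ∃ C : ℝ, 0 ≤ C ∧ ∀ Ψ : regDom N,
      ‖A Ψ‖ ≤ δ * ‖kinL N Ψ‖ + C * (‖numL N Ψ‖ + ‖(Ψ : Fk N)‖) := by
  obtain ⟨C, hC, h⟩ := hA
  refine ⟨C ^ 2 / δ + C, by positivity, fun Ψ => (h Ψ).trans ?_⟩
  set s := ‖numL N Ψ‖ + ‖(Ψ : Fk N)‖
  have h1 : C * √(s * ‖kinL N Ψ‖) ≤ δ * ‖kinL N Ψ‖ + C ^ 2 / δ * s := by
    refine (sq_le_sq₀ (by positivity) (by positivity)).1 ?_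
    rw [mul_pow, Real.sq_sqrt (by positivity)]
    have e : C ^ 2 * (s * ‖kinL N Ψ‖) = (δ * ‖kinL N Ψ‖) * (C ^ 2 / δ * s) := by
      field_simp
    rw [e]
    nlinarith [mul_nonneg (mul_nonneg hδ.le (norm_nonneg (kinL N Ψ)))
      (mul_nonneg (show 0 ≤ C ^ 2 / δ by positivity) (show 0 ≤ s by positivity)),
      sq_nonneg (δ * ‖kinL N Ψ‖), sq_nonneg (C ^ 2 / δ * s)]
  linarith

lemma RelBdd.tendsto_truncR {A : regDom N →ₗ[ℂ] Fk N} (hA : RelBdd A) (Ψ : regDom N) :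
    Tendsto (fun M => A (truncR M Ψ)) atTop (𝓝 (A Ψ)) := by
  obtain ⟨C, hC, h⟩ := hA.exists_le one_pos
  have h1 := tendsto_iff_norm_sub_tendsto_zero.1 (tendsto_kinL_truncR Ψ)
  have h2 := tendsto_iff_norm_sub_tendsto_zero.1 (tendsto_numL_truncR Ψ)
  have h3 := tendsto_iff_norm_sub_tendsto_zero.1 (tendsto_trunc (Ψ : Fk N))
  rw [tendsto_iff_norm_sub_tendsto_zero]
  have h4 := (h1.const_mul 1).add ((h2.add h3).const_mul C)
  rw [mul_zero, add_zero, mul_zero, add_zero] at h4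
  refine squeeze_zero (fun _ => norm_nonneg _) (fun M => ?_) h4
  have h5 := h (truncR M Ψ - Ψ)
  rwa [map_sub, map_sub, map_sub, Submodule.coe_sub, truncR_coe] at h5

end RegularDomain

/-! ### The interaction is bounded below relative to the number operator -/

section LowerBound

variable {N : ℕ}
variable {A : regDom N →ₗ[ℂ] Fk N}

lemma exists_young (A : ℝ) (hA : 0 ≤ A) {ε : ℝ} (hε : 0 < ε) : ∃ b : ℝ, 0 ≤ b ∧
    ∀ X n θ t : ℝ, 0 ≤ X → 0 ≤ n → θ ^ 2 ≤ X * n → t ^ 2 ≤ X * n →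
      A * (X * (n + θ + t)) ≤ ε * X ^ 2 + b * n ^ 2 := by
  set κ := ε / (4 * (A + 1)) with hκ
  have hκ0 : 0 < κ := by positivity
  set M := A * (1 + (2 * κ)⁻¹) with hM
  refine ⟨M ^ 2 / (2 * ε), by positivity, fun X n θ t hX hn hθ ht => ?_⟩
  have key : ∀ s : ℝ, s ^ 2 ≤ X * n → s ≤ κ * X + n / (4 * κ) := fun s hs => by
    refine le_of_sq_le_sq (hs.trans ?_) (by positivity)
    have e : X * n = 4 * (κ * X) * (n / (4 * κ)) := by field_simp
    rw [e]
    nlinarith [sq_nonneg (κ * X - n / (4 * κ))]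
  have h1 : n + θ + t ≤ n + (κ * X + n / (4 * κ)) + (κ * X + n / (4 * κ)) := by
    linarith [key θ hθ, key t ht]
  have h2 : A * (X * (n + θ + t)) ≤
      A * (X * (n + (κ * X + n / (4 * κ)) + (κ * X + n / (4 * κ)))) := by gcongr
  have e2 : A * (X * (n + (κ * X + n / (4 * κ)) + (κ * X + n / (4 * κ)))) =
      2 * (A * κ) * X ^ 2 + M * (X * n) := by
    rw [hM]
    field_simp
    ring
  have h3 : A * κ ≤ ε / 4 := by
    have e3 : A * κ = ε / 4 * (A / (A + 1)) := by rw [hκ]; field_simp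
    rw [e3]
    have : A / (A + 1) ≤ 1 := (div_le_one (by positivity)).2 (by linarith)
    nlinarith
  have h4 : M * (X * n) ≤ ε / 2 * X ^ 2 + M ^ 2 / (2 * ε) * n ^ 2 := by
    have e4 : M ^ 2 / (2 * ε) * n ^ 2 = (M * n) ^ 2 / (2 * ε) := by ring
    rw [e4, ← sub_nonneg]
    have e5 : ε / 2 * X ^ 2 + (M * n) ^ 2 / (2 * ε) - M * (X * n) =
        (ε * X - M * n) ^ 2 / (2 * ε) := by
      field_simp
      ring
    rw [e5]
    positivity
  nlinarith [mul_le_mul_of_nonneg_right h3 (sq_nonneg X)]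

/-- Up to arbitrarily small multiples of the square of the free operator, `A` is bounded below when
tested against the number operator. -/
def BddBelowRel (A : regDom N →ₗ[ℂ] Fk N) : Prop := ∀ ε : ℝ, 0 < ε → ∃ b : ℝ, 0 ≤ b ∧
  ∀ Ψ : regDom N, -(ε * (‖numL N Ψ‖ + ‖kinL N Ψ‖) ^ 2 + b * ‖(Ψ : Fk N)‖ ^ 2) ≤
    (inner ℂ (numL N Ψ) (A Ψ)).re

lemma BddBelowRel.add {B : regDom N →ₗ[ℂ] Fk N} (hA : BddBelowRel A) (hB : BddBelowRel B) :
    BddBelowRel (A + B) := by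
  intro ε hε
  obtain ⟨b, hb, h⟩ := hA (ε / 2) (half_pos hε)
  obtain ⟨b', hb', h'⟩ := hB (ε / 2) (half_pos hε)
  refine ⟨b + b', by positivity, fun Ψ => ?_⟩
  rw [LinearMap.add_apply, inner_add_right, Complex.add_re]
  linarith [h Ψ, h' Ψ]

lemma BddBelowRel.sum {ι : Type*} {s : Finset ι} {A : ι → regDom N →ₗ[ℂ] Fk N}
    (h : ∀ i ∈ s, BddBelowRel (A i)) : BddBelowRel (∑ i ∈ s, A i) :=
  Finset.sum_induction _ _ (fun _ _ => BddBelowRel.add) (fun ε hε => ⟨0, le_rfl, fun Ψ => by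
    have : 0 ≤ ε * (‖numL N Ψ‖ + ‖kinL N Ψ‖) ^ 2 := by positivity
    simpa using this⟩) h

lemma sq_sq0_reg_le (Ψ : regDom N) :
    ‖numFun sq0 (Ψ : Fk N)‖ ^ 2 ≤ (‖numL N Ψ‖ + ‖kinL N Ψ‖) * ‖(Ψ : Fk N)‖ := by
  refine (sq_norm_numFun_sq0_le (reg_wN Ψ)).trans ?_
  rw [← numL_apply]
  nlinarith [mul_nonneg (norm_nonneg (kinL N Ψ)) (norm_nonneg (Ψ : Fk N))]

lemma sq_d1_le' (l : Fin N × Fin 3) (Ψ : regDom N) :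
    ‖d1 l Ψ‖ ^ 2 ≤ (‖numL N Ψ‖ + ‖kinL N Ψ‖) * ‖(Ψ : Fk N)‖ := by
  refine (sq_d1_le l Ψ).trans ?_
  nlinarith [mul_nonneg (norm_nonneg (numL N Ψ)) (norm_nonneg (Ψ : Fk N))]

lemma sq0_d1_le (l : Fin N × Fin 3) (Ψ : regDom N) :
    ‖numFun sq0 (d1 l Ψ)‖ ≤ ‖numL N Ψ‖ + ‖kinL N Ψ‖ := by
  refine le_of_sq_le_sq ((sq_sq0_d1_le l Ψ).trans ?_) (by positivity)
  nlinarith [mul_nonneg (norm_nonneg (numL N Ψ)) (norm_nonneg (kinL N Ψ)),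
    sq_nonneg ‖numL N Ψ‖, sq_nonneg ‖kinL N Ψ‖]

lemma bddBelowRel_of_le {C : ℝ} (hC : 0 ≤ C)
    (h : ∀ Ψ : regDom N, ‖A Ψ‖ ≤ C * (‖(Ψ : Fk N)‖ + ‖numFun sq0 (Ψ : Fk N)‖)) :
    BddBelowRel A := by
  intro ε hε
  obtain ⟨b, hb, hy⟩ := exists_young C hC hε
  refine ⟨b, hb, fun Ψ => ?_⟩
  set X := ‖numL N Ψ‖ + ‖kinL N Ψ‖ with hX
  have h1 : ‖inner ℂ (numL N Ψ) (A Ψ)‖ ≤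
      X * (C * (‖(Ψ : Fk N)‖ + ‖numFun sq0 (Ψ : Fk N)‖)) :=
    (norm_inner_le_norm _ _).trans (mul_le_mul (by rw [hX]; linarith [norm_nonneg (kinL N Ψ)])
      (h Ψ) (norm_nonneg _) (by positivity))
  have h2 := hy X ‖(Ψ : Fk N)‖ ‖numFun sq0 (Ψ : Fk N)‖ 0 (by positivity) (norm_nonneg _)
    (sq_sq0_reg_le Ψ) (by rw [zero_pow two_ne_zero]; positivity)
  have h3 := (abs_le.1 (Complex.abs_re_le_norm (inner ℂ (numL N Ψ) (A Ψ)))).1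
  have e : C * (X * (‖(Ψ : Fk N)‖ + ‖numFun sq0 (Ψ : Fk N)‖ + 0)) =
      X * (C * (‖(Ψ : Fk N)‖ + ‖numFun sq0 (Ψ : Fk N)‖)) := by ring
  linarith

/-- A limit of truncated vectors reduces a lower bound to finitely many phonons. -/
lemma bddBelowRel_of_truncR
    (hA : ∀ Ψ, Tendsto (fun M => A (truncR M Ψ)) atTop (𝓝 (A Ψ)))
    (h : ∀ ε : ℝ, 0 < ε → ∃ b : ℝ, 0 ≤ b ∧ ∀ Ψ : regDom N, ∀ M : ℕ,
      -(ε * (‖numL N (truncR M Ψ)‖ + ‖kinL N (truncR M Ψ)‖) ^ 2 + b * ‖trunc M (Ψ : Fk N)‖ ^ 2) ≤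
        (inner ℂ (numL N (truncR M Ψ)) (A (truncR M Ψ))).re) : BddBelowRel A := by
  intro ε hε
  obtain ⟨b, hb, hM⟩ := h ε hε
  refine ⟨b, hb, fun Ψ => ?_⟩
  refine le_of_tendsto_of_tendsto' (((((tendsto_numL_truncR Ψ).norm.add
    (tendsto_kinL_truncR Ψ).norm).pow 2).const_mul ε).add
      (((tendsto_trunc (Ψ : Fk N)).norm.pow 2).const_mul b)).neg ?_ (hM Ψ)
  exact (Complex.continuous_re.tendsto _).comp ((tendsto_numL_truncR Ψ).inner (hA Ψ))

variable (P : GrossData N)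

lemma lower_terms_le {C G q η X n θ t a D : ℝ} (hC : 0 ≤ C) (hG : 0 ≤ G) (hq : 0 ≤ q)
    (hη : 0 ≤ η) (hn : 0 ≤ n) (hθ : 0 ≤ θ) (ht : 0 ≤ t) (ha : 0 ≤ a) (hθa : θ ≤ a)
    (haX : a ≤ X) (hDX : D ≤ X) :
    2 * C * (G * (D * n + θ * t)) + C ^ 2 * (2 * G ^ 2 * (n * (2 * a + θ) + θ * (2 * θ + n))) +
      2 * C * (θ * (q * a) + D * (η * (2 * a + θ))) ≤
      (2 * C * G + 8 * C ^ 2 * G ^ 2 + 2 * C * q) * (X * (n + θ + t)) + 6 * C * η * X ^ 2 := by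
  have hX : 0 ≤ X := ha.trans haX
  have hθX : θ ≤ X := hθa.trans haX
  have h1 : D * n + θ * t ≤ X * (n + θ + t) := by nlinarith [mul_nonneg hX hθ]
  have h2 : n * (2 * a + θ) + θ * (2 * θ + n) ≤ 4 * (X * (n + θ + t)) := by
    nlinarith [mul_nonneg hX ht, mul_nonneg hX hn, mul_nonneg hX hθ]
  have h3 : θ * (q * a) ≤ q * (X * (n + θ + t)) := by
    have : θ * a ≤ X * (n + θ + t) := by nlinarith [mul_nonneg hX ht, mul_nonneg hX hn]
    nlinarith
  have h4 : D * (η * (2 * a + θ)) ≤ η * (3 * X ^ 2) := by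
    have : D * (2 * a + θ) ≤ X * (3 * X) := by gcongr; linarith
    nlinarith
  have k1 := mul_le_mul_of_nonneg_left h1 (show 0 ≤ 2 * C * G by positivity)
  have k2 := mul_le_mul_of_nonneg_left h2 (show 0 ≤ 2 * (C ^ 2 * G ^ 2) by positivity)
  have k3 := mul_le_mul_of_nonneg_left (add_le_add h3 h4) (show 0 ≤ 2 * C by positivity)
  nlinarith

lemma bddBelowRel_inter (l : Fin N × Fin 3) : BddBelowRel (-d2 l + P.inter l) := by
  refine bddBelowRel_of_truncR (fun Ψ => ?_) fun ε hε => ?_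
  · simp only [LinearMap.add_apply, LinearMap.neg_apply, d2_truncR]
    exact (tendsto_trunc (d2 l Ψ)).neg.add ((relBdd_inter P l).tendsto_truncR Ψ)
  -- the cutoff is chosen such that the high momentum part of the form factor is small
  have h0 : Tendsto (fun R : ℝ => 6 * |P.c| * ‖P.v l.2 - lowF R (P.v l.2)‖) atTop (𝓝 0) := by
    have h1 := ((tendsto_const_nhds (x := P.v l.2)).sub (tendsto_lowF (P.v l.2))).norm
    have h2 := h1.const_mul (6 * |P.c|)
    rwa [sub_self, norm_zero, mul_zero] at h2
  obtain ⟨R, hR⟩ := (h0.eventually (gt_mem_nhds (half_pos hε))).exists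
  obtain ⟨b, hb, hy⟩ := exists_young (2 * |P.c| * ‖P.v l.2‖ + 8 * |P.c| ^ 2 * ‖P.v l.2‖ ^ 2 +
    2 * |P.c| * ‖kLow l.2 R (P.v l.2)‖) (by positivity) (half_pos hε)
  refine ⟨b, hb, fun Ψ M => ?_⟩
  set Φ := truncR M Ψ with hΦ
  have fΦ : IsFin (Φ : Fk N) := isFin_trunc M _
  have f1 : IsFin (d1 l Φ) := by rw [hΦ, d1_truncR]; exact isFin_trunc M _
  have h1 := re_inner_wN_ge Φ.2.1 (d1_mem_phSym l Φ) fΦ f1 (d1_spec l Φ) (d2_spec l Φ)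
    (P.dann_spec l Φ) P.c R
  have h2 := lower_terms_le (abs_nonneg P.c) (norm_nonneg (P.v l.2))
    (norm_nonneg (kLow l.2 R (P.v l.2))) (norm_nonneg (P.v l.2 - lowF R (P.v l.2)))
    (norm_nonneg (Φ : Fk N)) (norm_nonneg (numFun sq0 (Φ : Fk N))) (norm_nonneg (d1 l Φ))
    (norm_nonneg (numL N Φ)) (norm_sq0_reg_le Φ)
    (le_add_of_nonneg_right (norm_nonneg (kinL N Φ)))
    (sq0_d1_le l Φ)
  have h3 := hy (‖numL N Φ‖ + ‖kinL N Φ‖) ‖(Φ : Fk N)‖ ‖numFun sq0 (Φ : Fk N)‖ ‖d1 l Φ‖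
    (by positivity) (norm_nonneg _) (sq_sq0_reg_le Φ) (sq_d1_le' l Φ)
  have h4 := mul_le_mul_of_nonneg_right hR.le (sq_nonneg (‖numL N Φ‖ + ‖kinL N Φ‖))
  rw [sq_abs] at h2 h3
  rw [LinearMap.add_apply, LinearMap.neg_apply, P.inter_apply]
  rw [← numL_apply] at h1
  change -(ε * (‖numL N Φ‖ + ‖kinL N Φ‖) ^ 2 + b * ‖(Φ : Fk N)‖ ^ 2) ≤ _
  linarith

lemma bddBelowRel_kinL_add_pertL : BddBelowRel (kinL N + P.pertL) := by
  have e : kinL N + P.pertL = ∑ l, (-d2 l + P.inter l) +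
      ((P.c : ℂ) • ∑ j, fldMap P.g j (regDom N).subtype reg_sq0 +
        (mulB P.V P.hV).toLinearMap ∘ₗ (regDom N).subtype) := by
    rw [Finset.sum_add_distrib, Finset.sum_neg_distrib, kinL, GrossData.pertL]
    abel
  rw [e]
  refine (BddBelowRel.sum fun l _ => bddBelowRel_inter P l).add ?_
  obtain ⟨C, hC⟩ := P.hV.2
  have hC0 : 0 ≤ C := (norm_nonneg _).trans (hC 0)
  refine bddBelowRel_of_le (C := |P.c| * (N * (2 * ‖P.g‖)) + C) (by positivity) fun Ψ => ?_
  have h1 : ‖((mulB P.V P.hV).toLinearMap ∘ₗ (regDom N).subtype) Ψ‖ ≤ C * ‖(Ψ : Fk N)‖ :=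
    norm_mulB_le P.hV hC _
  set s := ‖(Ψ : Fk N)‖ + ‖numFun sq0 (Ψ : Fk N)‖ with hs
  have h2 : ∀ j, ‖fldMap P.g j (regDom N).subtype reg_sq0 Ψ‖ ≤ 2 * ‖P.g‖ * s := fun j => by
    refine (norm_fld_le P.g j (reg_sq0 Ψ)).trans ?_
    rw [hs]
    nlinarith [mul_nonneg (norm_nonneg P.g) (norm_nonneg (Ψ : Fk N))]
  have h3 : ‖((P.c : ℂ) • ∑ j, fldMap P.g j (regDom N).subtype reg_sq0) Ψ‖ ≤
      |P.c| * (N * (2 * ‖P.g‖ * s)) := by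
    rw [LinearMap.smul_apply, norm_smul, Complex.norm_real, Real.norm_eq_abs, LinearMap.sum_apply]
    gcongr
    refine (norm_sum_le_of_le _ fun j _ => h2 j).trans (le_of_eq ?_)
    simp
  rw [LinearMap.add_apply]
  refine (norm_add_le _ _).trans ((add_le_add h3 h1).trans ?_)
  have h4 : C * ‖(Ψ : Fk N)‖ ≤ C * s :=
    mul_le_mul_of_nonneg_left (by rw [hs]; linarith [norm_nonneg (numFun sq0 (Ψ : Fk N))]) hC0
  linarith

/-! ### Symmetry -/

lemma kinL_symm (χ Ψ : regDom N) :
    inner ℂ (kinL N χ) (Ψ : Fk N) = inner ℂ (χ : Fk N) (kinL N Ψ) := by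
  rw [kinL_apply, kinL_apply, inner_sum, sum_inner]
  refine Finset.sum_congr rfl fun l _ => ?_
  rw [inner_neg_left, inner_neg_right, (d2_spec l χ).inner_left (d1_spec l Ψ), neg_neg,
    ← (d1_spec l χ).inner_left (d2_spec l Ψ)]

lemma conj_wN (n : ℕ) : conj (wN n) = wN n := Complex.conj_natCast _

lemma numL_symm (χ Ψ : regDom N) :
    inner ℂ (numL N χ) (Ψ : Fk N) = inner ℂ (χ : Fk N) (numL N Ψ) :=
  inner_numFun_symm conj_wN (reg_wN Ψ) (reg_wN χ)

lemma inner_cre_left {χ Ψ : Fk N} (hΨ : Ψ ∈ phSym N) (h : χ ∈ numDom N sq0)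
    (h' : Ψ ∈ numDom N sq0) (g : Form) (j : Fin N) :
    inner ℂ (cre g j χ) Ψ = inner ℂ χ (ann g j Ψ) := by
  rw [← inner_conj_symm, inner_cre_right hΨ h' h, inner_conj_symm]

lemma inter_symm (l : Fin N × Fin 3) (χ Ψ : regDom N) :
    inner ℂ (P.inter l χ) (Ψ : Fk N) = inner ℂ (χ : Fk N) (P.inter l Ψ) := by
  have h1 := (P.dann_spec l χ).inner_left (d1_spec l Ψ)
  have h2 := (d1_spec l χ).inner_left (P.dann_spec l Ψ)
  have h3 := inner_cre_left Ψ.2.1 (d1_sq0 l χ) (reg_sq0 Ψ) (P.v l.2) l.1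
  have h4 := inner_cre_right χ.2.1 (reg_sq0 χ) (d1_sq0 l Ψ) (P.v l.2) l.1
  have s (Φ : regDom N) := fld_mem_phSym Φ.2.1 (P.v l.2) l.1
  have s' (Φ : regDom N) := fld_mem_sq0 (reg_wN Φ) (P.v l.2) l.1
  rw [P.inter_apply, P.inter_apply, inner_add_left, inner_add_right, inner_smul_left,
    inner_smul_right, inner_smul_left, inner_smul_right, inner_add_left, inner_add_right, h1, h3,
    h4, ← neg_eq_iff_eq_neg.2 h2, ← inner_fld_right (s χ) Ψ.2.1 (s' χ) (reg_sq0 Ψ),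
    ← inner_fld_right χ.2.1 (s Ψ) (reg_sq0 χ) (s' Ψ)]
  simp only [map_mul, map_pow, Complex.conj_I, Complex.conj_ofReal, Complex.conj_ofNat]
  ring

lemma pertL_symm (χ Ψ : regDom N) :
    inner ℂ (P.pertL χ) (Ψ : Fk N) = inner ℂ (χ : Fk N) (P.pertL Ψ) := by
  have h1 : inner ℂ (mulB P.V P.hV (χ : Fk N)) (Ψ : Fk N) =
      inner ℂ (χ : Fk N) (mulB P.V P.hV (Ψ : Fk N)) :=
    inner_mulB_left P.hV P.hV (fun x => (P.conj_V x).symm) _ _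
  rw [P.pertL_apply, P.pertL_apply, inner_add_left, inner_add_left, inner_add_right,
    inner_add_right, h1, inner_smul_left, inner_smul_right, sum_inner, inner_sum, sum_inner,
    inner_sum, Complex.conj_ofReal]
  simp only [inter_symm, inner_fld_right χ.2.1 Ψ.2.1 (reg_sq0 χ) (reg_sq0 Ψ)]

end LowerBound

/-! ### Solvability of the resolvent equation -/

section Resolvent

variable {N : ℕ}
variable {f Ψ : Fk N} {t : ℝ}

lemma norm_inv_sq1_le (n : ℕ) : ‖(sq1 n)⁻¹‖ ≤ 1 := by
  have h1 : 1 ≤ ‖sq1 n‖ := by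
    have := norm_sq1_sq n
    nlinarith [norm_nonneg (sq1 n), Nat.cast_nonneg (α := ℝ) n]
  rw [norm_inv]
  exact inv_le_one_of_one_le₀ h1

/-- `(𝓝 + 1)^{-1/2}`. -/
def invSqrt (N : ℕ) : Fk N →L[ℂ] Fk N :=
  diagOp (fun n => (sq1 n)⁻¹ • ContinuousLinearMap.id ℂ (L2 N n)) 1 fun n u => by
    rw [_root_.smul_apply, ContinuousLinearMap.id_apply, norm_smul]
    gcongr
    exact norm_inv_sq1_le n

lemma sec_invSqrt (n : ℕ) (Ψ : Fk N) : sec n (invSqrt N Ψ) = (sq1 n)⁻¹ • sec n Ψ := by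
  rw [invSqrt, sec_diagOp]
  rfl

lemma inner_invSqrt (Ψ χ : Fk N) : inner ℂ (invSqrt N Ψ) χ = inner ℂ Ψ (invSqrt N χ) := by
  refine (hasSum_inner_sec _ _).unique ((hasSum_inner_sec _ _).congr_fun fun n => ?_)
  rw [sec_invSqrt, sec_invSqrt, inner_smul_left, inner_smul_right, map_inv₀, conj_sq1]

lemma sq_norm_sq0_eq (h : Ψ ∈ numDom N wN) :
    inner ℂ (numFun wN Ψ) Ψ = ((‖numFun sq0 Ψ‖ ^ 2 : ℝ) : ℂ) := by
  rw [inner_wN h (wN_le_sq0 h), inner_self_eq_norm_sq_to_K]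
  norm_cast

/-- The free resolvent equation in the space without symmetry. -/
lemma exists_free_solution_aux (f : Fk N) : ∃ (u : Fk N) (b d : Fin N × Fin 3 → Fk N),
    (∀ l, (grad l.1 l.2).HasGen u (b l)) ∧ (∀ l, (grad l.1 l.2).HasGen (b l) (d l)) ∧
    u ∈ numDom N wN ∧ numFun wN u = f + ∑ l, d l - u := by
  obtain ⟨a, b, d, h1, h2, h3⟩ := exists_strong_solution (fun l : Fin N × Fin 3 => grad l.1 l.2)
    (fun l m => grad_commute _ _ _ _) (invSqrt N) inner_invSqrt (fun l _ x => sec_ext fun n => by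
      show sec n (invSqrt N (trans _ x)) = sec n (trans _ (invSqrt N x))
      rw [sec_invSqrt, sec_trans, sec_trans, sec_invSqrt, map_smul]) f
  have h4 : ∀ n, sec n (f + ∑ l, d l - invSqrt N a) = wN n • sec n (invSqrt N a) := fun n => by
    have h5 : sec n (f + ∑ l, d l) = ((n : ℂ) + 1) • sec n (invSqrt N a) := by
      have h6 := sq1_ne_zero n
      have h7 : ((n : ℂ) + 1) * (sq1 n)⁻¹ * (sq1 n)⁻¹ = 1 := by
        rw [← sq1_mul_self]
        field_simp
      rw [h3, sec_invSqrt, sec_invSqrt, smul_smul, smul_smul, h7, one_smul]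
    rw [sec_sub, h5, add_smul, one_smul, add_sub_cancel_right]
    rfl
  exact ⟨invSqrt N a, b, d, h1, h2, mem_numDom_of_sec h4, (eq_numFun_of_sec h4).symm⟩

lemma hasGen_permT (τ : ∀ n, Equiv.Perm (Fin n)) {j : Fin N} {i : Fin 3} {χ : Fk N}
    (h : (grad j i).HasGen Ψ χ) : (grad j i).HasGen (permT τ Ψ) (permT τ χ) :=
  h.map (permT τ).toContinuousLinearMap (G' := grad j i) fun _ z => permT_trans τ _ z

lemma exists_free_solution (hf : f ∈ phSym N) :
    ∃ Ψ : regDom N, (kinL N + numL N + (regDom N).subtype) Ψ = f := by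
  obtain ⟨u, b, d, h1, h2, h3, h4⟩ := exists_free_solution_aux f
  -- a solution is unique, hence it inherits the symmetry of the right hand side
  have hu : u ∈ phSym N := by
    refine mem_phSym_iff.2 fun τ => ?_
    have hn := numFun_permT τ h3
    set v := permT τ u - u with hv
    have g1 : ∀ l, (grad l.1 l.2).HasGen v (permT τ (b l) - b l) := fun l =>
      (hasGen_permT τ (h1 l)).sub (h1 l)
    have g2 : ∀ l, (grad l.1 l.2).HasGen (permT τ (b l) - b l) (permT τ (d l) - d l) := fun l =>
      (hasGen_permT τ (h2 l)).sub (h2 l)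
    have hvN : v ∈ numDom N wN := sub_mem hn.1 h3
    have e : numFun wN v + ∑ l, -(permT τ (d l) - d l) + v = 0 := by
      rw [hv, numFun_sub hn.1 h3, hn.2, h4, map_sub, map_add, map_sum, mem_phSym_iff.1 hf,
        Finset.sum_neg_distrib, Finset.sum_sub_distrib]
      abel
    have e2 := congrArg (inner ℂ v) e
    rw [inner_add_right, inner_add_right, inner_zero_right, inner_sum,
      Finset.sum_congr rfl fun l _ => inner_neg_second (g1 l) (g2 l), inner_self_eq_norm_sq_to_K,
      ← inner_numFun_symm conj_wN hvN hvN, sq_norm_sq0_eq hvN] at e2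
    have e3 := congrArg Complex.re e2
    have e4 : ‖numFun sq0 v‖ ^ 2 + ∑ l, ‖permT τ (b l) - b l‖ ^ 2 + ‖v‖ ^ 2 = 0 := by
      have h5 : (((‖numFun sq0 v‖ ^ 2 + ∑ l, ‖permT τ (b l) - b l‖ ^ 2 + ‖v‖ ^ 2 : ℝ)) : ℂ) = 0 := by
        push_cast at e2 ⊢
        exact e2
      exact_mod_cast h5
    have h5 : 0 ≤ ∑ l, ‖permT τ (b l) - b l‖ ^ 2 := Finset.sum_nonneg fun _ _ => sq_nonneg _
    have h6 : ‖v‖ ^ 2 = 0 := by nlinarith [sq_nonneg ‖numFun sq0 v‖, sq_nonneg ‖v‖]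
    exact sub_eq_zero.1 (norm_eq_zero.1 (pow_eq_zero_iff two_ne_zero |>.1 h6))
  let Ψ : regDom N := ⟨u, hu, h3, fun l => ⟨b l, d l, h1 l, h2 l⟩⟩
  refine ⟨Ψ, ?_⟩
  have k1 : ∀ l, d1 l Ψ = b l := fun l => (d1_spec l Ψ).unique (h1 l)
  have k2 : ∀ l, d2 l Ψ = d l := fun l => by
    have := d2_spec l Ψ
    rw [k1] at this
    exact this.unique (h2 l)
  rw [LinearMap.add_apply, LinearMap.add_apply, kinL_apply, numL_apply]
  simp only [k2]
  change ∑ l, -d l + numFun wN u + u = f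
  rw [h4, Finset.sum_neg_distrib]
  abel

/-- The continuity method for operators on the regular domain. -/
lemma exists_of_path {A B : regDom N →ₗ[ℂ] Fk N} (hA : ∀ Ψ, A Ψ ∈ phSym N)
    (hB : ∀ Ψ, B Ψ ∈ phSym N) {C : ℝ}
    (h : ∀ t : ℝ, 0 ≤ t → t ≤ 1 → ∀ Ψ, ‖B Ψ‖ ≤ C * ‖A Ψ + (t : ℂ) • B Ψ‖)
    (hs : ∀ f ∈ phSym N, ∃ Ψ, A Ψ = f) : ∀ f ∈ phSym N, ∃ Ψ, (A + B) Ψ = f := by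
  intro f hf
  have : CompleteSpace (phSym N) := (isClosed_phSym N).completeSpace_coe
  obtain ⟨Ψ, hΨ⟩ := surjective_of_path (A.codRestrict _ hA) (B.codRestrict _ hB) C
    (fun t h0 h1 Ψ => by
      have h2 := h t h0 h1 Ψ
      rw [Submodule.coe_norm, Submodule.coe_norm, LinearMap.add_apply, LinearMap.smul_apply,
        Submodule.coe_add, Submodule.coe_smul]
      exact h2) (fun g => by
      obtain ⟨Ψ, hΨ⟩ := hs g g.2
      exact ⟨Ψ, Subtype.ext hΨ⟩) ⟨f, hf⟩
  exact ⟨Ψ, congrArg Subtype.val hΨ⟩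

lemma kinL_mem_phSym (Ψ : regDom N) : kinL N Ψ ∈ phSym N := by
  rw [kinL_apply]
  exact sum_mem fun l _ => neg_mem (mem_phSym_of_hasGen (d2_spec l Ψ) (d1_mem_phSym l Ψ))

lemma numL_mem_phSym (Ψ : regDom N) : numL N Ψ ∈ phSym N := numFun_mem_phSym Ψ.2.1 _

lemma pertL_mem_phSym (P : GrossData N) (Ψ : regDom N) : P.pertL Ψ ∈ phSym N := by
  rw [P.pertL_apply]
  refine add_mem (add_mem (Submodule.smul_mem _ _ (sum_mem fun j _ => fld_mem_phSym Ψ.2.1 _ _))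
    (sum_mem fun l _ => ?_)) (mulB_mem_phSym _ Ψ.2.1)
  rw [P.inter_apply]
  exact add_mem (Submodule.smul_mem _ _ (add_mem
    (mem_phSym_of_hasGen (P.dann_spec l Ψ) (ann_mem_phSym Ψ.2.1 _ _))
    (cre_mem_phSym (d1_mem_phSym l Ψ) _ _)))
    (Submodule.smul_mem _ _ (fld_mem_phSym (fld_mem_phSym Ψ.2.1 _ _) _ _))

lemma free_nonneg (Ψ : regDom N) : ∃ e : ℝ, 0 ≤ e ∧
    inner ℂ (Ψ : Fk N) (kinL N Ψ + numL N Ψ) = (e : ℂ) := by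
  refine ⟨∑ l, ‖d1 l Ψ‖ ^ 2 + ‖numFun sq0 (Ψ : Fk N)‖ ^ 2,
    add_nonneg (Finset.sum_nonneg fun _ _ => sq_nonneg _) (sq_nonneg _), ?_⟩
  rw [inner_add_right, inner_kinL_self, ← numL_symm, numL_apply, sq_norm_sq0_eq (reg_wN Ψ)]
  push_cast
  rfl

/-- The free resolvent equation at `± i`. -/
lemma exists_free_solution_I (s : ℝ) (hs : |s| = 1) : ∀ f ∈ phSym N, ∃ Ψ : regDom N,
    (kinL N + numL N + (s * Complex.I : ℂ) • (regDom N).subtype) Ψ = f := by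
  have e : kinL N + numL N + (s * Complex.I : ℂ) • (regDom N).subtype =
      (kinL N + numL N + (regDom N).subtype) + (s * Complex.I - 1 : ℂ) • (regDom N).subtype := by
    rw [sub_smul, one_smul]
    abel
  rw [e]
  refine exists_of_path (C := 4)
    (fun Ψ => add_mem (add_mem (kinL_mem_phSym Ψ) (numL_mem_phSym Ψ)) Ψ.2.1)
    (fun Ψ => Submodule.smul_mem _ _ Ψ.2.1) (fun t h0 _ Ψ => ?_) fun f => exists_free_solution
  obtain ⟨w, hw, hw'⟩ := free_nonneg Ψ
  set n := ‖(Ψ : Fk N)‖ with hn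
  set L := ‖(kinL N + numL N + (regDom N).subtype) Ψ +
    (t : ℂ) • ((s * Complex.I - 1 : ℂ) • (regDom N).subtype) Ψ‖ with hL
  have hsn : ‖(s * Complex.I - 1 : ℂ)‖ ≤ 2 := by
    refine (norm_sub_le _ _).trans ?_
    rw [norm_mul, Complex.norm_I, Complex.norm_real, norm_one, mul_one, Real.norm_eq_abs,
      hs]
    norm_num
  have h2 : inner ℂ (Ψ : Fk N) ((kinL N + numL N + (regDom N).subtype) Ψ +
      (t : ℂ) • ((s * Complex.I - 1 : ℂ) • (regDom N).subtype) Ψ) =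
      ⟨w + (1 - t) * n ^ 2, t * s * n ^ 2⟩ := by
    rw [LinearMap.add_apply, inner_add_right, inner_add_right, LinearMap.add_apply, hw',
      LinearMap.smul_apply, inner_smul_right, inner_smul_right, Submodule.subtype_apply,
      inner_self_eq_norm_sq_to_K, hn, Complex.mk_eq_add_mul_I]
    push_cast
    simp only [RCLike.ofReal_eq_complex_ofReal]
    ring
  have h3 : ‖(⟨w + (1 - t) * n ^ 2, t * s * n ^ 2⟩ : ℂ)‖ ≤ n * L := h2 ▸ norm_inner_le_norm _ _
  have h4 : n ^ 2 ≤ 2 * (n * L) := by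
    have h5 := (Complex.re_le_norm _).trans h3
    have h6 := (Complex.abs_im_le_norm _).trans h3
    rw [abs_mul, abs_mul, abs_of_nonneg h0, hs, mul_one, abs_of_nonneg (sq_nonneg n)] at h6
    simp only at h5
    linarith
  have h5 : n ≤ 2 * L := by
    rcases (norm_nonneg (Ψ : Fk N)).eq_or_lt with h6 | h6
    · rw [hn, ← h6]; positivity
    · rw [← hn] at h6
      nlinarith
  calc _ = ‖(s * Complex.I - 1 : ℂ)‖ * n := norm_smul _ _
    _ ≤ 2 * (2 * L) := by gcongr
    _ = _ := by ring

variable (P : GrossData N)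

lemma sq_norm_ham_add_I {s : ℝ} (hs : |s| = 1) (Ψ : regDom N) :
    ‖kinL N Ψ + numL N Ψ + (t : ℂ) • P.pertL Ψ + (s * Complex.I : ℂ) • (Ψ : Fk N)‖ ^ 2 =
      ‖kinL N Ψ + numL N Ψ + (t : ℂ) • P.pertL Ψ‖ ^ 2 + ‖(Ψ : Fk N)‖ ^ 2 := by
  have h1 : inner ℂ (kinL N Ψ + numL N Ψ + (t : ℂ) • P.pertL Ψ) (Ψ : Fk N) =
      inner ℂ (Ψ : Fk N) (kinL N Ψ + numL N Ψ + (t : ℂ) • P.pertL Ψ) := by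
    rw [inner_add_left, inner_add_left, inner_add_right, inner_add_right, inner_smul_left,
      inner_smul_right, kinL_symm, numL_symm, pertL_symm, Complex.conj_ofReal]
  rw [sq_norm_add_I_smul (inner_im_eq_zero_of_symm h1), ← sq_abs s, hs, one_pow, one_mul]

lemma a_priori_real {a h n H L p C ε b : ℝ} (ha : 0 ≤ a) (hh : 0 ≤ h) (hn : 0 ≤ n)
    (hL : 0 ≤ L) (hC : 0 ≤ C) (hb : 0 ≤ b) (hε : ε = 1 / (8 * (3 + 2 * C) ^ 2))
    (h0 : L ^ 2 = H ^ 2 + n ^ 2) (h1 : a ^ 2 ≤ a * H + (ε * (a + h) ^ 2 + b * n ^ 2))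
    (h2 : h ≤ H + a + p) (h3 : p ≤ 1 / 2 * h + C * (a + n)) :
    p ≤ ((2 + 2 * C) * (4 + 4 * b) + C * (4 + 4 * b)) * L := by
  have hHL : H ≤ L := le_of_sq_le_sq (by nlinarith [sq_nonneg n]) hL
  have hnL : n ≤ L := le_of_sq_le_sq (by nlinarith [sq_nonneg H]) hL
  replace h1 : a ^ 2 ≤ a * L + ε * (a + h) ^ 2 + b * L ^ 2 := by
    have k1 := mul_le_mul_of_nonneg_left hHL ha
    have k2 := mul_le_mul_of_nonneg_left (pow_le_pow_left₀ hn hnL 2) hb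
    linarith
  replace h2 : h ≤ L + a + p := by linarith
  have e1 : h ≤ (2 + 2 * C) * (a + L) := by
    have := mul_le_mul_of_nonneg_left hnL hC
    linarith
  have e2 : a + h ≤ (3 + 2 * C) * (a + L) := by linarith
  have e3 : (a + h) ^ 2 ≤ (3 + 2 * C) ^ 2 * (a + L) ^ 2 := by
    rw [← mul_pow]
    exact pow_le_pow_left₀ (by positivity) e2 2
  have e4 : ε * (a + h) ^ 2 ≤ 1 / 8 * (a + L) ^ 2 := by
    rw [hε, div_mul_eq_mul_div, one_mul, div_le_iff₀ (by positivity)]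
    linarith
  have e5 : a ≤ (3 + 4 * b) * L := by
    refine le_of_sq_le_sq ?_ (by positivity)
    nlinarith [sq_nonneg (a - L), mul_nonneg hb (sq_nonneg L),
      mul_nonneg (mul_nonneg hb hb) (sq_nonneg L)]
  have e6 : a + L ≤ (4 + 4 * b) * L := by linarith
  have e7 := mul_le_mul_of_nonneg_left e6 (show 0 ≤ 2 + 2 * C by positivity)
  have e8 := mul_le_mul_of_nonneg_left e6 hC
  have e9 := mul_le_mul_of_nonneg_left hnL hC
  nlinarith

lemma sq_norm_le_of_re_inner {F : Type*} [NormedAddCommGroup F] [InnerProductSpace ℂ F]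
    (x y z : F) {q Q : ℝ} (hq : 0 ≤ q) (hxy : inner ℂ y x = (q : ℂ)) (h0 : 0 ≤ t) (h1 : t ≤ 1)
    (hQ : 0 ≤ Q) (h : -Q ≤ (inner ℂ y (x + z)).re) :
    ‖y‖ ^ 2 ≤ ‖y‖ * ‖x + y + (t : ℂ) • z‖ + Q := by
  have e1 : inner ℂ y (x + y + (t : ℂ) • z) = ((‖y‖ ^ 2 + (1 - t) * q : ℝ) : ℂ) +
      (t : ℂ) * inner ℂ y (x + z) := by
    rw [inner_add_right, inner_add_right, inner_add_right, inner_smul_right, hxy,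
      inner_self_eq_norm_sq_to_K]
    push_cast
    simp only [RCLike.ofReal_eq_complex_ofReal]
    ring
  have e2 := congrArg Complex.re e1
  rw [Complex.add_re, Complex.ofReal_re, Complex.re_ofReal_mul] at e2
  have e4 : (inner ℂ y (x + y + (t : ℂ) • z)).re ≤ ‖y‖ * ‖x + y + (t : ℂ) • z‖ :=
    (Complex.re_le_norm _).trans (norm_inner_le_norm _ _)
  have e5 := mul_nonneg (sub_nonneg.2 h1) hq
  have e6 := mul_le_mul_of_nonneg_left h h0
  have e7 := mul_le_of_le_one_left hQ h1
  linarith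

lemma norm_le_of_path {F : Type*} [NormedAddCommGroup F] [InnerProductSpace ℂ F] (x y z : F)
    (h0 : 0 ≤ t) (h1 : t ≤ 1) : ‖x‖ ≤ ‖x + y + (t : ℂ) • z‖ + ‖y‖ + ‖z‖ := by
  have e2 : ‖(t : ℂ) • z‖ ≤ ‖z‖ := by
    rw [norm_smul, Complex.norm_real, Real.norm_of_nonneg h0]
    exact mul_le_of_le_one_left (norm_nonneg _) h1
  have e3 : x = x + y + (t : ℂ) • z - y - (t : ℂ) • z := by abel
  have e4 : ‖x‖ ≤ ‖x + y + (t : ℂ) • z‖ + ‖y‖ + ‖(t : ℂ) • z‖ := by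
    conv_lhs => rw [e3]
    exact (norm_sub_le _ _).trans (by gcongr; exact norm_sub_le _ _)
  linarith

/-- The a priori estimate: along the path from the free to the interacting operator, the perturbation
is bounded relative to the full operator. -/
lemma exists_a_priori : ∃ C : ℝ, ∀ t : ℝ, 0 ≤ t → t ≤ 1 → ∀ s : ℝ, |s| = 1 → ∀ Ψ : regDom N,
    ‖P.pertL Ψ‖ ≤ C * ‖kinL N Ψ + numL N Ψ + (t : ℂ) • P.pertL Ψ +
      (s * Complex.I : ℂ) • (Ψ : Fk N)‖ := by
  obtain ⟨C, hC, hp⟩ := (relBdd_pertL P).exists_le (δ := 1 / 2) (by norm_num)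
  obtain ⟨ε, hε⟩ : ∃ ε : ℝ, ε = 1 / (8 * (3 + 2 * C) ^ 2) := ⟨_, rfl⟩
  have hε0 : 0 < ε := by rw [hε]; positivity
  obtain ⟨b, hb, hl⟩ := bddBelowRel_kinL_add_pertL P ε hε0
  refine ⟨(2 + 2 * C) * (4 + 4 * b) + C * (4 + 4 * b), fun t h0 h1 s hs Ψ => ?_⟩
  have k1 := sq_norm_ham_add_I P (t := t) hs Ψ
  have k2 := sq_norm_le_of_re_inner (kinL N Ψ) (numL N Ψ) (P.pertL Ψ)
    (Finset.sum_nonneg fun _ _ => sq_nonneg _) (inner_numL_kinL Ψ) h0 h1 (by positivity) (hl Ψ)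
  have k3 := norm_le_of_path (kinL N Ψ) (numL N Ψ) (P.pertL Ψ) h0 h1
  have k4 := hp Ψ
  exact a_priori_real (norm_nonneg _) (norm_nonneg _) (norm_nonneg _) (norm_nonneg _) hC hb hε k1 k2 k3 k4

lemma exists_solution (s : ℝ) (hs : |s| = 1) (hf : f ∈ phSym N) : ∃ Ψ : regDom N,
    kinL N Ψ + numL N Ψ + P.pertL Ψ + (s * Complex.I : ℂ) • (Ψ : Fk N) = f := by
  obtain ⟨C, hC⟩ := exists_a_priori P
  obtain ⟨Ψ, hΨ⟩ := exists_of_path (C := C)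
    (fun Ψ => add_mem (add_mem (kinL_mem_phSym Ψ) (numL_mem_phSym Ψ))
      (Submodule.smul_mem _ (s * Complex.I : ℂ) Ψ.2.1))
    (pertL_mem_phSym P) (fun t h0 h1 Ψ => by
      refine (hC t h0 h1 s hs Ψ).trans (le_of_eq ?_)
      rw [add_right_comm]
      rfl) (exists_free_solution_I s hs) f hf
  refine ⟨Ψ, ?_⟩
  rw [← hΨ, add_right_comm]
  rfl

/-! ### Permutations of the particles -/

lemma hasGen_permP (σ : Equiv.Perm (Fin N)) {j : Fin N} {i : Fin 3} {χ : Fk N}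
    (h : (grad j i).HasGen Ψ χ) : (grad (σ j) i).HasGen (permP σ Ψ) (permP σ χ) :=
  h.map (permP σ).toContinuousLinearMap (G' := grad (σ j) i) fun t z => by
    have e : (fun m => (t • eDir (σ j) i) (σ m)) = t • eDir j i := by
      funext m
      by_cases hm : m = j
      · subst hm
        simp [eDir]
      · have hm' : σ m ≠ σ j := fun h => hm (σ.injective h)
        simp [eDir, Pi.single_eq_of_ne hm, Pi.single_eq_of_ne hm']
    have h2 := permP_trans σ (t • eDir (σ j) i) z
    rw [e] at h2
    exact h2

/-- Permutation of the particles on the regular domain. -/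
def permR (σ : Equiv.Perm (Fin N)) (Ψ : regDom N) : regDom N :=
  ⟨permP σ Ψ, permP_mem_phSym Ψ.2.1 σ, (numFun_permP σ (reg_wN Ψ)).1, fun l =>
    ⟨permP σ (d1 (σ.symm l.1, l.2) Ψ), permP σ (d2 (σ.symm l.1, l.2) Ψ), by
      have := hasGen_permP σ (d1_spec (σ.symm l.1, l.2) Ψ)
      rwa [σ.apply_symm_apply] at this, by
      have := hasGen_permP σ (d2_spec (σ.symm l.1, l.2) Ψ)
      rwa [σ.apply_symm_apply] at this⟩⟩

lemma permR_coe (σ : Equiv.Perm (Fin N)) (Ψ : regDom N) :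
    (permR σ Ψ : Fk N) = permP σ Ψ := rfl

lemma d1_permR (σ : Equiv.Perm (Fin N)) (j : Fin N) (i : Fin 3) (Ψ : regDom N) :
    d1 (σ j, i) (permR σ Ψ) = permP σ (d1 (j, i) Ψ) :=
  (d1_spec (σ j, i) (permR σ Ψ)).unique (hasGen_permP σ (d1_spec (j, i) Ψ))

lemma d2_permR (σ : Equiv.Perm (Fin N)) (j : Fin N) (i : Fin 3) (Ψ : regDom N) :
    d2 (σ j, i) (permR σ Ψ) = permP σ (d2 (j, i) Ψ) := by
  have h := d2_spec (σ j, i) (permR σ Ψ)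
  rw [d1_permR] at h
  exact h.unique (hasGen_permP σ (d2_spec (j, i) Ψ))

lemma sum_perm {F : Type*} [AddCommMonoid F] (σ : Equiv.Perm (Fin N)) (A : Fin N × Fin 3 → F) :
    ∑ l, A l = ∑ l : Fin N × Fin 3, A (σ l.1, l.2) :=
  (Equiv.sum_comp (σ.prodCongr (Equiv.refl (Fin 3))) A).symm

lemma kinL_permR (σ : Equiv.Perm (Fin N)) (Ψ : regDom N) :
    kinL N (permR σ Ψ) = permP σ (kinL N Ψ) := by
  rw [kinL_apply, kinL_apply, sum_perm σ, map_sum]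
  exact Finset.sum_congr rfl fun l _ => by rw [d2_permR, map_neg]

lemma numL_permR (σ : Equiv.Perm (Fin N)) (Ψ : regDom N) :
    numL N (permR σ Ψ) = permP σ (numL N Ψ) := (numFun_permP σ (reg_wN Ψ)).2

lemma permP_ann (σ : Equiv.Perm (Fin N)) (g : Form) (j : Fin N)
    (h : Ψ ∈ numDom N sq0) : permP σ (ann g j Ψ) = ann g (σ j) (permP σ Ψ) := by
  rw [ann, ann, permP_alpha, (numFun_permP σ h).2]

lemma permP_cre (σ : Equiv.Perm (Fin N)) (g : Form) (j : Fin N)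
    (h : Ψ ∈ numDom N sq0) : permP σ (cre g j Ψ) = cre g (σ j) (permP σ Ψ) := by
  rw [cre, cre, permP_alphaD, (numFun_permP σ (sq0_le_sq1 h)).2]

lemma permP_fld (σ : Equiv.Perm (Fin N)) (g : Form) (j : Fin N)
    (h : Ψ ∈ numDom N sq0) : permP σ (fld g j Ψ) = fld g (σ j) (permP σ Ψ) := by
  rw [fld, fld, map_add, permP_ann σ g j h, permP_cre σ g j h]

lemma pertL_permR (σ : Equiv.Perm (Fin N)) (Ψ : regDom N) :
    P.pertL (permR σ Ψ) = permP σ (P.pertL Ψ) := by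
  rw [P.pertL_apply, P.pertL_apply, map_add, map_add, map_smul, map_sum, map_sum, sum_perm σ,
    ← Equiv.sum_comp σ, permP_mulB P.hV P.hV σ (P.V_perm σ)]
  refine congrArg₂ _ (congrArg₂ _ (congrArg _ (Finset.sum_congr rfl fun j _ => ?_))
    (Finset.sum_congr rfl fun l _ => ?_)) rfl
  · rw [permP_fld σ _ _ (reg_sq0 Ψ)]
    rfl
  · have h1 : P.dann (σ l.1, l.2) (permR σ Ψ) = permP σ (P.dann l Ψ) := by
      have h2 := hasGen_permP σ (P.dann_spec l Ψ)
      rw [permP_ann σ _ _ (reg_sq0 Ψ)] at h2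
      exact (P.dann_spec (σ l.1, l.2) (permR σ Ψ)).unique h2
    rw [P.inter_apply, P.inter_apply, h1, d1_permR, map_add, map_smul, map_smul, map_add,
      permP_cre σ _ _ (d1_sq0 l Ψ), permP_fld σ _ _ (fld_mem_sq0 (reg_wN Ψ) _ _),
      permP_fld σ _ _ (reg_sq0 Ψ)]
    rfl

lemma ham_injective (s : ℝ) (hs : |s| = 1) {Ψ χ : regDom N}
    (h : kinL N Ψ + numL N Ψ + P.pertL Ψ + (s * Complex.I : ℂ) • (Ψ : Fk N) =
      kinL N χ + numL N χ + P.pertL χ + (s * Complex.I : ℂ) • (χ : Fk N)) : Ψ = χ := by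
  have h1 := sq_norm_ham_add_I P (t := 1) hs (Ψ - χ)
  rw [Complex.ofReal_one, one_smul, map_sub, map_sub, map_sub, Submodule.coe_sub, smul_sub] at h1
  have h2 : kinL N Ψ - kinL N χ + (numL N Ψ - numL N χ) + (P.pertL Ψ - P.pertL χ) +
      ((s * Complex.I : ℂ) • (Ψ : Fk N) - (s * Complex.I : ℂ) • (χ : Fk N)) = 0 := by
    rw [← sub_eq_zero] at h
    rw [← h]
    abel
  rw [h2, norm_zero, zero_pow two_ne_zero] at h1
  have h3 : ‖(Ψ : Fk N) - χ‖ ^ 2 = 0 :=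
    le_antisymm (by linarith [sq_nonneg ‖kinL N Ψ - kinL N χ + (numL N Ψ - numL N χ) +
      (P.pertL Ψ - P.pertL χ)‖]) (sq_nonneg _)
  exact Subtype.ext (sub_eq_zero.1 (norm_eq_zero.1 (pow_eq_zero_iff two_ne_zero |>.1 h3)))

/-- The resolvent equation in the bosonic subspace. -/
lemma exists_bosonic_solution (s : ℝ) (hs : |s| = 1) (hf : f ∈ phSym N)
    (hf' : ∀ σ, permP σ f = f) : ∃ Ψ : regDom N, (∀ σ, permP σ (Ψ : Fk N) = Ψ) ∧
      kinL N Ψ + numL N Ψ + P.pertL Ψ + (s * Complex.I : ℂ) • (Ψ : Fk N) = f := by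
  obtain ⟨Ψ, hΨ⟩ := exists_solution P s hs hf
  refine ⟨Ψ, fun σ => congrArg Subtype.val (ham_injective P s hs (Ψ := permR σ Ψ) ?_), hΨ⟩
  rw [kinL_permR, numL_permR, pertL_permR, permR_coe, ← map_add, ← map_add, ← map_smul, ← map_add,
    hΨ, hf']

end Resolvent

/-! ### Graphs of operators on their natural domains -/

section Graphs

variable {V : Type*} [AddCommGroup V] [Module ℂ V]

lemma mem_graph_add {A B : V →ₗ.[ℂ] V} {x a b : V} (ha : (x, a) ∈ A.graph)
    (hb : (x, b) ∈ B.graph) : (x, a + b) ∈ (A + B).graph := by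
  obtain ⟨y, hy, rfl⟩ := (LinearPMap.mem_graph_iff A).1 ha
  obtain ⟨z, hz, rfl⟩ := (LinearPMap.mem_graph_iff B).1 hb
  simp only at hy hz
  subst hy
  refine (LinearPMap.mem_graph_iff _).2 ⟨⟨y, y.2, hz ▸ z.2⟩, rfl, ?_⟩
  rw [LinearPMap.add_apply]
  congr 2
  exact Subtype.ext hz.symm

lemma mem_graph_neg {A : V →ₗ.[ℂ] V} {x a : V} (ha : (x, a) ∈ A.graph) :
    (x, -a) ∈ (-A).graph := by
  obtain ⟨y, hy, rfl⟩ := (LinearPMap.mem_graph_iff A).1 ha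
  exact (LinearPMap.mem_graph_iff _).2 ⟨y, hy, rfl⟩

lemma mem_graph_smul {A : V →ₗ.[ℂ] V} {x a : V} (c : ℂ) (ha : (x, a) ∈ A.graph) :
    (x, c • a) ∈ (c • A).graph := by
  obtain ⟨y, hy, rfl⟩ := (LinearPMap.mem_graph_iff A).1 ha
  exact (LinearPMap.mem_graph_iff _).2 ⟨y, hy, rfl⟩

lemma mem_graph_zero (x : V) : (x, (0 : V)) ∈ (0 : V →ₗ.[ℂ] V).graph :=
  (LinearPMap.mem_graph_iff _).2 ⟨⟨x, trivial⟩, rfl, rfl⟩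

lemma mem_graph_sum {ι : Type*} (s : Finset ι) {A : ι → V →ₗ.[ℂ] V} {x : V} {a : ι → V}
    (h : ∀ i, (x, a i) ∈ (A i).graph) : (x, ∑ i ∈ s, a i) ∈ (∑ i ∈ s, A i).graph := by
  classical
  induction s using Finset.induction_on with
  | empty => exact mem_graph_zero x
  | insert i s hi ih =>
    rw [Finset.sum_insert hi, Finset.sum_insert hi]
    exact mem_graph_add (h i) ih

lemma domain_add (A B : V →ₗ.[ℂ] V) : (A + B).domain = A.domain ⊓ B.domain := rfl

lemma domain_sum_le {ι : Type*} (s : Finset ι) (A : ι → V →ₗ.[ℂ] V) {i : ι} (hi : i ∈ s) :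
    (∑ i ∈ s, A i).domain ≤ (A i).domain := by
  classical
  rw [← Finset.add_sum_erase s A hi, domain_add]
  exact inf_le_left

lemma mem_graph_domRestrict {A : V →ₗ.[ℂ] V} {S : Submodule ℂ V} {x a : V}
    (ha : (x, a) ∈ A.graph) (hx : x ∈ S) : (x, a) ∈ (A.domRestrict S).graph := by
  obtain ⟨y, hy, rfl⟩ := (LinearPMap.mem_graph_iff A).1 ha
  simp only at hy
  subst hy
  exact (LinearPMap.mem_graph_iff _).2 ⟨⟨y, hx, y.2⟩, rfl, rfl⟩

lemma mem_graph_toLinearPMap' {S : Submodule ℂ (V × V)} (h : ∀ y, (0, y) ∈ S → y = 0)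
    {p : V × V} : p ∈ S.toLinearPMap.graph ↔ p ∈ S := by
  rw [Submodule.toLinearPMap_graph_eq]
  rintro ⟨x, y⟩ hp hx
  simp only at hx
  subst hx
  exact h y hp

end Graphs

section NaturalDomain

variable {N : ℕ}
variable {a Ψ χ : Fk N} {A B : Full N →ₗ.[ℂ] Full N} {y : Full N} {g : E → ℂ}

lemma mem_graph_opComp {x a b : Full N} (ha : (x, a) ∈ A.graph)
    (hb : (a, b) ∈ B.graph) : (x, b) ∈ (opComp B A).graph := by
  obtain ⟨y, hy, rfl⟩ := (LinearPMap.mem_graph_iff A).1 ha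
  obtain ⟨z, hz, rfl⟩ := (LinearPMap.mem_graph_iff B).1 hb
  simp only at hy hz
  subst hy
  refine (LinearPMap.mem_graph_iff _).2 ⟨⟨y, ⟨y, ?_, rfl⟩, y.2⟩, rfl, ?_⟩
  · show A y ∈ B.domain
    rw [← hz]
    exact z.2
  · show B _ = B z
    congr 1
    exact Subtype.ext hz.symm

lemma exists_of_mem_opComp {x : Full N}
    (hx : x ∈ (opComp B A).domain) : ∃ a b, (x, a) ∈ A.graph ∧ (a, b) ∈ B.graph := by
  obtain ⟨⟨y, hy1, rfl⟩, hy2⟩ := hx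
  exact ⟨A y, B ⟨A y, hy1⟩, A.mem_graph y, B.mem_graph ⟨A y, hy1⟩⟩

lemma mem_graph_partialDeriv {j : Fin N} {i : Fin 3} :
    (toFull N Ψ, toFull N χ) ∈ (partialDeriv N j i).graph ↔ (grad j i).HasGen Ψ χ := by
  refine (mem_graph_toLinearPMap' fun y hy => HasPartial.eq_zero hy).trans (Iff.trans ?_ hasPartial_iff)
  exact Iff.rfl

lemma toFull_add (Ψ χ : Fk N) : toFull N (Ψ + χ) = toFull N Ψ + toFull N χ :=
  (toFull N).toLinearEquiv.map_add Ψ χ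

lemma toFull_neg (Ψ : Fk N) : toFull N (-Ψ) = -toFull N Ψ := (toFull N).toLinearEquiv.map_neg Ψ

lemma toFull_smul (c : ℂ) (Ψ : Fk N) : toFull N (c • Ψ) = c • toFull N Ψ :=
  (toFull N).toLinearEquiv.map_smul c Ψ

lemma toFull_sum {ι : Type*} (s : Finset ι) (u : ι → Fk N) :
    toFull N (∑ i ∈ s, u i) = ∑ i ∈ s, toFull N (u i) := map_sum (toFull N).toLinearEquiv u s

lemma toFull_zero : toFull N 0 = 0 := (toFull N).toLinearEquiv.map_zero

lemma HasNumberFun.eq_zero {c : ℕ → ℂ} (hy : HasNumberFun c 0 y) : y = 0 := by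
  have h1 : HasNumberFun c (toFull N 0) (toFull N ((toFull N).symm y)) := by
    rw [toFull_zero, (toFull N).apply_symm_apply]
    exact hy
  have h2 := hasNumberFun_iff.1 h1
  have h3 : (toFull N).symm y = 0 := sec_ext fun n => by rw [h2, sec_zero, smul_zero]
  rw [← (toFull N).apply_symm_apply y, h3, toFull_zero]

lemma mem_graph_numberFun {c : ℕ → ℂ} :
    (toFull N Ψ, toFull N χ) ∈ (numberFun N c).graph ↔ ∀ n, sec n χ = c n • sec n Ψ := by
  refine (mem_graph_toLinearPMap' fun y hy => HasNumberFun.eq_zero hy).trans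
    (Iff.trans ?_ hasNumberFun_iff)
  exact Iff.rfl

/-- `χ = A Ψ`. -/
def Gr (A : Full N →ₗ.[ℂ] Full N) (Ψ χ : Fk N) : Prop := (toFull N Ψ, toFull N χ) ∈ A.graph

lemma gr_congr (h : (toFull N Ψ, y) ∈ A.graph)
    (e : toFull N χ = y) : Gr A Ψ χ :=
  (congrArg (fun z => (toFull N Ψ, z) ∈ A.graph) e).mpr h

lemma Gr.add {b : Fk N} (ha : Gr A Ψ a) (hb : Gr B Ψ b) :
    Gr (A + B) Ψ (a + b) := gr_congr (mem_graph_add ha hb) (toFull_add a b)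

lemma Gr.neg (ha : Gr A Ψ a) : Gr (-A) Ψ (-a) :=
  gr_congr (mem_graph_neg ha) (toFull_neg a)

lemma Gr.smul (c : ℂ) (ha : Gr A Ψ a) :
    Gr (c • A) Ψ (c • a) := gr_congr (mem_graph_smul c ha) (toFull_smul c a)

lemma Gr.sum {ι : Type*} (s : Finset ι) {A : ι → Full N →ₗ.[ℂ] Full N} {a : ι → Fk N}
    (h : ∀ i, Gr (A i) Ψ (a i)) : Gr (∑ i ∈ s, A i) Ψ (∑ i ∈ s, a i) :=
  gr_congr (mem_graph_sum s h) (toFull_sum s a)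

lemma Gr.comp {b : Fk N} (ha : Gr A Ψ a) (hb : Gr B a b) :
    Gr (opComp B A) Ψ b := mem_graph_opComp ha hb

lemma Gr.mem_domain (ha : Gr A Ψ a) :
    toFull N Ψ ∈ A.domain := LinearPMap.mem_domain_of_mem_graph ha

lemma exists_gr (h : toFull N Ψ ∈ A.domain) :
    ∃ χ, Gr A Ψ χ := by
  obtain ⟨y, hy⟩ := LinearPMap.mem_domain_iff.1 h
  exact ⟨(toFull N).symm y, gr_congr hy ((toFull N).apply_symm_apply y)⟩

lemma mem_graph_annihilation (hg : MemLp g 2) (j : Fin N)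
    (h : Ψ ∈ numDom N sq0) :
    Gr (annihilation (formFactor g) j) Ψ (ann (hg.toLp g) j Ψ) := by
  exact (mem_graph_toLinearPMap' fun y hy => HasAnnihilation.eq_zero hy).2
    (hasAnnihilation_ann hg j h)

lemma mem_graph_creation (hg : MemLp g 2) (j : Fin N)
    (h : Ψ ∈ numDom N sq0) :
    Gr (creation (formFactor g) j) Ψ (cre (hg.toLp g) j Ψ) := by
  exact (mem_graph_toLinearPMap' fun y hy => HasCreation.eq_zero hy).2 (hasCreation_cre hg j h)

lemma mem_graph_field (hg : MemLp g 2) (j : Fin N)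
    (h : Ψ ∈ numDom N sq0) :
    Gr (field (formFactor g) j) Ψ (fld (hg.toLp g) j Ψ) := by
  exact (mem_graph_annihilation hg j h).add (mem_graph_creation hg j h)

lemma mem_graph_mulOp {m : (Fin N → E) → ℂ} (hm : IsBddMul m volume) (Ψ : Fk N) :
    Gr (mulOp m) Ψ (mulB m hm Ψ) := by
  refine (mem_graph_toLinearPMap' fun y hy => sector_ext fun n => Lp.ext ?_).2 ?_
  · filter_upwards [hy n, sector_zero_ae (N := N) n] with p h1 h2
    have h3 : sector n y p = m p.1 * sector n (0 : Full N) p := h1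
    rw [h3, h2, mul_zero]
  · show HasMul m (toFull N Ψ) (toFull N (mulB m hm Ψ))
    intro n
    rw [sector_toFull, sector_toFull]
    exact sec_mulB_ae hm n Ψ

lemma mem_graph_symPart {Ψ η : H N} :
    (Ψ, η) ∈ (symPart A).graph ↔ ((Ψ : Full N), (η : Full N)) ∈ A.graph := by
  rw [symPart, mem_graph_toLinearPMap' fun y hy => Subtype.ext ?_]
  · rfl
  · exact LinearPMap.graph_fst_eq_zero_snd A hy rfl

/-- The bosonic vector in `H N` that is represented by `Ψ`. -/
def mkH (Ψ : Fk N) (h : Ψ ∈ phSym N) (h' : ∀ σ, permP σ Ψ = Ψ) : H N :=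
  ⟨toFull N Ψ, toFull_mem_bosonic_iff.2 ⟨h, h'⟩⟩

/-- The underlying vector of an element of `H N`. -/
def valH : H N →ₗᵢ[ℂ] Fk N :=
  (toFull N).symm.toLinearIsometry.comp (bosonic N).subtypeₗᵢ

lemma toFull_valH (x : H N) : toFull N (valH x) = (x : Full N) := (toFull N).apply_symm_apply _

lemma valH_mkH (Ψ : Fk N) (h : Ψ ∈ phSym N) (h' : ∀ σ, permP σ Ψ = Ψ) :
    valH (mkH Ψ h h') = Ψ := (toFull N).symm_apply_apply _

lemma valH_bosonic (x : H N) : valH x ∈ phSym N ∧ ∀ σ, permP σ (valH x) = valH x :=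
  toFull_mem_bosonic_iff.1 (by rw [toFull_valH]; exact x.2)

lemma valH_injective : Function.Injective (valH : H N → Fk N) := valH.injective

lemma mem_graph_symPart_iff {x y : H N} :
    (x, y) ∈ (symPart A).graph ↔ Gr A (valH x) (valH y) := by
  rw [mem_graph_symPart]
  exact Iff.of_eq (congrArg₂ (fun a b => (a, b) ∈ A.graph) (toFull_valH x) (toFull_valH y)).symm

lemma exists_gr_of_mem_graph
    (h : (toFull N Ψ, y) ∈ A.graph) : ∃ χ, toFull N χ = y ∧ Gr A Ψ χ :=
  ⟨(toFull N).symm y, (toFull N).apply_symm_apply y,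
    gr_congr h ((toFull N).apply_symm_apply y)⟩

lemma exists_hasGen_of_mem_opComp {j l : Fin N} {i m : Fin 3}
    (h : toFull N Ψ ∈ (opComp (partialDeriv N l m) (partialDeriv N j i)).domain) :
    ∃ χ d, (grad j i).HasGen Ψ χ ∧ (grad l m).HasGen χ d := by
  obtain ⟨a, b, ha, hb⟩ := exists_of_mem_opComp h
  obtain ⟨χ, rfl, hχ⟩ := exists_gr_of_mem_graph ha
  obtain ⟨d, rfl, hd⟩ := exists_gr_of_mem_graph hb
  exact ⟨χ, d, mem_graph_partialDeriv.1 hχ, mem_graph_partialDeriv.1 hd⟩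

lemma mem_numDom_of_mem_numberOp (h : toFull N Ψ ∈ (numberOp N).domain) :
    Ψ ∈ numDom N wN := by
  obtain ⟨χ, hχ⟩ := exists_gr h
  exact mem_numDom_of_sec (mem_graph_numberFun.1 hχ)

lemma mem_graph_numberOp (Ψ : regDom N) :
    Gr (numberOp N) (Ψ : Fk N) (numL N Ψ) :=
  mem_graph_numberFun.2 (sec_numFun (reg_wN Ψ))

lemma mem_graph_d1 (l : Fin N × Fin 3) (Ψ : regDom N) :
    Gr (partialDeriv N l.1 l.2) (Ψ : Fk N) (d1 l Ψ) :=
  mem_graph_partialDeriv.2 (d1_spec l Ψ)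

lemma mem_graph_laplacian (j : Fin N) (Ψ : regDom N) :
    Gr (laplacian j) (Ψ : Fk N) (∑ i, d2 (j, i) Ψ) :=
  Gr.sum _ fun i => (mem_graph_d1 (j, i) Ψ).comp (mem_graph_partialDeriv.2 (d2_spec (j, i) Ψ))

lemma mem_sobolevTwo (Ψ : regDom N) : toFull N (Ψ : Fk N) ∈ sobolevTwo N := by
  refine (Submodule.mem_iInf _).2 fun j => (Submodule.mem_iInf _).2 fun i =>
    ⟨(mem_graph_d1 (j, i) Ψ).mem_domain, ?_⟩
  refine (Submodule.mem_iInf _).2 fun l => (Submodule.mem_iInf _).2 fun m => ?_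
  obtain ⟨y, hy⟩ := UnitaryGroup.exists_mixed (grad_commute l j m i) (d1_spec (l, m) Ψ) (d2_spec (l, m) Ψ)
    (d1_spec (j, i) Ψ) (d2_spec (j, i) Ψ)
  exact ((mem_graph_d1 (j, i) Ψ).comp (mem_graph_partialDeriv.2 hy)).mem_domain

lemma mem_regDom_of_laplacian (h : Ψ ∈ phSym N) (hn : toFull N Ψ ∈ (numberOp N).domain)
    (hl : ∀ j : Fin N, toFull N Ψ ∈ (laplacian j).domain) : Ψ ∈ regDom N :=
  ⟨h, mem_numDom_of_mem_numberOp hn, fun l => exists_hasGen_of_mem_opComp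
    (domain_sum_le _ _ (Finset.mem_univ l.2) (hl l.1))⟩

/-- The domain of the free Hamiltonian consists of the bosonic vectors in the regular domain. -/
lemma mem_domain_free {x : H N} : x ∈ (freeHamiltonian N).domain ↔ valH x ∈ regDom N := by
  constructor
  · intro h
    obtain ⟨y, hy⟩ := LinearPMap.mem_domain_iff.1 h
    have h1 := LinearPMap.mem_domain_of_mem_graph (mem_graph_symPart.1 hy)
    rw [← toFull_valH] at h1
    obtain ⟨h2, -, h3⟩ := h1
    have h4 : ∀ (j : Fin N) (i : Fin 3), toFull N (valH x) ∈
        (opComp (partialDeriv N j i) (partialDeriv N j i)).domain := fun j i =>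
      (Submodule.mem_iInf _).1 ((Submodule.mem_iInf _).1
        ((Submodule.mem_iInf _).1 ((Submodule.mem_iInf _).1 h2 j) i).2 j) i
    exact ⟨(valH_bosonic x).1, mem_numDom_of_mem_numberOp h3, fun l =>
      exists_hasGen_of_mem_opComp (h4 l.1 l.2)⟩
  · intro h
    let Ψ : regDom N := ⟨valH x, h⟩
    have hb : ∀ σ, permP σ (kinL N Ψ + numL N Ψ) = kinL N Ψ + numL N Ψ := fun σ => by
      have e : permR σ Ψ = Ψ := Subtype.ext ((valH_bosonic x).2 σ)
      rw [map_add, ← kinL_permR, ← numL_permR, e]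
    have e : kinL N Ψ = -∑ j, ∑ i, d2 (j, i) Ψ := by
      rw [kinL, LinearMap.neg_apply, LinearMap.sum_apply, Fintype.sum_prod_type]
    have h1 : Gr (-(∑ j : Fin N, laplacian j) + numberOp N) (Ψ : Fk N) (kinL N Ψ + numL N Ψ) := by
      rw [e]
      exact (Gr.sum _ fun j => mem_graph_laplacian j Ψ).neg.add (mem_graph_numberOp Ψ)
    refine LinearPMap.mem_domain_iff.2 ⟨mkH _ (add_mem (kinL_mem_phSym Ψ) (numL_mem_phSym Ψ)) hb,
      mem_graph_symPart_iff.2 ?_⟩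
    rw [valH_mkH]
    exact mem_graph_domRestrict h1 (mem_sobolevTwo Ψ)

end NaturalDomain

/-! ### The form factors and the potential of the Gross transformed Hamiltonian -/

section FormFactors

lemma memLp_inv_one_add_sq : MemLp (fun k : E => (1 + ‖k‖ ^ 2)⁻¹) 2 := by
  refine (memLp_two_iff_integrable_sq_norm (by fun_prop (disch := intro; positivity))).2 ?_
  have h := integrable_rpow_neg_one_add_norm_sq (E := E) (μ := volume) (r := 4) (by simp; norm_num)
  refine h.congr (ae_of_all _ fun k => ?_)
  have h0 : (0 : ℝ) ≤ 1 + ‖k‖ ^ 2 := by positivity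
  have e : (-4 / 2 : ℝ) = -(2 : ℕ) := by norm_num
  simp only [e, Real.rpow_neg h0, Real.rpow_natCast]
  rw [Real.norm_of_nonneg (by positivity), inv_pow]

lemma memLp_of_le_inv {f : E → ℂ} (hf : Measurable f) {C : ℝ}
    (h : ∀ k, ‖f k‖ ≤ C * (1 + ‖k‖ ^ 2)⁻¹) : MemLp f 2 :=
  memLp_inv_one_add_sq.of_le_mul (c := C) hf.aestronglyMeasurable (ae_of_all _ fun k => by
    rw [Real.norm_of_nonneg (by positivity)]
    exact h k)

lemma measurable_bCut (K : ℝ) : Measurable (bCut K) :=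
  Measurable.ite (measurableSet_le measurable_const measurable_norm)
    (Complex.measurable_ofReal.comp (by fun_prop)) measurable_const

lemma norm_mul_norm_bCut_le {K : ℝ} (hK : 0 < K) (k : E) :
    ‖k‖ * ‖bCut K k‖ ≤ (1 + ‖k‖ ^ 2)⁻¹ := by
  by_cases h : K ≤ ‖k‖
  · have h0 : 0 < ‖k‖ := hK.trans_le h
    rw [bCut, if_pos h, Complex.norm_real, Real.norm_eq_abs, abs_div, abs_neg, abs_one,
      abs_of_nonneg (by positivity)]
    field_simp
    rfl
  · rw [bCut, if_neg h, norm_zero, mul_zero]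
    positivity

lemma norm_bCut_le {K : ℝ} (hK : 0 < K) (k : E) :
    ‖bCut K k‖ ≤ K⁻¹ * (1 + ‖k‖ ^ 2)⁻¹ := by
  by_cases h : K ≤ ‖k‖
  · have h1 := norm_mul_norm_bCut_le hK k
    rw [inv_mul_eq_div, le_div_iff₀ hK, mul_comm]
    exact (mul_le_mul_of_nonneg_right h (norm_nonneg _)).trans h1
  · rw [bCut, if_neg h, norm_zero]
    positivity

lemma memLp_bCut {K : ℝ} (hK : 0 < K) : MemLp (bCut K) 2 :=
  memLp_of_le_inv (measurable_bCut K) (norm_bCut_le hK)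

lemma measurable_coord (i : Fin 3) : Measurable fun k : E => (k i : ℂ) :=
  Complex.measurable_ofReal.comp (by fun_prop)

lemma memLp_kbCut {K : ℝ} (hK : 0 < K) (i : Fin 3) :
    MemLp (fun k : E => (k i : ℂ) * bCut K k) 2 :=
  memLp_of_le_inv (C := 1) ((measurable_coord i).mul (measurable_bCut K)) fun k => by
    rw [norm_mul, Complex.norm_real, one_mul]
    exact (mul_le_mul_of_nonneg_right (PiLp.norm_apply_le k i) (norm_nonneg _)).trans
      (norm_mul_norm_bCut_le hK k)

/-- The function `|k| B_K(k)`. -/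
def nb (K : ℝ) (k : E) : ℂ := (‖k‖ : ℂ) * bCut K k

/-- The function `|k|⁻²` for `|k| ≥ K`. -/
def invSq (K : ℝ) (k : E) : ℂ := if K ≤ ‖k‖ then (((‖k‖ ^ 2)⁻¹ : ℝ) : ℂ) else 0

lemma memLp_nb {K : ℝ} (hK : 0 < K) : MemLp (nb K) 2 :=
  memLp_of_le_inv (C := 1) ((Complex.measurable_ofReal.comp measurable_norm).mul
    (measurable_bCut K)) fun k => by
    rw [nb, norm_mul, Complex.norm_real, norm_norm, one_mul]
    exact norm_mul_norm_bCut_le hK k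

lemma memLp_invSq {K : ℝ} (hK : 0 < K) : MemLp (invSq K) 2 := by
  refine memLp_of_le_inv (C := (K ^ 2)⁻¹ + 1) (Measurable.ite (measurableSet_le measurable_const
    measurable_norm) (Complex.measurable_ofReal.comp (by fun_prop)) measurable_const) fun k => ?_
  by_cases h : K ≤ ‖k‖
  · have h0 : 0 < ‖k‖ := hK.trans_le h
    rw [invSq, if_pos h, Complex.norm_real, Real.norm_of_nonneg (by positivity), ← div_eq_mul_inv,
      le_div_iff₀ (by positivity), mul_add, mul_one, inv_mul_cancel₀ (by positivity)]
    gcongr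
  · rw [invSq, if_neg h, norm_zero]
    positivity

variable {N : ℕ}
variable {K : ℝ} {x : H N}

lemma formFactor_congr {f g : E → ℂ} (h : f =ᵐ[volume] g) (x : E) :
    formFactor f x =ᵐ[volume] formFactor g x := by
  filter_upwards [h] with k hk
  rw [formFactor, formFactor, hk]

lemma pairing_toLp {f g : E → ℂ} (hf : MemLp f 2) (hg : MemLp g 2) (j l : Fin N)
    (x : Fin N → E) : pairing (hf.toLp f) (hg.toLp g) j l x =
      ∫ k, conj (formFactor f (x j) k) * formFactor g (x l) k := by
  refine integral_congr_ae ?_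
  filter_upwards [formFactor_congr hf.coeFn_toLp (x j), formFactor_congr hg.coeFn_toLp (x l)]
    with k h1 h2
  rw [h1, h2]

lemma grossV_eq (K : ℝ) (hK : 0 < K) (j l : Fin N) (x : Fin N → E) :
    grossV N K (x j) (x l) = (N : ℂ)⁻¹ *
      (pairing ((memLp_bCut hK).toLp _) ((memLp_bCut hK).toLp _) j l x +
        2 * ((pairing ((memLp_invSq hK).toLp _) ((memLp_nb hK).toLp _) j l x).re : ℂ)) := by
  rw [grossV, pairing_toLp, pairing_toLp]
  congr 5
  refine integral_congr_ae (ae_of_all _ fun k => ?_)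
  simp only [formFactor, nb, invSq, bCut]
  by_cases h : K ≤ ‖k‖
  · have h0 : (‖k‖ : ℂ) ≠ 0 := by exact_mod_cast (hK.trans_le h).ne'
    simp only [if_pos h, map_mul, Complex.conj_ofReal]
    push_cast
    field_simp
  · simp only [if_neg h]
    ring

/-- The potential `∑_{j,l} V_K(x_j - x_l)`. -/
def totalV (N : ℕ) (K : ℝ) (x : Fin N → E) : ℂ := ∑ j : Fin N, ∑ l : Fin N, grossV N K (x j) (x l)

lemma IsBddMul.add {α : Type*} [MeasurableSpace α] {μ : Measure α} {m m' : α → ℂ}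
    (h : IsBddMul m μ) (h' : IsBddMul m' μ) : IsBddMul (fun x => m x + m' x) μ := by
  obtain ⟨h1, C, hC⟩ := h
  obtain ⟨h2, C', hC'⟩ := h'
  exact ⟨h1.add h2, C + C', fun x => (norm_add_le _ _).trans (add_le_add (hC x) (hC' x))⟩

lemma IsBddMul.const_mul {α : Type*} [MeasurableSpace α] {μ : Measure α} {m : α → ℂ}
    (h : IsBddMul m μ) (c : ℂ) : IsBddMul (fun x => c * m x) μ := by
  obtain ⟨h1, C, hC⟩ := h
  exact ⟨h1.const_mul c, ‖c‖ * C, fun x => by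
    rw [norm_mul]
    exact mul_le_mul_of_nonneg_left (hC x) (norm_nonneg _)⟩

lemma IsBddMul.sum {α ι : Type*} [MeasurableSpace α] {μ : Measure α} (s : Finset ι)
    {m : ι → α → ℂ} (h : ∀ i, IsBddMul (m i) μ) : IsBddMul (fun x => ∑ i ∈ s, m i x) μ := by
  classical
  induction s using Finset.induction_on with
  | empty => exact ⟨by simpa using aestronglyMeasurable_const, 0, by simp⟩
  | insert i s hi ih =>
    simp only [Finset.sum_insert hi]
    exact (h i).add ih

lemma IsBddMul.re {α : Type*} [MeasurableSpace α] {μ : Measure α} {m : α → ℂ}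
    (h : IsBddMul m μ) : IsBddMul (fun x => ((m x).re : ℂ)) μ := by
  obtain ⟨h1, C, hC⟩ := h
  exact ⟨Complex.continuous_ofReal.comp_aestronglyMeasurable
    (Complex.continuous_re.comp_aestronglyMeasurable h1), C, fun x => by
      rw [Complex.norm_real]
      exact (Complex.abs_re_le_norm _).trans (hC x)⟩

lemma isBddMul_totalV (N : ℕ) (hK : 0 < K) : IsBddMul (totalV N K) volume := by
  have e : totalV N K = fun x => ∑ j : Fin N, ∑ l : Fin N, (N : ℂ)⁻¹ *
      (pairing ((memLp_bCut hK).toLp _) ((memLp_bCut hK).toLp _) j l x +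
        2 * ((pairing ((memLp_invSq hK).toLp _) ((memLp_nb hK).toLp _) j l x).re : ℂ)) := by
    funext x
    exact Finset.sum_congr rfl fun j _ => Finset.sum_congr rfl fun l _ => grossV_eq K hK j l x
  rw [e]
  exact IsBddMul.sum _ fun j => IsBddMul.sum _ fun l => ((isBddMul_pairing _ _ _ _).add
    ((isBddMul_pairing _ _ _ _).re.const_mul 2)).const_mul _

lemma conj_pairing (f g : Form) (j l : Fin N) (x : Fin N → E) :
    conj (pairing f g j l x) = pairing g f l j x := by
  rw [pairing, pairing, ← integral_conj]
  refine integral_congr_ae (ae_of_all _ fun k => ?_)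
  simp only [map_mul, Complex.conj_conj]
  ring

lemma conj_totalV (N : ℕ) (hK : 0 < K) (x : Fin N → E) :
    conj (totalV N K x) = totalV N K x := by
  have e : totalV N K x = ∑ j : Fin N, ∑ l : Fin N,
      (N : ℂ)⁻¹ * pairing ((memLp_bCut hK).toLp _) ((memLp_bCut hK).toLp _) j l x +
      ∑ j : Fin N, ∑ l : Fin N, (N : ℂ)⁻¹ *
        (2 * ((pairing ((memLp_invSq hK).toLp _) ((memLp_nb hK).toLp _) j l x).re : ℂ)) := by
    rw [← Finset.sum_add_distrib]
    refine Finset.sum_congr rfl fun j _ => ?_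
    rw [← Finset.sum_add_distrib]
    exact Finset.sum_congr rfl fun l _ => by rw [grossV_eq K hK, mul_add]
  rw [e, map_add]
  refine congrArg₂ _ ?_ ?_
  · rw [map_sum, Finset.sum_comm]
    refine Finset.sum_congr rfl fun j _ => ?_
    rw [map_sum]
    refine Finset.sum_congr rfl fun l _ => ?_
    rw [map_mul, map_inv₀, Complex.conj_natCast, conj_pairing]
  · simp only [map_sum, map_mul, map_inv₀, Complex.conj_natCast, Complex.conj_ofReal,
      Complex.conj_ofNat]

lemma totalV_perm (N : ℕ) (K : ℝ) (σ : Equiv.Perm (Fin N)) (x : Fin N → E) :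
    totalV N K (fun j => x (σ j)) = totalV N K x := by
  exact (Finset.sum_congr rfl fun j _ => Equiv.sum_comp σ fun l => grossV N K (x (σ j)) (x l)).trans
    (Equiv.sum_comp σ fun j => ∑ l, grossV N K (x j) (x l))

/-- The data of the Gross transformed Hamiltonian. -/
def grossData (N : ℕ) (hK : 0 < K) : GrossData N where
  c := (√(N : ℝ))⁻¹
  g := (memLp_gCut K).toLp _
  v := fun i => (memLp_kbCut hK i).toLp _
  hv := fun i => by
    filter_upwards [(memLp_kbCut hK i).coeFn_toLp] with k hk
    rw [hk, norm_mul, Complex.norm_real]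
    have h1 := (mul_le_mul_of_nonneg_right (PiLp.norm_apply_le k i) (norm_nonneg _)).trans
      (norm_mul_norm_bCut_le hK k)
    refine (mul_le_mul_of_nonneg_left h1 (sq_nonneg _)).trans ?_
    rw [← div_eq_mul_inv, div_le_one (by positivity)]
    linarith
  V := totalV N K
  hV := isBddMul_totalV N hK
  conj_V := conj_totalV N hK
  V_perm := totalV_perm N K

lemma coupling_eq (hK : 0 < K) : coupling N = ((grossData N hK).c : ℂ) := rfl

lemma coupling_sq (hK : 0 < K) : ((grossData N hK).c : ℂ) ^ 2 = (N : ℂ)⁻¹ := by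
  show (((√(N : ℝ))⁻¹ : ℝ) : ℂ) ^ 2 = _
  rw [← Complex.ofReal_pow, inv_pow, Real.sq_sqrt (Nat.cast_nonneg _)]
  push_cast
  rfl

/-- The Gross transformed Hamiltonian on the regular domain. -/
def hamL (N : ℕ) (hK : 0 < K) : regDom N →ₗ[ℂ] Fk N :=
  kinL N + numL N + (grossData N hK).pertL

lemma hamL_apply (hK : 0 < K) (Ψ : regDom N) :
    hamL N hK Ψ = kinL N Ψ + numL N Ψ + (grossData N hK).pertL Ψ := rfl

lemma add_shuffle {F : Type*} [AddCommGroup F] (a f n i m : F) :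
    a + n + (f + i + m) = a + f + n + i + m := by abel

lemma hamL_eq (hK : 0 < K) (Ψ : regDom N) :
    hamL N hK Ψ = ∑ j, (-∑ i, d2 (j, i) Ψ + coupling N • fld ((memLp_gCut K).toLp _) j
      (Ψ : Fk N)) + numL N Ψ + ∑ j, ((2 * Complex.I * coupling N) •
      ∑ i, ((grossData N hK).dann (j, i) Ψ + cre ((grossData N hK).v i) j (d1 (j, i) Ψ)) +
        (N : ℂ)⁻¹ • ∑ i, fld ((grossData N hK).v i) j (fld ((grossData N hK).v i) j (Ψ : Fk N))) +
      mulB _ (isBddMul_totalV N hK) (Ψ : Fk N) := by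
  set P := grossData N hK with hP
  have e1 : kinL N Ψ = ∑ j, -∑ i, d2 (j, i) Ψ := by
    rw [kinL, LinearMap.neg_apply, LinearMap.sum_apply, Fintype.sum_prod_type,
      Finset.sum_neg_distrib]
  have e2 : ∑ l, P.inter l Ψ = ∑ j, ((2 * Complex.I * coupling N) •
    ∑ i, (P.dann (j, i) Ψ + cre (P.v i) j (d1 (j, i) Ψ)) +
      (N : ℂ)⁻¹ • ∑ i, fld (P.v i) j (fld (P.v i) j (Ψ : Fk N))) := by
    rw [Fintype.sum_prod_type]
    refine Finset.sum_congr rfl fun j _ => ?_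
    simp only [P.inter_apply]
    rw [Finset.sum_add_distrib, ← Finset.smul_sum, ← Finset.smul_sum, hP, coupling_sq]
    rfl
  have e3 : ∑ j, (-∑ i, d2 (j, i) Ψ + coupling N • fld ((memLp_gCut K).toLp _) j (Ψ : Fk N)) =
      kinL N Ψ + (P.c : ℂ) • ∑ j, fld P.g j (Ψ : Fk N) := by
    rw [Finset.sum_add_distrib, ← Finset.smul_sum, ← e1]
    rfl
  have e4 : mulB P.V P.hV (Ψ : Fk N) = mulB _ (isBddMul_totalV N hK) (Ψ : Fk N) := rfl
  rw [hamL_apply, P.pertL_apply, e2, e3, ← e4]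
  generalize (P.c : ℂ) • ∑ j, fld P.g j (Ψ : Fk N) = f
  generalize mulB P.V P.hV (Ψ : Fk N) = m
  generalize kinL N Ψ = a
  generalize numL N Ψ = n
  exact add_shuffle _ _ _ _ _

lemma gr_gross (hK : 0 < K) (Ψ : regDom N) :
    Gr (∑ j : Fin N, (-laplacian j + coupling N • field (formFactor (gCut K)) j) + numberOp N
      + ∑ j : Fin N, grossA K j
      + mulOp fun x => ∑ j : Fin N, ∑ l : Fin N, grossV N K (x j) (x l))
      (Ψ : Fk N) (hamL N hK Ψ) := by
  set P := grossData N hK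
  have h1 (j : Fin N) : Gr (grossA K j) (Ψ : Fk N)
      ((2 * Complex.I * coupling N) • ∑ i, (P.dann (j, i) Ψ + cre (P.v i) j (d1 (j, i) Ψ)) +
        (N : ℂ)⁻¹ • ∑ i, fld (P.v i) j (fld (P.v i) j (Ψ : Fk N))) := by
    refine Gr.add (Gr.smul _ (Gr.sum _ fun i => Gr.add ?_ ?_)) (Gr.smul _ (Gr.sum _ fun i => ?_))
    · exact (mem_graph_annihilation (memLp_kbCut hK i) j (reg_sq0 Ψ)).comp
        (mem_graph_partialDeriv.2 (P.dann_spec (j, i) Ψ))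
    · exact (mem_graph_d1 (j, i) Ψ).comp
        (mem_graph_creation (memLp_kbCut hK i) j (d1_sq0 (j, i) Ψ))
    · exact (mem_graph_field (memLp_kbCut hK i) j (reg_sq0 Ψ)).comp
        (mem_graph_field (memLp_kbCut hK i) j (fld_mem_sq0 (reg_wN Ψ) _ _))
  have h2 := (((Gr.sum Finset.univ fun j => (mem_graph_laplacian j Ψ).neg.add
    ((mem_graph_field (memLp_gCut K) j (reg_sq0 Ψ)).smul (coupling N))).add
    (mem_graph_numberOp Ψ)).add (Gr.sum Finset.univ h1)).add
    (mem_graph_mulOp (isBddMul_totalV N hK) (Ψ : Fk N))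
  exact (congrArg (Gr _ (Ψ : Fk N)) (hamL_eq hK Ψ)).mpr h2

lemma hamL_bosonic (hK : 0 < K) {Ψ : regDom N} (h : ∀ σ, permP σ (Ψ : Fk N) = Ψ) :
    hamL N hK Ψ ∈ phSym N ∧ ∀ σ, permP σ (hamL N hK Ψ) = hamL N hK Ψ := by
  refine ⟨add_mem (add_mem (kinL_mem_phSym Ψ) (numL_mem_phSym Ψ)) (pertL_mem_phSym _ Ψ),
    fun σ => ?_⟩
  have e : permR σ Ψ = Ψ := Subtype.ext (h σ)
  rw [hamL_apply, map_add, map_add, ← kinL_permR, ← numL_permR, ← pertL_permR, e]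

/-- The graph of the Gross transformed Hamiltonian. -/
lemma mem_graph_gross (hK : 0 < K) {y : H N} :
    (x, y) ∈ (grossHamiltonian N K).graph ↔
      ∃ h : valH x ∈ regDom N, hamL N hK ⟨valH x, h⟩ = valH y := by
  rw [grossHamiltonian, mem_graph_symPart_iff]
  constructor
  · intro h
    have h1 := h.mem_domain
    obtain ⟨⟨⟨h2, h3⟩, h4⟩, h5⟩ := h1
    have h6 : valH x ∈ regDom N := mem_regDom_of_laplacian (valH_bosonic x).1 h3 fun j =>
      (domain_sum_le _ _ (Finset.mem_univ j) h2).1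
    refine ⟨h6, (toFull N).injective ?_⟩
    exact LinearPMap.mem_graph_snd_inj _ (gr_gross hK ⟨valH x, h6⟩) h rfl
  · rintro ⟨h, h'⟩
    exact (congrArg (Gr _ (valH x)) h').mp (gr_gross hK ⟨valH x, h⟩)

lemma mem_domain_gross (hK : 0 < K) :
    x ∈ (grossHamiltonian N K).domain ↔ valH x ∈ regDom N := by
  rw [LinearPMap.mem_domain_iff]
  constructor
  · rintro ⟨y, hy⟩
    exact ((mem_graph_gross hK).1 hy).1
  · intro h
    obtain ⟨h1, h2⟩ := hamL_bosonic hK (Ψ := ⟨valH x, h⟩) (valH_bosonic x).2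
    exact ⟨mkH _ h1 h2, (mem_graph_gross hK).2 ⟨h, (valH_mkH _ _ _).symm⟩⟩

lemma grossHamiltonian_domain (hK : 0 < K) :
    (grossHamiltonian N K).domain = (freeHamiltonian N).domain :=
  Submodule.ext fun _ => (mem_domain_gross hK).trans mem_domain_free.symm

lemma hamL_symm (hK : 0 < K) (χ Ψ : regDom N) :
    inner ℂ (hamL N hK χ) (Ψ : Fk N) = inner ℂ (χ : Fk N) (hamL N hK Ψ) := by
  rw [hamL_apply, hamL_apply, inner_add_left, inner_add_left, inner_add_right, inner_add_right,
    kinL_symm, numL_symm, pertL_symm]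

lemma exists_gross_solution (hK : 0 < K) (s : ℝ) (hs : |s| = 1) (f : H N) :
    ∃ x y : H N, (x, y) ∈ (grossHamiltonian N K).graph ∧ y + (s * Complex.I : ℂ) • x = f := by
  obtain ⟨Ψ, h1, h2⟩ := exists_bosonic_solution (grossData N hK) s hs (valH_bosonic f).1
    (valH_bosonic f).2
  obtain ⟨h3, h4⟩ := hamL_bosonic hK h1
  refine ⟨mkH Ψ Ψ.2.1 h1, mkH _ h3 h4, (mem_graph_gross hK).2 ?_, valH_injective ?_⟩
  · simp only [valH_mkH]
    exact ⟨Ψ.2, trivial⟩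
  · rw [map_add, map_smul, valH_mkH, valH_mkH]
    exact h2

lemma inner_gross_symm (hK : 0 < K) {y x' y' : H N}
    (h : (x, y) ∈ (grossHamiltonian N K).graph) (h' : (x', y') ∈ (grossHamiltonian N K).graph) :
    inner ℂ y x' = inner ℂ x y' := by
  obtain ⟨h1, h2⟩ := (mem_graph_gross hK).1 h
  obtain ⟨h3, h4⟩ := (mem_graph_gross hK).1 h'
  refine (valH.inner_map_map _ _).symm.trans (Eq.trans ?_ (valH.inner_map_map _ _))
  rw [← h2, ← h4]
  exact hamL_symm hK ⟨_, h1⟩ ⟨_, h3⟩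

lemma isSelfAdjoint_of_graph {F : Type*} [NormedAddCommGroup F] [InnerProductSpace ℂ F]
    [CompleteSpace F] (A : F →ₗ.[ℂ] F)
    (h : ∀ x y x' y' : F, (x, y) ∈ A.graph → (x', y') ∈ A.graph → inner ℂ y x' = inner ℂ x y')
    (h' : ∀ s : ℝ, |s| = 1 → ∀ f : F, ∃ x y : F, (x, y) ∈ A.graph ∧ y + (s * Complex.I : ℂ) • x = f) :
    IsSelfAdjoint A := by
  have key : ∀ (s : ℝ), |s| = 1 → ∀ f : F, ∃ x : A.domain,
      A x + (s * Complex.I : ℂ) • (x : F) = f := fun s hs f => by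
    obtain ⟨x, y, h1, h2⟩ := h' s hs f
    obtain ⟨z, hz, hz'⟩ := (LinearPMap.mem_graph_iff _).1 h1
    simp only at hz hz'
    exact ⟨z, by rw [hz, hz', h2]⟩
  refine isSelfAdjoint_of_surjective _ (fun x y => ?_) 1 one_ne_zero (key 1 abs_one) fun f => ?_
  · exact h _ _ _ _ (A.mem_graph x) (A.mem_graph y)
  · obtain ⟨x, hx⟩ := key (-1) (by simp) f
    refine ⟨x, ?_⟩
    rw [← hx]
    push_cast
    rw [neg_one_mul, neg_smul, one_mul, sub_eq_add_neg]

lemma isSelfAdjoint_gross (hK : 0 < K) : IsSelfAdjoint (grossHamiltonian N K) :=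
  isSelfAdjoint_of_graph _ (fun _ _ _ _ => inner_gross_symm hK) (exists_gross_solution hK)

end FormFactors

/-! ### Exponentials of antisymmetric operators on analytic vectors -/

section Exponential

variable {F : Type*} [NormedAddCommGroup F] [InnerProductSpace ℂ F] [CompleteSpace F]
  {V S : Submodule ℂ F}

/-- The term `Bᵐ / m!` of the exponential series. -/
def expTerm (B : Module.End ℂ V) (m : ℕ) : Module.End ℂ V := ((m.factorial : ℂ)⁻¹) • B ^ m

lemma expTerm_zero (B : Module.End ℂ V) : expTerm B 0 = 1 := by
  simp [expTerm]

lemma smul_expTerm_succ (B : Module.End ℂ V) (m : ℕ) :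
    ((m : ℂ) + 1) • expTerm B (m + 1) = B * expTerm B m := by
  have h : (m : ℂ) + 1 ≠ 0 := Nat.cast_add_one_ne_zero m
  rw [expTerm, expTerm, smul_smul, Nat.factorial_succ, Nat.cast_mul, mul_inv, ← mul_assoc,
    Nat.cast_add_one, mul_inv_cancel₀ h, one_mul, pow_succ', mul_smul_comm]

lemma expTerm_commute {B s : Module.End ℂ V} (h : Commute s B) (m : ℕ) :
    Commute s (expTerm B m) := (h.pow_right m).smul_right _

/-- The product of the exponential series of `-A` and `A` is `1`. -/
lemma sum_antidiagonal_expTerm (A : Module.End ℂ V) (n : ℕ) :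
    ∑ p ∈ Finset.HasAntidiagonal.antidiagonal n, expTerm (-A) p.1 * expTerm A p.2 = if n = 0 then 1 else 0 := by
  have h := (Commute.neg_left (Commute.refl A)).add_pow' n
  rw [neg_add_cancel, zero_pow_eq] at h
  have h2 : ∑ p ∈ Finset.HasAntidiagonal.antidiagonal n, expTerm (-A) p.1 * expTerm A p.2 =
      ((n.factorial : ℂ)⁻¹) • if n = 0 then (1 : Module.End ℂ V) else 0 := by
    rw [h, Finset.smul_sum]
    refine Finset.sum_congr rfl fun p hp => ?_
    rw [expTerm, expTerm, smul_mul_smul_comm, ← Nat.cast_smul_eq_nsmul ℂ, smul_smul]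
    congr 1
    obtain rfl := Finset.HasAntidiagonal.mem_antidiagonal.1 hp
    rw [← Nat.add_choose_mul_factorial_mul_factorial p.1 p.2, Nat.choose_symm_add]
    have h1 : ((p.1.factorial : ℂ)) ≠ 0 := Nat.cast_ne_zero.2 p.1.factorial_ne_zero
    have h2 : ((p.2.factorial : ℂ)) ≠ 0 := Nat.cast_ne_zero.2 p.2.factorial_ne_zero
    have h3 : (((p.1 + p.2).choose p.2 : ℕ) : ℂ) ≠ 0 :=
      Nat.cast_ne_zero.2 (Nat.choose_pos (Nat.le_add_left _ _)).ne'
    push_cast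
    field_simp
  rw [h2]
  split_ifs with h0
  · rw [h0, Nat.factorial_zero, Nat.cast_one, inv_one, one_smul]
  · rw [smul_zero]

lemma inner_expTerm {A : Module.End ℂ V}
    (hA : ∀ u w : V, inner ℂ (A u : F) w = -inner ℂ (u : F) (A w)) (m : ℕ) (u w : V) :
    inner ℂ (expTerm A m u : F) w = inner ℂ (u : F) (expTerm (-A) m w) := by
  induction m generalizing u w with
  | zero => rw [expTerm_zero, expTerm_zero, Module.End.one_apply, Module.End.one_apply]
  | succ m ih =>
    have h : (m : ℂ) + 1 ≠ 0 := Nat.cast_add_one_ne_zero m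
    have e1 := congrArg (fun T : Module.End ℂ V => (T u : F)) (smul_expTerm_succ A m)
    have e2 := congrArg (fun T : Module.End ℂ V => (T w : F))
      ((smul_expTerm_succ (-A) m).trans ((expTerm_commute (Commute.refl (-A)) m)).eq)
    have h1 : inner ℂ ((A * expTerm A m) u : F) (w : F) =
        inner ℂ (u : F) ((expTerm (-A) m * -A) w : F) := by
      rw [Module.End.mul_apply, Module.End.mul_apply, hA, ih, LinearMap.neg_apply, map_neg,
        Submodule.coe_neg, inner_neg_right]
    rw [← e1, ← e2] at h1
    simp only [LinearMap.smul_apply, Submodule.coe_smul, inner_smul_left, inner_smul_right,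
      map_add, map_natCast, map_one] at h1
    exact mul_left_cancel₀ h h1

lemma hasSum_inner_prod {x y : ℕ → F} {X Y : F} (hx : HasSum x X) (hy : HasSum y Y)
    (hx' : Summable fun m => ‖x m‖) (hy' : Summable fun m => ‖y m‖) :
    HasSum (fun p : ℕ × ℕ => inner ℂ (x p.1) (y p.2)) (inner ℂ X Y) := by
  have hs : Summable fun p : ℕ × ℕ => inner ℂ (x p.1) (y p.2) :=
    Summable.of_norm_bounded (hx'.mul_of_nonneg hy' (fun _ => norm_nonneg _)
      fun _ => norm_nonneg _) fun p => norm_inner_le_norm _ _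
  have h1 : HasSum (fun m => inner ℂ (x m) Y) (inner ℂ X Y) :=
    ((innerSL ℂ).flip Y).hasSum hx
  have h2 := hs.hasSum.prod_fiberwise fun m => (innerSL ℂ (x m)).hasSum hy
  exact (h2.unique h1) ▸ hs.hasSum

lemma inner_exp_exp {A : Module.End ℂ V}
    (hA : ∀ u w : V, inner ℂ (A u : F) w = -inner ℂ (u : F) (A w))
    (hs : ∀ u : V, Summable fun m => ‖(expTerm A m u : F)‖) {u w : V} {X Y : F}
    (hX : HasSum (fun m => (expTerm A m u : F)) X)
    (hY : HasSum (fun m => (expTerm A m w : F)) Y) : inner ℂ X Y = inner ℂ (u : F) w := by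
  have h1 := hasSum_inner_prod hX hY (hs u) (hs w)
  have h2 := (Finset.HasAntidiagonal.sigmaAntidiagonalEquivProd.hasSum_iff.2 h1).sigma
    fun n => hasSum_fintype _
  refine h2.unique ?_
  have h3 : HasSum (fun n : ℕ => if n = 0 then inner ℂ (u : F) (w : F) else 0)
      (inner ℂ (u : F) w) := hasSum_ite_eq 0 _
  refine h3.congr_fun fun n => ?_
  have h4 : ∑ p : Finset.HasAntidiagonal.antidiagonal n, inner ℂ (expTerm A p.1.1 u : F) (expTerm A p.1.2 w : F) =
      inner ℂ (u : F) ((∑ p ∈ Finset.HasAntidiagonal.antidiagonal n, expTerm (-A) p.1 * expTerm A p.2) w : V) := by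
    rw [Finset.sum_coe_sort (Finset.HasAntidiagonal.antidiagonal n)
      (fun p => inner ℂ (expTerm A p.1 u : F) (expTerm A p.2 w : F)), LinearMap.sum_apply,
      Submodule.coe_sum, inner_sum]
    exact Finset.sum_congr rfl fun p _ => inner_expTerm hA _ _ _
  refine Eq.trans h4 ?_
  rw [sum_antidiagonal_expTerm]
  split_ifs <;> simp

/-- An antisymmetric operator whose exponential series converges on a dense subspace generates an
isometry. -/
lemma exists_isometric_exp (hVS : V ≤ S) (hS : IsClosed (S : Set F))
    (hd : ∀ x ∈ S, ∃ u : ℕ → V, Tendsto (fun n => (u n : F)) atTop (𝓝 x)) {A : Module.End ℂ V}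
    (hA : ∀ u w : V, inner ℂ (A u : F) w = -inner ℂ (u : F) (A w))
    (hs : ∀ u : V, Summable fun m => ‖(expTerm A m u : F)‖) :
    ∃ U : F →L[ℂ] F, (∀ u : V, HasSum (fun m => (expTerm A m u : F)) (U u)) ∧
      (∀ x ∈ S, U x ∈ S) ∧ ∀ x ∈ S, ∀ y ∈ S, inner ℂ (U x) (U y) = inner ℂ x y := by
  have : CompleteSpace S := hS.completeSpace_coe
  let f : V →ₗ[ℂ] F :=
    { toFun := fun u => ∑' m, (expTerm A m u : F)
      map_add' := fun u w => by
        simp only [map_add, Submodule.coe_add]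
        exact (hs u).of_norm.tsum_add (hs w).of_norm
      map_smul' := fun c u => by
        simp only [map_smul, Submodule.coe_smul]
        exact (hs u).of_norm.tsum_const_smul c }
  have hf (u : V) : HasSum (fun m => (expTerm A m u : F)) (f u) := (hs u).of_norm.hasSum
  have hff (u w : V) : inner ℂ (f u) (f w) = inner ℂ (u : F) w := inner_exp_exp hA hs (hf u) (hf w)
  have hn (u : V) : ‖f u‖ ≤ 1 * ‖Submodule.inclusion hVS u‖ := by
    rw [one_mul]
    show ‖f u‖ ≤ ‖(u : F)‖
    refine (sq_le_sq₀ (norm_nonneg _) (norm_nonneg _)).1 (le_of_eq ?_)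
    have := congrArg RCLike.re (hff u u)
    rwa [inner_self_eq_norm_sq, inner_self_eq_norm_sq] at this
  have hdense : DenseRange (Submodule.inclusion hVS) := fun x => by
    obtain ⟨u, hu⟩ := hd x x.2
    refine mem_closure_of_tendsto (f := fun n => Submodule.inclusion hVS (u n)) (b := atTop) ?_
      (Eventually.of_forall fun n => Set.mem_range_self _)
    exact tendsto_subtype_rng.2 hu
  let U : F →L[ℂ] F := (f.extendOfNorm (Submodule.inclusion hVS)).comp S.orthogonalProjectionOnto
  have hU (u : V) : U u = f u := by
    have e : S.orthogonalProjectionOnto (u : F) = Submodule.inclusion hVS u :=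
      Submodule.orthogonalProjectionOnto_mem_subspace_eq_self (Submodule.inclusion hVS u)
    rw [← f.extendOfNorm_eq hdense ⟨1, hn⟩ u, ← e]
    rfl
  have ht {u : ℕ → V} {x : F} (h : Tendsto (fun n => (u n : F)) atTop (𝓝 x)) :
      Tendsto (fun n => f (u n)) atTop (𝓝 (U x)) :=
    ((U.continuous.tendsto x).comp h).congr fun n => hU (u n)
  refine ⟨U, fun u => (hU u).symm ▸ hf u, fun x hx => ?_, fun x hx y hy => ?_⟩
  · obtain ⟨u, hu⟩ := hd x hx
    refine hS.mem_of_tendsto (ht hu) (Eventually.of_forall fun n => ?_)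
    exact hS.mem_of_tendsto (hf (u n)) (Eventually.of_forall fun s =>
      S.sum_mem fun m _ => hVS (expTerm A m (u n)).2)
  · obtain ⟨u, hu⟩ := hd x hx
    obtain ⟨w, hw⟩ := hd y hy
    exact tendsto_nhds_unique ((ht hu).inner (ht hw))
      ((hu.inner hw).congr fun n => (hff (u n) (w n)).symm)

/-- The exponentials of `A` and of `-A` are inverse to each other. -/
lemma exists_unitary_exp (hVS : V ≤ S) (hS : IsClosed (S : Set F))
    (hd : ∀ x ∈ S, ∃ u : ℕ → V, Tendsto (fun n => (u n : F)) atTop (𝓝 x)) {A : Module.End ℂ V}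
    (hA : ∀ u w : V, inner ℂ (A u : F) w = -inner ℂ (u : F) (A w))
    (hs : ∀ u : V, Summable fun m => ‖(expTerm A m u : F)‖) :
    ∃ U W : F →L[ℂ] F, (∀ u : V, HasSum (fun m => (expTerm A m u : F)) (U u)) ∧
      (∀ u : V, HasSum (fun m => (expTerm (-A) m u : F)) (W u)) ∧
      ∀ x ∈ S, U x ∈ S ∧ W x ∈ S ∧ W (U x) = x ∧ U (W x) = x ∧ ‖U x‖ = ‖x‖ := by
  have hA' : ∀ u w : V, inner ℂ ((-A) u : F) w = -inner ℂ (u : F) ((-A) w) := fun u w => by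
    simp only [LinearMap.neg_apply, Submodule.coe_neg, inner_neg_left, inner_neg_right, hA]
  have hs' : ∀ u : V, Summable fun m => ‖(expTerm (-A) m u : F)‖ := fun u => by
    refine (hs u).congr fun m => ?_
    have e : (-A) ^ m = (-1 : ℂ) ^ m • A ^ m := by rw [← neg_one_smul ℂ A, smul_pow]
    rw [expTerm, expTerm, e, smul_comm, LinearMap.smul_apply ((-1 : ℂ) ^ m), Submodule.coe_smul,
      norm_smul, norm_pow, norm_neg, norm_one, one_pow, one_mul]
  obtain ⟨U, hU, hUS, hUi⟩ := exists_isometric_exp hVS hS hd hA hs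
  obtain ⟨W, hW, hWS, hWi⟩ := exists_isometric_exp hVS hS hd hA' hs'
  have adj : ∀ x ∈ S, ∀ y ∈ S, inner ℂ (U x) y = inner ℂ x (W y) := fun x hx y hy => by
    obtain ⟨u, hu⟩ := hd x hx
    obtain ⟨w, hw⟩ := hd y hy
    refine tendsto_nhds_unique (((U.continuous.tendsto x).comp hu).inner hw)
      ((hu.inner ((W.continuous.tendsto y).comp hw)).congr fun n => ?_)
    refine HasSum.unique ((innerSL ℂ (u n : F)).hasSum (hW (w n))) ?_
    refine (((innerSL ℂ).flip (w n : F)).hasSum (hU (u n))).congr_fun fun m => ?_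
    exact (inner_expTerm hA m (u n) (w n)).symm
  have key : ∀ z ∈ S, ∀ z' ∈ S, (∀ y ∈ S, inner ℂ y z = inner ℂ y z') → z = z' :=
    fun z hz z' hz' h => by
      have h1 := h (z - z') (S.sub_mem hz hz')
      rw [← sub_eq_zero, ← inner_sub_right] at h1
      exact sub_eq_zero.1 (inner_self_eq_zero.1 h1)
  refine ⟨U, W, hU, hW, fun x hx => ⟨hUS x hx, hWS x hx, ?_, ?_, ?_⟩⟩
  · exact key _ (hWS _ (hUS x hx)) _ hx fun y hy => by
      rw [← adj y hy _ (hUS x hx), hUi y hy x hx]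
  · refine key _ (hUS _ (hWS x hx)) _ hx fun y hy => ?_
    rw [← inner_conj_symm, adj _ (hWS x hx) y hy, hWi x hx y hy, inner_conj_symm]
  · refine (sq_eq_sq₀ (norm_nonneg _) (norm_nonneg _)).1 ?_
    have := congrArg RCLike.re (hUi x hx x hx)
    rwa [inner_self_eq_norm_sq, inner_self_eq_norm_sq] at this

/-! ### Conjugation by an exponential -/

/-- A sequence with a zero put in front. -/
def shiftSeq {M : Type*} [Zero M] (f : ℕ → M) : ℕ → M
  | 0 => 0
  | m + 1 => f m

lemma hasSum_shiftSeq {f : ℕ → F} {a : F} (h : HasSum f a) : HasSum (shiftSeq f) a :=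
  (hasSum_nat_add_iff' 1).1 (by simpa [shiftSeq] using h)

lemma coe_shiftSeq (f : ℕ → V) (m : ℕ) :
    ((shiftSeq f m : V) : F) = shiftSeq (fun n => (f n : F)) m := by
  cases m <;> simp [shiftSeq]

lemma mul_expTerm {B T s : Module.End ℂ V} (hT : T * B = B * T + s) (hs : Commute s B) (m : ℕ)
    (u : V) : T (expTerm B m u) = expTerm B m (T u) + shiftSeq (fun n => expTerm B n (s u)) m := by
  induction m with
  | zero => simp [expTerm_zero, shiftSeq]
  | succ m ih =>
    have h : (m : ℂ) + 1 ≠ 0 := Nat.cast_add_one_ne_zero m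
    have hB (n : ℕ) (w : V) : B (expTerm B n w) = ((n : ℂ) + 1) • expTerm B (n + 1) w :=
      (LinearMap.congr_fun (smul_expTerm_succ B n) w).symm
    refine smul_right_injective V h ?_
    show ((m : ℂ) + 1) • T (expTerm B (m + 1) u) = _
    rw [← map_smul, ← hB]
    have h1 : T (B (expTerm B m u)) = B (T (expTerm B m u)) + s (expTerm B m u) :=
      LinearMap.congr_fun hT (expTerm B m u)
    have h2 : s (expTerm B m u) = expTerm B m (s u) :=
      LinearMap.congr_fun (expTerm_commute hs m).eq u
    rw [h1, ih, h2, map_add, hB]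
    cases m with
    | zero => simp [shiftSeq]
    | succ m =>
      simp only [shiftSeq]
      rw [hB]
      push_cast
      module

lemma mul_neg_of_commutator {A T s : Module.End ℂ V} (h : A * T = T * A + s) :
    T * -A = -A * T + s := by
  have e1 : T * -A = -(T * A) := LinearMap.comp_neg A T
  have e2 : -A * T = -(A * T) := LinearMap.neg_comp T A
  rw [e1, e2, h]
  abel

/-- If `[X, B] = T`, `[T, B] = s` and `[s, B] = 0`, then
`X e^B = e^B (X + T + s / 2)`; here `X` is given by its graph. -/
lemma exp_mem_of_commutator {R : Submodule ℂ (F × F)} (hR : IsClosed (R : Set (F × F)))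
    {B T s : Module.End ℂ V} (hT : T * B = B * T + s) (hs : Commute s B)
    (hB : ∀ u u' : V, ((u : F), (u' : F)) ∈ R → ((B u : F), ((B u' + T u : V) : F)) ∈ R)
    {W : F →L[ℂ] F} (hW : ∀ u : V, HasSum (fun m => (expTerm B m u : F)) (W u)) {u u' : V}
    (h : ((u : F), (u' : F)) ∈ R) :
    (W u, W (u' + T u + (2⁻¹ : ℂ) • s u)) ∈ R := by
  set z : ℕ → V := fun m => expTerm B m u' + shiftSeq (fun n => expTerm B n (T u)) m +
    (2⁻¹ : ℂ) • shiftSeq (shiftSeq fun n => expTerm B n (s u)) m with hz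
  have hBe (n : ℕ) (w : V) : B (expTerm B n w) = ((n : ℂ) + 1) • expTerm B (n + 1) w :=
    (LinearMap.congr_fun (smul_expTerm_succ B n) w).symm
  have key : ∀ m, ((expTerm B m u : F), (z m : F)) ∈ R := fun m => by
    induction m with
    | zero => simpa [hz, expTerm_zero, shiftSeq] using h
    | succ m ih =>
      have h1 := R.smul_mem (((m : ℂ) + 1)⁻¹) (hB _ _ ih)
      have h0 : (m : ℂ) + 1 ≠ 0 := Nat.cast_add_one_ne_zero m
      have e1 : expTerm B (m + 1) u = (((m : ℂ) + 1)⁻¹) • B (expTerm B m u) := by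
        rw [hBe, inv_smul_smul₀ h0]
      have e2 : z (m + 1) = (((m : ℂ) + 1)⁻¹) • (B (z m) + T (expTerm B m u)) := by
        rw [eq_inv_smul_iff₀ h0, mul_expTerm hT hs]
        simp only [hz, map_add, map_smul, hBe]
        rcases m with _ | _ | m <;> simp only [shiftSeq, map_zero, hBe] <;> push_cast <;> module
      rw [e1, e2]
      exact h1
  have h1 : HasSum (fun m => (z m : F)) (W (u' + T u + (2⁻¹ : ℂ) • s u)) := by
    rw [map_add, map_add, map_smul]
    refine (((hW u').add (hasSum_shiftSeq (hW (T u)))).add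
      ((hasSum_shiftSeq (hasSum_shiftSeq (hW (s u)))).const_smul _)).congr_fun fun m => ?_
    simp only [hz, Submodule.coe_add, Submodule.coe_smul, coe_shiftSeq]
  refine hR.mem_of_tendsto ((hW u).prodMk_nhds h1) (Eventually.of_forall fun t => ?_)
  have h2 := R.sum_mem (t := t) fun m _ => key m
  have e : ∑ m ∈ t, ((expTerm B m u : F), (z m : F)) =
      (∑ m ∈ t, (expTerm B m u : F), ∑ m ∈ t, (z m : F)) := Prod.ext Prod.fst_sum Prod.snd_sum
  rwa [e] at h2

end Exponential

/-! ### The generator of the Gross transform -/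

section Generator

variable {N : ℕ}

/-- Multiplication by `⟨f_{x_j}, g_{x_l}⟩`. -/
def pairB (f g : Form) (j l : Fin N) : Fk N →L[ℂ] Fk N := mulB _ (isBddMul_pairing f g j l)

/-- Multiplication by `⟨f_{x_j}, g_{x_l}⟩` on vectors with finitely many phonons. -/
def pairV (f g : Form) (j l : Fin N) : Module.End ℂ (finV N) := mulV _ (isBddMul_pairing f g j l)

/-- The field operator on vectors with finitely many phonons. -/
def fldV (g : Form) (j : Fin N) : Module.End ℂ (finV N) := annV g j + creV g j

/-- The generator `c ∑ⱼ (a(b_{x_j}) - a*(b_{x_j}))`. -/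
def genV (N : ℕ) (b : Form) (c : ℝ) : Module.End ℂ (finV N) := (c : ℂ) • ∑ j, (annV b j - creV b j)

/-- The commutator of the generator with the field operator `Φ(g_{x_j})`. -/
def shiftV (b : Form) (c : ℝ) (g : Form) (j : Fin N) : Module.End ℂ (finV N) :=
  (c : ℂ) • ∑ l, (pairV b g l j + pairV g b j l)

/-- The shift of the field operator `Φ(g_{x_j})` under the Gross transform. -/
def shiftB (b : Form) (c : ℝ) (g : Form) (j : Fin N) : Fk N →L[ℂ] Fk N :=
  (c : ℂ) • ∑ l, (pairB b g l j + pairB g b j l)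

lemma coe_sum_apply {ι : Type*} (s : Finset ι) (A : ι → Module.End ℂ (finV N)) (u : finV N) :
    ((∑ i ∈ s, A i) u : Fk N) = ∑ i ∈ s, (A i u : Fk N) := by
  rw [LinearMap.sum_apply, Submodule.coe_sum]

lemma shiftV_coe (b : Form) (c : ℝ) (g : Form) (j : Fin N) (u : finV N) :
    (shiftV b c g j u : Fk N) = shiftB b c g j u := by
  rw [shiftV, shiftB, LinearMap.smul_apply, Submodule.coe_smul, coe_sum_apply,
    _root_.smul_apply, _root_.sum_apply]
  refine congrArg _ (Finset.sum_congr rfl fun l _ => ?_)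
  rw [LinearMap.add_apply, Submodule.coe_add, _root_.add_apply]
  rfl

lemma genV_coe (b : Form) (c : ℝ) (u : finV N) :
    (genV N b c u : Fk N) = (c : ℂ) • ∑ j, (ann b j (u : Fk N) - cre b j u) := by
  rw [genV, LinearMap.smul_apply, Submodule.coe_smul, coe_sum_apply]
  rfl

lemma genV_mul_fldV (b : Form) (c : ℝ) (g : Form) (j : Fin N) :
    genV N b c * fldV g j = fldV g j * genV N b c + shiftV b c g j := by
  have h (l : Fin N) : (annV b l - creV b l) * fldV g j =
      fldV g j * (annV b l - creV b l) + (pairV b g l j + pairV g b j l) := by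
    have h1 := annV_creV b g l j
    have h2 := annV_creV g b j l
    rw [fldV, sub_mul, mul_add, mul_add, h1, (annV_commute b g l j).eq, (creV_commute b g l j).eq,
      add_mul, mul_sub, mul_sub, h2, pairV, pairV]
    abel
  rw [genV, shiftV, smul_mul_assoc, mul_smul_comm, Finset.sum_mul, Finset.mul_sum, ← smul_add,
    ← Finset.sum_add_distrib]
  simp only [h]

lemma genV_mul_numV (b : Form) (c : ℝ) :
    genV N b c * numV N = numV N * genV N b c + (c : ℂ) • ∑ j, fldV b j := by
  have h (l : Fin N) : (annV b l - creV b l) * numV N =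
      numV N * (annV b l - creV b l) + fldV b l := by
    rw [mul_sub, numV_annV, numV_creV, fldV, sub_mul]
    abel
  rw [genV, smul_mul_assoc, mul_smul_comm, Finset.sum_mul, Finset.mul_sum, ← smul_add,
    ← Finset.sum_add_distrib]
  simp only [h]

lemma mulV_commute_genV {m : (Fin N → E) → ℂ} (hm : IsBddMul m volume) (b : Form) (c : ℝ) :
    Commute (mulV m hm) (genV N b c) :=
  (Commute.sum_right _ _ _ fun j _ =>
    (mulV_annV hm b j).sub_right (mulV_creV hm b j)).smul_right _

lemma shiftV_commute (b : Form) (c : ℝ) (g : Form) (j : Fin N) :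
    Commute (shiftV b c g j) (genV N b c) :=
  (Commute.sum_left _ _ _ fun _ _ => (mulV_commute_genV _ b c).add_left
    (mulV_commute_genV _ b c)).smul_left _

lemma genV_antisymm (b : Form) (c : ℝ) (u w : finV N) :
    inner ℂ (genV N b c u : Fk N) w = -inner ℂ (u : Fk N) (genV N b c w) := by
  rw [genV_coe, genV_coe, inner_smul_left, inner_smul_right, Complex.conj_ofReal, sum_inner,
    inner_sum, ← mul_neg, ← Finset.sum_neg_distrib]
  congr 1
  refine Finset.sum_congr rfl fun j _ => ?_
  have h1 : inner ℂ (cre b j (u : Fk N)) (w : Fk N) = inner ℂ (u : Fk N) (ann b j w) :=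
    inner_cre_left w.2.1 (finV_numDom u _) (finV_numDom w _) b j
  have h2 : inner ℂ (u : Fk N) (cre b j (w : Fk N)) = inner ℂ (ann b j (u : Fk N)) w :=
    inner_cre_right u.2.1 (finV_numDom u _) (finV_numDom w _) b j
  rw [inner_sub_left, inner_sub_right, h1, h2, neg_sub]

lemma genV_support (b : Form) (c : ℝ) {u : finV N} {M : ℕ} (h : ∀ n, M ≤ n → sec n (u : Fk N) = 0)
    (n : ℕ) (hn : M + 1 ≤ n) : sec n (genV N b c u : Fk N) = 0 := by
  obtain ⟨n, rfl⟩ : ∃ m, n = m + 1 := ⟨n - 1, by omega⟩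
  rw [genV_coe, sec_smul, map_sum, Finset.sum_eq_zero, smul_zero]
  intro j _
  rw [sec_sub, sec_ann (finV_numDom u _), sec_succ_cre (finV_numDom u _), h _ (by omega),
    h n (by omega), map_zero, map_zero, smul_zero, smul_zero, sub_zero]

lemma norm_genV_le (b : Form) (c : ℝ) {u : finV N} {M : ℕ}
    (h : ∀ n, M ≤ n → sec n (u : Fk N) = 0) :
    ‖(genV N b c u : Fk N)‖ ≤ 3 * |c| * N * ‖b‖ * √(M + 1) * ‖(u : Fk N)‖ := by
  have h1 : ‖numFun sq0 (u : Fk N)‖ ≤ √(M + 1) * ‖(u : Fk N)‖ := by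
    refine norm_le_of_sec_le (by positivity) fun n => ?_
    rw [sec_numFun (finV_numDom u _), norm_smul]
    rcases lt_or_ge n M with hn | hn
    · refine mul_le_mul_of_nonneg_right ?_ (norm_nonneg _)
      rw [sq0, Complex.norm_real, Real.norm_of_nonneg (Real.sqrt_nonneg _)]
      refine Real.sqrt_le_sqrt ?_
      have : (n : ℝ) < M := by exact_mod_cast hn
      linarith
    · rw [h n hn, norm_zero, mul_zero, mul_zero]
  have h2 : 1 ≤ √((M : ℝ) + 1) := Real.one_le_sqrt.2 (by linarith [Nat.cast_nonneg (α := ℝ) M])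
  have h3 (j : Fin N) : ‖ann b j (u : Fk N) - cre b j u‖ ≤ 3 * ‖b‖ * √(M + 1) * ‖(u : Fk N)‖ := by
    have h4 := norm_cre_le b j (finV_numDom u sq0)
    have h5 : ‖(u : Fk N)‖ ≤ √(M + 1) * ‖(u : Fk N)‖ := le_mul_of_one_le_left (norm_nonneg _) h2
    calc ‖ann b j (u : Fk N) - cre b j u‖ ≤ ‖ann b j (u : Fk N)‖ + ‖cre b j (u : Fk N)‖ :=
          norm_sub_le _ _
      _ ≤ ‖b‖ * ‖numFun sq0 (u : Fk N)‖ + ‖b‖ * (‖numFun sq0 (u : Fk N)‖ + ‖(u : Fk N)‖) :=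
          add_le_add (norm_ann_le _ _ _) h4
      _ ≤ ‖b‖ * (√(M + 1) * ‖(u : Fk N)‖) +
          ‖b‖ * (√(M + 1) * ‖(u : Fk N)‖ + √(M + 1) * ‖(u : Fk N)‖) := by gcongr
      _ = _ := by ring
  rw [genV_coe, norm_smul, Complex.norm_real, Real.norm_eq_abs]
  calc |c| * ‖∑ j, (ann b j (u : Fk N) - cre b j u)‖
      ≤ |c| * ∑ _j : Fin N, 3 * ‖b‖ * √(M + 1) * ‖(u : Fk N)‖ := by
        gcongr
        exact norm_sum_le_of_le _ fun j _ => h3 j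
    _ = _ := by
        rw [Finset.sum_const, Finset.card_univ, Fintype.card_fin, nsmul_eq_mul]
        ring

/-- Vectors with finitely many phonons are analytic for the generator: the `m`-th power of the
generator is bounded by a multiple of `√(m!)`. -/
lemma summable_expTerm_genV (b : Form) (c : ℝ) (u : finV N) :
    Summable fun m => ‖(expTerm (genV N b c) m u : Fk N)‖ := by
  obtain ⟨M, hM⟩ := u.2.2
  have hsupp (m : ℕ) : ∀ n, M + m ≤ n → sec n (expTerm (genV N b c) m u : Fk N) = 0 := by
    have h (n : ℕ) (hn : M + m ≤ n) : sec n (((genV N b c) ^ m) u : Fk N) = 0 := by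
      induction m generalizing n with
      | zero => exact hM n hn
      | succ m ih =>
        rw [pow_succ', Module.End.mul_apply]
        exact genV_support b c ih n hn
    intro n hn
    rw [expTerm, LinearMap.smul_apply, Submodule.coe_smul, sec_smul, h n hn, smul_zero]
  set κ := 3 * |c| * N * ‖b‖ with hκ
  have hκ0 : 0 ≤ κ := by positivity
  obtain ⟨m₀, hm₀⟩ := exists_nat_ge (4 * κ ^ 2 * (M + 1))
  refine summable_of_ratio_norm_eventually_le (r := 1 / 2) (by norm_num) ?_
  filter_upwards [eventually_ge_atTop m₀] with m hm
  rw [norm_norm, norm_norm]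
  have h1 := norm_genV_le b c (hsupp m)
  have h2 : ((m : ℝ) + 1) * ‖(expTerm (genV N b c) (m + 1) u : Fk N)‖ =
      ‖(genV N b c (expTerm (genV N b c) m u) : Fk N)‖ := by
    have e := congrArg (fun T : Module.End ℂ (finV N) => ‖(T u : Fk N)‖)
      (smul_expTerm_succ (genV N b c) m)
    simp only [LinearMap.smul_apply, Submodule.coe_smul, norm_smul] at e
    rw [← Nat.cast_add_one, Complex.norm_natCast] at e
    rw [← Nat.cast_add_one]
    exact e
  have h3 : κ * √((M + m : ℕ) + 1) ≤ ((m : ℝ) + 1) * (1 / 2) := by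
    refine (sq_le_sq₀ (by positivity) (by positivity)).1 ?_
    have h4 : (m₀ : ℝ) ≤ m := by exact_mod_cast hm
    have h5 : 4 * κ ^ 2 * (M + 1) * (m + 1) ≤ ((m : ℝ) + 1) * (m + 1) := by
      gcongr
      linarith
    have h6 : 0 ≤ κ ^ 2 * (M * m) := by positivity
    rw [mul_pow, Real.sq_sqrt (by positivity)]
    push_cast
    nlinarith
  have h4 : ((m : ℝ) + 1) * ‖(expTerm (genV N b c) (m + 1) u : Fk N)‖ ≤
      ((m : ℝ) + 1) * (1 / 2 * ‖(expTerm (genV N b c) m u : Fk N)‖) := by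
    rw [h2, ← mul_assoc]
    exact h1.trans (mul_le_mul_of_nonneg_right h3 (norm_nonneg _))
  exact le_of_mul_le_mul_left h4 (by positivity)

lemma finV_le_phSym : finV N ≤ phSym N := fun _ h => h.1

/-- The truncation of a symmetric vector, as an element of `finV N`. -/
def truncV (M : ℕ) {Ψ : Fk N} (h : Ψ ∈ phSym N) : finV N := ⟨trunc M Ψ, trunc_mem_finV h M⟩

/-- The Gross transform and its inverse, as operators on `Fk N` that are unitary on the symmetric
subspace. -/
lemma exists_gross_unitary (b : Form) (c : ℝ) : ∃ U W : Fk N →L[ℂ] Fk N,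
    (∀ u : finV N, HasSum (fun m => (expTerm (genV N b c) m u : Fk N)) (U u)) ∧
    (∀ u : finV N, HasSum (fun m => (expTerm (-genV N b c) m u : Fk N)) (W u)) ∧
    ∀ x ∈ phSym N, U x ∈ phSym N ∧ W x ∈ phSym N ∧ W (U x) = x ∧ U (W x) = x ∧ ‖U x‖ = ‖x‖ :=
  exists_unitary_exp finV_le_phSym (isClosed_phSym N)
    (fun x hx => ⟨fun M => truncV M hx, tendsto_trunc x⟩) (genV_antisymm b c)
    (summable_expTerm_genV b c)

end Generator

/-! ### Intertwining relations of the Gross transform -/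

section Intertwining

variable {N : ℕ}
variable {Φ Ψ χ : Fk N} {j : Fin N} {i : Fin 3}

/-- The pairs `(Ψ, χ)` whose sectors satisfy `χₙ = Lₙ Ψ`. -/
def secRel (L : ∀ n, Fk N →L[ℂ] L2 N n) : Submodule ℂ (Fk N × Fk N) where
  carrier := {p | ∀ n, sec n p.2 = L n p.1}
  zero_mem' := fun n => by
    show sec n (0 : Fk N) = L n 0
    rw [sec_zero, map_zero]
  add_mem' := fun {p q} hp hq n => by
    show sec n (p.2 + q.2) = L n (p.1 + q.1)
    rw [sec_add, hp n, hq n, map_add]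
  smul_mem' := fun c p hp n => by
    show sec n (c • p.2) = L n (c • p.1)
    rw [sec_smul, hp n, map_smul]

lemma isClosed_secRel (L : ∀ n, Fk N →L[ℂ] L2 N n) :
    IsClosed (secRel L : Set (Fk N × Fk N)) := by
  have e : (secRel L : Set (Fk N × Fk N)) = ⋂ n, {p | sec n p.2 = L n p.1} := by
    ext p
    simp only [Set.mem_iInter]
    rfl
  rw [e]
  exact isClosed_iInter fun n => isClosed_eq ((sec n).continuous.comp continuous_snd)
    ((L n).continuous.comp continuous_fst)

/-- The graph of a gradient component. -/
def gradRel (j : Fin N) (i : Fin 3) : Submodule ℂ (Fk N × Fk N) where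
  carrier := {p | (grad j i).HasGen p.1 p.2}
  zero_mem' := UnitaryGroup.hasGen_zero
  add_mem' := fun hp hq => UnitaryGroup.HasGen.add hp hq
  smul_mem' := fun c _ hp => UnitaryGroup.HasGen.smul hp c

lemma tendsto_fld_trunc (h : Φ ∈ numDom N sq0) (g : Form) (j : Fin N) :
    Tendsto (fun M => fld g j (trunc M Φ)) atTop (𝓝 (fld g j Φ)) := by
  have h1 := ((alpha g j).continuous.tendsto _).comp (tendsto_trunc (numFun sq0 Φ))
  have h2 := ((alphaD g j).continuous.tendsto _).comp (tendsto_trunc (numFun sq1 Φ))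
  refine (h1.add h2).congr fun M => ?_
  show alpha g j (trunc M (numFun sq0 Φ)) + alphaD g j (trunc M (numFun sq1 Φ)) = _
  rw [trunc_numFun M h, trunc_numFun M (sq0_le_sq1 h)]
  rfl

variable {b : Form} {c : ℝ} {W : Fk N →L[ℂ] Fk N}

/-- `W` is the exponential of the negative of the generator, that is, the inverse of the Gross
transform. -/
def IsInvGross (b : Form) (c : ℝ) (W : Fk N →L[ℂ] Fk N) : Prop :=
  ∀ u : finV N, HasSum (fun m => (expTerm (-genV N b c) m u : Fk N)) (W u)

lemma intertwine (hW : IsInvGross b c W) {R : Submodule ℂ (Fk N × Fk N)}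
    (hR : IsClosed (R : Set (Fk N × Fk N)))
    {T s : Module.End ℂ (finV N)} (hT : genV N b c * T = T * genV N b c + s)
    (hs : Commute s (genV N b c))
    (hA : ∀ u u' : finV N, ((u : Fk N), (u' : Fk N)) ∈ R →
      ((genV N b c u : Fk N), (genV N b c u' : Fk N) - T u) ∈ R)
    {u u' : ℕ → finV N} {Φ' θ σ : Fk N} (h : ∀ n, ((u n : Fk N), (u' n : Fk N)) ∈ R)
    (hu : Tendsto (fun n => (u n : Fk N)) atTop (𝓝 Φ))
    (hu' : Tendsto (fun n => (u' n : Fk N)) atTop (𝓝 Φ'))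
    (hθ : Tendsto (fun n => (T (u n) : Fk N)) atTop (𝓝 θ))
    (hσ : Tendsto (fun n => (s (u n) : Fk N)) atTop (𝓝 σ)) :
    (W Φ, W (Φ' + θ + (2⁻¹ : ℂ) • σ)) ∈ R := by
  refine hR.mem_of_tendsto (((W.continuous.tendsto _).comp hu).prodMk_nhds
    ((W.continuous.tendsto _).comp ((hu'.add hθ).add (hσ.const_smul _))))
    (Eventually.of_forall fun n => ?_)
  refine exp_mem_of_commutator hR (B := -genV N b c) (T := T) (s := s)
    (mul_neg_of_commutator hT) hs.neg_right (fun v v' hv => ?_) hW (h n)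
  have h1 := R.neg_mem (hA v v' hv)
  rw [Prod.neg_mk, neg_sub, sub_eq_neg_add] at h1
  exact h1

/-- The sectors of the field operator. -/
def fldSec (g : Form) (j : Fin N) : ∀ n, Fk N →L[ℂ] L2 N n
  | 0 => sq1 0 • (removeS g j 0).comp (sec 1)
  | n + 1 => sq1 (n + 1) • (removeS g j (n + 1)).comp (sec (n + 2)) +
      sq1 n • (symInsertS g j n).comp (sec n)

lemma mem_fldRel (h : Ψ ∈ numDom N sq0) (g : Form) (j : Fin N) :
    (Ψ, χ) ∈ secRel (fldSec g j) ↔ χ = fld g j Ψ := by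
  have h1 (n : ℕ) : sec n (fld g j Ψ) = fldSec g j n Ψ := by
    cases n with
    | zero =>
      rw [fld, sec_add, sec_ann h, sec_zero_cre, add_zero]
      rfl
    | succ n =>
      rw [fld, sec_add, sec_ann h, sec_succ_cre h]
      rfl
  exact ⟨fun h2 => sec_ext fun n => (h2 n).trans (h1 n).symm, fun h2 n => h2 ▸ h1 n⟩

/-- The Gross transform shifts the field operators by functions of the particle positions. -/
lemma fld_conj (hW : IsInvGross b c W) (hΦ : Φ ∈ phSym N) (h : Φ ∈ numDom N sq0)
    (h' : W Φ ∈ numDom N sq0) (g : Form) (j : Fin N) :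
    fld g j (W Φ) = W (fld g j Φ + shiftB b c g j Φ) := by
  have h1 := intertwine hW (R := secRel (fldSec g j)) (isClosed_secRel _) (T := shiftV b c g j)
    (s := 0) (by rw [add_zero]; exact (shiftV_commute b c g j).eq.symm) (Commute.zero_left _)
    (fun u u' hu => by
      rw [mem_fldRel (finV_numDom u _)] at hu
      rw [mem_fldRel (finV_numDom _ _)]
      have e : u' = fldV g j u := Subtype.ext hu
      have h2 := congrArg (fun T : Module.End ℂ (finV N) => (T u : Fk N))
        (genV_mul_fldV b c g j)
      rw [sub_eq_iff_eq_add, e]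
      exact h2)
    (u := fun M => truncV M hΦ) (u' := fun M => fldV g j (truncV M hΦ)) (Φ := Φ)
    (Φ' := fld g j Φ) (θ := shiftB b c g j Φ) (σ := 0)
    (fun M => (mem_fldRel (finV_numDom _ _) g j).2 rfl) (tendsto_trunc Φ) (tendsto_fld_trunc h g j)
    ((((shiftB b c g j).continuous.tendsto Φ).comp (tendsto_trunc Φ)).congr fun M =>
      (shiftV_coe b c g j _).symm)
    tendsto_const_nhds
  rw [smul_zero, add_zero] at h1
  exact ((mem_fldRel h' g j).1 h1).symm

lemma wN_conj (hW : IsInvGross b c W) (hΦ : Φ ∈ phSym N) (h : Φ ∈ numDom N wN) :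
    W Φ ∈ numDom N wN ∧ numFun wN (W Φ) = W (numFun wN Φ + (c : ℂ) • ∑ j, fld b j Φ +
      (2⁻¹ : ℂ) • (c : ℂ) • ∑ j, shiftB b c b j Φ) := by
  have hrel {Ψ χ : Fk N} (h : Ψ ∈ numDom N wN) :
      (Ψ, χ) ∈ secRel (fun n => wN n • sec n) ↔ χ = numFun wN Ψ :=
    ⟨fun h2 => eq_numFun_of_sec h2, fun h2 n => h2 ▸ sec_numFun h n⟩
  have hT (u : finV N) : (((c : ℂ) • ∑ j, fldV b j) u : Fk N) = (c : ℂ) • ∑ j, fld b j u := by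
    rw [LinearMap.smul_apply, Submodule.coe_smul, coe_sum_apply]
    rfl
  have hs (u : finV N) : (((c : ℂ) • ∑ j, shiftV b c b j) u : Fk N) =
      (c : ℂ) • ∑ j, shiftB b c b j u := by
    rw [LinearMap.smul_apply, Submodule.coe_smul, coe_sum_apply]
    simp only [shiftV_coe]
  have h1 := intertwine hW (R := secRel fun n => wN n • sec n) (isClosed_secRel _)
    (T := (c : ℂ) • ∑ j, fldV b j) (s := (c : ℂ) • ∑ j, shiftV b c b j)
    (by
      rw [mul_smul_comm, smul_mul_assoc, Finset.mul_sum, Finset.sum_mul, ← smul_add,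
        ← Finset.sum_add_distrib]
      simp only [genV_mul_fldV])
    ((Commute.sum_left _ _ _ fun j _ => shiftV_commute b c b j).smul_left _)
    (fun u u' hu => by
      rw [hrel (finV_numDom u _)] at hu
      rw [hrel (finV_numDom _ _)]
      have e : u' = numV N u := Subtype.ext hu
      have h2 := congrArg (fun T : Module.End ℂ (finV N) => (T u : Fk N)) (genV_mul_numV b c)
      rw [sub_eq_iff_eq_add, e]
      exact h2)
    (u := fun M => truncV M hΦ) (u' := fun M => numV N (truncV M hΦ)) (Φ := Φ)
    (Φ' := numFun wN Φ) (θ := (c : ℂ) • ∑ j, fld b j Φ) (σ := (c : ℂ) • ∑ j, shiftB b c b j Φ)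
    (fun M => (hrel (finV_numDom _ _)).2 rfl) (tendsto_trunc Φ)
    ((tendsto_trunc (numFun wN Φ)).congr fun M => trunc_numFun M h)
    (((tendsto_finsetSum Finset.univ fun j _ =>
      tendsto_fld_trunc (wN_le_sq0 h) b j).const_smul (c : ℂ)).congr fun M => (hT _).symm)
    (((tendsto_finsetSum Finset.univ fun j _ => ((shiftB b c b j).continuous.tendsto Φ).comp
      (tendsto_trunc Φ)).const_smul (c : ℂ)).congr fun M => (hs _).symm)
  exact ⟨mem_numDom_of_sec h1, (eq_numFun_of_sec h1).symm⟩

lemma hasGen_alpha_of_tendsto (h : (grad j i).HasGen Ψ χ)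
    {g q : Form} (hq : Tendsto (fun R => kLow i R g) atTop (𝓝 q)) :
    (grad j i).HasGen (alpha g j Ψ) (alpha q j Ψ + alpha g j χ) :=
  UnitaryGroup.hasGen_of_tendsto (l := atTop) (fun R => hasGen_alpha h (isMulK_low i R g))
    (tendsto_alpha_form (tendsto_lowF g) j Ψ)
    ((tendsto_alpha_form hq j Ψ).add (tendsto_alpha_form (tendsto_lowF g) j χ))

lemma hasGen_alphaD_of_tendsto (h : (grad j i).HasGen Ψ χ)
    {g q : Form} (hq : Tendsto (fun R => kLow i R g) atTop (𝓝 q)) :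
    (grad j i).HasGen (alphaD g j Ψ) (alphaD q j Ψ + alphaD g j χ) :=
  UnitaryGroup.hasGen_of_tendsto (l := atTop) (fun R => hasGen_alphaD h (isMulK_low i R g))
    (tendsto_alphaD_form (tendsto_lowF g) j Ψ)
    ((tendsto_alphaD_form hq j Ψ).add (tendsto_alphaD_form (tendsto_lowF g) j χ))

/-- The commutator of the gradient with the generator. -/
lemma hasGen_genV {v : Form}
    (hq : Tendsto (fun R => kLow i R b) atTop (𝓝 (-Complex.I • v))) {u u' : finV N}
    (h : (grad j i).HasGen (u : Fk N) u') :
    (grad j i).HasGen (genV N b c u : Fk N) (genV N b c u' + (c * Complex.I : ℂ) • fldV v j u) := by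
  have h0 := hasGen_numFun (finV_numDom u sq0) (finV_numDom u' sq0) h
  have h1 := hasGen_numFun (finV_numDom u sq1) (finV_numDom u' sq1) h
  have key (l : Fin N) : (grad j i).HasGen (ann b l (u : Fk N) - cre b l u)
      ((ann b l (u' : Fk N) - cre b l u') + if l = j then Complex.I • fld v j (u : Fk N) else 0) := by
    split_ifs with hl
    · subst hl
      have h2 := (hasGen_alpha_of_tendsto h0 hq).sub (hasGen_alphaD_of_tendsto h1 hq)
      rw [alpha_smul_form, alphaD_smul_form, map_neg, Complex.conj_I, neg_neg] at h2
      have e : ∀ p q r s : Fk N, Complex.I • p + q - (-Complex.I • r + s) =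
          q - s + Complex.I • (p + r) := fun p q r s => by module
      rw [e] at h2
      exact h2
    · rw [add_zero]
      exact (hasGen_alpha_of_ne h0 hl b).sub (hasGen_alphaD_of_ne h1 hl b)
  have h2 := (UnitaryGroup.HasGen.sum (s := Finset.univ) fun l _ => key l).smul (c : ℂ)
  rw [Finset.sum_add_distrib, Finset.sum_ite_eq' Finset.univ j, if_pos (Finset.mem_univ j),
    smul_add, smul_smul, ← genV_coe, ← genV_coe] at h2
  exact h2

lemma hasGen_conj (hW : IsInvGross b c W) {v : Form}
    (hq : Tendsto (fun R => kLow i R b) atTop (𝓝 (-Complex.I • v))) (hv : shiftV b c v j = 0)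
    {Φ' : Fk N} (hΦ : Φ ∈ phSym N) (h : Φ ∈ numDom N sq0) (hg : (grad j i).HasGen Φ Φ') :
    (grad j i).HasGen (W Φ) (W (Φ' - (c * Complex.I : ℂ) • fld v j Φ)) := by
  have hΦ' : Φ' ∈ phSym N := mem_phSym_of_hasGen (l := (j, i)) hg hΦ
  have h1 := intertwine hW (R := gradRel j i) UnitaryGroup.isClosed_hasGen
    (T := -((c * Complex.I : ℂ) • fldV v j)) (s := 0)
    (by
      have h2 := genV_mul_fldV b c v j
      rw [hv, add_zero] at h2
      rw [add_zero]
      exact ((Commute.smul_right (show Commute _ _ from h2) _).neg_right).eq)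
    (Commute.zero_left _)
    (fun u u' hu => by
      have h2 := hasGen_genV (c := c) hq hu
      have e : (genV N b c u' : Fk N) - ((-((c * Complex.I : ℂ) • fldV v j)) u : finV N) =
          genV N b c u' + (c * Complex.I : ℂ) • (fldV v j u : Fk N) := by
        rw [LinearMap.neg_apply, LinearMap.smul_apply, Submodule.coe_neg, Submodule.coe_smul,
          sub_neg_eq_add]
      rw [e]
      exact h2)
    (u := fun M => truncV M hΦ) (u' := fun M => truncV M hΦ') (Φ := Φ) (Φ' := Φ')
    (θ := -((c * Complex.I : ℂ) • fld v j Φ)) (σ := 0)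
    (fun M => hasGen_numFun (trunc_mem M _) (trunc_mem M _) hg) (tendsto_trunc Φ)
    (tendsto_trunc Φ') (((tendsto_fld_trunc h v j).const_smul _).neg) tendsto_const_nhds
  rw [smul_zero, add_zero, ← sub_eq_add_neg] at h1
  exact h1

end Intertwining

/-! ### Form factors of the Gross transform -/

section GrossFormFactors

variable {N : ℕ}
variable {m : (Fin N → E) → ℂ}

lemma pairing_eq_inner (f g : Form) (j l : Fin N) (x : Fin N → E) :
    pairing f g j l x = inner ℂ (modF (x j) f) (modF (x l) g) := by
  rw [MeasureTheory.L2.inner_def]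
  refine integral_congr_ae ?_
  filter_upwards [modF_ae (x j) f, modF_ae (x l) g] with k h1 h2
  rw [h1, h2, RCLike.inner_apply, formFactor, formFactor, mul_comm (f k), mul_comm (g k), mul_comm]

lemma pairing_congr {f g f' g' : Form} (h : ∀ᵐ k, conj (f k) * g k = conj (f' k) * g' k)
    (j l : Fin N) (x : Fin N → E) : pairing f g j l x = pairing f' g' j l x := by
  refine integral_congr_ae ?_
  filter_upwards [h] with k hk
  simp only [formFactor, map_mul]
  rw [mul_mul_mul_comm, hk, mul_mul_mul_comm]

lemma mulB_congr {m' : (Fin N → E) → ℂ} (hm : IsBddMul m volume) (hm' : IsBddMul m' volume)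
    (h : ∀ x, m x = m' x) (Ψ : Fk N) : mulB m hm Ψ = mulB m' hm' Ψ := by
  obtain rfl : m = m' := funext h
  rfl

lemma mulB_add {m' : (Fin N → E) → ℂ} (hm : IsBddMul m volume) (hm' : IsBddMul m' volume)
    (Ψ : Fk N) : mulB _ (hm.add hm') Ψ = mulB m hm Ψ + mulB m' hm' Ψ :=
  sec_ext fun n => Lp.ext (by
    rw [sec_add]
    filter_upwards [sec_mulB_ae (hm.add hm') n Ψ, sec_mulB_ae hm n Ψ, sec_mulB_ae hm' n Ψ,
      Lp.coeFn_add (sec n (mulB m hm Ψ)) (sec n (mulB m' hm' Ψ))] with p h1 h2 h3 h4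
    rw [h1, h4, Pi.add_apply, h2, h3, add_mul])

lemma mulB_const_mul (hm : IsBddMul m volume) (c : ℂ) (Ψ : Fk N) :
    mulB _ (hm.const_mul c) Ψ = c • mulB m hm Ψ :=
  sec_ext fun n => Lp.ext (by
    rw [sec_smul]
    filter_upwards [sec_mulB_ae (hm.const_mul c) n Ψ, sec_mulB_ae hm n Ψ,
      Lp.coeFn_smul c (sec n (mulB m hm Ψ))] with p h1 h2 h3
    rw [h1, h3, Pi.smul_apply, h2, smul_eq_mul, mul_assoc])

lemma mulB_zero (h : IsBddMul (fun _ : Fin N → E => (0 : ℂ)) volume) (Ψ : Fk N) :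
    mulB _ h Ψ = 0 :=
  norm_le_zero_iff.1 ((norm_mulB_le h (C := 0) (fun _ => norm_zero.le) Ψ).trans (by rw [zero_mul]))

lemma mulB_sum {ι : Type*} (s : Finset ι) {m : ι → (Fin N → E) → ℂ}
    (hm : ∀ i, IsBddMul (m i) volume) (Ψ : Fk N) :
    mulB _ (IsBddMul.sum s hm) Ψ = ∑ i ∈ s, mulB (m i) (hm i) Ψ := by
  classical
  induction s using Finset.induction_on with
  | empty => exact (mulB_congr _ (IsBddMul.sum ∅ hm) (fun x => rfl) Ψ).trans (mulB_zero _ Ψ)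
  | insert i s hi ih =>
    rw [Finset.sum_insert hi, ← ih, ← mulB_add]
    exact mulB_congr _ _ (fun x => Finset.sum_insert hi) Ψ

lemma tendsto_pairB {ι : Type*} {L : Filter ι} {f g : ι → Form} {f' g' : Form}
    (hf : Tendsto f L (𝓝 f')) (hg : Tendsto g L (𝓝 g')) (j l : Fin N) (Ψ : Fk N) :
    Tendsto (fun n => pairB (f n) (g n) j l Ψ) L (𝓝 (pairB f' g' j l Ψ)) := by
  have hn (z : E) (f : Form) : ‖modF z f‖ ≤ ‖f‖ := modF_neg_norm_le z f
  have h1 (n : ι) : ‖pairB (f n) (g n) j l Ψ - pairB f' g' j l Ψ‖ ≤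
      (‖f n - f'‖ * ‖g n‖ + ‖f'‖ * ‖g n - g'‖) * ‖Ψ‖ := by
    have e : pairB (f n) (g n) j l Ψ - pairB f' g' j l Ψ = mulB _ ((isBddMul_pairing (f n) (g n)
        j l).add ((isBddMul_pairing f' g' j l).const_mul (-1))) Ψ := by
      rw [mulB_add (isBddMul_pairing (f n) (g n) j l) ((isBddMul_pairing f' g' j l).const_mul (-1)),
        mulB_const_mul (isBddMul_pairing f' g' j l), neg_one_smul, ← sub_eq_add_neg]
      rfl
    rw [e]
    refine norm_mulB_le _ (fun x => ?_) Ψ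
    have e2 : pairing (f n) (g n) j l x + -1 * pairing f' g' j l x =
        inner ℂ (modF (x j) (f n - f')) (modF (x l) (g n)) +
          inner ℂ (modF (x j) f') (modF (x l) (g n - g')) := by
      rw [pairing_eq_inner, pairing_eq_inner, map_sub, map_sub, inner_sub_left, inner_sub_right]
      ring
    rw [e2]
    refine (norm_add_le _ _).trans (add_le_add ((norm_inner_le_norm _ _).trans ?_)
      ((norm_inner_le_norm _ _).trans ?_)) <;> gcongr <;> exact hn _ _
  refine tendsto_iff_norm_sub_tendsto_zero.2 (squeeze_zero (fun _ => norm_nonneg _) h1 ?_)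
  have h2 := (((tendsto_iff_norm_sub_tendsto_zero.1 hf).mul hg.norm).add
    ((tendsto_iff_norm_sub_tendsto_zero.1 hg).const_mul ‖f'‖)).mul_const ‖Ψ‖
  simpa using h2

variable {K : ℝ} (hK : 0 < K)

/-- The form factor `B_K`. -/
def bForm : Form := (memLp_bCut hK).toLp _

/-- The form factor `G_Λ`. -/
def gForm (Λ : ℝ) : Form := (memLp_gCut Λ).toLp _

lemma kLow_bForm (i : Fin 3) (R : ℝ) :
    kLow i R (bForm hK) = -Complex.I • lowF R ((grossData N hK).v i) := by
  refine Lp.ext ?_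
  filter_upwards [kLow_ae i R (bForm hK), (memLp_bCut hK).coeFn_toLp,
    Lp.coeFn_smul (-Complex.I) (lowF R ((grossData N hK).v i)), lowF_ae R ((grossData N hK).v i),
    (memLp_kbCut hK i).coeFn_toLp] with k h1 h2 h3 h4 h5
  rw [h1, h3, Pi.smul_apply, h4, bForm, h2]
  show _ = -Complex.I • (if ‖k‖ ≤ R then (memLp_kbCut hK i).toLp _ k else 0)
  rw [h5, smul_eq_mul]
  split_ifs
  · ring
  · rw [mul_zero]

lemma tendsto_kLow_bForm (i : Fin 3) : Tendsto (fun R => kLow i R (bForm hK)) atTop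
    (𝓝 (-Complex.I • (grossData N hK).v i)) := by
  simp only [kLow_bForm (N := N)]
  exact (tendsto_lowF _).const_smul _

/-- `Re ⟨B_x, k B_y⟩` vanishes, since its integrand is odd. -/
lemma pairing_add_pairing_eq_zero (i : Fin 3) (j l : Fin N) (x : Fin N → E) :
    pairing (bForm hK) ((grossData N hK).v i) l j x +
      pairing ((grossData N hK).v i) (bForm hK) j l x = 0 := by
  have e1 : pairing (bForm hK) ((grossData N hK).v i) l j x =
      ∫ k, conj (formFactor (bCut K) (x l) k) * formFactor (fun k => (k i : ℂ) * bCut K k) (x j) k :=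
    pairing_toLp (memLp_bCut hK) (memLp_kbCut hK i) _ _ _
  have e2 : pairing ((grossData N hK).v i) (bForm hK) j l x =
      ∫ k, conj (formFactor (fun k => (k i : ℂ) * bCut K k) (x j) k) * formFactor (bCut K) (x l) k :=
    pairing_toLp (memLp_kbCut hK i) (memLp_bCut hK) _ _ _
  rw [e1, e2, ← integral_neg_eq_self, add_eq_zero_iff_eq_neg, ← integral_neg]
  refine integral_congr_ae (ae_of_all _ fun k => ?_)
  have hb : conj (bCut K k) = bCut K k := by
    rw [bCut]
    split_ifs
    · exact Complex.conj_ofReal _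
    · exact map_zero _
  have hn : bCut K (-k) = bCut K k := by simp only [bCut, norm_neg]
  simp only [formFactor, map_mul, hb, hn, ← Complex.exp_conj, map_neg, Complex.conj_I,
    Complex.conj_ofReal, inner_neg_left, PiLp.neg_apply, Complex.ofReal_neg]
  ring_nf

lemma shiftV_momentum (c : ℝ) (i : Fin 3) (j : Fin N) :
    shiftV (bForm hK) c ((grossData N hK).v i) j = 0 := by
  rw [shiftV, Finset.sum_eq_zero, smul_zero]
  intro l _
  refine LinearMap.ext fun u => Subtype.ext ?_
  show pairB _ _ l j (u : Fk N) + pairB _ _ j l (u : Fk N) = 0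
  rw [pairB, pairB, ← mulB_add]
  refine norm_le_zero_iff.1 ((norm_mulB_le _ (C := 0) (fun x => ?_) _).trans (by rw [zero_mul]))
  rw [pairing_add_pairing_eq_zero hK, norm_zero]

/-- The interaction with momenta in `[K, Λ]` is absorbed by `(1 + |k|²) B_K`. -/
lemma gCut_eq (hK : 0 < K) {Λ : ℝ} (hΛ : K ≤ Λ) {k : E} (hk : ‖k‖ ≠ K) :
    gCut K k + (bCut K k - if ‖k‖ ≤ Λ then bCut K k else 0) =
      (if ‖k‖ ≤ Λ then (k 0 : ℂ) ^ 2 * bCut K k else 0) +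
      (if ‖k‖ ≤ Λ then (k 1 : ℂ) ^ 2 * bCut K k else 0) +
      (if ‖k‖ ≤ Λ then (k 2 : ℂ) ^ 2 * bCut K k else 0) + bCut K k + gCut Λ k := by
  have hsq : (k 0 : ℂ) ^ 2 + (k 1 : ℂ) ^ 2 + (k 2 : ℂ) ^ 2 = (‖k‖ : ℂ) ^ 2 := by
    have := EuclideanSpace.real_norm_sq_eq k
    rw [Fin.sum_univ_three] at this
    exact_mod_cast this.symm
  by_cases h1 : ‖k‖ ≤ Λ
  · simp only [if_pos h1]
    rw [← add_mul, ← add_mul, hsq, sub_self, add_zero]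
    rcases lt_or_gt_of_ne hk with h2 | h2
    · rw [bCut, if_neg (not_le.2 h2), gCut, gCut, if_pos h2.le, if_pos h1]
      ring
    · have h0 : (‖k‖ : ℂ) ≠ 0 := by exact_mod_cast (hK.trans h2).ne'
      have h3 : (1 : ℂ) + (‖k‖ : ℂ) ^ 2 ≠ 0 := by
        have : (1 : ℝ) + ‖k‖ ^ 2 ≠ 0 := by positivity
        exact_mod_cast this
      rw [bCut, if_pos h2.le, gCut, gCut, if_neg (not_le.2 h2), if_pos h1]
      push_cast
      field_simp
      ring
  · have h2 : ¬ ‖k‖ ≤ K := fun h => h1 (h.trans hΛ)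
    rw [gCut, gCut, if_neg h1, if_neg h2]
    simp only [if_neg h1]
    ring

lemma kLow_momentum_ae (i : Fin 3) (Λ : ℝ) :
    (Complex.I • kLow i Λ ((grossData N hK).v i) : Form) =ᵐ[volume]
      fun k => if ‖k‖ ≤ Λ then (k i : ℂ) ^ 2 * bCut K k else 0 := by
  filter_upwards [Lp.coeFn_smul Complex.I (kLow i Λ ((grossData N hK).v i)),
    kLow_ae i Λ ((grossData N hK).v i), (memLp_kbCut hK i).coeFn_toLp] with k h1 h2 h3
  rw [h1, Pi.smul_apply, h2, smul_eq_mul]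
  show Complex.I * (if ‖k‖ ≤ Λ then -Complex.I * (k i : ℂ) * (memLp_kbCut hK i).toLp _ k else 0) = _
  rw [h3]
  split_ifs
  · linear_combination (-(k i : ℂ) ^ 2 * bCut K k) * Complex.I_sq
  · rw [mul_zero]

lemma coeFn_add_three (a b c d e : Form) : (a + b + c + d + e : Form) =ᵐ[volume]
    fun k => a k + b k + c k + d k + e k := by
  filter_upwards [Lp.coeFn_add (a + b + c + d) e, Lp.coeFn_add (a + b + c) d,
    Lp.coeFn_add (a + b) c, Lp.coeFn_add a b] with k h1 h2 h3 h4
  rw [h1, Pi.add_apply, h2, Pi.add_apply, h3, Pi.add_apply, h4, Pi.add_apply]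

lemma form_sum_eq {Λ : ℝ} (hΛ : K ≤ Λ) : gForm K + (bForm hK - lowF Λ (bForm hK)) =
    ∑ i, Complex.I • kLow i Λ ((grossData N hK).v i) + bForm hK + gForm Λ := by
  have hs : ∀ᵐ k : E, ‖k‖ ≠ K := by
    have := Measure.addHaar_sphere_of_ne_zero (volume : Measure E) 0 hK.ne'
    filter_upwards [measure_eq_zero_iff_ae_notMem.1 this] with k hk h
    exact hk (mem_sphere_zero_iff_norm.2 h)
  rw [Fin.sum_univ_three]
  refine Lp.ext ((Lp.coeFn_add _ _).trans ?_)
  refine EventuallyEq.trans ?_ (coeFn_add_three _ _ _ _ _).symm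
  filter_upwards [Lp.coeFn_sub (bForm hK) (lowF Λ (bForm hK)), lowF_ae Λ (bForm hK),
    (memLp_bCut hK).coeFn_toLp, (memLp_gCut K).coeFn_toLp, (memLp_gCut Λ).coeFn_toLp,
    kLow_momentum_ae (N := N) hK 0 Λ, kLow_momentum_ae (N := N) hK 1 Λ,
    kLow_momentum_ae (N := N) hK 2 Λ, hs] with k a2 a3 a4 a5 a6 i0 i1 i2 hk
  have b0 : bForm hK k = bCut K k := a4
  have g0 : gForm K k = gCut K k := a5
  have g1 : gForm Λ k = gCut Λ k := a6
  rw [Pi.add_apply, a2, Pi.sub_apply, a3, i0, i1, i2, b0, g0, g1]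
  exact gCut_eq hK hΛ hk

/-- The interaction with the momenta beyond `K` is absorbed by the commutators of the kinetic
energy and of the number operator with the generator. -/
lemma tendsto_form_sum : Tendsto (fun Λ => ∑ i, Complex.I • kLow i Λ ((grossData N hK).v i) +
    bForm hK + gForm Λ) atTop (𝓝 (gForm K)) := by
  have h1 : Tendsto (fun Λ => gForm K + (bForm hK - lowF Λ (bForm hK))) atTop
      (𝓝 (gForm K + (bForm hK - bForm hK))) :=
    tendsto_const_nhds.add (tendsto_const_nhds.sub (tendsto_lowF _))
  rw [sub_self, add_zero] at h1
  refine h1.congr' ?_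
  filter_upwards [eventually_ge_atTop K] with Λ hΛ
  exact form_sum_eq hK hΛ

/-- The multiplication operators that arise from the Gross transform add up to the potential. -/
lemma tendsto_shift (Φ : Fk N) : Tendsto (fun Λ =>
    (2⁻¹ : ℂ) • ((grossData N hK).c : ℂ) • ∑ j, shiftB (bForm hK)
    (grossData N hK).c (bForm hK) j Φ +
      ((grossData N hK).c : ℂ) • ∑ j, shiftB (bForm hK) (grossData N hK).c (gForm Λ) j Φ) atTop
    (𝓝 (mulB (grossData N hK).V (grossData N hK).hV Φ)) := by
  set c : ℂ := ((grossData N hK).c : ℂ) with hc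
  set f : Form := (memLp_invSq hK).toLp _
  set g : Form := (memLp_nb hK).toLp _
  have hs (h : Form) (j : Fin N) : shiftB (bForm hK) (grossData N hK).c h j Φ =
      c • ∑ l, (pairB (bForm hK) h l j Φ + pairB h (bForm hK) j l Φ) := by
    rw [shiftB, _root_.smul_apply, _root_.sum_apply]
    exact congrArg _ (Finset.sum_congr rfl fun l _ => _root_.add_apply _ _ _)
  have hfg (Λ : ℝ) : ∀ᵐ k, conj (gForm Λ k) * bForm hK k = conj (lowF Λ f k) * g k := by
    filter_upwards [(memLp_gCut Λ).coeFn_toLp, (memLp_bCut hK).coeFn_toLp, lowF_ae Λ f,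
      (memLp_invSq hK).coeFn_toLp, (memLp_nb hK).coeFn_toLp] with k a1 a2 a3 a4 a5
    rw [gForm, bForm, a1, a2, a3, a4, a5, gCut, nb, invSq, bCut]
    by_cases h : K ≤ ‖k‖
    · have h0 : (‖k‖ : ℂ) ≠ 0 := by exact_mod_cast (hK.trans_le h).ne'
      rw [if_pos h, if_pos h]
      split_ifs
      · rw [Complex.conj_ofReal, Complex.conj_ofReal]
        push_cast
        field_simp
      · rw [map_zero, zero_mul, zero_mul]
    · rw [if_neg h, mul_zero, mul_zero, mul_zero]
  have e1 (Λ : ℝ) (j l : Fin N) : pairB (gForm Λ) (bForm hK) j l Φ = pairB (lowF Λ f) g j l Φ :=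
    mulB_congr _ _ (pairing_congr (hfg Λ) j l) Φ
  have e2 (Λ : ℝ) (j l : Fin N) : pairB (bForm hK) (gForm Λ) l j Φ = pairB g (lowF Λ f) l j Φ :=
    mulB_congr _ _ (pairing_congr ((hfg Λ).mono fun k hk => by
      have := congrArg conj hk
      simp only [map_mul, Complex.conj_conj] at this
      rw [mul_comm, this, mul_comm]) l j) Φ
  have hlim : mulB (grossData N hK).V (grossData N hK).hV Φ =
      (2⁻¹ : ℂ) • c • ∑ j, c • ∑ l, (pairB (bForm hK) (bForm hK) l j Φ +
        pairB (bForm hK) (bForm hK) j l Φ) +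
      c • ∑ j, c • ∑ l, (pairB g f l j Φ + pairB f g j l Φ) := by
    simp only [pairB, ← mulB_add, ← mulB_sum, ← mulB_const_mul]
    refine mulB_congr _ _ (fun x => ?_) Φ
    have hcc : c * c = (N : ℂ)⁻¹ := by rw [← sq, hc, coupling_sq]
    have h1 : ∑ j, ∑ l, pairing (bForm hK) (bForm hK) l j x =
        ∑ j, ∑ l, pairing (bForm hK) (bForm hK) j l x := Finset.sum_comm
    have h2 (j l : Fin N) : pairing g f l j x + pairing f g j l x =
        2 * ((pairing f g j l x).re : ℂ) := by
      rw [← conj_pairing f g j l x, add_comm, Complex.add_conj]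
      push_cast
      rfl
    show totalV N K x = _
    simp only [h2, ← Finset.mul_sum, Finset.sum_add_distrib, h1, ← mul_assoc, hcc, totalV,
      grossV_eq K hK, mul_add]
    simp only [bForm, f, g]
    ring
  rw [hlim]
  simp only [hs, e1, e2]
  refine tendsto_const_nhds.add (Tendsto.const_smul (tendsto_finsetSum _ fun j _ =>
    Tendsto.const_smul (tendsto_finsetSum _ fun l _ => ?_) c) c)
  exact (tendsto_pairB tendsto_const_nhds (tendsto_lowF f) l j Φ).add
    (tendsto_pairB (tendsto_lowF f) tendsto_const_nhds j l Φ)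

end GrossFormFactors

/-! ### The kinetic energy of the transformed vectors -/

section Kinetic

variable {N : ℕ}
variable {Ψ : Fk N}

lemma kLow_lowF (i : Fin 3) (R Λ : ℝ) (g : Form) :
    kLow i R (lowF Λ g) = kLow i (min R Λ) g := by
  refine Lp.ext ?_
  filter_upwards [kLow_ae i R (lowF Λ g), kLow_ae i (min R Λ) g, lowF_ae Λ g] with k h1 h2 h3
  rw [h1, h2, h3]
  by_cases hR : ‖k‖ ≤ R
  · by_cases hL : ‖k‖ ≤ Λ
    · rw [if_pos hR, if_pos hL, if_pos (le_min hR hL)]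
    · rw [if_pos hR, if_neg hL, if_neg fun h => hL (h.trans (min_le_right _ _)), mul_zero]
  · rw [if_neg hR, if_neg fun h => hR (h.trans (min_le_left _ _))]

/-- The annihilation operators with the form factors `k_i g` that are cut off at `|k| ≤ Λ` converge
along all `Λ → ∞` as soon as they converge along the powers of `1024`. -/
lemma tendsto_alpha_kLow {g : Form} (hg : ∀ᵐ k, ‖k‖ ^ 2 * ‖g k‖ ≤ 1) (i : Fin 3) {j : Fin N}
    {y : Fk N} {χ : Fin 3 → Fk N} (h : ∀ i, (grad j i).HasGen Ψ (χ i))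
    (hy : ∀ m : ℕ, ‖y - alpha (kLow i (1024 ^ m) g) j Ψ‖ ≤ 2 ^ 18 / 2 ^ m * (∑ i, ‖χ i‖ + ‖Ψ‖)) :
    Tendsto (fun Λ => alpha (kLow i Λ g) j Ψ) atTop (𝓝 y) := by
  set S := ∑ i, ‖χ i‖ + ‖Ψ‖ with hS
  have hS0 : 0 ≤ S := by positivity
  have hlow (Λ : ℝ) : ∀ᵐ k, ‖k‖ ^ 2 * ‖lowF Λ g k‖ ≤ 1 := by
    filter_upwards [hg, lowF_ae Λ g] with k h1 h2
    rw [h2]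
    split_ifs
    · exact h1
    · simp
  rw [Metric.tendsto_atTop]
  intro ε hε
  have h0 : Tendsto (fun M : ℕ => 2 ^ 19 * S * (1 / 2 : ℝ) ^ M) atTop (𝓝 (2 ^ 19 * S * 0)) :=
    (tendsto_pow_atTop_nhds_zero_of_lt_one (by norm_num) (by norm_num)).const_mul _
  rw [mul_zero] at h0
  obtain ⟨M, hM⟩ := (h0.eventually_lt_const hε).exists
  refine ⟨1024 ^ M, fun Λ hΛ => ?_⟩
  have h1024 : (1 : ℝ) < 1024 := by norm_num
  obtain ⟨m, hm1, hm2⟩ := exists_nat_pow_near ((one_le_pow₀ h1024.le).trans hΛ) h1024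
  have hMm : M ≤ m := by
    have := (pow_lt_pow_iff_right₀ h1024).1 (hΛ.trans_lt hm2)
    omega
  have e1 : kLow i (1024 ^ (m + 1)) (lowF Λ g) = kLow i Λ g := by
    rw [kLow_lowF, min_eq_right hm2.le]
  have e2 : kLow i (1024 ^ m) (lowF Λ g) = kLow i (1024 ^ m) g := by
    rw [kLow_lowF, min_eq_left hm1]
  have h1 := norm_alpha_shell_le (hlow Λ) i m h
  rw [e1, e2] at h1
  have h2 : (1 : ℝ) / 2 ^ m ≤ (1 / 2) ^ M := by
    rw [← one_div_pow]
    exact pow_le_pow_of_le_one (by norm_num) (by norm_num) hMm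
  rw [dist_eq_norm]
  calc ‖alpha (kLow i Λ g) j Ψ - y‖
      ≤ ‖alpha (kLow i Λ g) j Ψ - alpha (kLow i (1024 ^ m) g) j Ψ‖ +
        ‖alpha (kLow i (1024 ^ m) g) j Ψ - y‖ := norm_sub_le_norm_sub_add_norm_sub _ _ _
    _ ≤ 2 ^ 17 / 2 ^ m * S + 2 ^ 18 / 2 ^ m * S :=
        add_le_add h1 ((norm_sub_rev _ _).le.trans (hy m))
    _ ≤ 2 ^ 19 * S * (1 / 2 ^ m) := by
        have : 0 ≤ S * (1 / 2 ^ m) := by positivity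
        rw [div_eq_mul_one_div, div_eq_mul_one_div (2 ^ 18 : ℝ)]
        nlinarith
    _ ≤ 2 ^ 19 * S * (1 / 2) ^ M := by gcongr
    _ < ε := hM

lemma fld_def (g : Form) (j : Fin N) (Ψ : Fk N) : fld g j Ψ = ann g j Ψ + cre g j Ψ := rfl

lemma fld_add_form (f g : Form) (j : Fin N) (Ψ : Fk N) :
    fld (f + g) j Ψ = fld f j Ψ + fld g j Ψ := by
  rw [fld, ann_add_form, cre_add_form, fld, fld, add_add_add_comm]

lemma fld_sub_form (f g : Form) (j : Fin N) (Ψ : Fk N) :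
    fld (f - g) j Ψ = fld f j Ψ - fld g j Ψ := by
  rw [eq_sub_iff_add_eq, ← fld_add_form, sub_add_cancel]

lemma fld_sub {χ : Fk N} (h : Ψ ∈ numDom N sq0) (h' : χ ∈ numDom N sq0) (g : Form)
    (j : Fin N) : fld g j (Ψ - χ) = fld g j Ψ - fld g j χ := by
  rw [eq_sub_iff_add_eq, ← fld_add (sub_mem h h') h', sub_add_cancel]

lemma tendsto_fld_form {ι : Type*} {L : Filter ι} {g : ι → Form} {g' : Form}
    (h : Tendsto g L (𝓝 g')) (j : Fin N) (Ψ : Fk N) :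
    Tendsto (fun n => fld (g n) j Ψ) L (𝓝 (fld g' j Ψ)) :=
  (tendsto_alpha_form h j _).add (tendsto_alphaD_form h j _)

lemma tendsto_fld_fld_form {ι : Type*} {L : Filter ι} {g : ι → Form} {g' : Form}
    (h : Tendsto g L (𝓝 g')) (f : Form) (j : Fin N) (hΨ : Ψ ∈ numDom N wN) :
    Tendsto (fun n => fld f j (fld (g n) j Ψ)) L (𝓝 (fld f j (fld g' j Ψ))) := by
  have h1 (n : ι) : ‖fld f j (fld (g n) j Ψ) - fld f j (fld g' j Ψ)‖ ≤
      ‖f‖ * ‖g n - g'‖ * (6 * ‖numFun wN Ψ‖ + 3 * ‖Ψ‖) := by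
    rw [← fld_sub (fld_mem_sq0 hΨ _ _) (fld_mem_sq0 hΨ _ _), ← fld_sub_form]
    exact norm_fld_fld_le _ _ _ _ hΨ
  refine tendsto_iff_norm_sub_tendsto_zero.2 (squeeze_zero (fun _ => norm_nonneg _) h1 ?_)
  have h2 := ((tendsto_iff_norm_sub_tendsto_zero.1 h).const_mul ‖f‖).mul_const
    (6 * ‖numFun wN Ψ‖ + 3 * ‖Ψ‖)
  simpa using h2

lemma hasGen_fld_low {j : Fin N} {i : Fin 3} {χ : Fk N} (hΨ : Ψ ∈ numDom N sq0)
    (hχ : χ ∈ numDom N sq0) (h : (grad j i).HasGen Ψ χ) (R : ℝ) (g : Form) :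
    (grad j i).HasGen (fld (lowF R g) j Ψ) (fld (kLow i R g) j Ψ + fld (lowF R g) j χ) := by
  have h1 := hasGen_alpha (hasGen_numFun hΨ hχ h) (isMulK_low i R g)
  have h2 := hasGen_alphaD (hasGen_numFun (sq0_le_sq1 hΨ) (sq0_le_sq1 hχ) h) (isMulK_low i R g)
  have h3 := h1.add h2
  rwa [add_add_add_comm] at h3

namespace GrossData

variable (P : GrossData N) (l : Fin N × Fin 3)

lemma tendsto_ann_kLow (Ψ : regDom N) :
    Tendsto (fun Λ => ann (kLow l.2 Λ (P.v l.2)) l.1 (Ψ : Fk N)) atTop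
      (𝓝 (P.dann l Ψ - ann (P.v l.2) l.1 (d1 l Ψ))) := by
  obtain ⟨y, hy, hy'⟩ := P.exists_dann l Ψ
  rw [(P.dann_spec l Ψ).unique hy, add_sub_cancel_right]
  exact tendsto_alpha_kLow (P.hv l.2) l.2 (χ := fun i => numFun sq0 (d1 (l.1, i) Ψ))
    (fun i => hasGen_numFun (reg_sq0 Ψ) (d1_sq0 (l.1, i) Ψ) (d1_spec (l.1, i) Ψ)) hy'

/-- The transformed momentum with a cutoff at `|k| ≤ Λ`. -/
def mom (Λ : ℝ) (Ψ : regDom N) : Fk N :=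
  d1 l Ψ - (P.c * Complex.I : ℂ) • fld (lowF Λ (P.v l.2)) l.1 (Ψ : Fk N)

/-- The derivative of the transformed momentum with a cutoff. -/
def dmom (Λ : ℝ) (Ψ : regDom N) : Fk N :=
  d2 l Ψ - (P.c * Complex.I : ℂ) • (fld (kLow l.2 Λ (P.v l.2)) l.1 (Ψ : Fk N) +
    fld (lowF Λ (P.v l.2)) l.1 (d1 l Ψ))

/-- The square of the transformed momentum, one factor of which is cut off. -/
def momSq (Λ : ℝ) (Ψ : regDom N) : Fk N :=
  -(P.dmom l Λ Ψ - (P.c * Complex.I : ℂ) • fld (P.v l.2) l.1 (P.mom l Λ Ψ))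

lemma hasGen_mom (Λ : ℝ) (Ψ : regDom N) :
    (grad l.1 l.2).HasGen (P.mom l Λ Ψ) (P.dmom l Λ Ψ) :=
  (d2_spec l Ψ).sub ((hasGen_fld_low (reg_sq0 Ψ) (d1_sq0 l Ψ) (d1_spec l Ψ) Λ _).smul _)

lemma mom_mem_sq0 (Λ : ℝ) (Ψ : regDom N) : P.mom l Λ Ψ ∈ numDom N sq0 :=
  sub_mem (d1_sq0 l Ψ) (Submodule.smul_mem _ _ (fld_mem_sq0 (reg_wN Ψ) _ _))

lemma mom_mem_phSym (Λ : ℝ) (Ψ : regDom N) : P.mom l Λ Ψ ∈ phSym N :=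
  sub_mem (d1_mem_phSym l Ψ) (Submodule.smul_mem _ _ (fld_mem_phSym Ψ.2.1 _ _))

lemma tendsto_mom (Ψ : regDom N) : Tendsto (fun Λ => P.mom l Λ Ψ) atTop
    (𝓝 (d1 l Ψ - (P.c * Complex.I : ℂ) • fld (P.v l.2) l.1 (Ψ : Fk N))) :=
  tendsto_const_nhds.sub ((tendsto_fld_form (tendsto_lowF _) _ _).const_smul _)

lemma fld_I_smul (g : Form) (j : Fin N) (Ψ : Fk N) :
    fld (Complex.I • g) j Ψ = -Complex.I • ann g j Ψ + Complex.I • cre g j Ψ := by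
  rw [fld, ann, cre, alpha_smul_form, alphaD_smul_form, Complex.conj_I]
  rfl

lemma momSq_eq (Λ : ℝ) (Ψ : regDom N) :
    P.momSq l Λ Ψ = -d2 l Ψ + (2 * P.c * Complex.I : ℂ) • ann (kLow l.2 Λ (P.v l.2)) l.1 (Ψ : Fk N) +
      (P.c * Complex.I : ℂ) • (fld (lowF Λ (P.v l.2)) l.1 (d1 l Ψ) + fld (P.v l.2) l.1 (d1 l Ψ)) +
      (P.c : ℂ) ^ 2 • fld (P.v l.2) l.1 (fld (lowF Λ (P.v l.2)) l.1 (Ψ : Fk N)) +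
      (P.c : ℂ) • fld (Complex.I • kLow l.2 Λ (P.v l.2)) l.1 (Ψ : Fk N) := by
  have h1 := fld_mem_sq0 (reg_wN Ψ) (lowF Λ (P.v l.2)) l.1
  rw [momSq, mom, fld_sub (d1_sq0 l Ψ) (Submodule.smul_mem _ _ h1), fld_smul _ h1, dmom, fld_I_smul,
    fld_def (kLow l.2 Λ (P.v l.2))]
  generalize ann (kLow l.2 Λ (P.v l.2)) l.1 (Ψ : Fk N) = a
  generalize cre (kLow l.2 Λ (P.v l.2)) l.1 (Ψ : Fk N) = a'
  generalize fld (P.v l.2) l.1 (fld (lowF Λ (P.v l.2)) l.1 (Ψ : Fk N)) = b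
  generalize fld (lowF Λ (P.v l.2)) l.1 (d1 l Ψ) = e
  generalize fld (P.v l.2) l.1 (d1 l Ψ) = f
  generalize d2 l Ψ = d
  have hI := Complex.I_sq
  match_scalars <;> first | ring1 | linear_combination (-(P.c : ℂ) ^ 2) * hI

/-- Apart from a term that is linear in the field and that diverges with the cutoff, the square of
the transformed momentum is the one of the Gross transformed Hamiltonian. -/
lemma tendsto_momSq (Ψ : regDom N) : Tendsto (fun Λ => P.momSq l Λ Ψ -
      (P.c : ℂ) • fld (Complex.I • kLow l.2 Λ (P.v l.2)) l.1 (Ψ : Fk N)) atTop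
    (𝓝 (-d2 l Ψ + P.inter l Ψ)) := by
  simp only [momSq_eq, add_sub_cancel_right]
  have e : -d2 l Ψ + P.inter l Ψ = -d2 l Ψ + (2 * P.c * Complex.I : ℂ) • (P.dann l Ψ -
      ann (P.v l.2) l.1 (d1 l Ψ)) + (P.c * Complex.I : ℂ) • (fld (P.v l.2) l.1 (d1 l Ψ) +
      fld (P.v l.2) l.1 (d1 l Ψ)) +
      (P.c : ℂ) ^ 2 • fld (P.v l.2) l.1 (fld (P.v l.2) l.1 (Ψ : Fk N)) := by
    rw [inter_apply, fld_def (P.v l.2) l.1 (d1 l Ψ)]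
    module
  rw [e]
  exact ((tendsto_const_nhds.add ((P.tendsto_ann_kLow l Ψ).const_smul _)).add
    (((tendsto_fld_form (tendsto_lowF _) _ _).add tendsto_const_nhds).const_smul _)).add
    ((tendsto_fld_fld_form (tendsto_lowF _) _ _ (reg_wN Ψ)).const_smul _)

end GrossData

end Kinetic

section Form

variable {N : ℕ} {K : ℝ} (hK : 0 < K)

lemma fld_sum_three (f : Fin 3 → Form) (j : Fin N) (Ψ : Fk N) :
    fld (∑ i, f i) j Ψ = ∑ i, fld (f i) j Ψ := by
  rw [Fin.sum_univ_three, Fin.sum_univ_three, fld_add_form, fld_add_form]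

/-- The transformed vector of the Hamiltonian with cutoff `Λ` converges, since the terms that are
linear in the field and diverge add up to a convergent expression. -/
lemma tendsto_hamL (Φ : regDom N) : Tendsto (fun Λ =>
      ∑ l, (grossData N hK).momSq l Λ Φ +
      (numFun wN (Φ : Fk N) + ((grossData N hK).c : ℂ) • ∑ j, fld (bForm hK) j (Φ : Fk N) +
        (2⁻¹ : ℂ) • ((grossData N hK).c : ℂ) •
          ∑ j, shiftB (bForm hK) (grossData N hK).c (bForm hK) j (Φ : Fk N)) +
      ((grossData N hK).c : ℂ) • ∑ j, (fld (gForm Λ) j (Φ : Fk N) +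
        shiftB (bForm hK) (grossData N hK).c (gForm Λ) j (Φ : Fk N))) atTop
    (𝓝 (hamL N hK Φ)) := by
  have h1 := tendsto_finsetSum (Finset.univ : Finset (Fin N × Fin 3)) fun l _ =>
    (grossData N hK).tendsto_momSq l Φ
  have h2 := (tendsto_finsetSum (Finset.univ : Finset (Fin N)) fun j _ =>
    tendsto_fld_form (tendsto_form_sum (N := N) hK) j (Φ : Fk N)).const_smul ((grossData N hK).c : ℂ)
  have h3 := tendsto_shift hK (Φ : Fk N)
  have h4 := (h1.add (h2.add h3)).const_add (numFun wN (Φ : Fk N))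
  have e : numFun wN (Φ : Fk N) + (∑ l, (-d2 l Φ + (grossData N hK).inter l Φ) +
      (((grossData N hK).c : ℂ) • ∑ j, fld (gForm K) j (Φ : Fk N) +
        mulB (grossData N hK).V (grossData N hK).hV (Φ : Fk N))) = hamL N hK Φ := by
    rw [hamL_apply, GrossData.pertL_apply, Finset.sum_add_distrib, kinL_apply]
    show _ = ∑ l, -d2 l Φ + numFun wN (Φ : Fk N) + (((grossData N hK).c : ℂ) •
      ∑ j, fld (gForm K) j (Φ : Fk N) + _ + _)
    abel
  rw [e] at h4
  refine h4.congr fun Λ => ?_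
  have hs (j : Fin N) : fld (∑ i, Complex.I • kLow i Λ ((grossData N hK).v i) + bForm hK + gForm Λ) j
      (Φ : Fk N) = ∑ i, fld (Complex.I • kLow i Λ ((grossData N hK).v i)) j (Φ : Fk N) +
        fld (bForm hK) j (Φ : Fk N) + fld (gForm Λ) j (Φ : Fk N) := by
    rw [fld_add_form, fld_add_form, fld_sum_three]
  simp only [hs]
  simp only [Finset.sum_add_distrib, Finset.sum_sub_distrib, ← Finset.smul_sum,
    Fintype.sum_prod_type]
  module

variable {W : Fk N →L[ℂ] Fk N}

/-- The quadratic form with cutoff at the transformed vectors, in the limit that removes the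
cutoff. -/
lemma tendsto_form (hW : IsInvGross (bForm hK) (grossData N hK).c W) (Φ : regDom N)
    {χ : Fk N} {D : Fin N × Fin 3 → Fk N} (hD : ∀ l, (grad l.1 l.2).HasGen χ (D l)) :
    Tendsto (fun Λ => ∑ l, inner ℂ (D l) (W (d1 l Φ - ((grossData N hK).c * Complex.I : ℂ) •
        fld ((grossData N hK).v l.2) l.1 (Φ : Fk N))) +
      inner ℂ χ (numFun wN (W Φ)) + ((grossData N hK).c : ℂ) * ∑ j, inner ℂ χ (fld (gForm Λ) j (W Φ)))
      atTop (𝓝 (inner ℂ χ (W (hamL N hK Φ)))) := by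
  obtain ⟨hw, hw'⟩ := wN_conj hW Φ.2.1 (reg_wN Φ)
  have h1 (l : Fin N × Fin 3) (Λ : ℝ) : inner ℂ (D l) (W ((grossData N hK).mom l Λ Φ)) =
      inner ℂ χ (W ((grossData N hK).momSq l Λ Φ)) := by
    have := hasGen_conj hW (tendsto_kLow_bForm (N := N) hK l.2) (shiftV_momentum hK _ l.2 l.1)
      ((grossData N hK).mom_mem_phSym l Λ Φ) ((grossData N hK).mom_mem_sq0 l Λ Φ)
      ((grossData N hK).hasGen_mom l Λ Φ)
    rw [(hD l).inner_left this, GrossData.momSq, map_neg, inner_neg_right]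
  have h2 (j : Fin N) (Λ : ℝ) := fld_conj hW Φ.2.1 (reg_sq0 Φ) (wN_le_sq0 hw) (gForm Λ) j
  have h3 := (innerSL ℂ χ).continuous.tendsto _ |>.comp
    (W.continuous.tendsto _ |>.comp (tendsto_hamL hK Φ))
  have h4 := tendsto_finsetSum (Finset.univ : Finset (Fin N × Fin 3)) fun l _ =>
    (innerSL ℂ (D l)).continuous.tendsto _ |>.comp
      (W.continuous.tendsto _ |>.comp ((grossData N hK).tendsto_mom l Φ))
  have h5 := h3.add ((tendsto_const_nhds (x := ∑ l, inner ℂ (D l) (W (d1 l Φ -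
    ((grossData N hK).c * Complex.I : ℂ) • fld ((grossData N hK).v l.2) l.1 (Φ : Fk N))))).sub h4)
  simp only [innerSL_apply_apply, sub_self, add_zero] at h5
  refine h5.congr fun Λ => ?_
  simp only [Function.comp_apply, innerSL_apply_apply, h1, h2, hw', map_add, map_sum, map_smul,
    inner_add_right, inner_sum, inner_smul_right, Finset.sum_add_distrib]
  ring

end Form

/-! ### The Gross transform on the symmetric subspace -/

section GrossTransform

variable {N : ℕ}

lemma IsFin.permP {u : Fk N} (h : IsFin u) (σ : Equiv.Perm (Fin N)) : IsFin (permP σ u) := by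
  obtain ⟨M, hM⟩ := h
  refine ⟨M, fun n hn => ?_⟩
  rw [sec_permP, hM n hn, map_zero]

lemma trunc_permP (M : ℕ) (σ : Equiv.Perm (Fin N)) (Ψ : Fk N) :
    trunc M (permP σ Ψ) = permP σ (trunc M Ψ) := (numFun_permP σ (trunc_mem M Ψ)).2

/-- Permutations of the particles act on vectors with finitely many phonons. -/
def permV (σ : Equiv.Perm (Fin N)) (u : finV N) : finV N :=
  ⟨permP σ u, permP_mem_phSym u.2.1 σ, u.2.2.permP σ⟩

lemma genV_permV (b : Form) (c : ℝ) (σ : Equiv.Perm (Fin N)) (u : finV N) :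
    genV N b c (permV σ u) = permV σ (genV N b c u) := by
  refine Subtype.ext ?_
  show (genV N b c (permV σ u) : Fk N) = permP σ (genV N b c u : Fk N)
  rw [genV_coe, genV_coe, map_smul, map_sum, ← Equiv.sum_comp σ]
  refine congrArg _ (Finset.sum_congr rfl fun j _ => ?_)
  rw [map_sub, permP_ann σ b j (finV_numDom u _), permP_cre σ b j (finV_numDom u _)]
  rfl

lemma genV_pow_permV (b : Form) (c : ℝ) (σ : Equiv.Perm (Fin N)) (m : ℕ) (u : finV N) :
    (genV N b c ^ m) (permV σ u) = permV σ ((genV N b c ^ m) u) := by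
  induction m with
  | zero => rfl
  | succ m ih => rw [pow_succ', Module.End.mul_apply, Module.End.mul_apply, ih, genV_permV]

lemma permP_exp {b : Form} {c : ℝ} {U : Fk N →L[ℂ] Fk N}
    (hU : ∀ u : finV N, HasSum (fun m => (expTerm (genV N b c) m u : Fk N)) (U u))
    (σ : Equiv.Perm (Fin N)) {x : Fk N} (hx : x ∈ phSym N) : permP σ (U x) = U (permP σ x) := by
  have h1 (u : finV N) : permP σ (U u) = U (permP σ u) := by
    refine (((hU u).map (permP σ).toContinuousLinearMap (permP σ).continuous).congr_fun
      fun m => ?_).unique (hU (permV σ u))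
    show (((m.factorial : ℂ)⁻¹ • (genV N b c ^ m) (permV σ u) : finV N) : Fk N) =
      permP σ ((m.factorial : ℂ)⁻¹ • (((genV N b c ^ m) u : finV N) : Fk N))
    rw [genV_pow_permV, map_smul]
    rfl
  have h2 := tendsto_trunc x
  refine tendsto_nhds_unique (((permP σ).continuous.tendsto _).comp ((U.continuous.tendsto _).comp
    h2)) ?_
  refine ((U.continuous.tendsto _).comp (((permP σ).continuous.tendsto _).comp h2)).congr fun M => ?_
  exact (h1 (truncV M hx)).symm

/-- A unitary operator of the phonon-symmetric vectors that commutes with the permutations of the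
particles restricts to `H N`. -/
lemma exists_equiv_of_permP {U W : Fk N →L[ℂ] Fk N} (h : ∀ x ∈ phSym N,
      U x ∈ phSym N ∧ W x ∈ phSym N ∧ W (U x) = x ∧ U (W x) = x ∧ ‖U x‖ = ‖x‖)
    (hU : ∀ σ, ∀ x ∈ phSym N, permP σ (U x) = U (permP σ x)) :
    ∃ U' : H N ≃ₗᵢ[ℂ] H N, ∀ x, valH (U' x) = U (valH x) := by
  have hp (x : H N) := h (valH x) (valH_bosonic x).1
  have hUs (x : H N) (σ : Equiv.Perm (Fin N)) : permP σ (U (valH x)) = U (valH x) :=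
    (hU σ _ (valH_bosonic x).1).trans (congrArg U ((valH_bosonic x).2 σ))
  have hWs (x : H N) (σ : Equiv.Perm (Fin N)) : permP σ (W (valH x)) = W (valH x) := by
    have h1 := (hp x).2.1
    have h2 := (h _ (permP_mem_phSym h1 σ)).2.2.1
    have h3 : U (permP σ (W (valH x))) = valH x := ((hU σ _ h1).symm.trans
      (congrArg (permP σ) (hp x).2.2.2.1)).trans ((valH_bosonic x).2 σ)
    exact h2.symm.trans (congrArg W h3)
  refine ⟨{ toFun := fun x => mkH (U (valH x)) (hp x).1 (hUs x)
            invFun := fun x => mkH (W (valH x)) (hp x).2.1 (hWs x)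
            map_add' := fun x y => valH_injective ?_
            map_smul' := fun a x => valH_injective ?_
            left_inv := fun x => valH_injective ?_
            right_inv := fun x => valH_injective ?_
            norm_map' := fun x => ?_ }, fun x => valH_mkH (U (valH x)) (hp x).1 (hUs x)⟩
  · simp only [map_add, valH_mkH]
  · simp only [map_smul, valH_mkH, RingHom.id_apply]
  · simp only [valH_mkH]
    exact (hp x).2.2.1
  · simp only [valH_mkH]
    exact (hp x).2.2.2.1
  · refine (valH.norm_map _).symm.trans (Eq.trans ?_ (valH.norm_map x))
    exact (congrArg norm (valH_mkH (U (valH x)) (hp x).1 (hUs x))).trans (hp x).2.2.2.2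

set_option maxHeartbeats 800000 in
lemma exists_gross_equiv (b : Form) (c : ℝ) : ∃ (U : H N ≃ₗᵢ[ℂ] H N) (W : Fk N →L[ℂ] Fk N),
    IsInvGross b c W ∧ (∀ x, W (valH (U x)) = valH x) ∧
    ∀ (x : H N) (u : finV N), (u : Fk N) = valH x →
      HasSum (fun m => (expTerm (genV N b c) m u : Fk N)) (valH (U x)) := by
  obtain ⟨U, W, hU, hW, h⟩ := exists_gross_unitary (N := N) b c
  have hp (σ : Equiv.Perm (Fin N)) (x : Fk N) (hx : x ∈ phSym N) :
      permP σ (U x) = U (permP σ x) := permP_exp hU σ hx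
  obtain ⟨U', hU'⟩ := exists_equiv_of_permP h hp
  have hW' : IsInvGross b c W := hW
  have h1 : ∀ x, W (valH (U' x)) = valH x := fun x => by
    rw [hU' x]
    exact (h (valH x) (valH_bosonic x).1).2.2.1
  have h2 : ∀ (x : H N) (u : finV N), (u : Fk N) = valH x →
      HasSum (fun m => (expTerm (genV N b c) m u : Fk N)) (valH (U' x)) := fun x u hu => by
    rw [hU' x, ← hu]
    exact hU u
  clear hU hW h hp hU'
  exact ⟨U', W, hW', h1, h2⟩

end GrossTransform

/-! ### Existence and uniqueness of the Gross transform -/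

section Uniqueness

variable {N : ℕ} {K : ℝ} (hK : 0 < K)
variable {x : H N} {U : H N ≃ₗᵢ[ℂ] H N}

lemma isFinitePhonon_iff : IsFinitePhonon x ↔ IsFin (valH x) :=
  exists_congr fun _ => forall₂_congr fun n _ => by
    rw [← toFull_valH x, sector_toFull]

lemma finV_of_isFinitePhonon (h : IsFinitePhonon x) : valH x ∈ finV N :=
  ⟨(valH_bosonic x).1, isFinitePhonon_iff.1 h⟩

lemma gr_grossGenerator (u : finV N) : Gr (coupling N • ∑ j : Fin N,
      (annihilation (formFactor (bCut K)) j - creation (formFactor (bCut K)) j)) (u : Fk N)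
    (genV N (bForm hK) (grossData N hK).c u) := by
  rw [genV_coe]
  refine Gr.smul _ (Gr.sum _ fun j => ?_)
  rw [sub_eq_add_neg, sub_eq_add_neg]
  exact (mem_graph_annihilation (memLp_bCut hK) j (finV_numDom u _)).add
    (mem_graph_creation (memLp_bCut hK) j (finV_numDom u _)).neg

lemma permV_eq {σ : Equiv.Perm (Fin N)} {u : finV N} (h : permP σ (u : Fk N) = u) (b : Form)
    (c : ℝ) (m : ℕ) : permP σ ((genV N b c ^ m) u : Fk N) = (genV N b c ^ m) u := by
  have e : permV σ u = u := Subtype.ext h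
  have := congrArg Subtype.val (genV_pow_permV b c σ m u)
  rw [e] at this
  exact this.symm

lemma mem_graph_symPart_of_eq {A : Full N →ₗ.[ℂ] Full N} {y : H N} {a b : Fk N}
    (hx : valH x = a) (hy : valH y = b) (h : Gr A a b) : (x, y) ∈ (symPart A).graph := by
  subst hx hy
  exact mem_graph_symPart_iff.2 h

lemma hasSum_of_valH {f : ℕ → H N} {g : ℕ → Fk N} (h : ∀ m, valH (f m) = g m)
    (hs : HasSum g (valH x)) : HasSum f x := by
  obtain rfl : (fun m => valH (f m)) = g := funext h
  exact (valH.isometry.isEmbedding.isInducing.hasSum_iff (g := valH) f x).1 hs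

lemma exists_genV_pow (b : Form) (c : ℝ) {u : finV N} (hu : (u : Fk N) = valH x) :
    ∃ v : ℕ → H N, ∀ m, valH (v m) = ((genV N b c ^ m) u : Fk N) := by
  have hp (m : ℕ) (σ : Equiv.Perm (Fin N)) : permP σ ((genV N b c ^ m) u : Fk N) =
      (genV N b c ^ m) u := permV_eq (by rw [hu, (valH_bosonic x).2]) _ _ m
  exact ⟨fun m => mkH _ ((genV N b c ^ m) u).2.1 (hp m), fun m => valH_mkH _ _ _⟩

lemma isGrossTransform_of_hasSum (h : ∀ (x : H N) (u : finV N),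
      (u : Fk N) = valH x → HasSum (fun m => (expTerm (genV N (bForm hK) (grossData N hK).c) m u : Fk N))
        (valH (U x))) : IsGrossTransform N K U := by
  intro x hx
  obtain ⟨u, hu⟩ : ∃ u : finV N, (u : Fk N) = valH x := ⟨⟨_, finV_of_isFinitePhonon hx⟩, rfl⟩
  obtain ⟨v, hv⟩ := exists_genV_pow (bForm hK) (grossData N hK).c hu
  refine ⟨v, valH_injective ((hv 0).trans hu), fun m => ?_, hasSum_of_valH (fun m => ?_) (h x u hu)⟩
  · refine mem_graph_symPart_of_eq (hv m) (hv (m + 1)) ?_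
    rw [pow_succ', Module.End.mul_apply]
    exact gr_grossGenerator hK _
  · rw [map_smul, hv]
    rfl

lemma IsGrossTransform.eq_of_finite {U' : H N ≃ₗᵢ[ℂ] H N} (h : IsGrossTransform N K U)
    (h' : IsGrossTransform N K U') (hx : IsFinitePhonon x) : U x = U' x := by
  obtain ⟨v, hv0, hv, hs⟩ := h x hx
  obtain ⟨v', hv0', hv', hs'⟩ := h' x hx
  have e (m : ℕ) : v m = v' m := by
    induction m with
    | zero => rw [hv0, hv0']
    | succ m ih => exact LinearPMap.mem_graph_snd_inj _ (hv m) (hv' m) ih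
  simp only [e] at hs
  exact hs.unique hs'

/-- The truncation to finitely many phonons. -/
def truncH (M : ℕ) (x : H N) : H N :=
  mkH (trunc M (valH x)) (numFun_mem_phSym (valH_bosonic x).1 _) fun σ => by
    rw [← trunc_permP, (valH_bosonic x).2]

lemma valH_truncH (M : ℕ) (x : H N) : valH (truncH M x) = trunc M (valH x) := valH_mkH _ _ _

lemma tendsto_truncH (x : H N) : Tendsto (fun M => truncH M x) atTop (𝓝 x) := by
  rw [valH.isometry.isEmbedding.tendsto_nhds_iff]
  exact (tendsto_trunc (valH x)).congr fun M => (valH_truncH M x).symm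

lemma IsGrossTransform.unique {U' : H N ≃ₗᵢ[ℂ] H N} (h : IsGrossTransform N K U)
    (h' : IsGrossTransform N K U') : U = U' := by
  ext1 x
  have h1 : Tendsto (fun M => U (truncH M x)) atTop (𝓝 (U x)) :=
    (U.continuous.tendsto x).comp (tendsto_truncH x)
  have h2 : Tendsto (fun M => U' (truncH M x)) atTop (𝓝 (U' x)) :=
    (U'.continuous.tendsto x).comp (tendsto_truncH x)
  have e (M : ℕ) : U (truncH M x) = U' (truncH M x) := by
    refine h.eq_of_finite h' (isFinitePhonon_iff.2 ?_)
    rw [valH_truncH]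
    exact isFin_trunc M (valH x)
  simp only [e] at h1
  exact tendsto_nhds_unique h1 h2

end Uniqueness

/-! ### The quadratic form of the Fröhlich Hamiltonian -/

section FroehlichForm

variable {N : ℕ}
variable {Ψ : Fk N}

lemma formPartial_eq {D : Fk N} {j : Fin N} {i : Fin 3} (h : (grad j i).HasGen Ψ D)
    (hΨ : toFull N Ψ ∈ formDomain N) : formPartial j i ⟨toFull N Ψ, hΨ⟩ = toFull N D :=
  LinearPMap.mem_graph_snd_inj _ (LinearPMap.mem_graph (partialDeriv N j i)
    ⟨_, formDomain_le_partialDeriv j i hΨ⟩) (mem_graph_partialDeriv.2 h) rfl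

lemma gr_sqrtNumberOp (h : Ψ ∈ numDom N sq0) : Gr (sqrtNumberOp N) Ψ (numFun sq0 Ψ) :=
  mem_graph_numberFun.2 (sec_numFun h)

lemma formSqrtNumber_eq (h : Ψ ∈ numDom N sq0) (hΨ : toFull N Ψ ∈ formDomain N) :
    formSqrtNumber N ⟨toFull N Ψ, hΨ⟩ = toFull N (numFun sq0 Ψ) :=
  LinearPMap.mem_graph_snd_inj _ (LinearPMap.mem_graph (sqrtNumberOp N)
    ⟨_, formDomain_le_sqrtNumberOp N hΨ⟩) (gr_sqrtNumberOp h) rfl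

lemma formAnnihilation_eq (h : Ψ ∈ numDom N sq0) (hΨ : toFull N Ψ ∈ formDomain N)
    (Λ : ℝ) (j : Fin N) :
    formAnnihilation Λ j ⟨toFull N Ψ, hΨ⟩ = toFull N (ann (gForm Λ) j Ψ) :=
  LinearPMap.mem_graph_snd_inj _ (LinearPMap.mem_graph (annihilation (formFactor (gCut Λ)) j)
    ⟨_, formDomain_le_annihilation Λ j hΨ⟩) (mem_graph_annihilation (memLp_gCut Λ) j h) rfl

lemma toFull_inner (Ψ χ : Fk N) : inner ℂ (toFull N Ψ) (toFull N χ) = inner ℂ Ψ χ :=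
  (toFull N).inner_map_map Ψ χ

lemma mem_formDomain : toFull N Ψ ∈ formDomain N ↔
    toFull N Ψ ∈ bosonic N ∧ (∀ l : Fin N × Fin 3, ∃ D, (grad l.1 l.2).HasGen Ψ D) ∧
      Ψ ∈ numDom N sq0 := by
  constructor
  · rintro ⟨⟨h1, h2⟩, h3⟩
    refine ⟨h1, fun l => ?_, ?_⟩
    · obtain ⟨D, hD⟩ := exists_gr (formDomain_le_partialDeriv l.1 l.2 ⟨⟨h1, h2⟩, h3⟩)
      exact ⟨D, mem_graph_partialDeriv.1 hD⟩
    · obtain ⟨χ, hχ⟩ := exists_gr h3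
      exact mem_numDom_of_sec (mem_graph_numberFun.1 hχ)
  · rintro ⟨h1, h2, h3⟩
    refine ⟨⟨h1, ?_⟩, (gr_sqrtNumberOp h3).mem_domain⟩
    simp only [Submodule.mem_iInf, SetLike.mem_coe]
    intro j i
    obtain ⟨D, hD⟩ := h2 (j, i)
    exact LinearPMap.mem_domain_of_mem_graph (mem_graph_partialDeriv.2 hD)

lemma cutoffForm_congr {X Y : formDomain N} {χ s s' : Fk N} {D D' : Fin N × Fin 3 → Fk N}
    {a a' : Fin N → Fk N} {Λ : ℝ} (hX : (X : Full N) = toFull N χ) (hY : (Y : Full N) = toFull N Ψ)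
    (hD : ∀ j i, formPartial j i X = toFull N (D (j, i)))
    (hD' : ∀ j i, formPartial j i Y = toFull N (D' (j, i)))
    (hs : formSqrtNumber N X = toFull N s) (hs' : formSqrtNumber N Y = toFull N s')
    (ha : ∀ j, formAnnihilation Λ j X = toFull N (a j))
    (ha' : ∀ j, formAnnihilation Λ j Y = toFull N (a' j)) :
    cutoffForm Λ X Y = ∑ l, inner ℂ (D l) (D' l) + inner ℂ s s' +
      coupling N * ∑ j, (inner ℂ χ (a' j) + inner ℂ (a j) Ψ) := by
  simp only [cutoffForm, hX, hY, hD, hD', hs, hs', ha, ha', toFull_inner, Fintype.sum_prod_type]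

/-- On the domain of the number operator, the form with cutoff is given by the field operators. -/
lemma cutoffForm_eq {χ : Fk N} {D D' : Fin N × Fin 3 → Fk N}
    (hD : ∀ l, (grad l.1 l.2).HasGen χ (D l)) (hD' : ∀ l, (grad l.1 l.2).HasGen Ψ (D' l))
    (hχ : toFull N χ ∈ formDomain N) (hΨ : toFull N Ψ ∈ formDomain N) (h : Ψ ∈ numDom N wN)
    (Λ : ℝ) :
    cutoffForm Λ ⟨toFull N χ, hχ⟩ ⟨toFull N Ψ, hΨ⟩ = ∑ l, inner ℂ (D l) (D' l) +
      inner ℂ χ (numFun wN Ψ) + coupling N * ∑ j, inner ℂ χ (fld (gForm Λ) j Ψ) := by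
  obtain ⟨h1, -, h2⟩ := mem_formDomain.1 hχ
  have h3 : inner ℂ (numFun sq0 χ) (numFun sq0 Ψ) = inner ℂ χ (numFun wN Ψ) := by
    rw [← inner_conj_symm, ← inner_wN h h2, inner_conj_symm]
  have h4 (j : Fin N) : inner ℂ χ (ann (gForm Λ) j Ψ) + inner ℂ (ann (gForm Λ) j χ) Ψ =
      inner ℂ χ (fld (gForm Λ) j Ψ) := by
    rw [fld, inner_add_right, inner_cre_right (toFull_mem_bosonic_iff.1 h1).1 h2 (wN_le_sq0 h)]
  have h5 := cutoffForm_congr (Λ := Λ) (X := ⟨toFull N χ, hχ⟩) (Y := ⟨toFull N Ψ, hΨ⟩) rfl rfl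
    (fun j i => formPartial_eq (hD (j, i)) hχ) (fun j i => formPartial_eq (hD' (j, i)) hΨ)
    (formSqrtNumber_eq h2 hχ) (formSqrtNumber_eq (wN_le_sq0 h) hΨ)
    (formAnnihilation_eq h2 hχ Λ) (formAnnihilation_eq (wN_le_sq0 h) hΨ Λ)
  rw [h3] at h5
  exact h5.trans (congrArg _ (congrArg _ (Finset.sum_congr rfl fun j _ => h4 j)))

lemma conj_cutoffForm (Λ : ℝ) (χ Ψ : formDomain N) :
    conj (cutoffForm Λ χ Ψ) = cutoffForm Λ Ψ χ := by
  have h : conj (coupling N) = coupling N := Complex.conj_ofReal _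
  have key (a b d : ℂ) : conj (a + b + coupling N * d) = conj a + conj b + coupling N * conj d := by
    rw [map_add, map_add, map_mul, h]
  refine (key _ _ _).trans (congrArg₂ _ (congrArg₂ _ ?_ (inner_conj_symm _ _)) (congrArg _ ?_))
  · refine (map_sum (starRingEnd ℂ) _ _).trans (Finset.sum_congr rfl fun j _ => ?_)
    refine (map_sum (starRingEnd ℂ) _ _).trans (Finset.sum_congr rfl fun i _ => ?_)
    exact inner_conj_symm _ _
  · refine (map_sum (starRingEnd ℂ) _ _).trans (Finset.sum_congr rfl fun j _ => ?_)
    refine (map_add (starRingEnd ℂ) _ _).trans ((add_comm _ _).trans ?_)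
    exact congrArg₂ _ (inner_conj_symm _ _) (inner_conj_symm _ _)

lemma eq_of_tendsto_conj {a b : ℝ → ℂ} {u v : ℂ} (ha : Tendsto a atTop (𝓝 (conj u)))
    (hb : Tendsto b atTop (𝓝 v)) (h : ∀ Λ, conj (a Λ) = b Λ) : u = v := by
  have h1 := (Complex.continuous_conj.tendsto _).comp ha
  rw [Complex.conj_conj] at h1
  exact tendsto_nhds_unique (h1.congr h) hb

lemma HasFroehlich.inner_symm {x y x' y' : H N} (h : HasFroehlich x y) (h' : HasFroehlich x' y') :
    inner ℂ y x' = inner ℂ x y' := by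
  obtain ⟨h1, h2⟩ := h
  obtain ⟨h3, h4⟩ := h'
  have h5 : inner ℂ (x' : Full N) (y : Full N) = conj (inner ℂ y x' : ℂ) := (inner_conj_symm x' y).symm
  have h6 := h2 ⟨x', h3⟩
  rw [h5] at h6
  exact eq_of_tendsto_conj h6 (h4 ⟨x, h1⟩) fun Λ => conj_cutoffForm Λ _ _

end FroehlichForm

/-! ### The Fröhlich Hamiltonian and the Gross transformed Hamiltonian -/

section Equivalence

/-- A symmetric relation that contains a relation `T` with `T + i` surjective is contained in `T`. -/
lemma le_of_symmetric {F : Type*} [NormedAddCommGroup F] [InnerProductSpace ℂ F]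
    {S T : Submodule ℂ (F × F)} (h : T ≤ S)
    (hS : ∀ x y x' y' : F, (x, y) ∈ S → (x', y') ∈ S → inner ℂ y x' = inner ℂ x y')
    (hT : ∀ f : F, ∃ x y : F, (x, y) ∈ T ∧ y + Complex.I • x = f) : S ≤ T := by
  rintro ⟨x, y⟩ hxy
  obtain ⟨x', y', hT', e⟩ := hT (y + Complex.I • x)
  have h1 : (x - x', y - y') ∈ S := S.sub_mem hxy (h hT')
  have h2 : y - y' = -Complex.I • (x - x') := by
    have : y' = y + Complex.I • x - Complex.I • x' := eq_sub_of_add_eq e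
    rw [this]
    module
  have h3 := hS _ _ _ _ h1 h1
  rw [h2, inner_smul_left, inner_smul_right, map_neg, Complex.conj_I, neg_neg] at h3
  have h4 : 2 * Complex.I * inner ℂ (x - x') (x - x') = 0 := by linear_combination h3
  have h5 : x - x' = 0 :=
    inner_self_eq_zero.1 ((mul_eq_zero.1 h4).resolve_left (mul_ne_zero two_ne_zero Complex.I_ne_zero))
  rw [h5, smul_zero] at h2
  rw [sub_eq_zero.1 h5, sub_eq_zero.1 h2]
  exact hT'

lemma symm_add_smul_symm {F : Type*} [NormedAddCommGroup F] [InnerProductSpace ℂ F]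
    (U : F ≃ₗᵢ[ℂ] F) {c : ℂ} {x y f : F} (h : y + c • x = U f) :
    U.symm y + c • U.symm x = f := by
  rw [← U.symm_apply_apply f, ← h, map_add, map_smul]

lemma mem_comap_prodMap_symm {F : Type*} [NormedAddCommGroup F] [InnerProductSpace ℂ F]
    (U : F ≃ₗᵢ[ℂ] F) (T : Submodule ℂ (F × F)) (x y : F) :
    (U.symm x, U.symm y) ∈
      T.comap (U.toLinearEquiv.toLinearMap.prodMap U.toLinearEquiv.toLinearMap) ↔ (x, y) ∈ T := by
  simp

variable {N : ℕ} {K : ℝ}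
variable {U : H N ≃ₗᵢ[ℂ] H N} {x y : H N}

lemma hasFroehlich_of_eq {Ψ η : Fk N} (hΨ : toFull N Ψ ∈ formDomain N)
    (hx : (x : Full N) = toFull N Ψ) (hy : (y : Full N) = toFull N η)
    (h : ∀ (χ : Fk N) (hχ : toFull N χ ∈ formDomain N), Tendsto
      (fun Λ => cutoffForm Λ ⟨toFull N χ, hχ⟩ ⟨toFull N Ψ, hΨ⟩) atTop (𝓝 (inner ℂ χ η))) :
    HasFroehlich x y := by
  have key : ∀ (X Y : Full N), X = toFull N Ψ → Y = toFull N η → ∃ h : X ∈ formDomain N,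
      ∀ χ : formDomain N, Tendsto (fun Λ : ℝ => cutoffForm Λ χ ⟨X, h⟩) atTop
        (𝓝 (inner ℂ (χ : Full N) Y)) := by
    rintro _ _ rfl rfl
    refine ⟨hΨ, ?_⟩
    rintro ⟨X, hX⟩
    obtain ⟨χ, rfl⟩ := (toFull N).surjective X
    exact (h χ hX).mono_right (le_of_eq (congrArg 𝓝 (toFull_inner χ η).symm))
  exact key _ _ hx hy

/-- The inverse Gross transform maps the domain of the Gross transformed Hamiltonian to the domain of
the Fröhlich Hamiltonian. -/
lemma hasFroehlich_of_gross (hK : 0 < K) {W : Fk N →L[ℂ] Fk N}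
    (hW : IsInvGross (bForm hK) (grossData N hK).c W) {Φ : regDom N}
    (hx : W Φ = valH x) (hy : W (hamL N hK Φ) = valH y) : HasFroehlich x y := by
  have hw := (wN_conj hW Φ.2.1 (reg_wN Φ)).1
  have hg (l : Fin N × Fin 3) := hasGen_conj hW (tendsto_kLow_bForm (N := N) hK l.2)
    (shiftV_momentum hK _ l.2 l.1) Φ.2.1 (reg_sq0 Φ) (d1_spec l Φ)
  have hx' : (x : Full N) = toFull N (W Φ) := (toFull_valH x).symm.trans (congrArg _ hx.symm)
  have hy' : (y : Full N) = toFull N (W (hamL N hK Φ)) :=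
    (toFull_valH y).symm.trans (congrArg _ hy.symm)
  have hm : toFull N (W Φ) ∈ formDomain N :=
    mem_formDomain.2 ⟨hx' ▸ x.2, fun l => ⟨_, hg l⟩, wN_le_sq0 hw⟩
  refine hasFroehlich_of_eq hm hx' hy' fun χ hχ => ?_
  choose D hD using (mem_formDomain.1 hχ).2.1
  refine (tendsto_form hK hW Φ hD).congr fun Λ => ?_
  rw [← coupling_eq hK]
  exact (cutoffForm_eq hD hg hχ hm hw Λ).symm

/-- The graph of the Gross transformed Hamiltonian, transformed back. -/
def transformedGraph (U : H N ≃ₗᵢ[ℂ] H N) (K : ℝ) : Submodule ℂ (H N × H N) :=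
  (grossHamiltonian N K).graph.comap
    (U.toLinearEquiv.toLinearMap.prodMap U.toLinearEquiv.toLinearMap)

/-- The graph of the Fröhlich Hamiltonian. -/
def froehlichGraph (N : ℕ) : Submodule ℂ (H N × H N) where
  carrier := {w | HasFroehlich w.1 w.2}
  zero_mem' := HasFroehlich.zero N
  add_mem' := HasFroehlich.add
  smul_mem' := fun c _ => HasFroehlich.smul c

lemma mem_transformedGraph :
    (x, y) ∈ transformedGraph U K ↔ (U x, U y) ∈ (grossHamiltonian N K).graph := Iff.rfl

lemma exists_isGrossTransform (hK : 0 < K) : ∃ U : H N ≃ₗᵢ[ℂ] H N,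
    IsGrossTransform N K U ∧ transformedGraph U K ≤ froehlichGraph N := by
  obtain ⟨U, W, hW, h1, h2⟩ := exists_gross_equiv (N := N) (bForm hK) (grossData N hK).c
  refine ⟨U, isGrossTransform_of_hasSum hK h2, ?_⟩
  rintro ⟨x, y⟩ hxy
  obtain ⟨h3, h4⟩ := (mem_graph_gross hK).1 (mem_transformedGraph.1 hxy)
  exact hasFroehlich_of_gross hK hW (Φ := ⟨valH (U x), h3⟩) (h1 x) ((congrArg W h4).trans (h1 y))

lemma exists_transformed_solution (hK : 0 < K) (U : H N ≃ₗᵢ[ℂ] H N) {s : ℝ} (hs : |s| = 1)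
    (f : H N) :
    ∃ x y : H N, (x, y) ∈ transformedGraph U K ∧ y + (s * Complex.I : ℂ) • x = f := by
  obtain ⟨x, y, h1, h2⟩ := exists_gross_solution hK s hs (U f)
  exact ⟨U.symm x, U.symm y, (mem_comap_prodMap_symm U _ x y).2 h1, symm_add_smul_symm U h2⟩

lemma transformedGraph_eq (hK : 0 < K) (hU : IsGrossTransform N K U) :
    transformedGraph U K = froehlichGraph N := by
  obtain ⟨U', hU', h⟩ := exists_isGrossTransform (N := N) hK
  rw [← hU.unique hU'] at h
  refine le_antisymm h (le_of_symmetric (F := H N) h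
    (fun x y x' y' a b => HasFroehlich.inner_symm a b) fun f => ?_)
  obtain ⟨x, y, h1, h2⟩ := exists_transformed_solution hK U abs_one f
  rw [Complex.ofReal_one, one_mul] at h2
  exact ⟨x, y, h1, h2⟩

lemma froehlichHamiltonian_eq (hK : 0 < K) (hU : IsGrossTransform N K U) :
    froehlichHamiltonian N = conjugate U (grossHamiltonian N K) :=
  congrArg Submodule.toLinearPMap (transformedGraph_eq hK hU).symm

lemma mem_graph_froehlich (hK : 0 < K) (hU : IsGrossTransform N K U) :
    (x, y) ∈ (froehlichHamiltonian N).graph ↔ (x, y) ∈ transformedGraph U K := by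
  have h0 : ∀ y, (0, y) ∈ transformedGraph U K → y = 0 := fun y hy => by
    rw [mem_transformedGraph, map_zero] at hy
    exact (map_eq_zero_iff U U.injective).1 (LinearPMap.graph_fst_eq_zero_snd _ hy rfl)
  rw [froehlichHamiltonian_eq hK hU]
  exact mem_graph_toLinearPMap' h0

lemma isSelfAdjoint_froehlich (hK : 0 < K) (hU : IsGrossTransform N K U) :
    IsSelfAdjoint (froehlichHamiltonian N) := by
  refine isSelfAdjoint_of_graph _ (fun x y x' y' h h' => ?_) fun s hs f => ?_
  · rw [mem_graph_froehlich hK hU, transformedGraph_eq hK hU] at h h'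
    exact HasFroehlich.inner_symm h h'
  · obtain ⟨x, y, h1, h2⟩ := exists_transformed_solution hK U hs f
    exact ⟨x, y, (mem_graph_froehlich hK hU).2 h1, h2⟩

lemma froehlichHamiltonian_domain (hK : 0 < K) (hU : IsGrossTransform N K U) :
    (froehlichHamiltonian N).domain =
      (freeHamiltonian N).domain.map U.symm.toLinearEquiv.toLinearMap := by
  rw [← grossHamiltonian_domain hK]
  refine le_antisymm (fun x hx => ?_) ?_
  · obtain ⟨y, hy⟩ := LinearPMap.mem_domain_iff.1 hx
    exact ⟨U x, LinearPMap.mem_domain_of_mem_graph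
      (mem_transformedGraph.1 ((mem_graph_froehlich hK hU).1 hy)), U.symm_apply_apply x⟩
  · refine Submodule.map_le_iff_le_comap.2 fun z hz => ?_
    obtain ⟨y, hy⟩ := LinearPMap.mem_domain_iff.1 hz
    have h : (U.symm z, U.symm y) ∈ transformedGraph U K := (mem_comap_prodMap_symm U _ z y).2 hy
    exact LinearPMap.mem_domain_of_mem_graph ((mem_graph_froehlich hK hU).2 h)

end Equivalence

end Froehlich

end

theorem mainTheorem4 :
    (∀ N : ℕ, 1 ≤ N → ∀ K : ℝ, 0 < K →
      (Froehlich.grossHamiltonian N K).domain = (Froehlich.freeHamiltonian N).domain ∧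
      IsSelfAdjoint (Froehlich.grossHamiltonian N K)) ∧
    ∃ Kmin : ℝ, 0 < Kmin ∧ ∀ K : ℝ, Kmin ≤ K → ∀ N : ℕ, 1 ≤ N →
      IsSelfAdjoint (Froehlich.froehlichHamiltonian N) ∧
      (∃! U : Froehlich.H N ≃ₗᵢ[ℂ] Froehlich.H N, Froehlich.IsGrossTransform N K U) ∧
      ∀ U : Froehlich.H N ≃ₗᵢ[ℂ] Froehlich.H N, Froehlich.IsGrossTransform N K U →
        Froehlich.froehlichHamiltonian N =
          Froehlich.conjugate U (Froehlich.grossHamiltonian N K) ∧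
        (Froehlich.froehlichHamiltonian N).domain =
          (Froehlich.freeHamiltonian N).domain.map U.symm.toLinearEquiv.toLinearMap := by
  refine ⟨fun N _ K hK => ⟨Froehlich.grossHamiltonian_domain hK, Froehlich.isSelfAdjoint_gross hK⟩,
    1, one_pos, fun K hK1 N _ => ?_⟩
  have hK : 0 < K := one_pos.trans_le hK1
  obtain ⟨U, hU, -⟩ := Froehlich.exists_isGrossTransform (N := N) hK
  exact ⟨Froehlich.isSelfAdjoint_froehlich hK hU, ⟨U, hU, fun U' h => h.unique hU⟩, fun U hU =>
    ⟨Froehlich.froehlichHamiltonian_eq hK hU, Froehlich.froehlichHamiltonian_domain hK hU⟩⟩
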